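/- Let $\mathbb S^2\subset\mathbb R^3$ be the unit sphere and let $0\le r<\pi$. There is a function $C(M)$ of $M$ alone (depending on the fixed number $r$, but not on $T$, $p$ or the maps below) such that the following holds. Let $T>0$, and let $u^{(0)},u^{(1)}\in C([0,T];L^\infty(\mathbb R^2))\cap L^\infty([0,T];\dot H^1(\mathbb R^2)\cap\dot H^2(\mathbb R^2))$ be two $\mathbb S^2$-valued solutions, in the sense of distributions on $(0,T)\times\mathbb R^2$, of the Schrödinger map equation $\partial_t u=u\times\Delta u$, such that the distance on $\mathbb S^2$ of $u^{(0)}(x,t)$ and $u^{(1)}(x,t)$ is at most $r$ for every $t\in[0,T]$ and a.e. $x$. Let $X(1,0)$ be the parallel transport on $\mathbb S^2$ along the minimal geodesic $\gamma(s)$, $s\in[0,1]$, from $u^{(0)}(x,t)$ to $u^{(1)}(x,t)$, i.e. $X(1,0)\xi=F(1)$ where $F'+(F\cdot\gamma')\gamma=0$, $F(0)=\xi$. Put $$V_m=X(1,0)\,\partial_m u^{(0)}-\partial_m u^{(1)}\quad(m=1,2),\qquad q=u^{(0)}-u^{(1)},$$ and $$M=\|\nabla u^{\max}\|_{L^\infty_TH^1_x}=\operatorname*{ess\,sup}_{t\in[0,T]}\Big(\int_{\mathbb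 R^2}\sum_k|\partial_ku^{\max}|^2+\sum_{j,k}|\partial_j\partial_ku^{\max}|^2\,dx\Big)^{1/2},$$ where $|\partial_k u^{\max}|=\max_{i=0,1}|\partial_k u^{(i)}|$ and $|\partial_j\partial_k u^{\max}|=\max_{i=0,1}|\partial_j\partial_k u^{(i)}|$. Then, for $m=1,2$, $V_m\in L^\infty([0,T];H^1)\cap W^{1,\infty}([0,T];H^{-1})$, and for every real $p>2$ $$\big\|\langle\partial_tV_m,V_m\rangle\big\|_{L^\infty_t}\le C(M)\,p\,\Big(\|q\|_{L^\infty_TL^2_x}^2+\sum_{k=1,2}\|V_k\|_{L^\infty_TL^2_x}^2\Big)^{1-1/p},$$ where $\langle\cdot,\cdot\rangle$ on the left is the pairing of $H^{-1}$ and $H^1$. The right-hand side is $+\infty$ if $q\notin L^\infty_TL^2_x$. -/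

import Mathlib

open MeasureTheory Set Filter Topology
open scoped ENNReal NNReal ContDiff

/-- The plane `ℝ²` with its Euclidean norm. -/
abbrev Plane : Type := EuclideanSpace ℝ (Fin 2)

/-- The space `ℝ³` with its Euclidean norm. -/
abbrev Space : Type := EuclideanSpace ℝ (Fin 3)

/-! ### Weak derivatives -/

/-- `g` is the weak (distributional) partial derivative `∂_k f` of `f : ℝ² → ℝ³`. -/
structure HasWeakPartial (k : Fin 2) (f g : Plane → Space) : Prop where
  locInt : LocallyIntegrable f volume
  locInt_partial : LocallyIntegrable g volume
  integral_eq : ∀ φ : Plane → ℝ, ContDiff ℝ ∞ φ → HasCompactSupport φ →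
    ∫ x, fderiv ℝ φ x (EuclideanSpace.single k 1) • f x = -∫ x, φ x • g x

open Classical in
/-- The weak partial derivative `∂_k f`, as a function determined up to null sets
(and `0` if there is none). -/
noncomputable def weakPartial (k : Fin 2) (f : Plane → Space) : Plane → Space :=
  if h : ∃ g, HasWeakPartial k f g then h.choose else 0

theorem hasWeakPartial_weakPartial {k : Fin 2} {f : Plane → Space}
    (h : ∃ g, HasWeakPartial k f g) : HasWeakPartial k f (weakPartial k f) := by
  rw [weakPartial, dif_pos h]
  exact h.choose_spec

/-- The Laplacian `Δ f = ∂₁ ∂₁ f + ∂₂ ∂₂ f` in the sense of weak derivatives. -/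
noncomputable def weakLaplacian (f : Plane → Space) (x : Plane) : Space :=
  ∑ k, weakPartial k (weakPartial k f) x

/-! ### Norms in space-time -/

/-- Lebesgue measure on the time interval `[0, T]`. -/
noncomputable def timeMeasure (T : ℝ) : Measure ℝ := volume.restrict (Icc 0 T)

/-- The norm `‖f‖_{L^∞_T L^2_x}`, with value `∞` if it is not finite. -/
noncomputable def normLinftyL2 (T : ℝ) (f : ℝ → Plane → Space) : ℝ≥0∞ :=
  essSup (fun t => eLpNorm (f t) 2 volume) (timeMeasure T)

/-- The norm `‖∇u^max‖_{L^∞_T H^1_x}`, where `|∂_k u^max|` and `|∂_j ∂_k u^max|` are the pointwise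
maxima of `|∂_k u⁽⁰⁾|, |∂_k u⁽¹⁾|` and of `|∂_j ∂_k u⁽⁰⁾|, |∂_j ∂_k u⁽¹⁾|`. -/
noncomputable def normGradMax (T : ℝ) (u₀ u₁ : ℝ → Plane → Space) : ℝ≥0∞ :=
  essSup (fun t => (∫⁻ x,
      ((∑ k, (max ‖weakPartial k (u₀ t) x‖ₑ ‖weakPartial k (u₁ t) x‖ₑ) ^ 2) +
        ∑ j, ∑ k, (max ‖weakPartial j (weakPartial k (u₀ t)) x‖ₑ
          ‖weakPartial j (weakPartial k (u₁ t)) x‖ₑ) ^ 2)) ^ (1 / 2 : ℝ))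
    (timeMeasure T)

/-! ### Schrödinger maps -/

/-- The vector product on `ℝ³`. -/
noncomputable def vecProd (a b : Space) : Space :=
  WithLp.toLp 2 (crossProduct (WithLp.ofLp a) (WithLp.ofLp b))

/-- `u : [0, T] × ℝ² → 𝕊²` belongs to `C([0,T] : L^∞) ∩ L^∞([0,T] : Ḣ¹ ∩ Ḣ²)` and solves
`∂_t u = u × Δ u` on `(0, T) × ℝ²` in the sense of distributions. -/
structure IsSchrodingerMap (T : ℝ) (u : ℝ → Plane → Space) : Prop where
  measurable : ∀ t ∈ Icc 0 T, AEStronglyMeasurable (u t) volume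
  sphere : ∀ t ∈ Icc 0 T, ∀ᵐ x, ‖u t x‖ = 1
  continuous : ∀ t₀ ∈ Icc 0 T,
    Tendsto (fun t => eLpNorm (u t - u t₀) ⊤ volume) (𝓝[Icc 0 T] t₀) (𝓝 0)
  exists_partial : ∀ᵐ t ∂(timeMeasure T), ∀ k, ∃ g, HasWeakPartial k (u t) g
  exists_partial₂ : ∀ᵐ t ∂(timeMeasure T), ∀ j k, ∃ g,
    HasWeakPartial j (weakPartial k (u t)) g
  bound : ∀ k, normLinftyL2 T (fun t => weakPartial k (u t)) < ⊤
  bound₂ : ∀ j k, normLinftyL2 T (fun t => weakPartial j (weakPartial k (u t))) < ⊤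
  equation : ∀ φ : ℝ × Plane → ℝ, ContDiff ℝ ∞ φ → HasCompactSupport φ →
    tsupport φ ⊆ Ioo 0 T ×ˢ univ →
    ∫ t in Ioo 0 T, ∫ x, fderiv ℝ φ (t, x) (1, 0) • u t x =
      -∫ t in Ioo 0 T, ∫ x, φ (t, x) • vecProd (u t x) (weakLaplacian (u t) x)

/-! ### Geodesics and parallel transport on the sphere -/

/-- `γ` is a geodesic of `𝕊²`, `γ'' + (γ' · γ') γ = 0`, with `γ 0 = a` and `γ 1 = b`, which is
minimal on `[0, 1]`: its length is the distance on `𝕊²`, that is, the angle, of `a` and `b`. -/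
structure IsMinimalGeodesic (a b : Space) (γ : ℝ → Space) : Prop where
  sphere : ∀ s, ‖γ s‖ = 1
  smooth : ContDiff ℝ 2 γ
  geodesic : ∀ s, deriv (deriv γ) s + (inner ℝ (deriv γ s) (deriv γ s)) • γ s = 0
  left : γ 0 = a
  right : γ 1 = b
  minimal : ∫ s in (0 : ℝ)..1, ‖deriv γ s‖ = InnerProductGeometry.angle a b

open Classical in
/-- The minimal geodesic from `a` to `b`; it exists and is unique for `a, b ∈ 𝕊²`, `a ≠ -b`. -/
noncomputable def minimalGeodesic (a b : Space) : ℝ → Space :=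
  if h : ∃ γ, IsMinimalGeodesic a b γ then h.choose else 0

/-- `F` is parallel along `γ` : `D_s F = F' + (F · γ') γ = 0`. -/
def IsParallel (γ F : ℝ → Space) : Prop :=
  ∀ s, HasDerivAt F (-((inner ℝ (F s) (deriv γ s)) • γ s)) s

open Classical in
/-- The parallel transport `X(s, σ) ξ` of `ξ` along `γ` from parameter `σ` to parameter `s`. -/
noncomputable def parallelTransport (γ : ℝ → Space) (s σ : ℝ) (ξ : Space) : Space :=
  if h : ∃ F, IsParallel γ F ∧ F σ = ξ then h.choose s else 0

/-- `V_m = X(1,0) ∂_m u⁽⁰⁾ - ∂_m u⁽¹⁾`, where `X(1,0)` is the parallel transport along the minimal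
geodesic from `u⁽⁰⁾(x,t)` to `u⁽¹⁾(x,t)`. -/
noncomputable def derivDiff (u₀ u₁ : ℝ → Plane → Space) (m : Fin 2) (t : ℝ) (x : Plane) : Space :=
  parallelTransport (minimalGeodesic (u₀ t x) (u₁ t x)) 1 0 (weakPartial m (u₀ t) x)
    - weakPartial m (u₁ t) x

/-! ### The spaces `H¹` and `H⁻¹` -/

theorem integrable_smul_of_locallyIntegrable {f : Plane → Space} (hf : LocallyIntegrable f volume)
    {φ : Plane → ℝ} (hφ : Continuous φ) (hc : HasCompactSupport φ) :
    Integrable (fun x => φ x • f x) volume :=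
  hf.integrable_smul_left_of_hasCompactSupport hφ hc

theorem continuous_partial {φ : Plane → ℝ} (hφ : ContDiff ℝ ∞ φ) (v : Plane) :
    Continuous fun x => fderiv ℝ φ x v :=
  (hφ.continuous_fderiv (by simp)).clm_apply continuous_const

theorem HasWeakPartial.congr {k : Fin 2} {f g f' g' : Plane → Space} (h : HasWeakPartial k f g)
    (hf : f =ᵐ[volume] f') (hg : g =ᵐ[volume] g') : HasWeakPartial k f' g' := by
  refine ⟨h.locInt.congr hf, h.locInt_partial.congr hg, fun φ h1 h2 => ?_⟩
  have e1 : (fun x => fderiv ℝ φ x (EuclideanSpace.single k 1) • f' x) =ᵐ[volume]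
      fun x => fderiv ℝ φ x (EuclideanSpace.single k 1) • f x := hf.mono fun x hx => by simp [hx]
  have e2 : (fun x => φ x • g' x) =ᵐ[volume] fun x => φ x • g x := hg.mono fun x hx => by simp [hx]
  rw [integral_congr_ae e1, integral_congr_ae e2]
  exact h.integral_eq φ h1 h2

theorem HasWeakPartial.add {k : Fin 2} {f g f' g' : Plane → Space} (h : HasWeakPartial k f g)
    (h' : HasWeakPartial k f' g') : HasWeakPartial k (f + f') (g + g') := by
  refine ⟨h.locInt.add h'.locInt, h.locInt_partial.add h'.locInt_partial, fun φ h1 h2 => ?_⟩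
  have hc : HasCompactSupport fun x => fderiv ℝ φ x (EuclideanSpace.single k 1) :=
    h2.fderiv_apply (𝕜 := ℝ) _
  have e1 := h.integral_eq φ h1 h2
  have e2 := h'.integral_eq φ h1 h2
  simp only [Pi.add_apply, smul_add]
  rw [integral_add, integral_add, e1, e2, neg_add]
  · exact integrable_smul_of_locallyIntegrable h.locInt_partial h1.continuous h2
  · exact integrable_smul_of_locallyIntegrable h'.locInt_partial h1.continuous h2
  · exact integrable_smul_of_locallyIntegrable h.locInt (continuous_partial h1 _) hc
  · exact integrable_smul_of_locallyIntegrable h'.locInt (continuous_partial h1 _) hc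

theorem HasWeakPartial.const_smul {k : Fin 2} {f g : Plane → Space} (h : HasWeakPartial k f g)
    (c : ℝ) : HasWeakPartial k (c • f) (c • g) := by
  refine ⟨h.locInt.smul c, h.locInt_partial.smul c, fun φ h1 h2 => ?_⟩
  have e1 := h.integral_eq φ h1 h2
  simp only [Pi.smul_apply, smul_comm _ c]
  rw [integral_smul, integral_smul, e1, smul_neg]

theorem hasWeakPartial_zero (k : Fin 2) : HasWeakPartial k 0 0 :=
  ⟨locallyIntegrable_zero, locallyIntegrable_zero, by simp⟩

/-- The Hilbert space `H¹(ℝ²; ℝ³)`: the functions `f ∈ L²` (the component `none`) together with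
their weak derivatives `∂_k f ∈ L²` (the components `some k`), normed by
`‖f‖² = ‖f‖²_{L²} + ∑_k ‖∂_k f‖²_{L²}`. -/
noncomputable def H1 : Submodule ℝ (PiLp 2 fun _ : Option (Fin 2) => Lp Space 2 (volume : Measure Plane)) where
  carrier := {F | ∀ k : Fin 2, HasWeakPartial k (F none) (F (some k))}
  add_mem' := fun hF hG k =>
    ((hF k).add (hG k)).congr (Lp.coeFn_add _ _).symm (Lp.coeFn_add _ _).symm
  zero_mem' := fun k =>
    (hasWeakPartial_zero k).congr (Lp.coeFn_zero _ _ _).symm (Lp.coeFn_zero _ _ _).symm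
  smul_mem' := fun c _ hF k =>
    ((hF k).const_smul c).congr (Lp.coeFn_smul _ _).symm (Lp.coeFn_smul _ _).symm

/-- The element of `L²` underlying an element of `H¹`. -/
noncomputable def H1.toL2 (f : H1) : Lp Space 2 (volume : Measure Plane) :=
  (f : PiLp 2 fun _ : Option (Fin 2) => Lp Space 2 (volume : Measure Plane)) none

/-- The space `H⁻¹`, the dual of `H¹`. The pairing of `w ∈ H⁻¹` and `f ∈ H¹` is `w f`. -/
abbrev HNegOne : Type := StrongDual ℝ H1

/-- `v ∈ L^∞([0,T] : H¹) ∩ W^{1,∞}([0,T] : H⁻¹)` with weak time derivative `w = ∂_t v`. Here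
`f ∈ L²` is identified with the functional `⟨f, ·⟩` in `H⁻¹`. Since `H¹` is a separable
Hilbert space, measurability in time may be tested against its elements. -/
structure HasWeakTimeDeriv (T : ℝ) (v : ℝ → H1) (w : ℝ → HNegOne) : Prop where
  measurable : ∀ ψ : H1, AEStronglyMeasurable (fun t => inner ℝ (v t) ψ) (timeMeasure T)
  bound : essSup (fun t => ‖v t‖ₑ) (timeMeasure T) < ⊤
  measurable_deriv : ∀ ψ : H1, AEStronglyMeasurable (fun t => w t ψ) (timeMeasure T)
  bound_deriv : essSup (fun t => ‖w t‖ₑ) (timeMeasure T) < ⊤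
  integral_eq : ∀ θ : ℝ → ℝ, ContDiff ℝ ∞ θ → HasCompactSupport θ → tsupport θ ⊆ Ioo 0 T →
    ∀ ψ : H1, ∫ t in Ioo 0 T, deriv θ t * inner ℝ (H1.toL2 (v t)) (H1.toL2 ψ) =
      -∫ t in Ioo 0 T, θ t * w t ψ

/-!
# An energy estimate for the difference of two Schrödinger maps into the sphere

Let `a` and `b` be two solutions with `⟪a, b⟫ ≥ c > -1`, where `c` is the cosine of the largest
allowed distance. Parallel transport along the minimal geodesic from `a` to `b` agrees on the
tangent space at `a` with the reflection in the plane orthogonal to the bisector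
`n = (a + b) / |a + b|` (`parallelTransport_eq_mirror`). This reflection, `S = 1 - 2 n ⊗ n`, is an
isometry of the whole space with `S a = -b`, and it depends smoothly on `(a, b)` as long as
`⟪a, b⟫ ≥ c`. Hence `V_m = S ∂_m a - ∂_m b` (`transportDiff`) belongs to `H¹` by the product rule
for weak derivatives, and the differential geometry of the sphere is reduced to linear algebra.

*Time derivative.* Tested against functions of space, the equation says that `∂_t u = u × Δ u` lies
in `L²` uniformly in time. So the flow is Lipschitz continuous in `L²` (`eLpNorm_time_sub_le`), and
at almost every time its difference quotients converge weakly to `u × Δ u` (`ae_tendsto_quotient`).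
After an integration by parts, the increment of the pairing `⟨V_m, ψ⟩` with a function `ψ ∈ H¹`
contains only increments of `a`, `b` and `S`, and no increments of their derivatives
(`diffPairing_sub`). The pairing is therefore Lipschitz continuous, and its derivative at almost
every time is an explicit expression `fluxPairing` (`tendsto_diffPairing_quotient`). The null set of
times does not depend on `ψ`, so this expression defines an element of `H⁻¹`, which is `∂_t V_m`
(`exists_hasWeakTimeDeriv`).

*Energy.* For `ψ = V_m` the terms that contain derivatives of `V` have to disappear. The main one
does because `b ×` is antisymmetric (`pairing_pointwise`); the other one contains `∂_k V_m` once and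
is integrated by parts (`IsSphereMap.integral_flux`). What remains is bounded by the
`energyDensity` `|q| |V| |∂u| (|∂²u| + |∂u|²) + |V|² |∂u|²`, where `q = a - b`
(`IsSphereMap.enorm_integral_flux_le`).

*Integration.* In Hölder's inequality `|V|` is put in `L²` and, to a small power, in `L⁴`, while
`∂u` and `q` are put in `L^{4p}`. On the plane `H¹` embeds in `L^p` with a constant of the order
`√p` (`IsSobolev.eLpNorm_le`), as one sees from the localized Riesz potential of `|f| + |∇f|`
(`enorm_le_lintegral_ball`, `lintegral_potential_rpow_le`). The embedding is used twice, and so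
gives the factor `p`. The `H¹` norm of `q` itself is bounded by the `L²` norms of `q` and `V`
(`IsSphereMap.sum_eLpNorm_sub_le`), so the powers of the energy add up to `1 - 1/p`
(`IsSphereMap.exists_energy_bound`).
-/

set_option linter.unusedSectionVars false

/-! ### Weak partial derivatives and mollification -/

section WeakCalculus

variable {E F G : Type*} [NormedAddCommGroup E] [NormedSpace ℝ E] [NormedAddCommGroup F]
  [NormedSpace ℝ F] [NormedAddCommGroup G] [NormedSpace ℝ G]

/-- `g` is the weak partial derivative `∂_k f`, for functions on the plane with values in an
arbitrary normed space. For `E = Space` this is `HasWeakPartial`. -/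
structure IsWeakPartial (k : Fin 2) (f g : Plane → E) : Prop where
  locInt : LocallyIntegrable f volume
  locInt_partial : LocallyIntegrable g volume
  integral_eq : ∀ φ : Plane → ℝ, ContDiff ℝ ∞ φ → HasCompactSupport φ →
    ∫ x, fderiv ℝ φ x (EuclideanSpace.single k 1) • f x = -∫ x, φ x • g x

theorem isWeakPartial_iff {k : Fin 2} {f g : Plane → Space} :
    IsWeakPartial k f g ↔ HasWeakPartial k f g :=
  ⟨fun h => ⟨h.1, h.2, h.3⟩, fun h => ⟨h.1, h.2, h.3⟩⟩

theorem MeasureTheory.LocallyIntegrable.integrable_test_smul {f : Plane → E} (hf : LocallyIntegrable f volume)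
    {φ : Plane → ℝ} (hφ : Continuous φ) (hc : HasCompactSupport φ) :
    Integrable (fun x => φ x • f x) volume :=
  hf.integrable_smul_left_of_hasCompactSupport hφ hc

theorem MeasureTheory.LocallyIntegrable.integrable_partial_smul {f : Plane → E}
    (hf : LocallyIntegrable f volume) {φ : Plane → ℝ} (hφ : ContDiff ℝ ∞ φ)
    (hc : HasCompactSupport φ) (v : Plane) :
    Integrable (fun x => fderiv ℝ φ x v • f x) volume :=
  hf.integrable_smul_left_of_hasCompactSupport (continuous_partial hφ v)
    (hc.fderiv_apply (𝕜 := ℝ) _)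

namespace IsWeakPartial

variable {k : Fin 2} {f g f' g' : Plane → E}

theorem congr (h : IsWeakPartial k f g) (hf : f =ᵐ[volume] f') (hg : g =ᵐ[volume] g') :
    IsWeakPartial k f' g' := by
  refine ⟨h.locInt.congr hf, h.locInt_partial.congr hg, fun φ h1 h2 => ?_⟩
  have e1 : (fun x => fderiv ℝ φ x (EuclideanSpace.single k 1) • f' x) =ᵐ[volume]
      fun x => fderiv ℝ φ x (EuclideanSpace.single k 1) • f x := hf.mono fun x hx => by simp [hx]
  have e2 : (fun x => φ x • g' x) =ᵐ[volume] fun x => φ x • g x := hg.mono fun x hx => by simp [hx]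
  rw [integral_congr_ae e1, integral_congr_ae e2]
  exact h.integral_eq φ h1 h2

theorem add (h : IsWeakPartial k f g) (h' : IsWeakPartial k f' g') :
    IsWeakPartial k (fun x => f x + f' x) (fun x => g x + g' x) := by
  refine ⟨h.locInt.add h'.locInt, h.locInt_partial.add h'.locInt_partial, fun φ h1 h2 => ?_⟩
  have e1 := h.integral_eq φ h1 h2
  have e2 := h'.integral_eq φ h1 h2
  simp only [smul_add]
  rw [integral_add, integral_add, e1, e2, neg_add]
  · exact h.locInt_partial.integrable_test_smul h1.continuous h2
  · exact h'.locInt_partial.integrable_test_smul h1.continuous h2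
  · exact h.locInt.integrable_partial_smul h1 h2 _
  · exact h'.locInt.integrable_partial_smul h1 h2 _

theorem const_smul (h : IsWeakPartial k f g) (c : ℝ) :
    IsWeakPartial k (fun x => c • f x) (fun x => c • g x) := by
  refine ⟨h.locInt.smul c, h.locInt_partial.smul c, fun φ h1 h2 => ?_⟩
  have e1 := h.integral_eq φ h1 h2
  simp only [smul_comm _ c]
  rw [integral_smul, integral_smul, e1, smul_neg]

theorem neg (h : IsWeakPartial k f g) : IsWeakPartial k (fun x => -f x) (fun x => -g x) := by
  simpa using h.const_smul (-1)

theorem sub (h : IsWeakPartial k f g) (h' : IsWeakPartial k f' g') :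
    IsWeakPartial k (fun x => f x - f' x) (fun x => g x - g' x) := by
  simpa [sub_eq_add_neg] using h.add h'.neg

theorem const (k : Fin 2) (c : E) : IsWeakPartial k (fun _ => c) (fun _ => (0 : E)) := by
  refine ⟨locallyIntegrable_const c, locallyIntegrable_const 0, fun φ h1 h2 => ?_⟩
  have h := integral_smul_fderiv_eq_neg_fderiv_smul_of_integrable (μ := (volume : Measure Plane))
    (f := φ) (g := fun _ : Plane => c) (v := EuclideanSpace.single k 1)
    ((locallyIntegrable_const c).integrable_partial_smul h1 h2 _) (by simp)
    ((locallyIntegrable_const c).integrable_test_smul h1.continuous h2)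
    (fun x _ => (h1.differentiable (by simp)).differentiableAt)
    (fun x _ => differentiableAt_const _)
  simp only [fderiv_fun_const, Pi.zero_apply, zero_apply, smul_zero,
    integral_zero] at h ⊢
  rw [eq_comm, neg_eq_zero] at h
  rw [h, neg_zero]

theorem clm_comp [CompleteSpace E] [CompleteSpace F] (h : IsWeakPartial k f g) (L : E →L[ℝ] F) :
    IsWeakPartial k (fun x => L (f x)) (fun x => L (g x)) := by
  have hloc : ∀ {u : Plane → E}, LocallyIntegrable u volume →
      LocallyIntegrable (fun x => L (u x)) volume := fun hu x => by
    obtain ⟨s, hs, hi⟩ := hu x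
    exact ⟨s, hs, L.integrable_comp hi⟩
  refine ⟨hloc h.locInt, hloc h.locInt_partial, fun φ h1 h2 => ?_⟩
  have e := congrArg L (h.integral_eq φ h1 h2)
  rw [map_neg, ← L.integral_comp_comm (h.locInt.integrable_partial_smul h1 h2 _),
    ← L.integral_comp_comm (h.locInt_partial.integrable_test_smul h1.continuous h2)] at e
  simpa using e

theorem ae_unique [CompleteSpace E] (h : IsWeakPartial k f g) (h' : IsWeakPartial k f' g')
    (hf : f =ᵐ[volume] f') : g =ᵐ[volume] g' := by
  refine ae_eq_of_integral_contDiff_smul_eq h.locInt_partial h'.locInt_partial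
    fun φ h1 h2 => ?_
  rw [← neg_inj, ← h.integral_eq φ h1 h2,
    ← (h'.congr hf.symm (ae_eq_refl _)).integral_eq φ h1 h2]

end IsWeakPartial

theorem sq_eLpNorm_two {α : Type*} {m : MeasurableSpace α} {μ : Measure α} (f : α → E) :
    eLpNorm f 2 μ ^ 2 = ∫⁻ x, ‖f x‖ₑ ^ 2 ∂μ := by
  have := eLpNorm_nnreal_pow_eq_lintegral (f := f) (μ := μ) (p := 2) two_ne_zero
  simpa using this

/-- A sequence of bump functions around `0` whose supports shrink to the origin. -/
noncomputable def mollifier (n : ℕ) : ContDiffBump (0 : Plane) where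
  rIn := 1 / (2 * (n + 1))
  rOut := 1 / (n + 1)
  rIn_pos := by positivity
  rIn_lt_rOut := by
    apply one_div_lt_one_div_of_lt <;> nlinarith [(Nat.cast_nonneg n : (0 : ℝ) ≤ n)]

theorem mollifier_rOut (n : ℕ) : (mollifier n).rOut = 1 / ((n : ℝ) + 1) := rfl

theorem mollifier_rOut_le_one (n : ℕ) : (mollifier n).rOut ≤ 1 := by
  rw [mollifier_rOut, div_le_one (by positivity)]
  linarith [(Nat.cast_nonneg n : (0 : ℝ) ≤ n)]

theorem tendsto_mollifier_rOut : Tendsto (fun n => (mollifier n).rOut) atTop (𝓝 0) :=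
  tendsto_one_div_add_atTop_nhds_zero_nat

/-- The regularization `ρ_n * f` of `f`. -/
noncomputable def mollify (n : ℕ) (f : Plane → E) : Plane → E :=
  convolution ((mollifier n).normed volume) f (ContinuousLinearMap.lsmul ℝ ℝ) volume

theorem mollify_apply (n : ℕ) (f : Plane → E) (x : Plane) :
    mollify n f x = ∫ t, (mollifier n).normed volume t • f (x - t) := by
  simp [mollify, convolution_def]

theorem mollify_apply_swap (n : ℕ) (f : Plane → E) (x : Plane) :
    mollify n f x = ∫ t, (mollifier n).normed volume (x - t) • f t := by
  simp [mollify, convolution_eq_swap]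

theorem mollify_congr (n : ℕ) {f g : Plane → E} (h : f =ᵐ[volume] g) :
    mollify n f = mollify n g :=
  convolution_congr _ (ae_eq_refl _) h

theorem contDiff_mollify [CompleteSpace E] (n : ℕ) {f : Plane → E}
    (hf : LocallyIntegrable f volume) : ContDiff ℝ ∞ (mollify n f) :=
  (mollifier n).hasCompactSupport_normed.contDiff_convolution_left _
    (mollifier n).contDiff_normed hf

theorem HasCompactSupport.mollify (n : ℕ) {f : Plane → E} (hf : HasCompactSupport f) :
    HasCompactSupport (mollify n f) :=
  (mollifier n).hasCompactSupport_normed.convolution _ hf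

/-- Mollification commutes with weak differentiation. -/
theorem IsWeakPartial.fderiv_mollify [CompleteSpace E] {k : Fin 2} {f g : Plane → E}
    (h : IsWeakPartial k f g) (n : ℕ) (x : Plane) :
    fderiv ℝ (mollify n f) x (EuclideanSpace.single k 1) = mollify n g x := by
  set ρ := (mollifier n).normed volume with hρ
  have hρs : ContDiff ℝ ∞ ρ := (mollifier n).contDiff_normed
  have hρc : HasCompactSupport ρ := (mollifier n).hasCompactSupport_normed
  have h1 := (hρc.hasFDerivAt_convolution_left (ContinuousLinearMap.lsmul ℝ ℝ)
    (hρs.of_le (by simp)) h.locInt x).fderiv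
  have hex : ConvolutionExistsAt (fderiv ℝ ρ) f x
      ((ContinuousLinearMap.lsmul ℝ ℝ).precompL Plane) volume :=
    (hρc.fderiv (𝕜 := ℝ)).convolutionExists_left _ (hρs.continuous_fderiv (by simp)) h.locInt x
  have h2 : fderiv ℝ (_root_.mollify n f) x (EuclideanSpace.single k 1)
      = ∫ t, fderiv ℝ ρ (x - t) (EuclideanSpace.single k 1) • f t := by
    rw [_root_.mollify, h1, convolution_eq_swap, ContinuousLinearMap.integral_apply]
    · simp
    · exact hex.integrable_swap
  have hφ : ContDiff ℝ ∞ fun t => ρ (x - t) := hρs.comp (contDiff_const.sub contDiff_id)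
  have hφc : HasCompactSupport fun t => ρ (x - t) :=
    hρc.comp_homeomorph (Homeomorph.subLeft x)
  have h3 := h.integral_eq _ hφ hφc
  have h4 : ∀ t, fderiv ℝ (fun t => ρ (x - t)) t (EuclideanSpace.single k 1)
      = -fderiv ℝ ρ (x - t) (EuclideanSpace.single k 1) := fun t => by
    have := ((hρs.differentiable (by simp)).differentiableAt (x := x - t)).hasFDerivAt.comp t
      ((hasFDerivAt_const x t).sub (hasFDerivAt_id t))
    have h5 := this.fderiv
    simp only [Function.comp_def] at h5
    rw [h5]
    simp
  rw [h2, mollify_apply_swap, ← neg_inj, ← h3, ← integral_neg]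
  simp [h4]

theorem enorm_mollify_le (n : ℕ) (f : Plane → E) (x : Plane) :
    ‖mollify n f x‖ₑ ≤ ∫⁻ t, ENNReal.ofReal ((mollifier n).normed volume t) * ‖f (x - t)‖ₑ := by
  rw [mollify_apply]
  refine (enorm_integral_le_lintegral_enorm _).trans (le_of_eq ?_)
  congr 1
  ext t
  rw [enorm_smul, Real.enorm_eq_ofReal ((mollifier n).nonneg_normed t)]

theorem lintegral_mollifier (n : ℕ) :
    ∫⁻ t, ENNReal.ofReal ((mollifier n).normed volume t) = 1 := by
  rw [← ofReal_integral_eq_lintegral_ofReal (mollifier n).integrable_normed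
    (ae_of_all _ (mollifier n).nonneg_normed), (mollifier n).integral_normed, ENNReal.ofReal_one]

/-- Mollification is a contraction of `L²`. -/
theorem eLpNorm_mollify_le (n : ℕ) {f : Plane → E} (hf : AEStronglyMeasurable f volume) :
    eLpNorm (mollify n f) 2 volume ≤ eLpNorm f 2 volume := by
  obtain ⟨g, hg, hfg⟩ := hf
  rw [mollify_congr n hfg, eLpNorm_congr_ae hfg]
  set ρ : Plane → ℝ≥0∞ := fun t => ENNReal.ofReal ((mollifier n).normed volume t) with hρ
  have hρm : Measurable ρ := ((mollifier n).continuous_normed.measurable).ennreal_ofReal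
  set ν := (volume : Measure Plane).withDensity ρ with hν
  have : IsProbabilityMeasure ν := ⟨by
    rw [hν, withDensity_apply _ MeasurableSet.univ, Measure.restrict_univ, lintegral_mollifier]⟩
  -- Jensen's inequality for the probability measure `ρ dt`
  have key : ∀ x, ‖mollify n g x‖ₑ ^ 2 ≤ ∫⁻ t, ρ t * ‖g (x - t)‖ₑ ^ 2 := fun x => by
    have hm : StronglyMeasurable fun t => g (x - t) :=
      hg.comp_measurable (measurable_const.sub measurable_id)
    have h1 := eLpNorm_le_eLpNorm_of_exponent_le (p := 1) (q := 2) (μ := ν)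
      (by norm_num) hm.aestronglyMeasurable
    have h2 : ‖mollify n g x‖ₑ ≤ eLpNorm (fun t => g (x - t)) 1 ν := by
      refine (enorm_mollify_le n g x).trans (le_of_eq ?_)
      rw [eLpNorm_one_eq_lintegral_enorm, hν, lintegral_withDensity_eq_lintegral_mul _ hρm
        hm.enorm]
      rfl
    calc ‖mollify n g x‖ₑ ^ 2 ≤ eLpNorm (fun t => g (x - t)) 2 ν ^ 2 := by
          gcongr; exact h2.trans h1
      _ = _ := by
          rw [sq_eLpNorm_two, hν, lintegral_withDensity_eq_lintegral_mul _ hρm (hm.enorm.pow_const 2)]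
          rfl
  have h3 : eLpNorm (mollify n g) 2 volume ^ 2 ≤ eLpNorm g 2 volume ^ 2 := by
    rw [sq_eLpNorm_two, sq_eLpNorm_two]
    calc ∫⁻ x, ‖mollify n g x‖ₑ ^ 2 ≤ ∫⁻ x, ∫⁻ t, ρ t * ‖g (x - t)‖ₑ ^ 2 := lintegral_mono key
      _ = ∫⁻ t, ∫⁻ x, ρ t * ‖g (x - t)‖ₑ ^ 2 := by
          refine lintegral_lintegral_swap (Measurable.aemeasurable ?_)
          refine (hρm.comp measurable_snd).mul (Measurable.pow_const ?_ 2)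
          exact (hg.comp_measurable (measurable_fst.sub measurable_snd)).enorm
      _ = ∫⁻ t, ρ t * ∫⁻ x, ‖g x‖ₑ ^ 2 := by
          congr 1; ext t
          have hm : StronglyMeasurable fun x => g (x - t) :=
            hg.comp_measurable (measurable_id.sub_const t)
          rw [lintegral_const_mul _ (hm.enorm.pow_const 2),
            lintegral_sub_right_eq_self (fun x => ‖g x‖ₑ ^ 2)]
      _ = _ := by
          rw [lintegral_mul_const _ hρm, lintegral_mollifier, one_mul]
  exact (ENNReal.pow_le_pow_left_iff two_ne_zero).1 h3

theorem mollify_sub [CompleteSpace E] (n : ℕ) {f g : Plane → E} (hf : LocallyIntegrable f volume)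
    (hg : LocallyIntegrable g volume) : mollify n (f - g) = mollify n f - mollify n g := by
  ext x
  have hρ : ∀ {u : Plane → E}, LocallyIntegrable u volume →
      Integrable (fun t => (mollifier n).normed volume (x - t) • u t) volume := fun hu =>
    hu.integrable_test_smul ((mollifier n).continuous_normed.comp (by fun_prop))
      ((mollifier n).hasCompactSupport_normed.comp_homeomorph (Homeomorph.subLeft x))
  simp only [mollify_apply_swap, Pi.sub_apply, smul_sub]
  exact integral_sub (hρ hf) (hρ hg)

theorem tendsto_eLpNorm_mollify_sub_of_continuous [CompleteSpace E] {g : Plane → E}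
    (hg : Continuous g) (hc : HasCompactSupport g) :
    Tendsto (fun n => eLpNorm (mollify n g - g) 2 volume) atTop (𝓝 0) := by
  obtain ⟨R, hR⟩ := hc.isCompact.isBounded.subset_closedBall (0 : Plane)
  set s := Metric.closedBall (0 : Plane) (R + 1)
  have hs : (volume : Measure Plane) s ≠ ⊤ := (isCompact_closedBall _ _).measure_lt_top.ne
  have hsupp : ∀ n, Function.support (mollify n g) ⊆ s := fun n => by
    refine (support_convolution_subset _).trans ?_
    rw [(mollifier n).support_normed_eq]
    rintro _ ⟨x, hx, y, hy, rfl⟩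
    have h1 := hR (subset_tsupport _ hy)
    simp only [Metric.mem_ball, Metric.mem_closedBall, dist_zero_right, s] at *
    exact (norm_add_le _ _).trans (by linarith [mollifier_rOut_le_one n])
  have hsupp' : Function.support g ⊆ s := fun y hy => by
    have h1 := hR (subset_tsupport _ hy)
    simp only [Metric.mem_closedBall, dist_zero_right, s] at *
    linarith
  have huc := hg.uniformContinuous_of_tendsto_cocompact
    (hc.is_zero_at_infty)
  rw [ENNReal.tendsto_nhds_zero]
  intro ε hε
  set c := (volume : Measure Plane) s ^ (1 / (2 : ℝ≥0∞).toReal)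
  have hc' : c ≠ ⊤ := ENNReal.rpow_ne_top_of_nonneg (by positivity) hs
  obtain ⟨δ, hδ, hδε⟩ : ∃ δ : ℝ, 0 < δ ∧ ENNReal.ofReal δ * c ≤ ε := by
    obtain ⟨δ, hδ, h⟩ := ENNReal.exists_nnreal_pos_mul_lt hc' hε.ne'
    exact ⟨δ, hδ, by simpa using h.le⟩
  obtain ⟨η, hη, hηδ⟩ := Metric.uniformContinuous_iff.1 huc δ hδ
  filter_upwards [tendsto_mollifier_rOut.eventually (gt_mem_nhds hη)] with n hn
  refine (eLpNorm_sub_le_of_dist_bdd _ (by simp) measurableSet_closedBall hδ.le (fun x => ?_)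
    (hsupp n) hsupp').trans hδε
  exact (mollifier n).dist_normed_convolution_le hg.aestronglyMeasurable fun y hy =>
    (hηδ ((Metric.mem_ball.1 hy).trans hn)).le

theorem tendsto_eLpNorm_mollify_sub [CompleteSpace E] {f : Plane → E} (hf : MemLp f 2 volume) :
    Tendsto (fun n => eLpNorm (mollify n f - f) 2 volume) atTop (𝓝 0) := by
  rw [ENNReal.tendsto_nhds_zero]
  intro ε hε
  have hε3 : ε / 3 ≠ 0 := (ENNReal.div_pos hε.ne' (by simp)).ne'
  obtain ⟨g, hgc, hfg, hg, hgm⟩ := hf.exists_hasCompactSupport_eLpNorm_sub_le (by simp) hε3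
  have h1 := ENNReal.tendsto_nhds_zero.1 (tendsto_eLpNorm_mollify_sub_of_continuous hg hgc) _
    (pos_iff_ne_zero.2 hε3)
  filter_upwards [h1] with n hn
  have hfl := hf.locallyIntegrable (by norm_num)
  have hgl := hgm.locallyIntegrable (by norm_num)
  have e : mollify n f - f = mollify n (f - g) + (mollify n g - g) + (g - f) := by
    rw [mollify_sub n hfl hgl]; abel
  have m1 : AEStronglyMeasurable (mollify n (f - g)) volume :=
    (contDiff_mollify n (hfl.sub hgl)).continuous.aestronglyMeasurable
  have m2 : AEStronglyMeasurable (mollify n g - g) volume :=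
    ((contDiff_mollify n hgl).continuous.sub hg).aestronglyMeasurable
  rw [e]
  calc _ ≤ eLpNorm (mollify n (f - g)) 2 volume + eLpNorm (mollify n g - g) 2 volume
        + eLpNorm (g - f) 2 volume := by
        refine (eLpNorm_add_le (m1.add m2) (hgm.1.sub hf.1) (by norm_num)).trans ?_
        gcongr
        exact eLpNorm_add_le m1 m2 (by norm_num)
    _ ≤ ε / 3 + ε / 3 + ε / 3 := by
        gcongr
        · exact (eLpNorm_mollify_le n (hf.1.sub hgm.1)).trans hfg
        · rw [eLpNorm_sub_comm]; exact hfg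
    _ = ε := ENNReal.add_thirds ε

/-- Functions that are square integrable on bounded sets. -/
def LocL2 (f : Plane → E) : Prop :=
  ∀ R : ℝ, MemLp f 2 ((volume : Measure Plane).restrict (Metric.ball 0 R))

theorem MeasureTheory.MemLp.locL2 {f : Plane → E} (hf : MemLp f 2 volume) : LocL2 f :=
  fun _ => hf.restrict _

theorem LocL2.of_bound {f : Plane → E} (hf : AEStronglyMeasurable f volume) {C : ℝ}
    (hC : ∀ᵐ x, ‖f x‖ ≤ C) : LocL2 f := fun R => by
  have : IsFiniteMeasure ((volume : Measure Plane).restrict (Metric.ball 0 R)) :=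
    ⟨by rw [Measure.restrict_apply_univ]; exact measure_ball_lt_top⟩
  exact MemLp.of_bound hf.restrict C (ae_restrict_of_ae hC)

theorem tendsto_eLpNorm_mollify_sub_ball [CompleteSpace E] {f : Plane → E} (hf : LocL2 f) (R : ℝ) :
    Tendsto (fun n => eLpNorm (mollify n f - f) 2
      ((volume : Measure Plane).restrict (Metric.ball 0 R))) atTop (𝓝 0) := by
  set g := (Metric.ball (0 : Plane) (R + 1)).indicator f
  have hg : MemLp g 2 volume := (memLp_indicator_iff_restrict measurableSet_ball).2 (hf (R + 1))
  refine tendsto_of_tendsto_of_tendsto_of_le_of_le tendsto_const_nhds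
    (tendsto_eLpNorm_mollify_sub hg) (fun _ => zero_le) fun n => ?_
  have : ∀ x ∈ Metric.ball (0 : Plane) R, (mollify n f - f) x = (mollify n g - g) x := fun x hx => by
    rw [mem_ball_zero_iff] at hx
    have h1 : g x = f x := indicator_of_mem (by rw [mem_ball_zero_iff]; linarith) _
    have h2 : mollify n g x = mollify n f x := by
      simp only [mollify_apply]
      congr 1; ext t
      by_cases ht : t ∈ Metric.ball (0 : Plane) 1
      · rw [mem_ball_zero_iff] at ht
        have : g (x - t) = f (x - t) := indicator_of_mem (by
          rw [mem_ball_zero_iff]; exact (norm_sub_le _ _).trans_lt (by linarith)) _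
        rw [this]
      · have : (mollifier n).normed volume t = 0 := by
          rw [← Function.notMem_support, (mollifier n).support_normed_eq]
          exact fun h => ht (Metric.ball_subset_ball (mollifier_rOut_le_one n) h)
        simp [this]
    simp [h1, h2]
  calc _ = eLpNorm (mollify n g - g) 2 ((volume : Measure Plane).restrict (Metric.ball 0 R)) := by
        refine eLpNorm_congr_ae ?_
        filter_upwards [ae_restrict_mem measurableSet_ball] with x hx using this x hx
    _ ≤ _ := eLpNorm_mono_measure _ Measure.restrict_le_self

theorem ae_tendsto_mollify [CompleteSpace E] {f : Plane → E} (hf : LocallyIntegrable f volume) :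
    ∀ᵐ x, Tendsto (fun n => mollify n f x) atTop (𝓝 (f x)) := by
  refine ContDiffBump.ae_convolution_tendsto_right_of_locallyIntegrable (K := 2)
    tendsto_mollifier_rOut (Eventually.of_forall fun n => ?_) hf
  change 1 / ((n : ℝ) + 1) ≤ 2 * (1 / (2 * (n + 1)))
  apply le_of_eq; field_simp

theorem LocL2.locallyIntegrable {f : Plane → E} (hf : LocL2 f) : LocallyIntegrable f volume := by
  intro x
  refine ⟨Metric.ball 0 (‖x‖ + 1), Metric.isOpen_ball.mem_nhds (by simp), ?_⟩
  have : IsFiniteMeasure ((volume : Measure Plane).restrict (Metric.ball 0 (‖x‖ + 1))) :=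
    ⟨by rw [Measure.restrict_apply_univ]; exact measure_ball_lt_top⟩
  exact (hf _).integrable (by norm_num)

end WeakCalculus

/-! ### Calculus of weak derivatives -/

section Calculus

variable {E F G : Type*} [NormedAddCommGroup E] [NormedSpace ℝ E] [NormedAddCommGroup F]
  [NormedSpace ℝ F] [NormedAddCommGroup G] [NormedSpace ℝ G]

theorem ContinuousLinearMap.aestronglyMeasurable_bilin {α : Type*} {m : MeasurableSpace α}
    {μ : Measure α} (B : E →L[ℝ] F →L[ℝ] G) {f : α → E} {g : α → F}
    (hf : AEStronglyMeasurable f μ) (hg : AEStronglyMeasurable g μ) :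
    AEStronglyMeasurable (fun x => B (f x) (g x)) μ :=
  B.aestronglyMeasurable_comp₂ hf hg

theorem ContinuousLinearMap.eLpNorm_bilin_le {α : Type*} {m : MeasurableSpace α} {μ : Measure α}
    (B : E →L[ℝ] F →L[ℝ] G) {f : α → E} {g : α → F} {p q r : ℝ≥0∞} [ENNReal.HolderTriple p q r]
    (hf : AEStronglyMeasurable f μ) (hg : AEStronglyMeasurable g μ) :
    eLpNorm (fun x => B (f x) (g x)) r μ ≤ ‖B‖₊ * eLpNorm f p μ * eLpNorm g q μ :=
  eLpNorm_le_eLpNorm_mul_eLpNorm_of_nnnorm hf hg (fun a b => B a b) ‖B‖₊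
    (ae_of_all _ fun _ => B.le_opNorm₂ _ _)

theorem ContinuousLinearMap.memLp_bilin {α : Type*} {m : MeasurableSpace α} {μ : Measure α}
    (B : E →L[ℝ] F →L[ℝ] G) {f : α → E} {g : α → F} {p q r : ℝ≥0∞} [ENNReal.HolderTriple p q r]
    (hf : MemLp f p μ) (hg : MemLp g q μ) : MemLp (fun x => B (f x) (g x)) r μ :=
  ⟨B.aestronglyMeasurable_bilin hf.1 hg.1, (B.eLpNorm_bilin_le hf.1 hg.1).trans_lt
    (ENNReal.mul_lt_top (ENNReal.mul_lt_top (by simp) hf.2) hg.2)⟩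

/-- The pairing of two sequences that converge in `L²` converges. -/
theorem tendsto_integral_bilin [CompleteSpace G] {α : Type*} {m : MeasurableSpace α}
    {μ : Measure α} (B : E →L[ℝ] F →L[ℝ] G) {f : α → E} {g : α → F} {fn : ℕ → α → E}
    {gn : ℕ → α → F} (hf : MemLp f 2 μ) (hg : MemLp g 2 μ) (hfn : ∀ n, MemLp (fn n) 2 μ)
    (hgn : ∀ n, MemLp (gn n) 2 μ)
    (hfl : Tendsto (fun n => eLpNorm (fn n - f) 2 μ) atTop (𝓝 0))
    (hgl : Tendsto (fun n => eLpNorm (gn n - g) 2 μ) atTop (𝓝 0)) :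
    Tendsto (fun n => ∫ x, B (fn n x) (gn n x) ∂μ) atTop (𝓝 (∫ x, B (f x) (g x) ∂μ)) := by
  have : ENNReal.HolderTriple 2 2 1 := ⟨by simp [ENNReal.inv_two_add_inv_two]⟩
  refine tendsto_integral_of_L1' (fun x => B (f x) (g x))
    (memLp_one_iff_integrable.1 (B.memLp_bilin hf hg)).1
    (Eventually.of_forall fun n => memLp_one_iff_integrable.1 (B.memLp_bilin (hfn n) (hgn n))) ?_
  have hlim : Tendsto (fun n => ‖B‖₊ * eLpNorm (fn n - f) 2 μ *
      (eLpNorm (gn n - g) 2 μ + eLpNorm g 2 μ) + ‖B‖₊ * eLpNorm f 2 μ * eLpNorm (gn n - g) 2 μ)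
      atTop (𝓝 (‖B‖₊ * 0 * (0 + eLpNorm g 2 μ) + ‖B‖₊ * eLpNorm f 2 μ * 0)) := by
    refine Tendsto.add (ENNReal.Tendsto.mul (ENNReal.Tendsto.const_mul hfl (by simp)) ?_
      (hgl.add_const _) (by simp)) (ENNReal.Tendsto.const_mul hgl (Or.inr ?_))
    · right; simpa using hg.2.ne
    · exact ENNReal.mul_ne_top (by simp) hf.2.ne
  simp only [mul_zero, zero_mul, add_zero] at hlim
  refine tendsto_of_tendsto_of_tendsto_of_le_of_le tendsto_const_nhds hlim (fun _ => zero_le)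
    fun n => ?_
  have e : ((fun x => B (fn n x) (gn n x)) - fun x => B (f x) (g x)) =
      (fun x => B ((fn n - f) x) (gn n x)) + fun x => B (f x) ((gn n - g) x) := by
    ext x; simp
  rw [e]
  refine (eLpNorm_add_le (B.aestronglyMeasurable_bilin ((hfn n).sub hf).1 (hgn n).1)
    (B.aestronglyMeasurable_bilin hf.1 ((hgn n).sub hg).1) le_rfl).trans ?_
  gcongr
  · refine (B.eLpNorm_bilin_le (p := 2) (q := 2) ((hfn n).sub hf).1 (hgn n).1).trans ?_
    gcongr
    calc eLpNorm (gn n) 2 μ = eLpNorm ((gn n - g) + g) 2 μ := by simp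
      _ ≤ _ := eLpNorm_add_le ((hgn n).sub hg).1 hg.1 (by norm_num)
  · exact B.eLpNorm_bilin_le (p := 2) (q := 2) hf.1 ((hgn n).sub hg).1

theorem tendsto_eLpNorm_smul_sub {α : Type*} {m : MeasurableSpace α} {μ : Measure α}
    {f : α → E} {fn : ℕ → α → E} {φ : α → ℝ} {C : ℝ} (hC : ∀ x, ‖φ x‖ ≤ C)
    (hfl : Tendsto (fun n => eLpNorm (fn n - f) 2 μ) atTop (𝓝 0)) :
    Tendsto (fun n => eLpNorm ((fun x => φ x • fn n x) - fun x => φ x • f x) 2 μ) atTop (𝓝 0) := by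
  have h := ENNReal.Tendsto.const_mul (a := ENNReal.ofReal C) hfl (by simp)
  rw [mul_zero] at h
  refine tendsto_of_tendsto_of_tendsto_of_le_of_le tendsto_const_nhds h (fun _ => zero_le)
    fun n => ?_
  refine eLpNorm_le_mul_eLpNorm_of_ae_le_mul (ae_of_all _ fun x => ?_) 2
  simp only [Pi.sub_apply, ← smul_sub, norm_smul]
  exact mul_le_mul_of_nonneg_right (hC x) (norm_nonneg _)

theorem exists_ball_of_hasCompactSupport {φ : Plane → E} (h : HasCompactSupport φ) :
    ∃ R : ℝ, ∀ x, x ∉ Metric.ball (0 : Plane) R → φ x = 0 := by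
  obtain ⟨R, hR⟩ := h.isCompact.isBounded.subset_ball (0 : Plane)
  exact ⟨R, fun x hx => image_eq_zero_of_notMem_tsupport fun h' => hx (hR h')⟩

theorem partial_eq_zero_of_notMem_ball {φ : Plane → E} {R : ℝ}
    (h : ∀ x, x ∉ Metric.ball (0 : Plane) R → φ x = 0) (x : Plane)
    (hx : x ∉ Metric.ball (0 : Plane) (R + 1)) : fderiv ℝ φ x = 0 := by
  have : φ =ᶠ[𝓝 x] fun _ => 0 := by
    have ho : (Metric.closedBall (0 : Plane) R)ᶜ ∈ 𝓝 x := by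
      refine Metric.isClosed_closedBall.isOpen_compl.mem_nhds ?_
      simp only [Metric.mem_ball, dist_zero_right, not_lt, mem_compl_iff, Metric.mem_closedBall,
        not_le] at *
      linarith
    filter_upwards [ho] with y hy
    exact h y fun hy' => hy (Metric.ball_subset_closedBall hy')
  rw [this.fderiv_eq]; simp

theorem LocL2.integrable_test_bilin {f : Plane → E} {g : Plane → F} (hf : LocL2 f) (hg : LocL2 g)
    (B : E →L[ℝ] F →L[ℝ] G) : LocallyIntegrable (fun x => B (f x) (g x)) volume := by
  have : ENNReal.HolderTriple 2 2 1 := ⟨by simp [ENNReal.inv_two_add_inv_two]⟩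
  intro x
  exact ⟨Metric.ball 0 (‖x‖ + 1), Metric.isOpen_ball.mem_nhds (by simp),
    memLp_one_iff_integrable.1 (B.memLp_bilin (hf _) (hg _))⟩

/-- If `f_n → f` and `g_n → g` in `L²` on bounded sets, then `∫ φ B(f_n, g_n) → ∫ φ B(f, g)`. -/
theorem tendsto_integral_test_bilin [CompleteSpace E] [CompleteSpace F] [CompleteSpace G]
    (B : E →L[ℝ] F →L[ℝ] G) {f : Plane → E} {g : Plane → F} {fn : ℕ → Plane → E}
    {gn : ℕ → Plane → F} {φ : Plane → ℝ} (hφ : Continuous φ) {R C : ℝ} (hC : ∀ x, ‖φ x‖ ≤ C)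
    (hR : ∀ x, x ∉ Metric.ball (0 : Plane) R → φ x = 0)
    (hf : LocL2 f) (hg : LocL2 g) (hfn : ∀ n, LocL2 (fn n)) (hgn : ∀ n, LocL2 (gn n))
    (hfl : Tendsto (fun n => eLpNorm (fn n - f) 2
      ((volume : Measure Plane).restrict (Metric.ball 0 R))) atTop (𝓝 0))
    (hgl : Tendsto (fun n => eLpNorm (gn n - g) 2
      ((volume : Measure Plane).restrict (Metric.ball 0 R))) atTop (𝓝 0)) :
    Tendsto (fun n => ∫ x, φ x • B (fn n x) (gn n x)) atTop (𝓝 (∫ x, φ x • B (f x) (g x))) := by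
  have e : ∀ (u : Plane → E) (v : Plane → F), ∫ x, φ x • B (u x) (v x)
      = ∫ x in Metric.ball (0 : Plane) R, B (φ x • u x) (v x) := fun u v => by
    rw [setIntegral_eq_integral_of_forall_compl_eq_zero fun x hx => by simp [hR x hx]]
    simp
  have hm : ∀ {u : Plane → E}, LocL2 u → MemLp (fun x => φ x • u x) 2
      ((volume : Measure Plane).restrict (Metric.ball 0 R)) := fun {u} hu =>
    (hu R).of_le_mul (c := C) (hφ.aestronglyMeasurable.smul (hu R).1) (ae_of_all _ fun x => by
      rw [norm_smul]; exact mul_le_mul_of_nonneg_right (hC x) (norm_nonneg _))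
  simp only [e]
  exact tendsto_integral_bilin B (hm hf) (hg R) (fun n => hm (hfn n)) (fun n => hgn n R)
    (tendsto_eLpNorm_smul_sub hC hfl) hgl

theorem LocL2.of_continuous {f : Plane → E} (hf : Continuous f) : LocL2 f := fun R => by
  have : IsFiniteMeasure ((volume : Measure Plane).restrict (Metric.ball 0 R)) :=
    ⟨by rw [Measure.restrict_apply_univ]; exact measure_ball_lt_top⟩
  obtain ⟨C, hC⟩ := (isCompact_closedBall (0 : Plane) R).exists_bound_of_continuousOn
    hf.continuousOn
  refine MemLp.of_bound hf.aestronglyMeasurable C ?_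
  filter_upwards [ae_restrict_mem measurableSet_ball] with x hx
  exact hC x (Metric.ball_subset_closedBall hx)

theorem test_bounds {φ : Plane → ℝ} (h1 : ContDiff ℝ ∞ φ) (h2 : HasCompactSupport φ)
    (v : Plane) : ∃ R C : ℝ, (∀ x, ‖φ x‖ ≤ C) ∧ (∀ x, ‖fderiv ℝ φ x v‖ ≤ C) ∧
      (∀ x, x ∉ Metric.ball (0 : Plane) R → φ x = 0) ∧
      ∀ x, x ∉ Metric.ball (0 : Plane) R → fderiv ℝ φ x v = 0 := by
  obtain ⟨R, hR⟩ := exists_ball_of_hasCompactSupport h2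
  obtain ⟨C1, hC1⟩ := h1.continuous.bounded_above_of_compact_support h2
  obtain ⟨C2, hC2⟩ := (continuous_partial h1 v).bounded_above_of_compact_support
    (h2.fderiv_apply (𝕜 := ℝ) v)
  refine ⟨R + 1, max C1 C2, fun x => (hC1 x).trans (le_max_left _ _),
    fun x => (hC2 x).trans (le_max_right _ _), fun x hx => hR x fun h => hx
      (Metric.ball_subset_ball (by linarith) h), fun x hx => ?_⟩
  rw [partial_eq_zero_of_notMem_ball hR x hx]; simp

/-- The product rule for functions that are, with their weak derivatives, locally in `L²`. -/
theorem IsWeakPartial.bilin [CompleteSpace E] [CompleteSpace F] [CompleteSpace G]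
    (B : E →L[ℝ] F →L[ℝ] G) {k : Fin 2} {f f' : Plane → E} {g g' : Plane → F}
    (hf : IsWeakPartial k f f') (hg : IsWeakPartial k g g')
    (hf2 : LocL2 f) (hf2' : LocL2 f') (hg2 : LocL2 g) (hg2' : LocL2 g') :
    IsWeakPartial k (fun x => B (f x) (g x)) (fun x => B (f' x) (g x) + B (f x) (g' x)) := by
  refine ⟨hf2.integrable_test_bilin hg2 B, (hf2'.integrable_test_bilin hg2 B).add
    (hf2.integrable_test_bilin hg2' B), fun φ h1 h2 => ?_⟩
  obtain ⟨R, C, hC, hC', hR, hR'⟩ := test_bounds h1 h2 (EuclideanSpace.single k 1)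
  have hs1 := fun n => contDiff_mollify n hf.locInt
  have hs2 := fun n => contDiff_mollify n hg.locInt
  have hs1' := fun n => contDiff_mollify n hf.locInt_partial
  have hs2' := fun n => contDiff_mollify n hg.locInt_partial
  have c1 := fun n => LocL2.of_continuous (hs1 n).continuous
  have c2 := fun n => LocL2.of_continuous (hs2 n).continuous
  have c1' := fun n => LocL2.of_continuous (hs1' n).continuous
  have c2' := fun n => LocL2.of_continuous (hs2' n).continuous
  have l1 := tendsto_eLpNorm_mollify_sub_ball hf2 R
  have l2 := tendsto_eLpNorm_mollify_sub_ball hg2 R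
  have l1' := tendsto_eLpNorm_mollify_sub_ball hf2' R
  have l2' := tendsto_eLpNorm_mollify_sub_ball hg2' R
  have t1 := tendsto_integral_test_bilin B (continuous_partial h1 _) hC' hR' hf2 hg2 c1 c2 l1 l2
  have t2 := tendsto_integral_test_bilin B h1.continuous hC hR hf2' hg2 c1' c2 l1' l2
  have t3 := tendsto_integral_test_bilin B h1.continuous hC hR hf2 hg2' c1 c2' l1 l2'
  -- the product rule for the mollified functions, from which the claim follows as `n → ∞`
  have key : ∀ n, ∫ x, fderiv ℝ φ x (EuclideanSpace.single k 1) • B (mollify n f x) (mollify n g x)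
      = -((∫ x, φ x • B (mollify n f' x) (mollify n g x))
        + ∫ x, φ x • B (mollify n f x) (mollify n g' x)) := fun n => by
    have hB : ∀ x, fderiv ℝ (fun x => B (mollify n f x) (mollify n g x)) x
        (EuclideanSpace.single k 1)
        = B (mollify n f' x) (mollify n g x) + B (mollify n f x) (mollify n g' x) := fun x => by
      rw [← hf.fderiv_mollify n x, ← hg.fderiv_mollify n x]
      have d1 := (((hs1 n).differentiable (by simp)) x).hasFDerivAt
      have d2 := (((hs2 n).differentiable (by simp)) x).hasFDerivAt
      rw [(B.hasFDerivAt_of_bilinear d1 d2).fderiv]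
      simp [add_comm]
    have hd : Differentiable ℝ (fun x => B (mollify n f x) (mollify n g x)) := fun x =>
      (B.hasFDerivAt_of_bilinear (((hs1 n).differentiable (by simp)) x).hasFDerivAt
        (((hs2 n).differentiable (by simp)) x).hasFDerivAt).differentiableAt
    have i1 := ((c1 n).integrable_test_bilin (c2 n) B)
    have i2 := ((c1' n).integrable_test_bilin (c2 n) B)
    have i3 := ((c1 n).integrable_test_bilin (c2' n) B)
    have h := integral_smul_fderiv_eq_neg_fderiv_smul_of_integrable
      (μ := (volume : Measure Plane)) (f := φ)
      (g := fun x => B (mollify n f x) (mollify n g x)) (v := EuclideanSpace.single k 1)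
      (i1.integrable_partial_smul h1 h2 _)
      (by simp only [hB]; exact (i2.add i3).integrable_test_smul h1.continuous h2)
      (i1.integrable_test_smul h1.continuous h2)
      (fun x _ => (h1.differentiable (by simp)).differentiableAt) (fun x _ => hd x)
    simp only [hB, smul_add] at h
    rw [integral_add (i2.integrable_test_smul h1.continuous h2)
      (i3.integrable_test_smul h1.continuous h2)] at h
    rw [h, neg_neg]
  have t4 := (t2.add t3).neg
  simp only [← key] at t4
  rw [tendsto_nhds_unique t1 t4]
  simp only [smul_add]
  rw [integral_add ((hf2'.integrable_test_bilin hg2 B).integrable_test_smul h1.continuous h2)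
    ((hf2.integrable_test_bilin hg2' B).integrable_test_smul h1.continuous h2)]

theorem mollify_mem_Icc {f : Plane → ℝ} (hf : LocallyIntegrable f volume) {c d : ℝ}
    (h : ∀ᵐ x, f x ∈ Icc c d) (n : ℕ) (x : Plane) : mollify n f x ∈ Icc c d := by
  have hi : Integrable (fun t => (mollifier n).normed volume (x - t) • f t) volume :=
    hf.integrable_test_smul ((mollifier n).continuous_normed.comp (by fun_prop))
      ((mollifier n).hasCompactSupport_normed.comp_homeomorph (Homeomorph.subLeft x))
  have h0 : Integrable (fun t => (mollifier n).normed volume (x - t)) volume :=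
    (mollifier n).integrable_normed.comp_sub_left x
  have h1 : ∫ t, (mollifier n).normed volume (x - t) = 1 := by
    rw [integral_sub_left_eq_self (fun t => (mollifier n).normed volume t)]
    exact (mollifier n).integral_normed
  rw [mollify_apply_swap]
  constructor
  · calc c = ∫ t, (mollifier n).normed volume (x - t) • c := by
          rw [integral_smul_const, h1, one_smul]
      _ ≤ _ := integral_mono_ae (h0.smul_const c) hi (h.mono fun t ht =>
          mul_le_mul_of_nonneg_left ht.1 ((mollifier n).nonneg_normed _))
  · calc _ ≤ ∫ t, (mollifier n).normed volume (x - t) • d :=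
          integral_mono_ae hi (h0.smul_const d) (h.mono fun t ht =>
          mul_le_mul_of_nonneg_left ht.2 ((mollifier n).nonneg_normed _))
      _ = d := by rw [integral_smul_const, h1, one_smul]

theorem tendsto_eLpNorm_comp_sub {μ : Measure Plane} {g : Plane → ℝ} {gn : ℕ → Plane → ℝ}
    {H : ℝ → ℝ} {s : Set ℝ} {L : ℝ≥0} (hH : LipschitzOnWith L H s) (hg : ∀ᵐ x ∂μ, g x ∈ s)
    (hgn : ∀ n x, gn n x ∈ s) (h : Tendsto (fun n => eLpNorm (gn n - g) 2 μ) atTop (𝓝 0)) :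
    Tendsto (fun n => eLpNorm ((fun x => H (gn n x)) - fun x => H (g x)) 2 μ) atTop (𝓝 0) := by
  have h' := ENNReal.Tendsto.const_mul (a := ENNReal.ofReal L) h (by simp)
  rw [mul_zero] at h'
  refine tendsto_of_tendsto_of_tendsto_of_le_of_le tendsto_const_nhds h' (fun _ => zero_le)
    fun n => ?_
  refine eLpNorm_le_mul_eLpNorm_of_ae_le_mul (hg.mono fun x hx => ?_) 2
  exact hH.norm_sub_le (hgn n x) hx

/-- The chain rule for `H ∘ g`, where `g` takes values in an interval on which `H` is `C^{1,1}`. -/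
theorem IsWeakPartial.comp_real {k : Fin 2} {g g' : Plane → ℝ} {H H' : ℝ → ℝ} {c d : ℝ} {L : ℝ≥0}
    (hH : ∀ s ∈ Icc c d, HasDerivAt H (H' s) s) (hL : LipschitzOnWith L H (Icc c d))
    (hL' : LipschitzOnWith L H' (Icc c d))
    (hg : IsWeakPartial k g g') (hgm : ∀ᵐ x, g x ∈ Icc c d) (hg2' : LocL2 g') :
    IsWeakPartial k (fun x => H (g x)) (fun x => H' (g x) * g' x) := by
  have hg2 : LocL2 g := LocL2.of_bound (C := max |c| |d|) hg.locInt.aestronglyMeasurable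
    (hgm.mono fun x hx => abs_le_max_abs_abs hx.1 hx.2)
  obtain ⟨x₀, hx₀⟩ := hgm.exists
  have hmeas : ∀ {K : ℝ → ℝ}, LipschitzOnWith L K (Icc c d) →
      AEStronglyMeasurable (fun x => K (g x)) volume := fun {K} hK => by
    have hcd : c ≤ d := hx₀.1.trans hx₀.2
    have h1 : Continuous (IccExtend hcd ((Icc c d).domRestrict K)) :=
      (hK.continuousOn.domRestrict).Icc_extend'
    refine (h1.comp_aestronglyMeasurable hg.locInt.aestronglyMeasurable).congr ?_
    filter_upwards [hgm] with x hx
    rw [IccExtend_of_mem hcd _ hx]; rfl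
  have hloc : ∀ {K : ℝ → ℝ}, LipschitzOnWith L K (Icc c d) → LocL2 (fun x => K (g x)) :=
    fun {K} hK => by
    refine LocL2.of_bound (hmeas hK) (C := ‖K c‖ + L * (d - c)) ?_
    filter_upwards [hgm] with x hx
    have h1 := hK.norm_sub_le hx (left_mem_Icc.2 (hx.1.trans hx.2))
    have h2 : ‖g x - c‖ ≤ d - c := by
      rw [Real.norm_eq_abs, abs_of_nonneg (by linarith [hx.1])]; linarith [hx.2]
    have h3 : (L : ℝ) * ‖g x - c‖ ≤ L * (d - c) := by gcongr
    have h4 := norm_sub_norm_le (K (g x)) (K c)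
    linarith
  have hgs := fun n => contDiff_mollify n hg.locInt
  have hgs' := fun n => contDiff_mollify n hg.locInt_partial
  have hm := fun n x => mollify_mem_Icc hg.locInt hgm n x
  have hHc : ∀ n, Continuous (fun x => H (mollify n g x)) := fun n =>
    hL.continuousOn.comp_continuous (hgs n).continuous (hm n)
  have hHc' : ∀ n, Continuous (fun x => H' (mollify n g x)) := fun n =>
    hL'.continuousOn.comp_continuous (hgs n).continuous (hm n)
  let B := ContinuousLinearMap.mul ℝ ℝ
  refine ⟨(hloc hL).locallyIntegrable, (hloc hL').integrable_test_bilin hg2' B, fun φ h1 h2 => ?_⟩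
  obtain ⟨R, C, hC, hC', hR, hR'⟩ := test_bounds h1 h2 (EuclideanSpace.single k 1)
  have l := tendsto_eLpNorm_mollify_sub_ball hg2 R
  have l' := tendsto_eLpNorm_mollify_sub_ball hg2' R
  have lH := tendsto_eLpNorm_comp_sub hL (ae_restrict_of_ae hgm) hm l
  have lH' := tendsto_eLpNorm_comp_sub hL' (ae_restrict_of_ae hgm) hm l
  have one : LocL2 (fun _ : Plane => (1 : ℝ)) := LocL2.of_continuous continuous_const
  have t1 := tendsto_integral_test_bilin B (continuous_partial h1 _) hC' hR' (hloc hL) one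
    (fun n => LocL2.of_continuous (hHc n)) (fun _ => one) lH (gn := fun _ _ => 1)
    (by simp)
  have t2 := tendsto_integral_test_bilin B h1.continuous hC hR (hloc hL') hg2'
    (fun n => LocL2.of_continuous (hHc' n)) (fun n => LocL2.of_continuous (hgs' n).continuous) lH' l'
  simp only [B, ContinuousLinearMap.mul_apply', mul_one] at t1 t2
  -- the classical chain rule: the mollified functions take values in the same interval
  have key : ∀ n, ∫ x, fderiv ℝ φ x (EuclideanSpace.single k 1) • H (mollify n g x)
      = -∫ x, φ x • (H' (mollify n g x) * mollify n g' x) := fun n => by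
    have hd : ∀ x, HasFDerivAt (fun x => H (mollify n g x))
        (H' (mollify n g x) • fderiv ℝ (mollify n g) x) x := fun x =>
      (hH _ (hm n x)).comp_hasFDerivAt x (((hgs n).differentiable (by simp)) x).hasFDerivAt
    have hB : ∀ x, fderiv ℝ (fun x => H (mollify n g x)) x (EuclideanSpace.single k 1)
        = H' (mollify n g x) * mollify n g' x := fun x => by
      rw [(hd x).fderiv, ← hg.fderiv_mollify n x]; simp
    have i1 := (LocL2.of_continuous (hHc n)).locallyIntegrable
    have i2 := (LocL2.of_continuous ((hHc' n).mul (hgs' n).continuous)).locallyIntegrable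
    have h := integral_smul_fderiv_eq_neg_fderiv_smul_of_integrable
      (μ := (volume : Measure Plane)) (f := φ)
      (g := fun x => H (mollify n g x)) (v := EuclideanSpace.single k 1)
      (i1.integrable_partial_smul h1 h2 _)
      (by simp only [hB]; exact i2.integrable_test_smul h1.continuous h2)
      (i1.integrable_test_smul h1.continuous h2)
      (fun x _ => (h1.differentiable (by simp)).differentiableAt)
      (fun x _ => (hd x).differentiableAt)
    simp only [hB] at h
    rw [h, neg_neg]
  have t3 := t2.neg
  simp only [← key] at t3
  exact tendsto_nhds_unique t1 t3

end Calculus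

/-! ### Cutoffs, integration by parts and density of test functions -/

section Cutoff

variable {E F G : Type*} [NormedAddCommGroup E] [NormedSpace ℝ E] [NormedAddCommGroup F]
  [NormedSpace ℝ F] [NormedAddCommGroup G] [NormedSpace ℝ G]

/-- A fixed bump function, equal to `1` on the unit ball. -/
noncomputable def cutoffBump : ContDiffBump (0 : Plane) := ⟨1, 2, one_pos, one_lt_two⟩

/-- Smooth cutoff functions, equal to `1` on the ball of radius `n + 1`, whose derivatives are
`O(1 / n)`. -/
noncomputable def cutoff (n : ℕ) (x : Plane) : ℝ := cutoffBump (((n : ℝ) + 1)⁻¹ • x)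

theorem contDiff_cutoff (n : ℕ) : ContDiff ℝ ∞ (cutoff n) :=
  cutoffBump.contDiff.comp (contDiff_const_smul _)

theorem hasCompactSupport_cutoff (n : ℕ) : HasCompactSupport (cutoff n) :=
  cutoffBump.hasCompactSupport.comp_homeomorph
    (Homeomorph.smulOfNeZero (((n : ℝ) + 1)⁻¹) (by positivity))

theorem cutoff_nonneg (n : ℕ) (x : Plane) : 0 ≤ cutoff n x := cutoffBump.nonneg

theorem cutoff_le_one (n : ℕ) (x : Plane) : cutoff n x ≤ 1 := cutoffBump.le_one

theorem norm_cutoff_le (n : ℕ) (x : Plane) : ‖cutoff n x‖ ≤ 1 := by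
  rw [Real.norm_eq_abs, abs_of_nonneg (cutoff_nonneg n x)]; exact cutoff_le_one n x

theorem tendsto_inv_nat_add_one : Tendsto (fun n : ℕ => ((n : ℝ) + 1)⁻¹) atTop (𝓝 0) := by
  simpa [one_div] using tendsto_one_div_add_atTop_nhds_zero_nat (𝕜 := ℝ)

theorem tendsto_cutoff (x : Plane) : Tendsto (fun n => cutoff n x) atTop (𝓝 1) := by
  refine tendsto_const_nhds.congr' ?_
  have h : Tendsto (fun n : ℕ => ((n : ℝ) + 1)⁻¹ • x) atTop (𝓝 0) := by
    simpa using tendsto_inv_nat_add_one.smul_const x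
  filter_upwards [h.eventually (Metric.closedBall_mem_nhds (0 : Plane) one_pos)] with n hn
  exact (cutoffBump.one_of_mem_closedBall hn).symm

theorem fderiv_cutoff (n : ℕ) (x v : Plane) : fderiv ℝ (cutoff n) x v
    = ((n : ℝ) + 1)⁻¹ * fderiv ℝ cutoffBump (((n : ℝ) + 1)⁻¹ • x) v := by
  have h1 : HasFDerivAt (fun x : Plane => ((n : ℝ) + 1)⁻¹ • x)
      (((n : ℝ) + 1)⁻¹ • ContinuousLinearMap.id ℝ Plane) x := (hasFDerivAt_id (𝕜 := ℝ) x).fun_const_smul _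
  have h2 := ((cutoffBump.contDiff (n := 1)).differentiable (by simp)
    (((n : ℝ) + 1)⁻¹ • x)).hasFDerivAt.comp x h1
  have h3 : fderiv ℝ (cutoff n) x = _ := h2.fderiv
  rw [h3]; simp

theorem exists_fderiv_cutoff_bound (v : Plane) :
    ∃ C : ℝ, 0 ≤ C ∧ ∀ n x, ‖fderiv ℝ (cutoff n) x v‖ ≤ ((n : ℝ) + 1)⁻¹ * C := by
  have h1 : ContDiff ℝ ∞ cutoffBump := cutoffBump.contDiff
  obtain ⟨C, hC⟩ := (continuous_partial h1 v).bounded_above_of_compact_support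
    (cutoffBump.hasCompactSupport.fderiv_apply (𝕜 := ℝ) v)
  refine ⟨C, (norm_nonneg _).trans (hC 0), fun n x => ?_⟩
  rw [fderiv_cutoff, norm_mul, Real.norm_of_nonneg (by positivity)]
  gcongr
  exact hC _

theorem tendsto_integral_cutoff_smul [CompleteSpace E] {h : Plane → E} (hi : Integrable h volume) :
    Tendsto (fun n => ∫ x, cutoff n x • h x) atTop (𝓝 (∫ x, h x)) := by
  refine tendsto_integral_of_dominated_convergence (fun x => ‖h x‖)
    (fun n => (contDiff_cutoff n).continuous.aestronglyMeasurable.smul hi.1) hi.norm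
    (fun n => ae_of_all _ fun x => ?_) (ae_of_all _ fun x => ?_)
  · rw [norm_smul]; exact mul_le_of_le_one_left (norm_nonneg _) (norm_cutoff_le n x)
  · simpa using (tendsto_cutoff x).smul_const (h x)

/-- The integral of a weak partial derivative vanishes. -/
theorem IsWeakPartial.integral_eq_zero [CompleteSpace E] {k : Fin 2} {h h' : Plane → E}
    (hw : IsWeakPartial k h h') (hi : Integrable h volume) (hi' : Integrable h' volume) :
    ∫ x, h' x = 0 := by
  obtain ⟨C, hC0, hC⟩ := exists_fderiv_cutoff_bound (EuclideanSpace.single k 1)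
  have t1 := (tendsto_integral_cutoff_smul hi').neg
  simp only [← fun n => hw.integral_eq (cutoff n) (contDiff_cutoff n)
    (hasCompactSupport_cutoff n)] at t1
  have t2 : Tendsto (fun n => ∫ x, fderiv ℝ (cutoff n) x (EuclideanSpace.single k 1) • h x) atTop
      (𝓝 0) := by
    refine squeeze_zero_norm (a := fun n : ℕ => ((n : ℝ) + 1)⁻¹ * (C * ∫ x, ‖h x‖)) (fun n => ?_) ?_
    · rw [← mul_assoc, ← integral_const_mul]
      refine norm_integral_le_of_norm_le (hi.norm.const_mul _) (ae_of_all _ fun x => ?_)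
      rw [norm_smul]
      exact mul_le_mul_of_nonneg_right (hC n x) (norm_nonneg _)
    · simpa using tendsto_inv_nat_add_one.mul_const (C * ∫ x, ‖h x‖)
  simpa using tendsto_nhds_unique t1 t2

/-- The product rule for a smooth function and a weakly differentiable function. -/
theorem IsWeakPartial.smooth_smul {k : Fin 2} {f g : Plane → E} (h : IsWeakPartial k f g)
    {χ : Plane → ℝ} (hχ : ContDiff ℝ ∞ χ) (hc : HasCompactSupport χ) :
    IsWeakPartial k (fun x => χ x • f x)
      (fun x => fderiv ℝ χ x (EuclideanSpace.single k 1) • f x + χ x • g x) := by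
  have i1 := h.locInt.integrable_partial_smul hχ hc (EuclideanSpace.single k 1)
  have i2 := h.locInt_partial.integrable_test_smul hχ.continuous hc
  refine ⟨(h.locInt.integrable_test_smul hχ.continuous hc).locallyIntegrable,
    (i1.add i2).locallyIntegrable, fun φ h1 h2 => ?_⟩
  have e := h.integral_eq (fun x => φ x * χ x) (h1.mul hχ) (h2.mul_right)
  have e1 : ∀ x, fderiv ℝ (fun x => φ x * χ x) x (EuclideanSpace.single k 1)
      = φ x * fderiv ℝ χ x (EuclideanSpace.single k 1)
        + fderiv ℝ φ x (EuclideanSpace.single k 1) * χ x := fun x => by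
    rw [fderiv_fun_mul (h1.differentiable (by simp) x) (hχ.differentiable (by simp) x)]
    simp [mul_comm]
  simp only [e1, add_smul, mul_smul] at e
  rw [integral_add (i1.locallyIntegrable.integrable_test_smul h1.continuous h2)
    ((h.locInt.integrable_test_smul hχ.continuous
      hc).locallyIntegrable.integrable_partial_smul h1 h2 _)] at e
  simp only [smul_add]
  rw [integral_add (i1.locallyIntegrable.integrable_test_smul h1.continuous h2)
    (i2.locallyIntegrable.integrable_test_smul h1.continuous h2), neg_add, ← e]
  abel

/-- `f` belongs to `H¹`, with weak partial derivatives `f' k`. -/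
structure IsSobolev (f : Plane → E) (f' : Fin 2 → Plane → E) : Prop where
  memLp : MemLp f 2 volume
  memLp_partial : ∀ k, MemLp (f' k) 2 volume
  weak : ∀ k, IsWeakPartial k f (f' k)

theorem integrable_bilin {α : Type*} {m : MeasurableSpace α} {μ : Measure α}
    (B : E →L[ℝ] F →L[ℝ] G) {f : α → E} {g : α → F} (hf : MemLp f 2 μ) (hg : MemLp g 2 μ) :
    Integrable (fun x => B (f x) (g x)) μ := by
  have : ENNReal.HolderTriple 2 2 1 := ⟨by simp [ENNReal.inv_two_add_inv_two]⟩
  exact memLp_one_iff_integrable.1 (B.memLp_bilin hf hg)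

/-- Integration by parts in `H¹`. -/
theorem IsSobolev.integral_bilin [CompleteSpace E] [CompleteSpace F] [CompleteSpace G]
    (B : E →L[ℝ] F →L[ℝ] G) {f : Plane → E} {f' : Fin 2 → Plane → E} {g : Plane → F}
    {g' : Fin 2 → Plane → F} (hf : IsSobolev f f') (hg : IsSobolev g g') (k : Fin 2) :
    ∫ x, B (f' k x) (g x) = -∫ x, B (f x) (g' k x) := by
  have i1 := integrable_bilin B (hf.memLp_partial k) hg.memLp
  have i2 := integrable_bilin B hf.memLp (hg.memLp_partial k)
  have h := ((hf.weak k).bilin B (hg.weak k) hf.memLp.locL2 (hf.memLp_partial k).locL2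
    hg.memLp.locL2 (hg.memLp_partial k).locL2).integral_eq_zero
    (integrable_bilin B hf.memLp hg.memLp) (i1.add i2)
  rw [integral_add i1 i2] at h
  exact eq_neg_of_add_eq_zero_left h

theorem IsSobolev.add {f g : Plane → E} {f' g' : Fin 2 → Plane → E} (hf : IsSobolev f f')
    (hg : IsSobolev g g') : IsSobolev (fun x => f x + g x) (fun k x => f' k x + g' k x) :=
  ⟨hf.memLp.add hg.memLp, fun k => (hf.memLp_partial k).add (hg.memLp_partial k),
    fun k => (hf.weak k).add (hg.weak k)⟩

theorem IsSobolev.sub {f g : Plane → E} {f' g' : Fin 2 → Plane → E} (hf : IsSobolev f f')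
    (hg : IsSobolev g g') : IsSobolev (fun x => f x - g x) (fun k x => f' k x - g' k x) :=
  ⟨hf.memLp.sub hg.memLp, fun k => (hf.memLp_partial k).sub (hg.memLp_partial k),
    fun k => (hf.weak k).sub (hg.weak k)⟩

theorem IsSobolev.const_smul {f : Plane → E} {f' : Fin 2 → Plane → E} (hf : IsSobolev f f')
    (c : ℝ) : IsSobolev (fun x => c • f x) (fun k x => c • f' k x) :=
  ⟨hf.memLp.const_smul c, fun k => (hf.memLp_partial k).const_smul c,
    fun k => (hf.weak k).const_smul c⟩

/-- A smooth compactly supported function belongs to `H¹`, with its classical derivatives. -/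
theorem IsSobolev.of_contDiff [CompleteSpace E] {f : Plane → E} (hf : ContDiff ℝ ∞ f)
    (hc : HasCompactSupport f) :
    IsSobolev f (fun k x => fderiv ℝ f x (EuclideanSpace.single k 1)) := by
  have hd : ∀ k : Fin 2, Continuous fun x => fderiv ℝ f x (EuclideanSpace.single k 1) := fun k =>
    (hf.continuous_fderiv (by simp)).clm_apply continuous_const
  have hdc : ∀ k : Fin 2, HasCompactSupport fun x => fderiv ℝ f x (EuclideanSpace.single k 1) :=
    fun k => hc.fderiv_apply (𝕜 := ℝ) _
  refine ⟨hf.continuous.memLp_of_hasCompactSupport hc,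
    fun k => (hd k).memLp_of_hasCompactSupport (hdc k), fun k => ⟨hf.continuous.locallyIntegrable,
    (hd k).locallyIntegrable, fun φ h1 h2 => ?_⟩⟩
  have h := integral_smul_fderiv_eq_neg_fderiv_smul_of_integrable
      (μ := (volume : Measure Plane)) (f := φ) (g := f) (v := EuclideanSpace.single k 1)
      (hf.continuous.locallyIntegrable.integrable_partial_smul h1 h2 _)
      ((hd k).locallyIntegrable.integrable_test_smul h1.continuous h2)
      (hf.continuous.locallyIntegrable.integrable_test_smul h1.continuous h2)
      (fun x _ => (h1.differentiable (by simp)).differentiableAt)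
      (fun x _ => (hf.differentiable (by simp)).differentiableAt)
  rw [h, neg_neg]

theorem tendsto_eLpNorm_cutoff_smul_sub {f : Plane → E} (hf : MemLp f 2 volume) :
    Tendsto (fun n => eLpNorm ((fun x => cutoff n x • f x) - f) 2 volume) atTop (𝓝 0) := by
  have h : Tendsto (fun n => ∫⁻ x, ‖cutoff n x • f x - f x‖ₑ ^ 2) atTop (𝓝 (∫⁻ _ : Plane, 0)) := by
    refine tendsto_lintegral_of_dominated_convergence' (fun x => ‖f x‖ₑ ^ 2) (fun n => ?_)
      (fun n => ae_of_all _ fun x => ?_) ?_ (ae_of_all _ fun x => ?_)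
    · exact (((contDiff_cutoff n).continuous.aestronglyMeasurable.smul hf.1).sub
        hf.1).enorm.pow_const 2
    · refine pow_le_pow_left' ?_ 2
      have e : cutoff n x • f x - f x = -((1 - cutoff n x) • f x) := by rw [sub_smul, one_smul]; abel
      rw [e, enorm_neg, enorm_smul]
      refine mul_le_of_le_one_left zero_le ?_
      rw [Real.enorm_eq_ofReal (by linarith [cutoff_le_one n x])]
      exact ENNReal.ofReal_le_one.2 (by linarith [cutoff_nonneg n x])
    · rw [← sq_eLpNorm_two]; exact (ENNReal.pow_lt_top hf.2).ne
    · have h1 : Tendsto (fun n => cutoff n x • f x - f x) atTop (𝓝 0) := by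
        simpa using ((tendsto_cutoff x).smul_const (f x)).sub_const (f x)
      have h2 := (ENNReal.continuous_pow 2).tendsto _ |>.comp h1.enorm
      simpa [Function.comp_def] using h2
  have h2 := (ENNReal.continuous_rpow_const (y := (1 / 2 : ℝ))).tendsto _ |>.comp h
  simp only [lintegral_zero] at h2
  rw [ENNReal.zero_rpow_of_pos (by norm_num)] at h2
  refine h2.congr fun n => ?_
  simp only [Function.comp_apply]
  have := sq_eLpNorm_two (μ := volume) ((fun x => cutoff n x • f x) - f)
  simp only [Pi.sub_apply] at this
  rw [← this, ← ENNReal.rpow_natCast, ← ENNReal.rpow_mul]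
  norm_num

theorem eLpNorm_smul_le_of_bound {f : Plane → E} {φ : Plane → ℝ} {C : ℝ}
    (hC : ∀ x, ‖φ x‖ ≤ C) (p : ℝ≥0∞) :
    eLpNorm (fun x => φ x • f x) p volume ≤ ENNReal.ofReal C * eLpNorm f p volume :=
  eLpNorm_le_mul_eLpNorm_of_ae_le_mul (ae_of_all _ fun x => by
    rw [norm_smul]; exact mul_le_mul_of_nonneg_right (hC x) (norm_nonneg _)) p

/-- Test functions are dense in `H¹`. -/
theorem IsSobolev.exists_approx [CompleteSpace E] {f : Plane → E} {f' : Fin 2 → Plane → E}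
    (hf : IsSobolev f f') : ∃ fn : ℕ → Plane → E, (∀ n, ContDiff ℝ ∞ (fn n)) ∧
      (∀ n, HasCompactSupport (fn n)) ∧
      Tendsto (fun n => eLpNorm (fn n - f) 2 volume) atTop (𝓝 0) ∧
      ∀ k, Tendsto (fun n => eLpNorm
        ((fun x => fderiv ℝ (fn n) x (EuclideanSpace.single k 1)) - f' k) 2 volume) atTop (𝓝 0) := by
  have key : ∀ ε : ℝ≥0∞, ε ≠ 0 → ∃ g : Plane → E, ContDiff ℝ ∞ g ∧ HasCompactSupport g ∧
      eLpNorm (g - f) 2 volume ≤ ε ∧ ∀ k,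
        eLpNorm ((fun x => fderiv ℝ g x (EuclideanSpace.single k 1)) - f' k) 2 volume ≤ ε := by
    intro ε hε
    have hε2 : ε / 2 ≠ 0 := (ENNReal.half_pos hε).ne'
    have d : ∀ k n, MemLp (fun x => fderiv ℝ (cutoff n) x (EuclideanSpace.single k 1) • f x) 2
        volume := fun k n => by
      obtain ⟨C, -, hC⟩ := exists_fderiv_cutoff_bound (EuclideanSpace.single k 1)
      exact ⟨(continuous_partial (contDiff_cutoff n) _).aestronglyMeasurable.smul hf.memLp.1,
        (eLpNorm_smul_le_of_bound (hC n) 2).trans_lt (ENNReal.mul_lt_top (by simp) hf.memLp.2)⟩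
    have d' : ∀ {u : Plane → E} (n : ℕ), MemLp u 2 volume →
        MemLp (fun x => cutoff n x • u x) 2 volume := fun n hu =>
      ⟨(contDiff_cutoff n).continuous.aestronglyMeasurable.smul hu.1,
        (eLpNorm_smul_le_of_bound (norm_cutoff_le n) 2).trans_lt (ENNReal.mul_lt_top (by simp) hu.2)⟩
    have t1 := tendsto_eLpNorm_cutoff_smul_sub hf.memLp
    have t2 : ∀ k, Tendsto (fun n => eLpNorm ((fun x => fderiv ℝ (cutoff n) x
        (EuclideanSpace.single k 1) • f x + cutoff n x • f' k x) - f' k) 2 volume) atTop (𝓝 0) := by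
      intro k
      obtain ⟨C, hC0, hC⟩ := exists_fderiv_cutoff_bound (EuclideanSpace.single k 1)
      have t3 := tendsto_eLpNorm_cutoff_smul_sub (hf.memLp_partial k)
      have t4 : Tendsto (fun n : ℕ => ENNReal.ofReal (((n : ℝ) + 1)⁻¹ * C) * eLpNorm f 2 volume)
          atTop (𝓝 0) := by
        have : Tendsto (fun n : ℕ => ENNReal.ofReal (((n : ℝ) + 1)⁻¹ * C)) atTop (𝓝 0) := by
          simpa using ENNReal.tendsto_ofReal (tendsto_inv_nat_add_one.mul_const C)
        simpa using ENNReal.Tendsto.mul_const this (Or.inr hf.memLp.2.ne)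
      have t5 := t4.add t3
      rw [add_zero] at t5
      refine tendsto_of_tendsto_of_tendsto_of_le_of_le tendsto_const_nhds t5 (fun _ => zero_le)
        fun n => ?_
      rw [show ((fun x => fderiv ℝ (cutoff n) x (EuclideanSpace.single k 1) • f x
        + cutoff n x • f' k x) - f' k) = (fun x => fderiv ℝ (cutoff n) x
          (EuclideanSpace.single k 1) • f x) + ((fun x => cutoff n x • f' k x) - f' k) by
        ext x; simp [add_sub_assoc]]
      refine (eLpNorm_add_le (d k n).1 ((d' n (hf.memLp_partial k)).sub (hf.memLp_partial k)).1
        (by norm_num)).trans ?_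
      gcongr
      exact eLpNorm_smul_le_of_bound (hC n) 2
    have e1 := ENNReal.tendsto_nhds_zero.1 t1 _ (pos_iff_ne_zero.2 hε2)
    have e2 := fun k => ENNReal.tendsto_nhds_zero.1 (t2 k) _ (pos_iff_ne_zero.2 hε2)
    -- cut off first, then mollify
    obtain ⟨n, h1, h2⟩ := (e1.and (eventually_all.2 e2)).exists
    set F₀ : Plane → E := fun x => cutoff n x • f x
    set F₁ : Fin 2 → Plane → E := fun k x => fderiv ℝ (cutoff n) x (EuclideanSpace.single k 1) • f x
        + cutoff n x • f' k x
    have hF₀ : MemLp F₀ 2 volume := d' n hf.memLp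
    have hF₁ : ∀ k, MemLp (F₁ k) 2 volume := fun k => (d k n).add (d' n (hf.memLp_partial k))
    have hw : ∀ k, IsWeakPartial k F₀ (F₁ k) := fun k =>
      (hf.weak k).smooth_smul (contDiff_cutoff n) (hasCompactSupport_cutoff n)
    have e3 := ENNReal.tendsto_nhds_zero.1 (tendsto_eLpNorm_mollify_sub hF₀) _
      (pos_iff_ne_zero.2 hε2)
    have e4 := fun k => ENNReal.tendsto_nhds_zero.1 (tendsto_eLpNorm_mollify_sub (hF₁ k)) _
      (pos_iff_ne_zero.2 hε2)
    obtain ⟨m, h3, h4⟩ := (e3.and (eventually_all.2 e4)).exists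
    have tri : ∀ {u v w : Plane → E}, AEStronglyMeasurable u volume → AEStronglyMeasurable v volume →
        AEStronglyMeasurable w volume → eLpNorm (u - v) 2 volume ≤ ε / 2 →
        eLpNorm (v - w) 2 volume ≤ ε / 2 → eLpNorm (u - w) 2 volume ≤ ε := by
      intro u v w hu hv hw a b
      calc eLpNorm (u - w) 2 volume = eLpNorm ((u - v) + (v - w)) 2 volume := by simp
        _ ≤ ε / 2 + ε / 2 := (eLpNorm_add_le (hu.sub hv) (hv.sub hw) (by norm_num)).trans
            (add_le_add a b)
        _ = ε := ENNReal.add_halves ε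
    refine ⟨mollify m F₀, contDiff_mollify m (hw 0).locInt,
      HasCompactSupport.mollify m ((hasCompactSupport_cutoff n).smul_right), ?_, fun k => ?_⟩
    · exact tri (contDiff_mollify m (hw 0).locInt).continuous.aestronglyMeasurable hF₀.1
        hf.memLp.1 h3 h1
    · simp only [(hw k).fderiv_mollify m]
      exact tri (contDiff_mollify m (hw k).locInt_partial).continuous.aestronglyMeasurable (hF₁ k).1
        (hf.memLp_partial k).1 (h4 k) (h2 k)
  choose g hg1 hg2 hg3 hg4 using fun n : ℕ => key ((n : ℝ≥0∞) + 1)⁻¹ (by simp)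
  have hlim : Tendsto (fun n : ℕ => ((n : ℝ≥0∞) + 1)⁻¹) atTop (𝓝 0) := by
    have := (tendsto_add_atTop_iff_nat 1).2 ENNReal.tendsto_inv_nat_nhds_zero
    simpa using this
  exact ⟨g, hg1, hg2, tendsto_of_tendsto_of_tendsto_of_le_of_le tendsto_const_nhds hlim
    (fun _ => zero_le) hg3, fun k => tendsto_of_tendsto_of_tendsto_of_le_of_le tendsto_const_nhds
    hlim (fun _ => zero_le) fun n => hg4 n k⟩

end Cutoff

/-! ### The Sobolev inequality with the growth `√p` of the constant -/

section Sobolev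

variable {E : Type*} [NormedAddCommGroup E] [NormedSpace ℝ E]

/-- The power `‖y‖^{-β}` with `β < 2`, integrated over the unit disc in polar coordinates. -/
theorem lintegral_ball_norm_rpow_le {β : ℝ} (hβ : β < 2) :
    ∫⁻ y in Metric.ball (0 : Plane) 1, ‖y‖ₑ ^ (-β) ≤ ENNReal.ofReal (2 * Real.pi / (2 - β)) := by
  set f : ℝ → ℝ := (Iio (1 : ℝ)).indicator fun r => r ^ (-β) with hf
  have hdim : Module.finrank ℝ Plane - 1 = 1 := by simp
  have hpow : ∀ y ∈ Ioi (0 : ℝ), y ^ (Module.finrank ℝ Plane - 1) • f y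
      = (Iio (1 : ℝ)).indicator (fun r => r ^ (1 - β)) y := fun y hy => by
    rw [hdim, hf]
    by_cases h : y ∈ Iio (1 : ℝ)
    · simp only [indicator_of_mem h, pow_one, smul_eq_mul]
      rw [sub_eq_add_neg, Real.rpow_add hy, Real.rpow_one]
    · simp [indicator_of_notMem h]
  have hint : IntegrableOn (fun r : ℝ => r ^ (1 - β)) (Ioo 0 1) :=
    ((intervalIntegral.intervalIntegrable_rpow' (by linarith : -1 < 1 - β)).1).mono_set
      Ioo_subset_Ioc_self
  have hset : Ioi (0 : ℝ) ∩ Iio 1 = Ioo 0 1 := rfl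
  have hi : Integrable (fun x : Plane => f ‖x‖) volume := by
    rw [integrable_fun_norm_addHaar]
    refine IntegrableOn.congr_fun ?_ (fun y hy => (hpow y hy).symm) measurableSet_Ioi
    rw [IntegrableOn, integrable_indicator_iff measurableSet_Iio, IntegrableOn,
      Measure.restrict_restrict measurableSet_Iio, inter_comm, hset]
    exact hint
  have hval : ∫ x : Plane, f ‖x‖ = 2 * Real.pi / (2 - β) := by
    rw [integral_fun_norm_addHaar, setIntegral_congr_fun measurableSet_Ioi hpow,
      integral_indicator measurableSet_Iio, Measure.restrict_restrict measurableSet_Iio,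
      inter_comm, hset, ← integral_Ioc_eq_integral_Ioo, ← intervalIntegral.integral_of_le zero_le_one,
      integral_rpow (Or.inl (by linarith))]
    have hb : (volume : Measure Plane).real (Metric.ball 0 1) = Real.pi := by
      simp [Measure.real, Real.pi_pos.le]
    rw [hb, Real.one_rpow, Real.zero_rpow (by linarith)]
    simp only [finrank_euclideanSpace, Fintype.card_fin, smul_eq_mul, nsmul_eq_mul]
    rw [show 1 - β + 1 = 2 - β by ring]
    push_cast; ring
  have hnn : ∀ x : Plane, 0 ≤ f ‖x‖ := fun x =>
    indicator_apply_nonneg fun _ => Real.rpow_nonneg (norm_nonneg _) _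
  rw [← hval, ofReal_integral_eq_lintegral_ofReal hi (ae_of_all _ hnn),
    ← lintegral_indicator measurableSet_ball]
  refine lintegral_mono_ae ?_
  filter_upwards [compl_mem_ae_iff.2 (measure_singleton (0 : Plane))] with y hy
  have hy0 : 0 < ‖y‖ := norm_pos_iff.2 hy
  by_cases h : y ∈ Metric.ball (0 : Plane) 1
  · have h' : ‖y‖ ∈ Iio (1 : ℝ) := mem_ball_zero_iff.1 h
    rw [indicator_of_mem h, hf, indicator_of_mem h', ← ENNReal.ofReal_rpow_of_pos hy0,
      ofReal_norm]
  · simp [indicator_of_notMem h]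

theorem lintegral_Ioi_rpow_neg_three_le {r : ℝ} (hr : 0 < r) :
    ∫⁻ s in Ioi r, ENNReal.ofReal (s ^ (-3 : ℝ)) ≤ ENNReal.ofReal (r ^ (-2 : ℝ)) := by
  rw [← ofReal_integral_eq_lintegral_ofReal (integrableOn_Ioi_rpow_of_lt (by norm_num) hr)
    ((ae_restrict_mem measurableSet_Ioi).mono fun s hs => Real.rpow_nonneg (hr.trans hs).le _),
    integral_Ioi_rpow_of_lt (by norm_num) hr]
  refine ENNReal.ofReal_le_ofReal ?_
  have : 0 ≤ r ^ (-2 : ℝ) := Real.rpow_nonneg hr.le _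
  rw [show (-3 : ℝ) + 1 = -2 by norm_num, neg_div_neg_eq]
  linarith

/-- The fundamental theorem of calculus on the segment from `x` to `x + z`. -/
theorem enorm_le_add_lintegral_segment [CompleteSpace E] {f : Plane → E} (hf : ContDiff ℝ 1 f)
    (x z : Plane) : ‖f x‖ₑ ≤ ‖f (x + z)‖ₑ
      + ∫⁻ s in Ioc (0 : ℝ) 1, ‖fderiv ℝ f (x + s • z)‖ₑ * ‖z‖ₑ := by
  have hc : Continuous fun s : ℝ => fderiv ℝ f (x + s • z) z :=
    ((hf.continuous_fderiv (by simp)).comp (by fun_prop)).clm_apply continuous_const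
  have h1 : ∫ s in (0 : ℝ)..1, fderiv ℝ f (x + s • z) z = f (x + z) - f x := by
    have h2 : ∀ s : ℝ, HasDerivAt (fun s : ℝ => f (x + s • z)) (fderiv ℝ f (x + s • z) z) s :=
      fun s => by
        have h3 : HasDerivAt (fun s : ℝ => x + s • z) z s := by
          simpa using ((hasDerivAt_id s).smul_const z).const_add x
        exact ((hf.differentiable (by simp)) (x + s • z)).hasFDerivAt.comp_hasDerivAt s h3
    rw [intervalIntegral.integral_eq_sub_of_hasDerivAt (fun s _ => h2 s)
      (hc.intervalIntegrable _ _)]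
    simp
  have h4 : f x = f (x + z) - ∫ s in (0 : ℝ)..1, fderiv ℝ f (x + s • z) z := by rw [h1]; abel
  calc ‖f x‖ₑ ≤ ‖f (x + z)‖ₑ + ‖∫ s in (0 : ℝ)..1, fderiv ℝ f (x + s • z) z‖ₑ := by
        conv_lhs => rw [h4]
        exact enorm_sub_le
    _ ≤ _ := by
        gcongr
        rw [intervalIntegral.integral_of_le zero_le_one]
        refine (enorm_integral_le_lintegral_enorm _).trans (lintegral_mono fun s => ?_)
        exact ContinuousLinearMap.le_opENorm _ _

/-- A pointwise bound of a function by the Riesz potential of its gradient, localized to a unit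
ball. It comes from averaging `f(x) = f(x + z) - ∫₀¹ Df(x + sz) z ds` over `z` in the ball. -/
theorem enorm_le_lintegral_ball [CompleteSpace E] {f : Plane → E} (hf : ContDiff ℝ 1 f)
    (x : Plane) : ENNReal.ofReal Real.pi * ‖f x‖ₑ ≤ ∫⁻ y in Metric.ball (0 : Plane) 1,
      (‖f (x + y)‖ₑ + ‖fderiv ℝ f (x + y)‖ₑ) * ‖y‖ₑ ^ (-1 : ℝ) := by
  set D : Plane → ℝ≥0∞ := fun y => ‖fderiv ℝ f (x + y)‖ₑ with hD
  have hDc : Continuous D := ((hf.continuous_fderiv (by simp)).comp (by fun_prop)).enorm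
  have hfc : Continuous fun y => ‖f (x + y)‖ₑ := (hf.continuous.comp (by fun_prop)).enorm
  set B := Metric.ball (0 : Plane) 1
  have hB : MeasurableSet B := measurableSet_ball
  have hvol : (volume : Measure Plane) B = ENNReal.ofReal Real.pi := by simp [B]
  have hjm : Measurable fun p : Plane × ℝ => D (p.2 • p.1) * ‖p.1‖ₑ :=
    (hDc.measurable.comp (by fun_prop)).mul (by fun_prop)
  have step1 : ENNReal.ofReal Real.pi * ‖f x‖ₑ ≤ (∫⁻ z in B, ‖f (x + z)‖ₑ)
      + ∫⁻ z in B, ∫⁻ s in Ioc (0 : ℝ) 1, D (s • z) * ‖z‖ₑ := by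
    rw [← lintegral_add_left hfc.measurable]
    calc ENNReal.ofReal Real.pi * ‖f x‖ₑ = ∫⁻ _ in B, ‖f x‖ₑ := by
          rw [setLIntegral_const, hvol, mul_comm]
      _ ≤ _ := lintegral_mono fun z => enorm_le_add_lintegral_segment hf x z
  have step2 : ∫⁻ z in B, ∫⁻ s in Ioc (0 : ℝ) 1, D (s • z) * ‖z‖ₑ
      ≤ ∫⁻ y in B, D y * ‖y‖ₑ ^ (-1 : ℝ) := by
    have hsub : ∀ s ∈ Ioc (0 : ℝ) 1, ∫⁻ z in B, D (s • z) * ‖z‖ₑ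
        = ∫⁻ y, (Metric.ball (0 : Plane) s).indicator (fun y => D y * ‖y‖ₑ) y
          * ENNReal.ofReal (s ^ (-3 : ℝ)) := by
      intro s hs
      have hm : Measurable fun y : Plane =>
          (Metric.ball (0 : Plane) s).indicator (fun y => D y * ‖y‖ₑ) y * ENNReal.ofReal s⁻¹ :=
        ((hDc.measurable.mul (by fun_prop)).indicator measurableSet_ball).mul_const _
      have e1 : ∀ z : Plane, B.indicator (fun z => D (s • z) * ‖z‖ₑ) z
          = (Metric.ball (0 : Plane) s).indicator (fun y => D y * ‖y‖ₑ) (s • z)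
            * ENNReal.ofReal s⁻¹ := fun z => by
        have hmem : z ∈ B ↔ s • z ∈ Metric.ball (0 : Plane) s := by
          simp only [B, mem_ball_zero_iff, norm_smul, Real.norm_of_nonneg hs.1.le]
          exact ⟨fun h => by nlinarith [hs.1], fun h => by
            by_contra h'; nlinarith [hs.1]⟩
        by_cases hz : z ∈ B
        · rw [indicator_of_mem hz, indicator_of_mem (hmem.1 hz), mul_assoc, enorm_smul,
            Real.enorm_eq_ofReal hs.1.le, mul_comm (ENNReal.ofReal s), mul_assoc ‖z‖ₑ,
            ← ENNReal.ofReal_mul hs.1.le, mul_inv_cancel₀ hs.1.ne', ENNReal.ofReal_one, mul_one]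
        · rw [indicator_of_notMem hz, indicator_of_notMem (fun h => hz (hmem.2 h)), zero_mul]
      rw [← lintegral_indicator hB]
      simp only [e1]
      rw [← lintegral_map (f := fun y : Plane =>
          (Metric.ball (0 : Plane) s).indicator (fun y => D y * ‖y‖ₑ) y * ENNReal.ofReal s⁻¹)
          (g := fun z : Plane => s • z) hm (by fun_prop), Measure.map_addHaar_smul _ hs.1.ne',
        lintegral_smul_measure, smul_eq_mul, ← lintegral_const_mul _ hm]
      congr 1; ext y
      rw [mul_left_comm, ← ENNReal.ofReal_mul (by positivity)]
      congr 2
      rw [abs_of_pos (by have := hs.1; positivity)]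
      simp only [finrank_euclideanSpace, Fintype.card_fin]
      rw [show (-3 : ℝ) = -((3 : ℕ) : ℝ) by norm_num, Real.rpow_neg hs.1.le, Real.rpow_natCast,
        ← mul_inv]
      ring
    -- for fixed `s` substitute `y = s z`; then the integral over `s ∈ (‖y‖, 1)` gives `‖y‖⁻¹`
    rw [lintegral_lintegral_swap (by exact hjm.aemeasurable),
      setLIntegral_congr_fun measurableSet_Ioc hsub, lintegral_lintegral_swap]
    · rw [← lintegral_indicator hB]
      refine lintegral_mono fun y => ?_
      by_cases hy0 : y = 0
      · subst hy0
        have : ∀ s : ℝ, (Metric.ball (0 : Plane) s).indicator (fun y => D y * ‖y‖ₑ) 0 = 0 :=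
          fun s => by simp [indicator]
        simp [this]
      have hyp : 0 < ‖y‖ := norm_pos_iff.2 hy0
      have e2 : ∀ s ∈ Ioc (0 : ℝ) 1,
          (Metric.ball (0 : Plane) s).indicator (fun y => D y * ‖y‖ₑ) y
            * ENNReal.ofReal (s ^ (-3 : ℝ)) = (D y * ‖y‖ₑ) *
              (Ioi ‖y‖).indicator (fun s => ENNReal.ofReal (s ^ (-3 : ℝ))) s := fun s _ => by
        by_cases h : ‖y‖ < s
        · rw [indicator_of_mem (mem_ball_zero_iff.2 h), indicator_of_mem (mem_Ioi.2 h)]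
        · rw [indicator_of_notMem (fun h' => h (mem_ball_zero_iff.1 h')),
            indicator_of_notMem (show s ∉ Ioi ‖y‖ from h), zero_mul, mul_zero]
      have hm3 : Measurable fun s : ℝ => ENNReal.ofReal (s ^ (-3 : ℝ)) := by fun_prop
      rw [setLIntegral_congr_fun measurableSet_Ioc e2,
        lintegral_const_mul _ (hm3.indicator measurableSet_Ioi),
        setLIntegral_indicator measurableSet_Ioi]
      by_cases hy : y ∈ B
      · rw [indicator_of_mem hy, mul_assoc]
        gcongr
        calc ‖y‖ₑ * ∫⁻ s in Ioi ‖y‖ ∩ Ioc 0 1, ENNReal.ofReal (s ^ (-3 : ℝ))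
            ≤ ‖y‖ₑ * ENNReal.ofReal (‖y‖ ^ (-2 : ℝ)) := by
              gcongr
              exact (lintegral_mono_set inter_subset_left).trans
                (lintegral_Ioi_rpow_neg_three_le hyp)
          _ = ‖y‖ₑ ^ (-1 : ℝ) := by
              rw [← ENNReal.ofReal_rpow_of_pos hyp, ofReal_norm]
              nth_rewrite 1 [← ENNReal.rpow_one ‖y‖ₑ]
              rw [← ENNReal.rpow_add _ _ (by simpa using hy0) (by simp)]
              norm_num
      · have : Ioi ‖y‖ ∩ Ioc 0 1 = ∅ := by
          ext s
          simp only [B, mem_ball_zero_iff, not_lt] at hy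
          simp only [mem_inter_iff, mem_Ioi, mem_Ioc, mem_empty_iff_false, iff_false]
          rintro ⟨h1, h2, h3⟩
          linarith
        simp [this]
    · refine Measurable.aemeasurable (Measurable.mul ?_ (by fun_prop))
      have hset : MeasurableSet {p : ℝ × Plane | ‖p.2‖ < p.1} :=
        measurableSet_lt (by fun_prop) (by fun_prop)
      have hm : Measurable fun p : ℝ × Plane => D p.2 * ‖p.2‖ₑ :=
        (hDc.measurable.comp measurable_snd).mul (by fun_prop)
      convert hm.indicator hset using 1
      ext p
      simp [indicator]
  refine (step1.trans (add_le_add_right step2 _)).trans ?_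
  rw [← lintegral_add_left hfc.measurable]
  refine setLIntegral_mono' hB fun y hy => ?_
  rw [add_mul]
  gcongr
  refine le_mul_of_one_le_right' ?_
  rw [ENNReal.rpow_neg_one, ENNReal.one_le_inv]
  rw [mem_ball_zero_iff] at hy
  rw [← ofReal_norm]
  exact ENNReal.ofReal_le_one.2 hy.le

/-- An `L² → L^p` bound for the localized Riesz potential. -/
theorem lintegral_potential_rpow_le {g : Plane → ℝ≥0∞} (hg : Measurable g) {p : ℝ} (hp : 2 ≤ p) :
    ∫⁻ x, (∫⁻ y in Metric.ball (0 : Plane) 1, g (x + y) * ‖y‖ₑ ^ (-1 : ℝ)) ^ p ≤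
      (ENNReal.ofReal (Real.pi * p)) ^ (p / 2) * (∫⁻ x, g x ^ 2) ^ (p / 2)
        * ENNReal.ofReal (2 * Real.pi) := by
  set B := Metric.ball (0 : Plane) 1
  have hp0 : 0 < p := by linarith
  set κ : ℝ≥0∞ := ∫⁻ y in B, ‖y‖ₑ ^ (-(2 - 2 / p) : ℝ) with hκ
  set I : ℝ≥0∞ := ∫⁻ x, g x ^ 2 with hI
  -- the source of the growth of the Sobolev constant: `κ` has size `p`, and it enters with the
  -- power `1/2`
  have hκle : κ ≤ ENNReal.ofReal (Real.pi * p) := by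
    refine (lintegral_ball_norm_rpow_le (by have : 0 < 2 / p := by positivity
                                            linarith)).trans (le_of_eq ?_)
    congr 1
    field_simp
    ring
  have key : ∀ x, (∫⁻ y in B, g (x + y) * ‖y‖ₑ ^ (-1 : ℝ)) ^ p ≤
      κ ^ (p / 2) * I ^ (p / 2 - 1) * ∫⁻ y in B, g (x + y) ^ 2 * ‖y‖ₑ ^ (-1 : ℝ) := by
    intro x
    have hgx : Measurable fun y => g (x + y) := hg.comp (by fun_prop)
    have hw : ∀ a : ℝ, Measurable fun y : Plane => ‖y‖ₑ ^ a := fun a => by fun_prop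
    -- Hölder with the exponents `2`, `(1/2 - 1/p)⁻¹` and `p`, after splitting the integrand as
    -- `(‖y‖^{-(2 - 2/p)})^{1/2} (g²)^{1/2 - 1/p} (g² ‖y‖⁻¹)^{1/p}`
    have hhold := ENNReal.lintegral_prod_norm_pow_le (μ := volume.restrict B) Finset.univ
      (f := ![fun y => ‖y‖ₑ ^ (-(2 - 2 / p) : ℝ), fun y => g (x + y) ^ 2,
        fun y => g (x + y) ^ 2 * ‖y‖ₑ ^ (-1 : ℝ)])
      (p := ![1 / 2, 1 / 2 - 1 / p, 1 / p]) (by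
        intro i _
        fin_cases i
        · exact (hw _).aemeasurable
        · exact (hgx.pow_const 2).aemeasurable
        · exact ((hgx.pow_const 2).mul (hw _)).aemeasurable)
      (by simp [Fin.sum_univ_three]; ring) (by
        have : 1 / p ≤ 1 / 2 := one_div_le_one_div_of_le (by norm_num) hp
        intro i _
        fin_cases i
        · simp
        · simp only [Fin.mk_one, Fin.isValue, Matrix.cons_val_one, Matrix.cons_val_zero]
          linarith
        · simp only [Fin.reduceFinMk, Matrix.cons_val]; positivity)
    simp only [Fin.prod_univ_three, Matrix.cons_val_zero, Matrix.cons_val_one,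
      Matrix.cons_val] at hhold
    have hpt : ∫⁻ y in B, g (x + y) * ‖y‖ₑ ^ (-1 : ℝ) ≤ ∫⁻ y in B,
        (‖y‖ₑ ^ (-(2 - 2 / p) : ℝ)) ^ (1 / 2 : ℝ) * (g (x + y) ^ 2) ^ (1 / 2 - 1 / p)
          * (g (x + y) ^ 2 * ‖y‖ₑ ^ (-1 : ℝ)) ^ (1 / p) := by
      refine lintegral_mono_ae (ae_restrict_of_ae ?_)
      filter_upwards [compl_mem_ae_iff.2 (measure_singleton (0 : Plane))] with y hy
      have hy0 : ‖y‖ₑ ≠ 0 := by simpa using hy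
      have hyt : ‖y‖ₑ ≠ ⊤ := by simp
      have h1p : 1 / p ≤ 1 / 2 := one_div_le_one_div_of_le (by norm_num) hp
      rw [ENNReal.mul_rpow_of_nonneg _ _ (by positivity : 0 ≤ 1 / p), ← ENNReal.rpow_mul,
        ← ENNReal.rpow_mul]
      have e1 : (g (x + y) ^ 2) ^ (1 / 2 - 1 / p) * (g (x + y) ^ 2) ^ (1 / p) = g (x + y) := by
        rw [← ENNReal.rpow_add_of_nonneg _ _ (by linarith) (by positivity), sub_add_cancel,
          ← ENNReal.rpow_natCast, ← ENNReal.rpow_mul]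
        norm_num
      have e2 : ‖y‖ₑ ^ (-(2 - 2 / p) * (1 / 2)) * ‖y‖ₑ ^ (-1 * (1 / p)) = ‖y‖ₑ ^ (-1 : ℝ) := by
        rw [← ENNReal.rpow_add _ _ hy0 hyt]
        congr 1
        field_simp
        ring
      rw [← e2]
      nth_rewrite 1 [← e1]
      apply le_of_eq
      ring
    have h1 := ENNReal.rpow_le_rpow (hpt.trans hhold) hp0.le
    refine h1.trans ?_
    rw [ENNReal.mul_rpow_of_nonneg _ _ hp0.le, ENNReal.mul_rpow_of_nonneg _ _ hp0.le,
      ← ENNReal.rpow_mul, ← ENNReal.rpow_mul, ← ENNReal.rpow_mul]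
    rw [show 1 / 2 * p = p / 2 by ring, show (1 / 2 - 1 / p) * p = p / 2 - 1 by field_simp,
      show 1 / p * p = 1 by field_simp, ENNReal.rpow_one]
    gcongr
    · linarith
    · calc ∫⁻ y in B, g (x + y) ^ 2 ≤ ∫⁻ y, g (x + y) ^ 2 := setLIntegral_le_lintegral _ _
        _ = I := lintegral_add_left_eq_self (fun y => g y ^ 2) x
  calc _ ≤ ∫⁻ x, κ ^ (p / 2) * I ^ (p / 2 - 1) * ∫⁻ y in B, g (x + y) ^ 2 * ‖y‖ₑ ^ (-1 : ℝ) :=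
        lintegral_mono key
    _ = κ ^ (p / 2) * I ^ (p / 2 - 1) * ∫⁻ y in B, I * ‖y‖ₑ ^ (-1 : ℝ) := by
        have hjm : Measurable fun q : Plane × Plane => g (q.1 + q.2) ^ 2 * ‖q.2‖ₑ ^ (-1 : ℝ) :=
          ((hg.comp (by fun_prop)).pow_const 2).mul (by fun_prop)
        rw [lintegral_const_mul _ hjm.lintegral_prod_right', lintegral_lintegral_swap
          hjm.aemeasurable]
        congr 2; ext y
        have hgy : Measurable fun x => g (x + y) ^ 2 := (hg.comp (by fun_prop)).pow_const 2
        change ∫⁻ x, g (x + y) ^ 2 * ‖y‖ₑ ^ (-1 : ℝ) = I * ‖y‖ₑ ^ (-1 : ℝ)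
        rw [lintegral_mul_const _ hgy, lintegral_add_right_eq_self (fun x => g x ^ 2)]
    _ = κ ^ (p / 2) * (I ^ (p / 2 - 1) * I) * ∫⁻ y in B, ‖y‖ₑ ^ (-1 : ℝ) := by
        rw [lintegral_const_mul _ (by fun_prop)]; ring
    _ ≤ _ := by
        gcongr
        · nth_rewrite 2 [← ENNReal.rpow_one I]
          rw [← ENNReal.rpow_add_of_nonneg _ _ (by linarith) zero_le_one, sub_add_cancel]
        · refine (lintegral_ball_norm_rpow_le (by norm_num)).trans (le_of_eq ?_)
          norm_num

theorem opNorm_le_sum_partial (A : Plane →L[ℝ] E) :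
    ‖A‖ ≤ ∑ k : Fin 2, ‖A (EuclideanSpace.single k 1)‖ := by
  refine A.opNorm_le_bound (Finset.sum_nonneg fun _ _ => norm_nonneg _) fun v => ?_
  have hv : v = ∑ k : Fin 2, v k • (EuclideanSpace.single k (1 : ℝ) : Plane) := by
    ext i
    fin_cases i <;> simp [Fin.sum_univ_two]
  conv_lhs => rw [hv, map_sum]
  rw [Finset.sum_mul]
  refine (norm_sum_le _ _).trans (Finset.sum_le_sum fun k _ => ?_)
  rw [map_smul, norm_smul, mul_comm]
  exact mul_le_mul_of_nonneg_left (PiLp.norm_apply_le v k) (norm_nonneg _)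

/-- The Sobolev inequality `‖f‖_{L^p} ≤ 4 √p ‖f‖_{H¹}` on the plane, for smooth functions. -/
theorem eLpNorm_le_sobolev_of_contDiff [CompleteSpace E] {f : Plane → E} (hf : ContDiff ℝ 1 f)
    {p : ℝ} (hp : 2 ≤ p) : eLpNorm f (ENNReal.ofReal p) volume ≤ ENNReal.ofReal (4 * √p) *
      (eLpNorm f 2 volume + ∑ k : Fin 2,
        eLpNorm (fun x => fderiv ℝ f x (EuclideanSpace.single k 1)) 2 volume) := by
  have hp0 : 0 < p := by linarith
  have hdc : Continuous fun x => fderiv ℝ f x := hf.continuous_fderiv (by simp)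
  set g : Plane → ℝ := fun x => ‖f x‖ + ‖fderiv ℝ f x‖ with hg
  have hge : ∀ x, ‖g x‖ₑ = ‖f x‖ₑ + ‖fderiv ℝ f x‖ₑ := fun x => by
    rw [Real.enorm_eq_ofReal (by positivity), ENNReal.ofReal_add (norm_nonneg _) (norm_nonneg _),
      ofReal_norm, ofReal_norm]
  have hgm : Continuous g := hf.continuous.norm.add hdc.norm
  have hG : eLpNorm g 2 volume ≤ eLpNorm f 2 volume + ∑ k : Fin 2,
        eLpNorm (fun x => fderiv ℝ f x (EuclideanSpace.single k 1)) 2 volume := by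
    have h1 : eLpNorm (fun x => ‖fderiv ℝ f x‖) 2 volume ≤
        eLpNorm (fun x => ∑ k : Fin 2, ‖fderiv ℝ f x (EuclideanSpace.single k 1)‖) 2 volume :=
      eLpNorm_mono_real fun x => by
        rw [norm_norm]; exact opNorm_le_sum_partial _
    refine (eLpNorm_add_le hf.continuous.norm.aestronglyMeasurable
      hdc.norm.aestronglyMeasurable (by norm_num)).trans ?_
    gcongr
    · rw [eLpNorm_norm]
    · refine h1.trans ?_
      simp only [Fin.sum_univ_two]
      refine (eLpNorm_add_le ?_ ?_ (by norm_num)).trans ?_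
      · exact (hdc.clm_apply continuous_const).norm.aestronglyMeasurable
      · exact (hdc.clm_apply continuous_const).norm.aestronglyMeasurable
      · rw [eLpNorm_norm, eLpNorm_norm]
  have h2 := lintegral_potential_rpow_le (g := fun x => ‖g x‖ₑ) hgm.enorm.measurable hp
  rw [← sq_eLpNorm_two, ← ENNReal.rpow_natCast, ← ENNReal.rpow_mul] at h2
  have h3 : ENNReal.ofReal Real.pi ^ p * eLpNorm f (ENNReal.ofReal p) volume ^ p ≤
      (ENNReal.ofReal (Real.pi * p)) ^ (p / 2) * eLpNorm g 2 volume ^ ((2 : ℕ) * (p / 2))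
        * ENNReal.ofReal (2 * Real.pi) := by
    refine le_trans (le_of_eq ?_) ((lintegral_mono fun x =>
      ENNReal.rpow_le_rpow ((enorm_le_lintegral_ball hf x).trans_eq ?_) hp0.le).trans h2)
    · have := eLpNorm_nnreal_pow_eq_lintegral (f := f) (μ := volume) (p := p.toNNReal)
        (by simpa using hp0)
      rw [Real.coe_toNNReal _ hp0.le] at this
      change _ * eLpNorm f (p.toNNReal : ℝ≥0∞) volume ^ p = _
      rw [this, ← lintegral_const_mul _ (hf.continuous.enorm.measurable.pow_const p)]
      simp only [ENNReal.mul_rpow_of_nonneg _ _ hp0.le]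
    · simp only [hge]
  rw [show ((2 : ℕ) : ℝ) * (p / 2) = p by push_cast; ring] at h3
  have h4 := ENNReal.rpow_le_rpow h3 (by positivity : 0 ≤ 1 / p)
  rw [← ENNReal.mul_rpow_of_nonneg _ _ hp0.le,
    ENNReal.mul_rpow_of_nonneg _ _ (by positivity : 0 ≤ 1 / p),
    ENNReal.mul_rpow_of_nonneg _ _ (by positivity : 0 ≤ 1 / p), ← ENNReal.rpow_mul,
    ← ENNReal.rpow_mul, ← ENNReal.rpow_mul, mul_one_div_cancel hp0.ne', ENNReal.rpow_one,
    ENNReal.rpow_one, show p / 2 * (1 / p) = 1 / 2 by field_simp,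
    ENNReal.ofReal_rpow_of_pos (by positivity), ENNReal.ofReal_rpow_of_pos (by positivity)] at h4
  have hpi := Real.pi_gt_three
  have h5 : ENNReal.ofReal ((2 * Real.pi) ^ (1 / p)) ≤ ENNReal.ofReal (2 * Real.pi) := by
    refine ENNReal.ofReal_le_ofReal ?_
    calc (2 * Real.pi) ^ (1 / p) ≤ (2 * Real.pi) ^ (1 : ℝ) :=
          Real.rpow_le_rpow_of_exponent_le (by linarith) (by
            rw [div_le_one hp0]; linarith)
      _ = _ := Real.rpow_one _
  have h6 : ENNReal.ofReal Real.pi * eLpNorm f (ENNReal.ofReal p) volume ≤ ENNReal.ofReal Real.pi *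
      (ENNReal.ofReal (4 * √p) * eLpNorm g 2 volume) := by
    refine h4.trans ((mul_le_mul_right h5 _).trans ?_)
    rw [mul_right_comm, ← mul_assoc, ← ENNReal.ofReal_mul (by positivity),
      ← ENNReal.ofReal_mul (by positivity)]
    refine mul_le_mul_left (ENNReal.ofReal_le_ofReal ?_) _
    rw [← Real.sqrt_eq_rpow, Real.sqrt_mul (by positivity)]
    have : √Real.pi ≤ 2 := Real.sqrt_le_iff.2 ⟨by norm_num, by linarith [Real.pi_le_four]⟩
    nlinarith [Real.sqrt_nonneg p, mul_nonneg (Real.sqrt_nonneg p) Real.pi_pos.le]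
  have h7 := (ENNReal.mul_le_mul_iff_right (by simpa using Real.pi_pos) (by simp)).1 h6
  exact h7.trans (by gcongr)

/-- The Sobolev inequality `‖f‖_{L^p} ≤ 4 √p ‖f‖_{H¹}` on the plane. -/
theorem IsSobolev.eLpNorm_le [CompleteSpace E] {f : Plane → E} {f' : Fin 2 → Plane → E}
    (hf : IsSobolev f f') {p : ℝ} (hp : 2 ≤ p) :
    eLpNorm f (ENNReal.ofReal p) volume ≤ ENNReal.ofReal (4 * √p) *
      (eLpNorm f 2 volume + ∑ k : Fin 2, eLpNorm (f' k) 2 volume) := by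
  have hs := fun n => contDiff_mollify n (hf.weak 0).locInt
  refine (Lp.eLpNorm_lim_le_liminf_eLpNorm
    (fun n => (hs n).continuous.aestronglyMeasurable) f (ae_tendsto_mollify (hf.weak 0).locInt)).trans
    ((liminf_le_liminf (Eventually.of_forall fun n => ?_)).trans_eq (liminf_const _))
  refine (eLpNorm_le_sobolev_of_contDiff ((hs n).of_le (by simp)) hp).trans ?_
  gcongr with k _
  · exact eLpNorm_mollify_le n hf.memLp.1
  · simp only [(hf.weak k).fderiv_mollify n]
    exact eLpNorm_mollify_le n (hf.memLp_partial k).1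

theorem IsSobolev.memLp_four [CompleteSpace E] {f : Plane → E} {f' : Fin 2 → Plane → E}
    (hf : IsSobolev f f') : MemLp f 4 volume := by
  refine ⟨hf.memLp.1, ?_⟩
  have h := hf.eLpNorm_le (p := 4) (by norm_num)
  rw [ENNReal.ofReal_ofNat] at h
  refine h.trans_lt (ENNReal.mul_lt_top ENNReal.ofReal_lt_top (ENNReal.add_lt_top.2 ⟨hf.memLp.2, ?_⟩))
  exact ENNReal.sum_lt_top.2 fun k _ => (hf.memLp_partial k).2

end Sobolev

/-! ### Products of `H¹` functions and bounded functions -/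

section Algebra

variable {E F G : Type*} [NormedAddCommGroup E] [NormedSpace ℝ E] [NormedAddCommGroup F]
  [NormedSpace ℝ F] [NormedAddCommGroup G] [NormedSpace ℝ G]

instance holderTriple_four_four_two : ENNReal.HolderTriple 4 4 2 := ⟨by
  rw [← two_mul, show (4 : ℝ≥0∞) = 2 * 2 by norm_num,
    ENNReal.mul_inv (by simp) (by simp), ← mul_assoc, ENNReal.mul_inv_cancel (by simp) (by simp),
    one_mul]⟩

instance holderTriple_two_two_one : ENNReal.HolderTriple 2 2 1 :=
  ⟨by simp [ENNReal.inv_two_add_inv_two]⟩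

theorem eLpNorm_norm_mul_norm_le {α : Type*} {m : MeasurableSpace α} {μ : Measure α} {f : α → E}
    {g : α → F} (hf : AEStronglyMeasurable f μ) (hg : AEStronglyMeasurable g μ)
    {p q r : ℝ≥0∞} [ENNReal.HolderTriple p q r] :
    eLpNorm (fun x => ‖f x‖ * ‖g x‖) r μ ≤ eLpNorm f p μ * eLpNorm g q μ := by
  have := eLpNorm_le_eLpNorm_mul_eLpNorm_of_nnnorm (p := p) (q := q) (r := r) hf.norm hg.norm
    (fun a b : ℝ => a * b) 1 (ae_of_all _ fun x => by simp)
  simpa using this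

theorem lintegral_enorm_mul_le {α : Type*} {m : MeasurableSpace α} {μ : Measure α} {f : α → E}
    {g : α → F} (hf : AEStronglyMeasurable f μ) (hg : AEStronglyMeasurable g μ) :
    ∫⁻ x, ‖f x‖ₑ * ‖g x‖ₑ ∂μ ≤ eLpNorm f 2 μ * eLpNorm g 2 μ := by
  have := eLpNorm_norm_mul_norm_le (p := 2) (q := 2) (r := 1) hf hg
  rw [eLpNorm_one_eq_lintegral_enorm] at this
  simpa using this

/-- Hölder's inequality with exponents `2`, `4`, `4`. -/
theorem lintegral_enorm_mul_mul_le {α : Type*} {m : MeasurableSpace α} {μ : Measure α} {f : α → E}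
    {g : α → F} {h : α → G} (hf : AEStronglyMeasurable f μ) (hg : AEStronglyMeasurable g μ)
    (hh : AEStronglyMeasurable h μ) :
    ∫⁻ x, ‖f x‖ₑ * (‖g x‖ₑ * ‖h x‖ₑ) ∂μ ≤ eLpNorm f 2 μ * (eLpNorm g 4 μ * eLpNorm h 4 μ) := by
  have h1 := lintegral_enorm_mul_le (g := fun x => ‖g x‖ * ‖h x‖) hf (hg.norm.mul hh.norm)
  have h2 := eLpNorm_norm_mul_norm_le (p := 4) (q := 4) (r := 2) hg hh
  simp only [enorm_mul, enorm_norm] at h1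
  exact h1.trans (by gcongr)

theorem memLp_bilin_of_bound {α : Type*} {m : MeasurableSpace α} {μ : Measure α}
    (B : E →L[ℝ] F →L[ℝ] G) {f : α → E} {g : α → F} {p : ℝ≥0∞} {C : ℝ}
    (hf : AEStronglyMeasurable f μ) (hC : ∀ᵐ x ∂μ, ‖f x‖ ≤ C) (hg : MemLp g p μ) :
    MemLp (fun x => B (f x) (g x)) p μ := by
  refine hg.of_le_mul (c := ‖B‖ * C) (B.aestronglyMeasurable_bilin hf hg.1) (hC.mono fun x hx => ?_)
  refine (B.le_opNorm₂ _ _).trans ?_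
  gcongr

/-- `f` is bounded and has weak partial derivatives `f' k` in `L² ∩ L⁴`. These functions form an
algebra, and multiplication by them preserves `H¹`. -/
structure IsBddSobolev (f : Plane → E) (f' : Fin 2 → Plane → E) : Prop where
  aesm : AEStronglyMeasurable f volume
  bound : ∃ C : ℝ, ∀ᵐ x, ‖f x‖ ≤ C
  memLp_two : ∀ k, MemLp (f' k) 2 volume
  memLp_four : ∀ k, MemLp (f' k) 4 volume
  weak : ∀ k, IsWeakPartial k f (f' k)

namespace IsBddSobolev

variable [CompleteSpace E] [CompleteSpace F] [CompleteSpace G]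
variable {f : Plane → E} {f' : Fin 2 → Plane → E} {g : Plane → F} {g' : Fin 2 → Plane → F}

theorem locL2 (hf : IsBddSobolev f f') : LocL2 f :=
  let ⟨_, hC⟩ := hf.bound
  LocL2.of_bound hf.aesm hC

theorem bilin (B : E →L[ℝ] F →L[ℝ] G) (hf : IsBddSobolev f f') (hg : IsBddSobolev g g') :
    IsBddSobolev (fun x => B (f x) (g x)) (fun k x => B (f' k x) (g x) + B (f x) (g' k x)) := by
  obtain ⟨C, hC⟩ := hf.bound
  obtain ⟨D, hD⟩ := hg.bound
  refine ⟨B.aestronglyMeasurable_bilin hf.aesm hg.aesm, ⟨‖B‖ * C * D, ?_⟩, fun k => ?_, fun k => ?_,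
    fun k => (hf.weak k).bilin B (hg.weak k) hf.locL2 (hf.memLp_two k).locL2 hg.locL2
      (hg.memLp_two k).locL2⟩
  · filter_upwards [hC, hD] with x hx hx'
    refine (B.le_opNorm₂ _ _).trans ?_
    have : 0 ≤ C := (norm_nonneg _).trans hx
    gcongr
  · exact (memLp_bilin_of_bound B.flip hg.aesm hD (hf.memLp_two k)).add
      (memLp_bilin_of_bound B hf.aesm hC (hg.memLp_two k))
  · exact (memLp_bilin_of_bound B.flip hg.aesm hD (hf.memLp_four k)).add
      (memLp_bilin_of_bound B hf.aesm hC (hg.memLp_four k))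

theorem bilin_sobolev (B : E →L[ℝ] F →L[ℝ] G) (hf : IsBddSobolev f f') (hg : IsSobolev g g') :
    IsSobolev (fun x => B (f x) (g x)) (fun k x => B (f' k x) (g x) + B (f x) (g' k x)) := by
  obtain ⟨C, hC⟩ := hf.bound
  refine ⟨memLp_bilin_of_bound B hf.aesm hC hg.memLp, fun k => ?_, fun k =>
    (hf.weak k).bilin B (hg.weak k) hf.locL2 (hf.memLp_two k).locL2 hg.memLp.locL2
      (hg.memLp_partial k).locL2⟩
  exact (B.memLp_bilin (hf.memLp_four k) hg.memLp_four).add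
    (memLp_bilin_of_bound B hf.aesm hC (hg.memLp_partial k))

theorem _root_.IsSobolev.bilin_bdd (B : E →L[ℝ] F →L[ℝ] G) (hf : IsSobolev f f')
    (hg : IsBddSobolev g g') :
    IsSobolev (fun x => B (f x) (g x)) (fun k x => B (f' k x) (g x) + B (f x) (g' k x)) := by
  have := hg.bilin_sobolev B.flip hf
  simpa only [ContinuousLinearMap.flip_apply, add_comm] using this

theorem add {g : Plane → E} {g' : Fin 2 → Plane → E} (hf : IsBddSobolev f f')
    (hg : IsBddSobolev g g') : IsBddSobolev (fun x => f x + g x) (fun k x => f' k x + g' k x) := by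
  obtain ⟨C, hC⟩ := hf.bound
  obtain ⟨D, hD⟩ := hg.bound
  refine ⟨hf.aesm.add hg.aesm, ⟨C + D, ?_⟩, fun k => (hf.memLp_two k).add (hg.memLp_two k),
    fun k => (hf.memLp_four k).add (hg.memLp_four k), fun k => (hf.weak k).add (hg.weak k)⟩
  filter_upwards [hC, hD] with x hx hx' using (norm_add_le _ _).trans (add_le_add hx hx')

theorem clm_comp (hf : IsBddSobolev f f') (L : E →L[ℝ] F) :
    IsBddSobolev (fun x => L (f x)) (fun k x => L (f' k x)) := by
  obtain ⟨C, hC⟩ := hf.bound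
  refine ⟨L.continuous.comp_aestronglyMeasurable hf.aesm, ⟨‖L‖ * C, ?_⟩,
    fun k => L.comp_memLp' (hf.memLp_two k), fun k => L.comp_memLp' (hf.memLp_four k),
    fun k => (hf.weak k).clm_comp L⟩
  filter_upwards [hC] with x hx using (L.le_opNorm _).trans (by gcongr)

theorem const_smul (hf : IsBddSobolev f f') (c : ℝ) :
    IsBddSobolev (fun x => c • f x) (fun k x => c • f' k x) := by
  simpa using hf.clm_comp (c • ContinuousLinearMap.id ℝ E)

theorem const (c : E) : IsBddSobolev (fun _ : Plane => c) (fun _ _ => (0 : E)) :=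
  ⟨aestronglyMeasurable_const, ⟨‖c‖, ae_of_all _ fun _ => le_rfl⟩, fun _ => MemLp.zero,
    fun _ => MemLp.zero, fun k => IsWeakPartial.const k c⟩

/-- The chain rule for bounded functions. -/
theorem comp_real {g : Plane → ℝ} {g' : Fin 2 → Plane → ℝ} (hg : IsBddSobolev g g')
    {H H' : ℝ → ℝ} {c d : ℝ} {L : ℝ≥0} (hH : ∀ s ∈ Icc c d, HasDerivAt H (H' s) s)
    (hL : LipschitzOnWith L H (Icc c d)) (hL' : LipschitzOnWith L H' (Icc c d))
    (hgm : ∀ᵐ x, g x ∈ Icc c d) :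
    IsBddSobolev (fun x => H (g x)) (fun k x => H' (g x) * g' k x) := by
  have hw := fun k => (hg.weak k).comp_real hH hL hL' hgm (hg.memLp_two k).locL2
  have hb : ∀ {K : ℝ → ℝ}, LipschitzOnWith L K (Icc c d) →
      ∀ᵐ x, ‖K (g x)‖ ≤ ‖K c‖ + L * (d - c) := fun {K} hK => by
    filter_upwards [hgm] with x hx
    have h1 := hK.norm_sub_le hx (left_mem_Icc.2 (hx.1.trans hx.2))
    have h2 : ‖g x - c‖ ≤ d - c := by
      rw [Real.norm_eq_abs, abs_of_nonneg (by linarith [hx.1])]; linarith [hx.2]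
    have h3 : (L : ℝ) * ‖g x - c‖ ≤ L * (d - c) := by gcongr
    have h4 := norm_sub_norm_le (K (g x)) (K c)
    linarith
  have hle : ∀ k, ∀ᵐ x, ‖H' (g x) * g' k x‖ ≤ (‖H' c‖ + L * (d - c)) * ‖g' k x‖ := fun k => by
    filter_upwards [hb hL'] with x hx
    rw [norm_mul]
    gcongr
  exact ⟨(hw 0).locInt.aestronglyMeasurable, ⟨_, hb hL⟩,
    fun k => (hg.memLp_two k).of_le_mul (hw k).locInt_partial.aestronglyMeasurable (hle k),
    fun k => (hg.memLp_four k).of_le_mul (hw k).locInt_partial.aestronglyMeasurable (hle k), hw⟩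

theorem _root_.IsSobolev.isBddSobolev_of_contDiff {f : Plane → E} (hf : ContDiff ℝ ∞ f)
    (hc : HasCompactSupport f) :
    IsBddSobolev f (fun k x => fderiv ℝ f x (EuclideanSpace.single k 1)) := by
  have h := IsSobolev.of_contDiff hf hc
  obtain ⟨C, hC⟩ := hf.continuous.bounded_above_of_compact_support hc
  have hd : ∀ k : Fin 2, Continuous fun x => fderiv ℝ f x (EuclideanSpace.single k 1) := fun k =>
    (hf.continuous_fderiv (by simp)).clm_apply continuous_const
  exact ⟨hf.continuous.aestronglyMeasurable, ⟨C, ae_of_all _ hC⟩, h.memLp_partial,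
    fun k => (hd k).memLp_of_hasCompactSupport (hc.fderiv_apply (𝕜 := ℝ) _), h.weak⟩

end IsBddSobolev

section Trilinear

set_option maxSynthPendingDepth 3

variable [CompleteSpace E] [CompleteSpace F] [CompleteSpace G]

theorem ContinuousLinearMap.le_opNorm₃ (T : E →L[ℝ] F →L[ℝ] G →L[ℝ] ℝ) (a : E) (b : F) (c : G) :
    ‖T a b c‖ ≤ ‖T‖ * (‖a‖ * (‖b‖ * ‖c‖)) := by
  calc ‖T a b c‖ ≤ ‖T a b‖ * ‖c‖ := (T a b).le_opNorm c
    _ ≤ (‖T‖ * ‖a‖ * ‖b‖) * ‖c‖ := by gcongr; exact T.le_opNorm₂ a b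
    _ = _ := by ring

theorem ContinuousLinearMap.aestronglyMeasurable_trilin (T : E →L[ℝ] F →L[ℝ] G →L[ℝ] ℝ)
    {a : Plane → E} {b : Plane → F} {c : Plane → G} (ha : AEStronglyMeasurable a volume)
    (hb : AEStronglyMeasurable b volume) (hc : AEStronglyMeasurable c volume) :
    AEStronglyMeasurable (fun x => T (a x) (b x) (c x)) volume := by
  have h1 := T.aestronglyMeasurable_bilin ha hb
  exact (ContinuousLinearMap.id ℝ (G →L[ℝ] ℝ)).aestronglyMeasurable_bilin h1 hc

theorem integrable_trilin (T : E →L[ℝ] F →L[ℝ] G →L[ℝ] ℝ)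
    {a : Plane → E} {b : Plane → F} {c : Plane → G} (ha : AEStronglyMeasurable a volume)
    (hb : AEStronglyMeasurable b volume) (hc : AEStronglyMeasurable c volume)
    (h : ∫⁻ x, ‖a x‖ₑ * (‖b x‖ₑ * ‖c x‖ₑ) < ⊤) :
    Integrable (fun x => T (a x) (b x) (c x)) volume := by
  refine ⟨T.aestronglyMeasurable_trilin ha hb hc, ?_⟩
  have : Integrable (fun x => ‖T‖ * (‖a x‖ * (‖b x‖ * ‖c x‖))) volume := by
    refine Integrable.const_mul ⟨ha.norm.mul (hb.norm.mul hc.norm), ?_⟩ _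
    rw [hasFiniteIntegral_iff_enorm]
    simpa only [enorm_mul, enorm_norm, Pi.mul_apply] using h
  exact (this.mono' (T.aestronglyMeasurable_trilin ha hb hc)
    (ae_of_all _ fun x => T.le_opNorm₃ _ _ _)).2

theorem enorm_integral_trilin_le (T : E →L[ℝ] F →L[ℝ] G →L[ℝ] ℝ)
    (a : Plane → E) (b : Plane → F) (c : Plane → G) :
    ‖∫ x, T (a x) (b x) (c x)‖ₑ ≤ ‖T‖ₑ * ∫⁻ x, ‖a x‖ₑ * (‖b x‖ₑ * ‖c x‖ₑ) := by
  refine (enorm_integral_le_lintegral_enorm _).trans ?_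
  rw [← lintegral_const_mul' _ _ (by simp)]
  refine lintegral_mono fun x => ?_
  rw [← ofReal_norm, ← ofReal_norm T, ← ofReal_norm (a x), ← ofReal_norm (b x), ← ofReal_norm (c x),
    ← ENNReal.ofReal_mul (norm_nonneg _), ← ENNReal.ofReal_mul (norm_nonneg _),
    ← ENNReal.ofReal_mul (norm_nonneg _)]
  exact ENNReal.ofReal_le_ofReal (T.le_opNorm₃ _ _ _)

theorem lintegral_trilin_lt_top₁ {a : Plane → E} {b : Plane → F} {c : Plane → G}
    (ha : MemLp a 2 volume) (hb : MemLp b 4 volume) (hc : MemLp c 4 volume) :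
    ∫⁻ x, ‖a x‖ₑ * (‖b x‖ₑ * ‖c x‖ₑ) < ⊤ :=
  (lintegral_enorm_mul_mul_le ha.1 hb.1 hc.1).trans_lt
    (ENNReal.mul_lt_top ha.2 (ENNReal.mul_lt_top hb.2 hc.2))

theorem lintegral_trilin_le₂ {a : Plane → E} {b : Plane → F} {c : Plane → G}
    (ha : AEStronglyMeasurable a volume) (hb : AEStronglyMeasurable b volume)
    (hc : AEStronglyMeasurable c volume) :
    ∫⁻ x, ‖a x‖ₑ * (‖b x‖ₑ * ‖c x‖ₑ) ≤
      eLpNorm b 2 volume * (eLpNorm a 4 volume * eLpNorm c 4 volume) := by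
  simpa only [mul_left_comm] using lintegral_enorm_mul_mul_le hb ha hc

theorem lintegral_trilin_le₃ {a : Plane → E} {b : Plane → F} {c : Plane → G}
    (ha : AEStronglyMeasurable a volume) (hb : AEStronglyMeasurable b volume)
    (hc : AEStronglyMeasurable c volume) :
    ∫⁻ x, ‖a x‖ₑ * (‖b x‖ₑ * ‖c x‖ₑ) ≤
      eLpNorm c 2 volume * (eLpNorm a 4 volume * eLpNorm b 4 volume) := by
  refine le_trans (le_of_eq ?_) (lintegral_enorm_mul_mul_le hc ha hb)
  congr 1; ext x; ring

theorem tendsto_integral_trilin_of (T : E →L[ℝ] F →L[ℝ] G →L[ℝ] ℝ)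
    {an : ℕ → Plane → E} {a : Plane → E} {b : Plane → F} {c : Plane → G}
    (hlim : Tendsto (fun n => ∫⁻ x, ‖an n x - a x‖ₑ * (‖b x‖ₑ * ‖c x‖ₑ)) atTop (𝓝 0))
    (hin : ∀ n, Integrable (fun x => T (an n x) (b x) (c x)) volume)
    (hi : Integrable (fun x => T (a x) (b x) (c x)) volume) :
    Tendsto (fun n => ∫ x, T (an n x) (b x) (c x)) atTop (𝓝 (∫ x, T (a x) (b x) (c x))) := by
  rw [tendsto_iff_edist_tendsto_0]
  have h := ENNReal.Tendsto.const_mul (a := ‖T‖ₑ) hlim (by simp)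
  rw [mul_zero] at h
  refine tendsto_of_tendsto_of_tendsto_of_le_of_le tendsto_const_nhds h (fun _ => zero_le)
    fun n => ?_
  rw [edist_eq_enorm_sub, ← integral_sub (hin n) hi]
  have := enorm_integral_trilin_le T (fun x => an n x - a x) b c
  simpa using this

/-- Integration by parts for a product of three `H¹` functions. The product of two of them need
not have its derivative in `L²`, so one factor is approximated by test functions. -/
theorem IsSobolev.integral_trilin (T : E →L[ℝ] F →L[ℝ] G →L[ℝ] ℝ)
    {a : Plane → E} {b : Plane → F} {c : Plane → G} {a' : Fin 2 → Plane → E}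
    {b' : Fin 2 → Plane → F} {c' : Fin 2 → Plane → G} (ha : IsSobolev a a') (hb : IsSobolev b b')
    (hc : IsSobolev c c') (k : Fin 2) :
    ∫ x, T (a' k x) (b x) (c x) = -∫ x, (T (a x) (b' k x) (c x) + T (a x) (b x) (c' k x)) := by
  have j1 : ∀ {a b c}, MemLp a 2 volume → MemLp b 4 volume → MemLp c 4 volume →
      Integrable (fun x => T (a x) (b x) (c x)) volume := fun ha hb hc =>
    integrable_trilin T ha.1 hb.1 hc.1 (lintegral_trilin_lt_top₁ ha hb hc)
  have j2 : ∀ {a b c}, MemLp a 4 volume → MemLp b 2 volume → MemLp c 4 volume →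
      Integrable (fun x => T (a x) (b x) (c x)) volume := fun ha hb hc =>
    integrable_trilin T ha.1 hb.1 hc.1 ((lintegral_trilin_le₂ ha.1 hb.1 hc.1).trans_lt
      (ENNReal.mul_lt_top hb.2 (ENNReal.mul_lt_top ha.2 hc.2)))
  have j3 : ∀ {a b c}, MemLp a 4 volume → MemLp b 4 volume → MemLp c 2 volume →
      Integrable (fun x => T (a x) (b x) (c x)) volume := fun ha hb hc =>
    integrable_trilin T ha.1 hb.1 hc.1 ((lintegral_trilin_le₃ ha.1 hb.1 hc.1).trans_lt
      (ENNReal.mul_lt_top hc.2 (ENNReal.mul_lt_top ha.2 hb.2)))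
  obtain ⟨an, hs, hcs, hl, hl'⟩ := ha.exists_approx
  have hS := fun n => IsSobolev.of_contDiff (hs n) (hcs n)
  have hB := fun n => IsSobolev.isBddSobolev_of_contDiff (hs n) (hcs n)
  have hl4 : Tendsto (fun n => eLpNorm (an n - a) 4 volume) atTop (𝓝 0) := by
    have h1 : Tendsto (fun n => ENNReal.ofReal (4 * √4) * (eLpNorm (an n - a) 2 volume +
        ∑ k : Fin 2, eLpNorm ((fun x => fderiv ℝ (an n) x (EuclideanSpace.single k 1)) - a' k) 2
          volume)) atTop (𝓝 (ENNReal.ofReal (4 * √4) * (0 + ∑ k : Fin 2, 0))) :=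
      ENNReal.Tendsto.const_mul (hl.add (tendsto_finsetSum _ fun k _ => hl' k))
        (Or.inr ENNReal.ofReal_ne_top)
    simp only [Finset.sum_const_zero, add_zero, mul_zero] at h1
    refine tendsto_of_tendsto_of_tendsto_of_le_of_le tendsto_const_nhds h1 (fun _ => zero_le)
      fun n => ?_
    have h2 := ((hS n).sub ha).eLpNorm_le (p := 4) (by norm_num)
    rw [ENNReal.ofReal_ofNat] at h2
    exact h2
  -- `an n` is bounded with bounded derivatives, so that `T (an n) b` belongs to `H¹`
  have key : ∀ n, ∫ x, T (fderiv ℝ (an n) x (EuclideanSpace.single k 1)) (b x) (c x)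
      = -((∫ x, T (an n x) (b' k x) (c x)) + ∫ x, T (an n x) (b x) (c' k x)) := fun n => by
    have h := ((hB n).bilin_sobolev T hb).integral_bilin
      (ContinuousLinearMap.id ℝ (G →L[ℝ] ℝ)) hc k
    simp only [ContinuousLinearMap.id_apply, add_apply] at h
    rw [integral_add (j1 ((hS n).memLp_partial k) hb.memLp_four hc.memLp_four)
      (j2 (hS n).memLp_four (hb.memLp_partial k) hc.memLp_four)] at h
    linarith
  have lim : ∀ (p : ℝ≥0∞) (un : ℕ → Plane → E) (u : Plane → E) (K : ℝ≥0∞), K ≠ ⊤ →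
      Tendsto (fun n => eLpNorm (un n - u) p volume) atTop (𝓝 0) →
      Tendsto (fun n => eLpNorm (un n - u) p volume * K) atTop (𝓝 0) := fun p un u K hK h => by
    simpa using ENNReal.Tendsto.mul_const h (Or.inr hK)
  have t1 : Tendsto (fun n => ∫ x, T (fderiv ℝ (an n) x (EuclideanSpace.single k 1)) (b x) (c x))
      atTop (𝓝 (∫ x, T (a' k x) (b x) (c x))) := by
    refine tendsto_integral_trilin_of T ?_
      (fun n => j1 ((hS n).memLp_partial k) hb.memLp_four hc.memLp_four)
      (j1 (ha.memLp_partial k) hb.memLp_four hc.memLp_four)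
    refine tendsto_of_tendsto_of_tendsto_of_le_of_le tendsto_const_nhds
      (lim 2 _ _ (eLpNorm b 4 volume * eLpNorm c 4 volume)
        (ENNReal.mul_ne_top hb.memLp_four.2.ne hc.memLp_four.2.ne) (hl' k)) (fun _ => zero_le)
      fun n => ?_
    exact lintegral_enorm_mul_mul_le (((hS n).memLp_partial k).sub (ha.memLp_partial k)).1
      hb.memLp.1 hc.memLp.1
  have t2 : Tendsto (fun n => ∫ x, T (an n x) (b' k x) (c x)) atTop
      (𝓝 (∫ x, T (a x) (b' k x) (c x))) := by
    refine tendsto_integral_trilin_of T ?_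
      (fun n => j2 (hS n).memLp_four (hb.memLp_partial k) hc.memLp_four)
      (j2 ha.memLp_four (hb.memLp_partial k) hc.memLp_four)
    refine tendsto_of_tendsto_of_tendsto_of_le_of_le tendsto_const_nhds
      (lim 4 _ _ (eLpNorm (b' k) 2 volume * eLpNorm c 4 volume)
        (ENNReal.mul_ne_top (hb.memLp_partial k).2.ne hc.memLp_four.2.ne) hl4) (fun _ => zero_le)
      fun n => ?_
    refine (lintegral_trilin_le₂ ((hS n).memLp.sub ha.memLp).1
      (hb.memLp_partial k).1 hc.memLp.1).trans_eq (mul_left_comm _ _ _)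
  have t3 : Tendsto (fun n => ∫ x, T (an n x) (b x) (c' k x)) atTop
      (𝓝 (∫ x, T (a x) (b x) (c' k x))) := by
    refine tendsto_integral_trilin_of T ?_
      (fun n => j3 (hS n).memLp_four hb.memLp_four (hc.memLp_partial k))
      (j3 ha.memLp_four hb.memLp_four (hc.memLp_partial k))
    refine tendsto_of_tendsto_of_tendsto_of_le_of_le tendsto_const_nhds
      (lim 4 _ _ (eLpNorm (c' k) 2 volume * eLpNorm b 4 volume)
        (ENNReal.mul_ne_top (hc.memLp_partial k).2.ne hb.memLp_four.2.ne) hl4) (fun _ => zero_le)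
      fun n => ?_
    refine (lintegral_trilin_le₃ ((hS n).memLp.sub ha.memLp).1
      hb.memLp.1 (hc.memLp_partial k).1).trans_eq (mul_left_comm _ _ _)
  have t4 := (t2.add t3).neg
  simp only [← key] at t4
  rw [tendsto_nhds_unique t1 t4, integral_add
    (j2 ha.memLp_four (hb.memLp_partial k) hc.memLp_four)
    (j3 ha.memLp_four hb.memLp_four (hc.memLp_partial k))]

end Trilinear

end Algebra

/-! ### Parallel transport along minimal geodesics of the sphere -/

section Transport

variable {a b ξ : Space} {γ F : ℝ → Space}

theorem eq_of_hasDerivAt_zero {E : Type*} [NormedAddCommGroup E] [NormedSpace ℝ E] {f : ℝ → E}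
    (h : ∀ s, HasDerivAt f 0 s) (s t : ℝ) : f s = f t :=
  is_const_of_deriv_eq_zero (fun s => (h s).differentiableAt) (fun s => (h s).deriv) s t

namespace IsMinimalGeodesic

theorem hasDerivAt (h : IsMinimalGeodesic a b γ) (s : ℝ) : HasDerivAt γ (deriv γ s) s :=
  (h.smooth.differentiable (by norm_num) s).hasDerivAt

theorem hasDerivAt_deriv (h : IsMinimalGeodesic a b γ) (s : ℝ) :
    HasDerivAt (deriv γ) (-((inner ℝ (deriv γ s) (deriv γ s)) • γ s)) s := by
  have h1 : ContDiff ℝ 1 (deriv γ) := h.smooth.deriv' (n := 1)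
  have h2 := ((h1.differentiable (by norm_num)) s).hasDerivAt
  rwa [eq_neg_of_add_eq_zero_left (h.geodesic s)] at h2

theorem inner_self (h : IsMinimalGeodesic a b γ) (s : ℝ) : inner ℝ (γ s) (γ s) = 1 := by
  rw [real_inner_self_eq_norm_sq, h.sphere, one_pow]

theorem inner_deriv (h : IsMinimalGeodesic a b γ) (s : ℝ) : inner ℝ (γ s) (deriv γ s) = 0 := by
  have h1 := (h.hasDerivAt s).inner ℝ (h.hasDerivAt s)
  have h2 : (fun t => inner ℝ (γ t) (γ t)) = fun _ : ℝ => (1 : ℝ) := funext h.inner_self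
  rw [h2] at h1
  have h3 := h1.unique (hasDerivAt_const s (1 : ℝ))
  rw [real_inner_comm (γ s) (deriv γ s)] at h3
  linarith

/-- A geodesic has constant speed, and the speed of a minimal one is the angle of its ends. -/
theorem norm_deriv (h : IsMinimalGeodesic a b γ) (s : ℝ) :
    ‖deriv γ s‖ = InnerProductGeometry.angle a b := by
  have h1 : ∀ s t, inner ℝ (deriv γ s) (deriv γ s) = inner ℝ (deriv γ t) (deriv γ t) := by
    refine eq_of_hasDerivAt_zero (f := fun s => inner ℝ (deriv γ s) (deriv γ s)) fun s => ?_
    refine ((h.hasDerivAt_deriv s).inner ℝ (h.hasDerivAt_deriv s)).congr_deriv ?_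
    rw [inner_neg_left, inner_neg_right, inner_smul_left, inner_smul_right,
      real_inner_comm (γ s) (deriv γ s), h.inner_deriv]
    simp
  have h2 : ∀ t, ‖deriv γ t‖ = ‖deriv γ s‖ := fun t => by
    have := h1 t s
    rw [real_inner_self_eq_norm_sq, real_inner_self_eq_norm_sq] at this
    exact (pow_left_inj₀ (norm_nonneg _) (norm_nonneg _) two_ne_zero).1 this
  have h3 := h.minimal
  simp only [h2] at h3
  simpa using h3

theorem hasDerivAt_deriv' (h : IsMinimalGeodesic a b γ) (s : ℝ) :
    HasDerivAt (deriv γ) (-(InnerProductGeometry.angle a b ^ 2 • γ s)) s := by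
  have := h.hasDerivAt_deriv s
  rwa [real_inner_self_eq_norm_sq, h.norm_deriv] at this

/-- The velocity of a minimal geodesic, written with `θ` the angle of its ends. The functions
`θ sin (θ s) γ + cos (θ s) γ'` and `cos (θ s) θ γ - sin (θ s) γ'` are constant. -/
theorem deriv_eq (h : IsMinimalGeodesic a b γ) {θ : ℝ} (hθ : θ = InnerProductGeometry.angle a b)
    (s : ℝ) : deriv γ s = Real.cos (θ * s) • deriv γ 0 - (θ * Real.sin (θ * s)) • a ∧
      θ • γ s = (θ * Real.cos (θ * s)) • a + Real.sin (θ * s) • deriv γ 0 := by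
  have hc : ∀ s, HasDerivAt (fun s => Real.cos (θ * s)) (-Real.sin (θ * s) * θ) s := fun s => by
    simpa using ((hasDerivAt_id s).const_mul θ).cos
  have hs : ∀ s, HasDerivAt (fun s => Real.sin (θ * s)) (Real.cos (θ * s) * θ) s := fun s => by
    simpa using ((hasDerivAt_id s).const_mul θ).sin
  have hd := h.hasDerivAt_deriv'
  simp only [← hθ] at hd
  have A := eq_of_hasDerivAt_zero
    (f := fun s => (θ * Real.cos (θ * s)) • γ s - Real.sin (θ * s) • deriv γ s) (fun s => by
      refine ((((hc s).const_mul θ).smul (h.hasDerivAt s)).sub ((hs s).smul (hd s))).congr_deriv ?_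
      module) s 0
  have B := eq_of_hasDerivAt_zero
    (f := fun s => (θ * Real.sin (θ * s)) • γ s + Real.cos (θ * s) • deriv γ s) (fun s => by
      refine ((((hs s).const_mul θ).smul (h.hasDerivAt s)).add ((hc s).smul (hd s))).congr_deriv ?_
      module) s 0
  simp only [mul_zero, Real.cos_zero, Real.sin_zero, zero_smul, one_smul, sub_zero, zero_add,
    mul_one, h.left] at A B
  have e := Real.sin_sq_add_cos_sq (θ * s)
  constructor
  · calc deriv γ s = (Real.sin (θ * s) ^ 2 + Real.cos (θ * s) ^ 2) • deriv γ s := by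
          rw [e, one_smul]
      _ = Real.cos (θ * s) • ((θ * Real.sin (θ * s)) • γ s + Real.cos (θ * s) • deriv γ s)
          - Real.sin (θ * s) • ((θ * Real.cos (θ * s)) • γ s - Real.sin (θ * s) • deriv γ s) := by
          module
      _ = _ := by rw [A, B]; module
  · calc θ • γ s = (θ * (Real.sin (θ * s) ^ 2 + Real.cos (θ * s) ^ 2)) • γ s := by
          rw [e, mul_one]
      _ = Real.sin (θ * s) • ((θ * Real.sin (θ * s)) • γ s + Real.cos (θ * s) • deriv γ s)
          + Real.cos (θ * s) • ((θ * Real.cos (θ * s)) • γ s - Real.sin (θ * s) • deriv γ s) := by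
          module
      _ = _ := by rw [A, B]; module

/-- A parallel field along a minimal geodesic which is tangential at the start stays tangential
and keeps its component along the velocity. -/
theorem isParallel_inner (h : IsMinimalGeodesic a b γ) (hF : IsParallel γ F)
    (h0 : inner ℝ (F 0) a = 0) (s : ℝ) :
    inner ℝ (F s) (deriv γ s) = inner ℝ (F 0) (deriv γ 0) := by
  have h1 : ∀ s, inner ℝ (F s) (γ s) = 0 := fun s => by
    rw [← h0, ← h.left]
    refine eq_of_hasDerivAt_zero (f := fun s => inner ℝ (F s) (γ s)) (fun s => ?_) s 0
    refine ((hF s).inner ℝ (h.hasDerivAt s)).congr_deriv ?_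
    rw [inner_neg_left, inner_smul_left, h.inner_self]
    simp
  refine eq_of_hasDerivAt_zero (f := fun s => inner ℝ (F s) (deriv γ s)) (fun s => ?_) s 0
  refine ((hF s).inner ℝ (h.hasDerivAt_deriv' s)).congr_deriv ?_
  rw [inner_neg_left, inner_smul_left, inner_neg_right, inner_smul_right, h.inner_deriv, h1]
  simp

/-- Along a parallel tangential field `θ² F - ⟪F, γ'⟫ γ'` is constant, where `θ` is the speed of
`γ`. -/
theorem isParallel_eq (h : IsMinimalGeodesic a b γ) (hF : IsParallel γ F)
    (h0 : inner ℝ (F 0) a = 0) :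
    InnerProductGeometry.angle a b ^ 2 • F 1 = InnerProductGeometry.angle a b ^ 2 • F 0 +
      (inner ℝ (F 0) (deriv γ 0)) • (deriv γ 1 - deriv γ 0) := by
  have := eq_of_hasDerivAt_zero (f := fun s => InnerProductGeometry.angle a b ^ 2 • F s
      - (inner ℝ (F 0) (deriv γ 0)) • deriv γ s) (fun s => by
    refine (((hF s).const_smul (InnerProductGeometry.angle a b ^ 2)).sub
      ((h.hasDerivAt_deriv' s).const_smul (inner ℝ (F 0) (deriv γ 0)))).congr_deriv ?_
    rw [h.isParallel_inner hF h0]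
    module) 1 0
  rw [smul_sub, ← sub_eq_zero, ← sub_eq_zero.2 this]
  module

theorem exists_isParallel (h : IsMinimalGeodesic a b γ) (ha : inner ℝ ξ a = 0) :
    ∃ F, IsParallel γ F ∧ F 0 = ξ := by
  obtain ⟨θ, hθ⟩ : ∃ θ, θ = InnerProductGeometry.angle a b := ⟨_, rfl⟩
  have hn := h.norm_deriv
  rw [← hθ] at hn
  rcases eq_or_ne θ 0 with h0 | h0
  · refine ⟨fun _ => ξ, fun s => ?_, rfl⟩
    have : deriv γ s = 0 := norm_eq_zero.1 ((hn s).trans h0)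
    rw [this, inner_zero_right, zero_smul, neg_zero]
    exact hasDerivAt_const _ _
  -- the component of `ξ` along the velocity turns with `γ'`, the rest is constant
  · refine ⟨fun s => ξ + (inner ℝ ξ (deriv γ 0) / θ ^ 2) • (deriv γ s - deriv γ 0), fun s => ?_,
      by simp⟩
    have hd := h.hasDerivAt_deriv' s
    rw [← hθ] at hd
    refine (((hd.sub_const (deriv γ 0)).const_smul
      (inner ℝ ξ (deriv γ 0) / θ ^ 2)).const_add ξ).congr_deriv ?_
    have e : inner ℝ (ξ + (inner ℝ ξ (deriv γ 0) / θ ^ 2) • (deriv γ s - deriv γ 0)) (deriv γ s)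
        = inner ℝ ξ (deriv γ 0) := by
      have e1 : inner ℝ (deriv γ 0) (deriv γ s) = Real.cos (θ * s) * θ ^ 2 := by
        have h2 : inner ℝ (deriv γ 0) a = 0 := by
          rw [real_inner_comm, ← h.left]; exact h.inner_deriv 0
        rw [(h.deriv_eq hθ s).1, inner_sub_right, inner_smul_right, inner_smul_right, h2,
          real_inner_self_eq_norm_sq, hn]
        ring
      have e2 : inner ℝ ξ (deriv γ s) = Real.cos (θ * s) * inner ℝ ξ (deriv γ 0) := by
        rw [(h.deriv_eq hθ s).1, inner_sub_right, inner_smul_right, inner_smul_right, ha]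
        ring
      rw [inner_add_left, inner_smul_left, inner_sub_left, real_inner_self_eq_norm_sq, hn, e1, e2]
      simp only [conj_trivial]
      field_simp
      ring
    rw [e, smul_neg, smul_smul, div_mul_cancel₀ _ (pow_ne_zero 2 h0)]

end IsMinimalGeodesic

theorem exists_isMinimalGeodesic (ha : ‖a‖ = 1) (hb : ‖b‖ = 1)
    (hab : InnerProductGeometry.angle a b < Real.pi) : ∃ γ, IsMinimalGeodesic a b γ := by
  obtain ⟨θ, hθ⟩ : ∃ θ, θ = InnerProductGeometry.angle a b := ⟨_, rfl⟩
  have hθ0 : 0 ≤ θ := hθ ▸ InnerProductGeometry.angle_nonneg a b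
  have hcos : inner ℝ a b = Real.cos θ := by
    rw [hθ, InnerProductGeometry.cos_angle, ha, hb]; simp
  rcases hθ0.eq_or_lt with h0 | h0
  · have hab' : a = b := by
      rw [← h0, Real.cos_zero] at hcos
      exact (inner_eq_one_iff_of_norm_eq_one ha hb).1 hcos
    subst hab'
    exact ⟨fun _ => a, fun _ => ha, contDiff_const, by simp, rfl, rfl, by simp [← hθ, ← h0]⟩
  have hsin : 0 < Real.sin θ := Real.sin_pos_of_pos_of_lt_pi h0 (hθ ▸ hab)
  -- the unit tangent vector at `a` in the direction of `b`
  obtain ⟨e, he⟩ : ∃ e, e = (Real.sin θ)⁻¹ • (b - Real.cos θ • a) := ⟨_, rfl⟩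
  have haa : inner ℝ a a = (1 : ℝ) := by rw [real_inner_self_eq_norm_sq, ha, one_pow]
  have hbb : inner ℝ b b = (1 : ℝ) := by rw [real_inner_self_eq_norm_sq, hb, one_pow]
  have hae : inner ℝ a e = (0 : ℝ) := by
    rw [he, inner_smul_right, inner_sub_right, inner_smul_right, haa, hcos]; ring
  have hee : inner ℝ e e = (1 : ℝ) := by
    have h2 := Real.sin_sq_add_cos_sq θ
    rw [he, inner_smul_right, inner_smul_left, inner_sub_right, inner_sub_left, inner_sub_left,
      inner_smul_right, inner_smul_right, inner_smul_left, inner_smul_left, hbb, haa,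
      real_inner_comm a b, hcos]
    simp only [conj_trivial]
    field_simp
    linarith
  have hc : ∀ s, HasDerivAt (fun s => Real.cos (θ * s)) (-Real.sin (θ * s) * θ) s := fun s => by
    simpa using ((hasDerivAt_id s).const_mul θ).cos
  have hs : ∀ s, HasDerivAt (fun s => Real.sin (θ * s)) (Real.cos (θ * s) * θ) s := fun s => by
    simpa using ((hasDerivAt_id s).const_mul θ).sin
  obtain ⟨γ, hγ⟩ : ∃ γ : ℝ → Space, γ = fun s => Real.cos (θ * s) • a + Real.sin (θ * s) • e :=
    ⟨_, rfl⟩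
  have hd : deriv γ = fun s => θ • (Real.cos (θ * s) • e - Real.sin (θ * s) • a) := by
    ext1 s
    rw [hγ]
    refine ((((hc s).smul_const a).add ((hs s).smul_const e)).congr_deriv ?_).deriv
    module
  have hdd : ∀ s, deriv (deriv γ) s = -(θ ^ 2 • γ s) := fun s => by
    rw [hd, hγ]
    refine (((((hc s).smul_const e).sub ((hs s).smul_const a)).const_smul θ).congr_deriv ?_).deriv
    module
  have hn : ∀ s, inner ℝ (deriv γ s) (deriv γ s) = θ ^ 2 := fun s => by
    rw [hd]
    simp only [inner_smul_left, inner_smul_right, inner_sub_left, inner_sub_right, haa, hee, hae,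
      real_inner_comm a e, conj_trivial]
    linear_combination θ ^ 2 * Real.sin_sq_add_cos_sq (θ * s)
  refine ⟨γ, fun s => ?_, ?_, fun s => ?_, ?_, ?_, ?_⟩
  · rw [← sq_eq_sq₀ (norm_nonneg _) zero_le_one, ← real_inner_self_eq_norm_sq, hγ]
    simp only [inner_smul_left, inner_smul_right, inner_add_left, inner_add_right, haa, hee, hae,
      real_inner_comm a e, conj_trivial]
    linear_combination Real.sin_sq_add_cos_sq (θ * s)
  · rw [hγ]
    fun_prop
  · rw [hdd, hn]; simp
  · simp [hγ]
  · rw [hγ, he]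
    simp only [mul_one, smul_smul, mul_inv_cancel₀ hsin.ne', one_smul]
    abel
  · have : ∀ s, ‖deriv γ s‖ = θ := fun s => by
      rw [← sq_eq_sq₀ (norm_nonneg _) hθ0, ← real_inner_self_eq_norm_sq, hn]
    simp [this, hθ]

/-- Parallel transport along the minimal geodesic from `a` to `b` acts on the tangent space of `a`
as the reflection in the plane orthogonal to `a + b`. -/
theorem parallelTransport_minimalGeodesic (ha : ‖a‖ = 1) (hb : ‖b‖ = 1)
    (hab : InnerProductGeometry.angle a b < Real.pi) (hξ : inner ℝ ξ a = 0) :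
    parallelTransport (minimalGeodesic a b) 1 0 ξ
      = ξ - (inner ℝ ξ b / (1 + inner ℝ a b)) • (a + b) := by
  have hex := exists_isMinimalGeodesic ha hb hab
  have h : IsMinimalGeodesic a b (minimalGeodesic a b) := by
    rw [minimalGeodesic, dif_pos hex]; exact hex.choose_spec
  obtain ⟨γ, hγ⟩ : ∃ γ, γ = minimalGeodesic a b := ⟨_, rfl⟩
  rw [← hγ] at h ⊢
  have hF := h.exists_isParallel hξ
  rw [parallelTransport, dif_pos hF]
  obtain ⟨hP, h0⟩ := hF.choose_spec
  obtain ⟨F, hFe⟩ : ∃ F, F = hF.choose := ⟨_, rfl⟩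
  rw [← hFe] at hP h0 ⊢
  obtain ⟨θ, hθ⟩ : ∃ θ, θ = InnerProductGeometry.angle a b := ⟨_, rfl⟩
  have hcos : inner ℝ a b = Real.cos θ := by
    rw [hθ, InnerProductGeometry.cos_angle, ha, hb]; simp
  have hθ0 : 0 ≤ θ := hθ ▸ InnerProductGeometry.angle_nonneg a b
  rcases hθ0.eq_or_lt with h1 | h1
  · have hab' : a = b := by
      rw [← h1, Real.cos_zero] at hcos
      exact (inner_eq_one_iff_of_norm_eq_one ha hb).1 hcos
    have hz : ∀ s, deriv γ s = 0 := fun s => norm_eq_zero.1 (by rw [h.norm_deriv, ← hθ, ← h1])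
    have := eq_of_hasDerivAt_zero (f := F) (fun s => (hP s).congr_deriv (by simp [hz])) 1 0
    rw [this, h0, ← hab', hξ]
    simp
  · have hE := h.isParallel_eq hP (by rw [h0, hξ])
    have h2 := h.deriv_eq hθ 1
    rw [← hθ, h0] at hE
    rw [mul_one, h.right] at h2
    have hc : (1 : ℝ) + Real.cos θ ≠ 0 := by
      have := Real.cos_lt_cos_of_nonneg_of_le_pi hθ0 le_rfl (hθ ▸ hab)
      rw [Real.cos_pi] at this
      linarith
    have hb' : b = Real.cos θ • a + (Real.sin θ / θ) • deriv γ 0 := by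
      have := congrArg (fun x => θ⁻¹ • x) h2.2
      simp only [smul_smul, inv_mul_cancel₀ h1.ne', one_smul, smul_add] at this
      rw [this, ← mul_assoc, inv_mul_cancel₀ h1.ne', one_mul, div_eq_inv_mul]
    have hξb : inner ℝ ξ b = Real.sin θ / θ * inner ℝ ξ (deriv γ 0) := by
      rw [hb', inner_add_right, inner_smul_right, inner_smul_right, hξ]; ring
    have hE' : F 1 = ξ + ((inner ℝ ξ (deriv γ 0)) / θ ^ 2) • (deriv γ 1 - deriv γ 0) := by
      have := congrArg (fun x => (θ ^ 2)⁻¹ • x) hE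
      simp only [smul_smul, inv_mul_cancel₀ (pow_ne_zero 2 h1.ne'), one_smul, smul_add] at this
      rw [this, div_eq_inv_mul]
    rw [hE', h2.1, hξb, hcos]
    conv_rhs => rw [hb']
    have e := Real.sin_sq_add_cos_sq θ
    match_scalars
    · simp
    · field_simp
      linear_combination inner ℝ ξ (deriv γ 0) * e
    · field_simp

end Transport

/-! ### Vector algebra -/

section VectorAlgebra

theorem inner_eq_sum_three (x y : Space) : inner ℝ x y = x 0 * y 0 + x 1 * y 1 + x 2 * y 2 := by
  rw [PiLp.inner_apply, Fin.sum_univ_three]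
  simp [mul_comm]

theorem vecProd_apply_zero (x y : Space) : vecProd x y 0 = x 1 * y 2 - x 2 * y 1 := by
  simp [vecProd, cross_apply]

theorem vecProd_apply_one (x y : Space) : vecProd x y 1 = x 2 * y 0 - x 0 * y 2 := by
  simp [vecProd, cross_apply]

theorem vecProd_apply_two (x y : Space) : vecProd x y 2 = x 0 * y 1 - x 1 * y 0 := by
  simp [vecProd, cross_apply]

theorem vecProd_add_left (x y z : Space) : vecProd (x + y) z = vecProd x z + vecProd y z := by
  simp [vecProd]

theorem vecProd_add_right (x y z : Space) : vecProd x (y + z) = vecProd x y + vecProd x z := by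
  simp [vecProd]

theorem vecProd_smul_left (c : ℝ) (x y : Space) : vecProd (c • x) y = c • vecProd x y := by
  simp [vecProd]

theorem vecProd_smul_right (c : ℝ) (x y : Space) : vecProd x (c • y) = c • vecProd x y := by
  simp [vecProd]

theorem norm_vecProd_le (x y : Space) : ‖vecProd x y‖ ≤ ‖x‖ * ‖y‖ := by
  rw [← sq_le_sq₀ (norm_nonneg _) (by positivity), mul_pow, ← real_inner_self_eq_norm_sq,
    ← real_inner_self_eq_norm_sq, ← real_inner_self_eq_norm_sq]
  simp only [inner_eq_sum_three, vecProd_apply_zero, vecProd_apply_one, vecProd_apply_two]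
  nlinarith [sq_nonneg (x 0 * y 0 + x 1 * y 1 + x 2 * y 2)]

/-- The vector product as a continuous bilinear map. -/
noncomputable def crossL : Space →L[ℝ] Space →L[ℝ] Space :=
  LinearMap.mkContinuous₂ (LinearMap.mk₂ ℝ vecProd vecProd_add_left vecProd_smul_left
    vecProd_add_right vecProd_smul_right) 1 fun x y => by simpa using norm_vecProd_le x y

@[simp] theorem crossL_apply (x y : Space) : crossL x y = vecProd x y := rfl

/-- The operator `ξ ↦ ⟪x, ξ⟫ y`, bilinear in `x` and `y`. -/
noncomputable def dyadL : Space →L[ℝ] Space →L[ℝ] Space →L[ℝ] Space :=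
  (ContinuousLinearMap.smulRightL ℝ Space Space).comp (innerSL ℝ)

@[simp] theorem dyadL_apply (x y ξ : Space) : dyadL x y ξ = inner ℝ x ξ • y := rfl

theorem norm_dyadL_le (x y : Space) : ‖dyadL x y‖ ≤ ‖x‖ * ‖y‖ := by
  refine ContinuousLinearMap.opNorm_le_bound _ (by positivity) fun ξ => ?_
  rw [dyadL_apply, norm_smul, mul_right_comm]
  gcongr
  exact norm_inner_le_norm _ _

/-- The reflection `ξ ↦ ξ - 2 ⟪n, ξ⟫ n` in the plane orthogonal to a unit vector `n`. -/
noncomputable def mirror (n : Space) : Space →L[ℝ] Space :=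
  ContinuousLinearMap.id ℝ Space + (-2 : ℝ) • dyadL n n

/-- The polarisation of `n ↦ mirror n`: the derivative of `mirror` at `n` in the direction `n₁`. -/
noncomputable def mirrorDeriv (n n₁ : Space) : Space →L[ℝ] Space :=
  (-2 : ℝ) • (dyadL n₁ n + dyadL n n₁)

theorem mirror_apply (n ξ : Space) : mirror n ξ = ξ - (2 * inner ℝ n ξ) • n := by
  simp only [mirror, add_apply, smul_apply, dyadL_apply, ContinuousLinearMap.id_apply]
  module

theorem mirrorDeriv_apply (n n₁ ξ : Space) :
    mirrorDeriv n n₁ ξ = (-2 : ℝ) • (inner ℝ n₁ ξ • n + inner ℝ n ξ • n₁) := by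
  simp [mirrorDeriv]

theorem inner_mirror_left (n x y : Space) : inner ℝ (mirror n x) y = inner ℝ x (mirror n y) := by
  simp only [mirror_apply, inner_sub_left, inner_sub_right, inner_smul_left, inner_smul_right,
    conj_trivial, real_inner_comm n x]
  ring

theorem inner_mirrorDeriv_left (n n₁ x y : Space) :
    inner ℝ (mirrorDeriv n n₁ x) y = inner ℝ x (mirrorDeriv n n₁ y) := by
  simp only [mirrorDeriv_apply, inner_add_left, inner_add_right, inner_smul_left, inner_smul_right,
    conj_trivial, real_inner_comm n x, real_inner_comm n₁ x]
  ring

theorem mirror_mirror {n : Space} (hn : inner ℝ n n = (1 : ℝ)) (ξ : Space) :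
    mirror n (mirror n ξ) = ξ := by
  rw [mirror_apply n (mirror n ξ), mirror_apply, inner_sub_right, inner_smul_right, hn]
  module

theorem norm_mirror {n : Space} (hn : inner ℝ n n = (1 : ℝ)) (ξ : Space) : ‖mirror n ξ‖ = ‖ξ‖ := by
  rw [← sq_eq_sq₀ (norm_nonneg _) (norm_nonneg _), ← real_inner_self_eq_norm_sq, inner_mirror_left,
    mirror_mirror hn, real_inner_self_eq_norm_sq]

theorem inner_vecProd_left_comm (x y z : Space) :
    inner ℝ x (vecProd y z) = inner ℝ y (vecProd z x) := by
  simp only [inner_eq_sum_three, vecProd_apply_zero, vecProd_apply_one, vecProd_apply_two]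
  ring

theorem vecProd_comm (x y : Space) : vecProd x y = -vecProd y x := by
  ext i
  fin_cases i <;>
    simp [vecProd_apply_zero, vecProd_apply_one, vecProd_apply_two] <;> ring

theorem vecProd_self (x : Space) : vecProd x x = 0 := by simp [vecProd]

theorem inner_vecProd_self_right (x y : Space) : inner ℝ x (vecProd y x) = 0 := by
  simp only [inner_eq_sum_three, vecProd_apply_zero, vecProd_apply_one, vecProd_apply_two]
  ring

/-- A reflection reverses the orientation. -/
theorem mirror_vecProd {n : Space} (hn : inner ℝ n n = (1 : ℝ)) (x y : Space) :
    mirror n (vecProd x y) = -vecProd (mirror n x) (mirror n y) := by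
  rw [inner_eq_sum_three] at hn
  simp only [mirror_apply]
  ext i
  fin_cases i <;>
    simp only [Fin.zero_eta, Fin.mk_one, Fin.reduceFinMk, PiLp.sub_apply, PiLp.neg_apply,
      PiLp.smul_apply, smul_eq_mul, vecProd_apply_zero, vecProd_apply_one, vecProd_apply_two,
      inner_eq_sum_three]
  · linear_combination 2 * (x 1 * y 2 - x 2 * y 1) * -hn
  · linear_combination 2 * (x 2 * y 0 - x 0 * y 2) * -hn
  · linear_combination 2 * (x 0 * y 1 - x 1 * y 0) * -hn

theorem vecProd_eq_smul {b x y : Space} (hb : inner ℝ b b = (1 : ℝ)) (hx : inner ℝ b x = (0 : ℝ))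
    (hy : inner ℝ b y = (0 : ℝ)) : vecProd x y = inner ℝ b (vecProd x y) • b := by
  -- `b × (x × y) = (b · y) x - (b · x) y = 0`
  rw [inner_eq_sum_three] at hb hx hy
  ext i
  fin_cases i <;>
    simp only [Fin.zero_eta, Fin.mk_one, Fin.reduceFinMk,
      PiLp.smul_apply, smul_eq_mul, vecProd_apply_zero, vecProd_apply_one, vecProd_apply_two,
      inner_eq_sum_three]
  · linear_combination (x 1 * y 2 - x 2 * y 1) * -hb + (b 1 * y 2 - b 2 * y 1) * hx +
      (b 2 * x 1 - b 1 * x 2) * hy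
  · linear_combination (x 2 * y 0 - x 0 * y 2) * -hb + (b 2 * y 0 - b 0 * y 2) * hx +
      (b 0 * x 2 - b 2 * x 0) * hy
  · linear_combination (x 0 * y 1 - x 1 * y 0) * -hb + (b 0 * y 1 - b 1 * y 0) * hx +
      (b 1 * x 0 - b 0 * x 1) * hy

end VectorAlgebra

/-! ### Pointwise cancellations -/

section Pointwise

variable {a b n aₘ aₖ bₘ bₖ aₘₖ bₘₖ V Vₖ n₁ : Space}

/-- The pointwise identity behind the energy estimate. The quadratic term `⟪Vₖ, b × Vₖ⟫` vanishes,
and the terms which are cubic in the first derivatives of the maps combine to a multiple of their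
difference. Here `n₁` is the derivative of `n`, and `V = S aₘ - bₘ` for the reflection `S` in
`n^⊥`. -/
theorem pairing_pointwise (hn : inner ℝ n n = (1 : ℝ)) (hb : inner ℝ b b = (1 : ℝ))
    (hab : mirror n a = -b) (hbₘ : inner ℝ b bₘ = (0 : ℝ)) (hbₖ : inner ℝ b bₖ = (0 : ℝ))
    (haₘ : inner ℝ a aₘ = (0 : ℝ)) (haₖ : inner ℝ a aₖ = (0 : ℝ))
    (hVk : Vₖ = mirrorDeriv n n₁ aₘ + mirror n aₘₖ - bₘₖ)
    (hbVk : inner ℝ b Vₖ = -inner ℝ bₖ V) (hSa : mirrorDeriv n n₁ a = -bₖ - mirror n aₖ) :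
    -inner ℝ (vecProd aₘ aₖ + vecProd a aₘₖ) (mirrorDeriv n n₁ V + mirror n Vₖ)
        + inner ℝ (vecProd bₘ bₖ + vecProd b bₘₖ) Vₖ =
      inner ℝ Vₖ (vecProd b (mirrorDeriv n n₁ aₘ)) - inner ℝ (vecProd a aₘₖ) (mirrorDeriv n n₁ V)
        + inner ℝ V (inner ℝ b (vecProd (mirror n aₘ) (mirror n aₖ)) • mirror n aₖ
          - inner ℝ b (vecProd bₘ bₖ) • bₖ) := by
  obtain ⟨α, hα⟩ : ∃ α, α = inner ℝ b (vecProd (mirror n aₘ) (mirror n aₖ)) := ⟨_, rfl⟩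
  obtain ⟨β, hβ⟩ : ∃ α, α = inner ℝ b (vecProd bₘ bₖ) := ⟨_, rfl⟩
  have hbS : ∀ x, inner ℝ b (mirror n x) = -inner ℝ a x := fun x => by
    rw [← inner_mirror_left, ← neg_neg b, ← hab, map_neg, mirror_mirror hn, inner_neg_left]
  -- the vector product of two tangent vectors is normal
  have h1 : vecProd (mirror n aₘ) (mirror n aₖ) = α • b := by
    rw [hα]
    exact vecProd_eq_smul hb (by rw [hbS, haₘ, neg_zero]) (by rw [hbS, haₖ, neg_zero])
  have h2 : vecProd bₘ bₖ = β • b := by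
    rw [hβ]
    exact vecProd_eq_smul hb hbₘ hbₖ
  have h3 : vecProd aₘ aₖ = α • a := by
    have : mirror n (vecProd aₘ aₖ) = mirror n (α • a) := by
      rw [mirror_vecProd hn, h1, map_smul, hab, smul_neg]
    rw [← mirror_mirror hn (vecProd aₘ aₖ), this, mirror_mirror hn]
  have h4 : mirror n (vecProd a aₘₖ) = vecProd b (mirror n aₘₖ) := by
    rw [mirror_vecProd hn, hab, ← crossL_apply, ← crossL_apply, map_neg, neg_apply, neg_neg]
  have h5 : inner ℝ a (mirror n Vₖ) = inner ℝ bₖ V := by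
    rw [← inner_mirror_left, hab, inner_neg_left, hbVk, neg_neg]
  have h6 : inner ℝ a (mirrorDeriv n n₁ V) = -inner ℝ bₖ V - inner ℝ (mirror n aₖ) V := by
    rw [← inner_mirrorDeriv_left, hSa, inner_sub_left, inner_neg_left]
  have h7 : inner ℝ (vecProd b bₘₖ) Vₖ = inner ℝ Vₖ (vecProd b (mirrorDeriv n n₁ aₘ))
      + inner ℝ (vecProd a aₘₖ) (mirror n Vₖ) := by
    have : bₘₖ = mirrorDeriv n n₁ aₘ + mirror n aₘₖ - Vₖ := by rw [hVk]; abel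
    rw [← inner_mirror_left, h4, this, ← crossL_apply, map_sub, map_add]
    simp only [crossL_apply]
    rw [inner_sub_left, inner_add_left, real_inner_comm, real_inner_comm Vₖ (vecProd b Vₖ),
      inner_vecProd_self_right, sub_zero]
  rw [← hα, ← hβ, h2, h3, inner_add_left, inner_add_left, inner_add_right, inner_add_right,
    inner_smul_left, inner_smul_left, inner_smul_left, h5, h6, hbVk, h7]
  simp only [conj_trivial, inner_sub_right, inner_smul_right, real_inner_comm V]
  ring

end Pointwise

section Bounds

variable {a b n aₘ aₖ bₘ bₖ aₘₖ bₘₖ V Vₖ n₁ n₂ nₜ : Space} {K q v g G : ℝ}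

theorem abs_inner_smul_vecProd_le {x y z : Space} {s A B v : ℝ} (hs : |s| ≤ A)
    (hyz : ‖vecProd y z‖ ≤ B) (hx : ‖x‖ ≤ v) : |inner ℝ x (s • vecProd y z)| ≤ v * (A * B) := by
  refine (abs_real_inner_le_norm _ _).trans ?_
  rw [norm_smul, Real.norm_eq_abs]
  have := (norm_nonneg x).trans hx
  have := (abs_nonneg s).trans hs
  gcongr

/-- Bound for the divergence term `⟪V, ∂ₖ (b × S₁ aₘ)⟫`. Every term contains one of the small
quantities `⟪n, aₘ⟫`, `b × n`, or the derivative of one of them. -/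
theorem abs_inner_div_le (hK : 0 ≤ K) (hq : 0 ≤ q) (hv : 0 ≤ v) (hg : 0 ≤ g) (hgG : g * g ≤ G)
    (hb : ‖b‖ = 1)
    (hna : |inner ℝ n aₘ| ≤ K * (q * g)) (hbn : ‖vecProd b n‖ ≤ K * q) (hn₁ : ‖n₁‖ ≤ K * g)
    (hn₂ : ‖n₂‖ ≤ K * G) (hbn₁ : ‖vecProd bₖ n + vecProd b n₁‖ ≤ K * (q * g + v))
    (hna₁ : |inner ℝ n₁ aₘ + inner ℝ n aₘₖ| ≤ K * (q * G + g * v)) (haₘ : ‖aₘ‖ ≤ g)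
    (hbₖ : ‖bₖ‖ ≤ g) (haₘₖ : ‖aₘₖ‖ ≤ G) (hV : ‖V‖ ≤ v) :
    |inner ℝ V (vecProd bₖ (mirrorDeriv n n₁ aₘ)
        + vecProd b (((-2 : ℝ) • (dyadL n₂ n + dyadL n₁ n₁ + (dyadL n₁ n₁ + dyadL n n₂))) aₘ)
        + vecProd b (mirrorDeriv n n₁ aₘₖ))| ≤
      12 * K ^ 2 * (q * v * g * G + v ^ 2 * g ^ 2) := by
  have hG : 0 ≤ G := (mul_nonneg hg hg).trans hgG
  have e : vecProd bₖ (mirrorDeriv n n₁ aₘ)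
        + vecProd b (((-2 : ℝ) • (dyadL n₂ n + dyadL n₁ n₁ + (dyadL n₁ n₁ + dyadL n n₂))) aₘ)
        + vecProd b (mirrorDeriv n n₁ aₘₖ) =
      (-2 : ℝ) • (inner ℝ n aₘ • vecProd bₖ n₁ + inner ℝ n aₘ • vecProd b n₂
        + inner ℝ n₁ aₘ • (vecProd bₖ n + vecProd b n₁) + inner ℝ n₂ aₘ • vecProd b n
        + inner ℝ n₁ aₘₖ • vecProd b n
        + (inner ℝ n₁ aₘ + inner ℝ n aₘₖ) • vecProd b n₁) := by
    simp only [mirrorDeriv_apply, smul_apply, add_apply, dyadL_apply, ← crossL_apply, map_smul,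
      map_add]
    module
  have h1 : |inner ℝ V (inner ℝ n aₘ • vecProd bₖ n₁)| ≤ v * (K * (q * g) * (g * (K * g))) :=
    abs_inner_smul_vecProd_le hna ((norm_vecProd_le _ _).trans (by gcongr)) hV
  have h2 : |inner ℝ V (inner ℝ n aₘ • vecProd b n₂)| ≤ v * (K * (q * g) * (K * G)) :=
    abs_inner_smul_vecProd_le hna ((norm_vecProd_le _ _).trans (by rw [hb, one_mul]; exact hn₂)) hV
  have h3 : |inner ℝ V (inner ℝ n₁ aₘ • (vecProd bₖ n + vecProd b n₁))| ≤
      v * ((K * g * g) * (K * (q * g + v))) := by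
    refine (abs_real_inner_le_norm _ _).trans ?_
    rw [norm_smul]
    gcongr
    exact (norm_inner_le_norm _ _).trans (by gcongr)
  have h4 : |inner ℝ V (inner ℝ n₂ aₘ • vecProd b n)| ≤ v * (K * G * g * (K * q)) :=
    abs_inner_smul_vecProd_le ((abs_real_inner_le_norm _ _).trans (by gcongr)) hbn hV
  have h5 : |inner ℝ V (inner ℝ n₁ aₘₖ • vecProd b n)| ≤ v * (K * g * G * (K * q)) :=
    abs_inner_smul_vecProd_le ((abs_real_inner_le_norm _ _).trans (by gcongr)) hbn hV
  have h6 : |inner ℝ V ((inner ℝ n₁ aₘ + inner ℝ n aₘₖ) • vecProd b n₁)| ≤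
      v * (K * (q * G + g * v) * (K * g)) :=
    abs_inner_smul_vecProd_le hna₁ ((norm_vecProd_le _ _).trans (by rw [hb, one_mul]; exact hn₁)) hV
  have h7 : K ^ 2 * q * g * v * (g * g) ≤ K ^ 2 * q * g * v * G := by gcongr
  rw [e, inner_smul_right, abs_mul]
  simp only [inner_add_right]
  have h8 : |(-2 : ℝ)| = 2 := by norm_num
  rw [h8]
  refine (mul_le_mul_of_nonneg_left ((abs_add_le _ _).trans (add_le_add ((abs_add_le _ _).trans
    (add_le_add ((abs_add_le _ _).trans (add_le_add ((abs_add_le _ _).trans (add_le_add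
    ((abs_add_le _ _).trans (add_le_add h1 h2)) ?_)) h4)) h5)) h6)) zero_le_two).trans
    (b := 2 * (v * (K * (q * g) * (g * (K * g))) + v * (K * (q * g) * (K * G)) +
      v * ((K * g * g) * (K * (q * g + v))) + v * (K * G * g * (K * q)) +
      v * (K * g * G * (K * q)) + v * (K * (q * G + g * v) * (K * g)))) ?_
  · rwa [inner_smul_right, inner_add_right, ← inner_add_right, ← inner_smul_right]
  · have h9 : 0 ≤ K ^ 2 * (v ^ 2 * g ^ 2) := by positivity
    nlinarith

/-- Bound for `⟪a × aₘₖ, S₁ V⟫`, where both `⟪n, V⟫` and `a × n` are small. -/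
theorem abs_inner_vecProd_mirrorDeriv_le (hK : 0 ≤ K) (hq : 0 ≤ q) (hv : 0 ≤ v) (hg : 0 ≤ g)
    (hG : 0 ≤ G) (ha : ‖a‖ = 1) (hnV : |inner ℝ n V| ≤ K * (q * v)) (han : ‖vecProd a n‖ ≤ K * q)
    (hn₁ : ‖n₁‖ ≤ K * g) (haₘₖ : ‖aₘₖ‖ ≤ G) (hV : ‖V‖ ≤ v) :
    |inner ℝ (vecProd a aₘₖ) (mirrorDeriv n n₁ V)| ≤ 4 * K ^ 2 * (q * v * g * G) := by
  rw [mirrorDeriv_apply, inner_smul_right, inner_add_right, inner_smul_right, inner_smul_right]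
  have h1 : |inner ℝ n₁ V| ≤ K * g * v := (abs_real_inner_le_norm _ _).trans (by gcongr)
  have h2 : |inner ℝ (vecProd a aₘₖ) n| ≤ K * q * G := by
    rw [real_inner_comm, inner_vecProd_left_comm, inner_vecProd_left_comm, vecProd_comm,
      inner_neg_right, abs_neg, real_inner_comm]
    refine (abs_real_inner_le_norm _ _).trans ?_
    gcongr
  have h3 : |inner ℝ (vecProd a aₘₖ) n₁| ≤ G * (K * g) := by
    refine (abs_real_inner_le_norm _ _).trans ?_
    have := norm_vecProd_le a aₘₖ
    rw [ha, one_mul] at this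
    gcongr
    exact this.trans haₘₖ
  rw [abs_mul, show |(-2 : ℝ)| = 2 by norm_num]
  have h4 := abs_add_le (inner ℝ n₁ V * inner ℝ (vecProd a aₘₖ) n)
    (inner ℝ n V * inner ℝ (vecProd a aₘₖ) n₁)
  rw [abs_mul, abs_mul] at h4
  calc _ ≤ 2 * (K * g * v * (K * q * G) + K * (q * v) * (G * (K * g))) := by
        gcongr
        exact h4.trans (by gcongr)
    _ = _ := by ring

theorem abs_inner_mirrorDeriv_le (hK : 0 ≤ K) (hq : 0 ≤ q) (hv : 0 ≤ v) (hg : 0 ≤ g)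
    (hG : 0 ≤ G) (hna : |inner ℝ n aₘ| ≤ K * (q * g)) (hnV : |inner ℝ n V| ≤ K * (q * v))
    (hnₜ : ‖nₜ‖ ≤ K * G) (haₘ : ‖aₘ‖ ≤ g) (hV : ‖V‖ ≤ v) :
    |inner ℝ aₘ (mirrorDeriv n nₜ V)| ≤ 4 * K ^ 2 * (q * v * g * G) := by
  rw [mirrorDeriv_apply, inner_smul_right, inner_add_right, inner_smul_right, inner_smul_right]
  have h1 : |inner ℝ nₜ V| ≤ K * G * v := (abs_real_inner_le_norm _ _).trans (by gcongr)
  have h3 : |inner ℝ aₘ nₜ| ≤ g * (K * G) := (abs_real_inner_le_norm _ _).trans (by gcongr)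
  rw [real_inner_comm] at hna
  rw [abs_mul, show |(-2 : ℝ)| = 2 by norm_num]
  have h4 := abs_add_le (inner ℝ nₜ V * inner ℝ aₘ n) (inner ℝ n V * inner ℝ aₘ nₜ)
  rw [abs_mul, abs_mul] at h4
  calc _ ≤ 2 * (K * G * v * (K * (q * g)) + K * (q * v) * (g * (K * G))) := by
        gcongr
        exact h4.trans (by gcongr)
    _ = _ := by ring

theorem abs_inner_sub_smul_le (hb : ‖b‖ = 1) {x y x' y' : Space} (hV : ‖V‖ ≤ v) (hx : ‖x‖ ≤ g)
    (hy : ‖y‖ ≤ g) (hx' : ‖x'‖ ≤ g) (hy' : ‖y'‖ ≤ g) (hxx : ‖x - x'‖ ≤ v) (hyy : ‖y - y'‖ ≤ v) :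
    |inner ℝ V (inner ℝ b (vecProd x y) • y - inner ℝ b (vecProd x' y') • y')| ≤
      3 * (v ^ 2 * g ^ 2) := by
  have hv : 0 ≤ v := (norm_nonneg _).trans hV
  have hg : 0 ≤ g := (norm_nonneg _).trans hx
  have hd : ∀ z w : Space, |inner ℝ b (vecProd z w)| ≤ ‖z‖ * ‖w‖ := fun z w => by
    refine (abs_real_inner_le_norm _ _).trans ?_
    rw [hb, one_mul]
    exact norm_vecProd_le z w
  have e : inner ℝ b (vecProd x y) • y - inner ℝ b (vecProd x' y') • y' =
      inner ℝ b (vecProd (x - x') y) • y + inner ℝ b (vecProd x' (y - y')) • y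
        + inner ℝ b (vecProd x' y') • (y - y') := by
    simp only [← crossL_apply, map_sub, sub_apply, inner_sub_right]
    module
  have h : ‖inner ℝ b (vecProd x y) • y - inner ℝ b (vecProd x' y') • y'‖ ≤
      v * g * g + g * v * g + g * g * v := by
    rw [e]
    refine (norm_add₃_le).trans ?_
    rw [norm_smul, norm_smul, norm_smul]
    gcongr
    · exact (hd _ _).trans (by gcongr)
    · exact (hd _ _).trans (by gcongr)
    · exact (hd _ _).trans (by gcongr)
  refine (abs_real_inner_le_norm _ _).trans ?_
  calc ‖V‖ * _ ≤ v * (v * g * g + g * v * g + g * g * v) := by gcongr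
    _ = _ := by ring

end Bounds

/-! ### The bisector of two points of the sphere -/

section Frame

variable {a b aₘ aₖ bₘ bₖ aₘₖ V : Space} {K l l₁ g G v : ℝ}

theorem inner_bisector (haₘ : inner ℝ a aₘ = (0 : ℝ)) :
    inner ℝ (l • (a + b)) aₘ = -(l * inner ℝ (a - b) aₘ) := by
  rw [inner_smul_left, inner_add_left, inner_sub_left, haₘ]
  simp only [conj_trivial]
  ring

theorem abs_inner_bisector_le (hl : |l| ≤ K) (haₘ : inner ℝ a aₘ = (0 : ℝ)) (hg : ‖aₘ‖ ≤ g) :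
    |inner ℝ (l • (a + b)) aₘ| ≤ K * (‖a - b‖ * g) := by
  rw [inner_bisector haₘ, abs_neg, abs_mul]
  have := (abs_nonneg l).trans hl
  have := abs_real_inner_le_norm (a - b) aₘ
  gcongr
  exact this.trans (by gcongr)

theorem abs_inner_bisector_le' (hl : |l| ≤ K) (hbV : inner ℝ b V = (0 : ℝ)) (hv : ‖V‖ ≤ v) :
    |inner ℝ (l • (a + b)) V| ≤ K * (‖a - b‖ * v) := by
  rw [add_comm a b, norm_sub_rev]
  exact abs_inner_bisector_le hl hbV hv

theorem norm_vecProd_bisector_le (hl : |l| ≤ K) (hb : ‖b‖ = 1) :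
    ‖vecProd b (l • (a + b))‖ ≤ K * ‖a - b‖ := by
  have e : vecProd b (l • (a + b)) = l • vecProd b (a - b) := by
    simp only [← crossL_apply, map_smul, map_add, map_sub]
    simp [vecProd_self]
  rw [e, norm_smul]
  have := (abs_nonneg l).trans hl
  have := norm_vecProd_le b (a - b)
  rw [hb, one_mul] at this
  gcongr
  exact hl

theorem norm_vecProd_bisector_le' (hl : |l| ≤ K) (ha : ‖a‖ = 1) :
    ‖vecProd a (l • (a + b))‖ ≤ K * ‖a - b‖ := by
  rw [add_comm a b, norm_sub_rev]
  exact norm_vecProd_bisector_le hl ha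

/-- The derivative of `q = a - b` in terms of `V = S aₖ - bₖ`. -/
theorem sub_eq_mirror_sub_add (n aₖ bₖ : Space) :
    aₖ - bₖ = (mirror n aₖ - bₖ) + (2 * inner ℝ n aₖ) • n := by
  rw [mirror_apply]; abel

theorem norm_sub_le_mirror {n aₖ bₖ : Space} (hn : ‖n‖ = 1) {A : ℝ} (hA : |inner ℝ n aₖ| ≤ A) :
    ‖aₖ - bₖ‖ ≤ ‖mirror n aₖ - bₖ‖ + 2 * A := by
  rw [sub_eq_mirror_sub_add n]
  refine (norm_add_le _ _).trans ?_
  rw [norm_smul, hn, mul_one, norm_mul, Real.norm_eq_abs, Real.norm_eq_abs]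
  gcongr
  norm_num

theorem norm_vecProd_bisector_deriv_le (hl : |l| ≤ K) (hl₁ : |l₁| ≤ K * g) (hb : ‖b‖ = 1)
    (hbₖ : ‖bₖ‖ ≤ g) {d : ℝ} (hd : ‖aₖ - bₖ‖ ≤ d) :
    ‖vecProd bₖ (l • (a + b)) + vecProd b (l₁ • (a + b) + l • (aₖ + bₖ))‖ ≤
      K * (2 * (‖a - b‖ * g) + d) := by
  have e : vecProd bₖ (l • (a + b)) + vecProd b (l₁ • (a + b) + l • (aₖ + bₖ)) =
      l₁ • vecProd b (a - b) + (l • vecProd bₖ (a - b) + l • vecProd b (aₖ - bₖ)) := by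
    simp only [← crossL_apply, map_smul, map_add, map_sub]
    simp only [crossL_apply, vecProd_self]
    rw [vecProd_comm bₖ b]
    module
  have hK := (abs_nonneg l).trans hl
  rw [e]
  refine (norm_add_le _ _).trans ((add_le_add le_rfl (norm_add_le _ _)).trans ?_)
  simp only [norm_smul, Real.norm_eq_abs]
  have h1 := norm_vecProd_le b (a - b)
  have h2 := norm_vecProd_le bₖ (a - b)
  have h3 := norm_vecProd_le b (aₖ - bₖ)
  rw [hb, one_mul] at h1 h3
  have hg := (norm_nonneg _).trans hbₖ
  calc _ ≤ K * g * ‖a - b‖ + (K * (g * ‖a - b‖) + K * d) := by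
        gcongr
        · exact h2.trans (by gcongr)
        · exact h3.trans hd
    _ = _ := by ring

theorem abs_inner_bisector_deriv_le (hl : |l| ≤ K) (hl₁ : |l₁| ≤ K * g)
    (haₘ : inner ℝ a aₘ = (0 : ℝ)) (haₘₖ : inner ℝ aₖ aₘ + inner ℝ a aₘₖ = (0 : ℝ))
    (hg : ‖aₘ‖ ≤ g) (hG : ‖aₘₖ‖ ≤ G) (hgG : g * g ≤ G) {d : ℝ} (hd : ‖aₖ - bₖ‖ ≤ d) :
    |inner ℝ (l₁ • (a + b) + l • (aₖ + bₖ)) aₘ + inner ℝ (l • (a + b)) aₘₖ| ≤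
      K * (2 * (‖a - b‖ * G) + d * g) := by
  have e : inner ℝ (l₁ • (a + b) + l • (aₖ + bₖ)) aₘ + inner ℝ (l • (a + b)) aₘₖ =
      -(l₁ * inner ℝ (a - b) aₘ + (l * inner ℝ (aₖ - bₖ) aₘ + l * inner ℝ (a - b) aₘₖ)) := by
    simp only [inner_smul_left, inner_add_left, inner_sub_left, haₘ, conj_trivial]
    linear_combination 2 * l * haₘₖ
  have hK := (abs_nonneg l).trans hl
  have hg0 := (norm_nonneg _).trans hg
  rw [e, abs_neg]
  refine (abs_add_le _ _).trans ((add_le_add le_rfl (abs_add_le _ _)).trans ?_)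
  simp only [abs_mul]
  have h1 := abs_real_inner_le_norm (a - b) aₘ
  have h2 := abs_real_inner_le_norm (aₖ - bₖ) aₘ
  have h3 := abs_real_inner_le_norm (a - b) aₘₖ
  have hd0 := (norm_nonneg _).trans hd
  calc _ ≤ K * g * (‖a - b‖ * g) + (K * (d * g) + K * (‖a - b‖ * G)) := by
        gcongr
        · exact h1.trans (by gcongr)
        · exact h2.trans (by gcongr)
        · exact h3.trans (by gcongr)
    _ ≤ K * (2 * (‖a - b‖ * G) + d * g) := by
        have : K * ‖a - b‖ * (g * g) ≤ K * ‖a - b‖ * G := by gcongr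
        linarith

end Frame

/-- The inner product of `ℝ³` as a bilinear map. -/
noncomputable def innerL : Space →L[ℝ] Space →L[ℝ] ℝ := innerSL ℝ

@[simp] theorem innerL_apply (x y : Space) : innerL x y = inner ℝ x y := rfl

/-! ### Sphere-valued maps with two weak derivatives -/

section Symmetry

variable {E F G : Type*} [NormedAddCommGroup E] [NormedSpace ℝ E] [NormedAddCommGroup F]
  [NormedSpace ℝ F] [NormedAddCommGroup G] [NormedSpace ℝ G]

theorem contDiff_partial {f : Plane → E} (hf : ContDiff ℝ ∞ f) (v : Plane) :
    ContDiff ℝ ∞ fun x => fderiv ℝ f x v :=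
  (hf.fderiv_right (m := ∞) (by simp)).clm_apply contDiff_const

theorem partial_comm {f : Plane → E} (hf : ContDiff ℝ ∞ f) (x v w : Plane) :
    fderiv ℝ (fun y => fderiv ℝ f y v) x w = fderiv ℝ (fun y => fderiv ℝ f y w) x v := by
  have hd : DifferentiableAt ℝ (fderiv ℝ f) x :=
    (hf.fderiv_right (m := ∞) (by simp)).differentiable (by simp) x
  have h : ∀ v w, fderiv ℝ (fun y => fderiv ℝ f y v) x w = fderiv ℝ (fderiv ℝ f) x w v :=
    fun v w => by
      have := (hd.hasFDerivAt.clm_apply (hasFDerivAt_const v x)).fderiv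
      rw [this]
      simp
  rw [h, h]
  exact (hf.contDiffAt.isSymmSndFDerivAt (by
    simp only [minSmoothness_of_isRCLikeNormedField]; exact ENat.LEInfty.out)).eq w v

theorem IsWeakPartial.symm {j k : Fin 2} {f fj fk fkj : Plane → E} (hj : IsWeakPartial j f fj)
    (hk : IsWeakPartial k f fk) (hkj : IsWeakPartial k fj fkj) : IsWeakPartial j fk fkj := by
  refine ⟨hk.locInt_partial, hkj.locInt_partial, fun φ h1 h2 => ?_⟩
  have e1 := hk.integral_eq _ (contDiff_partial h1 (EuclideanSpace.single j 1))
    (h2.fderiv_apply (𝕜 := ℝ) _)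
  have e2 := hj.integral_eq _ (contDiff_partial h1 (EuclideanSpace.single k 1))
    (h2.fderiv_apply (𝕜 := ℝ) _)
  have e3 := hkj.integral_eq φ h1 h2
  simp only [partial_comm h1 _ (EuclideanSpace.single j 1)] at e1
  rw [e2] at e1
  rw [← neg_inj.1 e1, e3]

variable [CompleteSpace E] [CompleteSpace F] [CompleteSpace G]

/-- Two integrations by parts exchange the derivatives of two `H¹` functions. -/
theorem IsSobolev.integral_bilin_swap (B : E →L[ℝ] F →L[ℝ] G) {f : Plane → E}
    {f' : Fin 2 → Plane → E} {g : Plane → F} {g' : Fin 2 → Plane → F} (hf : IsSobolev f f')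
    (hg : IsSobolev g g') (j k : Fin 2) :
    ∫ x, B (f' j x) (g' k x) = ∫ x, B (f' k x) (g' j x) := by
  obtain ⟨fn, hs, hc, -, hl⟩ := hf.exists_approx
  have hS := fun n (k : Fin 2) => IsSobolev.of_contDiff
    (contDiff_partial (hs n) (EuclideanSpace.single k 1)) ((hc n).fderiv_apply (𝕜 := ℝ) _)
  have key : ∀ n, ∫ x, B (fderiv ℝ (fn n) x (EuclideanSpace.single j 1)) (g' k x)
      = ∫ x, B (fderiv ℝ (fn n) x (EuclideanSpace.single k 1)) (g' j x) := fun n => by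
    have h1 := (hS n j).integral_bilin B hg k
    have h2 := (hS n k).integral_bilin B hg j
    simp only [partial_comm (hs n) _ (EuclideanSpace.single j 1)] at h1
    exact neg_inj.1 (h1.symm.trans h2)
  have lim : ∀ j k, Tendsto (fun n => ∫ x, B (fderiv ℝ (fn n) x (EuclideanSpace.single j 1))
      (g' k x)) atTop (𝓝 (∫ x, B (f' j x) (g' k x))) := fun j k =>
    tendsto_integral_bilin B (hf.memLp_partial j) (hg.memLp_partial k)
      (fun n => (hS n j).memLp) (fun _ => hg.memLp_partial k) (hl j) (by simp)
  refine tendsto_nhds_unique (lim j k) ?_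
  simp only [key]
  exact lim k j

end Symmetry

/-- A map `a : ℝ² → 𝕊²` with weak derivatives `a' k ∈ H¹`, whose derivatives are
`a'' j k = ∂_j ∂_k a`. -/
structure IsSphereMap (a : Plane → Space) (a' : Fin 2 → Plane → Space)
    (a'' : Fin 2 → Fin 2 → Plane → Space) : Prop where
  norm_eq : ∀ᵐ x, ‖a x‖ = 1
  weak : ∀ k, IsWeakPartial k a (a' k)
  sobolev : ∀ k, IsSobolev (a' k) fun j => a'' j k

namespace IsSphereMap

variable {a : Plane → Space} {a' : Fin 2 → Plane → Space} {a'' : Fin 2 → Fin 2 → Plane → Space}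

theorem bdd (h : IsSphereMap a a' a'') : IsBddSobolev a a' :=
  ⟨(h.weak 0).locInt.aestronglyMeasurable, ⟨1, h.norm_eq.mono fun _ hx => hx.le⟩,
    fun k => (h.sobolev k).memLp, fun k => (h.sobolev k).memLp_four, h.weak⟩

theorem inner_self (h : IsSphereMap a a' a'') : ∀ᵐ x, inner ℝ (a x) (a x) = (1 : ℝ) :=
  h.norm_eq.mono fun x hx => by rw [real_inner_self_eq_norm_sq, hx, one_pow]

theorem inner_eq_zero (h : IsSphereMap a a' a'') (k : Fin 2) :
    ∀ᵐ x, inner ℝ (a x) (a' k x) = (0 : ℝ) := by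
  have h1 := ((h.bdd.bilin innerL h.bdd).weak k).ae_unique (IsWeakPartial.const k (1 : ℝ))
    h.inner_self
  filter_upwards [h1] with x hx
  simp only [innerL_apply] at hx
  rw [real_inner_comm] at hx
  linarith

theorem inner_add_inner (h : IsSphereMap a a' a'') (j k : Fin 2) :
    ∀ᵐ x, inner ℝ (a' j x) (a' k x) + inner ℝ (a x) (a'' j k x) = (0 : ℝ) :=
  ((h.bdd.bilin_sobolev innerL (h.sobolev k)).weak j).ae_unique
    (IsWeakPartial.const j (0 : ℝ)) (h.inner_eq_zero k)

theorem symm (h : IsSphereMap a a' a'') (j k : Fin 2) : a'' j k =ᵐ[volume] a'' k j :=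
  ((h.sobolev k).weak j).ae_unique ((h.weak j).symm (h.weak k) ((h.sobolev j).weak k)) .rfl

/-- The field `u × Δ u`. -/
noncomputable def _root_.schrodingerField (a : Plane → Space)
    (a'' : Fin 2 → Fin 2 → Plane → Space) (x : Plane) : Space :=
  ∑ k, vecProd (a x) (a'' k k x)

theorem memLp_schrodingerField (h : IsSphereMap a a' a'') :
    MemLp (schrodingerField a a'') 2 volume :=
  memLp_finsetSum _ fun k _ => memLp_bilin_of_bound (C := 1) crossL h.bdd.aesm
    (h.norm_eq.mono fun _ hx => hx.le) ((h.sobolev k).memLp_partial k)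

/-- The field `a × ∂_k a`, whose divergence is `a × Δ a`. -/
theorem sobolev_vecProd (h : IsSphereMap a a' a'') (k : Fin 2) :
    IsSobolev (fun x => vecProd (a x) (a' k x))
      (fun j x => vecProd (a' j x) (a' k x) + vecProd (a x) (a'' j k x)) :=
  h.bdd.bilin_sobolev crossL (h.sobolev k)

theorem integral_schrodingerField (h : IsSphereMap a a' a'') {f : Plane → Space}
    {f' : Fin 2 → Plane → Space} (hf : IsSobolev f f') (m : Fin 2) :
    ∫ x, inner ℝ (schrodingerField a a'' x) (f' m x) =
      ∑ k, ∫ x, inner ℝ (vecProd (a' m x) (a' k x) + vecProd (a x) (a'' m k x)) (f' k x) := by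
  have h1 : ∀ k, ∫ x, inner ℝ (vecProd (a x) (a'' k k x)) (f' m x) =
      ∫ x, inner ℝ (vecProd (a' m x) (a' k x) + vecProd (a x) (a'' m k x)) (f' k x) := fun k => by
    have := (h.sobolev_vecProd k).integral_bilin_swap innerL hf k m
    simpa only [vecProd_self, zero_add, innerL_apply] using this
  rw [← Finset.sum_congr rfl fun k _ => h1 k, ← integral_finsetSum]
  · simp only [schrodingerField, sum_inner]
  · intro k _
    have := integrable_bilin innerL ((h.sobolev_vecProd k).memLp_partial k)
      (hf.memLp_partial m)
    simpa only [vecProd_self, zero_add, innerL_apply] using this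

end IsSphereMap

/-! ### The bisecting frame of two sphere-valued maps -/

section Bisector

/-- The reciprocal of `|a + b|` for unit vectors, as a function of `⟪a, b⟫`. -/
noncomputable def biScale (s : ℝ) : ℝ := (2 + 2 * s) ^ (-1 / 2 : ℝ)

theorem biScale_pos {s : ℝ} (hs : -1 < s) : 0 < biScale s :=
  Real.rpow_pos_of_pos (by linarith) _

theorem biScale_sq {s : ℝ} (hs : -1 < s) : biScale s ^ 2 * (2 + 2 * s) = 1 := by
  have h : 0 < 2 + 2 * s := by linarith
  rw [biScale, ← Real.rpow_natCast, ← Real.rpow_mul h.le]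
  norm_num
  rw [Real.rpow_neg_one, inv_mul_cancel₀ h.ne']

theorem biScale_le {c s : ℝ} (hc : -1 < c) (hs : c ≤ s) : biScale s ≤ biScale c :=
  Real.rpow_le_rpow_of_nonpos (by linarith) (by linarith) (by norm_num)

theorem hasDerivAt_biScale {s : ℝ} (hs : -1 < s) : HasDerivAt biScale (-biScale s ^ 3) s := by
  have h : 0 < 2 + 2 * s := by linarith
  have h1 : HasDerivAt (fun s : ℝ => 2 + 2 * s) 2 s := by
    simpa using ((hasDerivAt_id s).const_mul 2).const_add 2
  refine (h1.rpow_const (p := -1 / 2) (Or.inl h.ne')).congr_deriv ?_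
  rw [biScale, ← Real.rpow_natCast, ← Real.rpow_mul h.le]
  norm_num

theorem hasDerivAt_biScale_cube {s : ℝ} (hs : -1 < s) :
    HasDerivAt (fun s => -biScale s ^ 3) (3 * biScale s ^ 5) s := by
  refine ((hasDerivAt_biScale hs).pow 3).neg.congr_deriv ?_
  push_cast
  ring

theorem exists_lipschitz_biScale {c : ℝ} (hc : -1 < c) : ∃ L : ℝ≥0,
    LipschitzOnWith L biScale (Icc c 1) ∧ LipschitzOnWith L (fun s => -biScale s ^ 3) (Icc c 1) := by
  have hb : ∀ s ∈ Icc c 1, |biScale s| ≤ biScale c := fun s hs => by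
    rw [abs_of_pos (biScale_pos (hc.trans_le hs.1))]; exact biScale_le hc hs.1
  have h0 := (biScale_pos hc).le
  refine ⟨Real.toNNReal (biScale c ^ 3 + 3 * biScale c ^ 5),
    (convex_Icc c 1).lipschitzOnWith_of_nnnorm_hasDerivWithin_le
      (fun s hs => (hasDerivAt_biScale (hc.trans_le hs.1)).hasDerivWithinAt) fun s hs => ?_,
    (convex_Icc c 1).lipschitzOnWith_of_nnnorm_hasDerivWithin_le
      (fun s hs => (hasDerivAt_biScale_cube (hc.trans_le hs.1)).hasDerivWithinAt) fun s hs => ?_⟩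
  · rw [← NNReal.coe_le_coe, Real.coe_toNNReal _ (by positivity), coe_nnnorm, norm_neg, norm_pow, Real.norm_eq_abs]
    have : |biScale s| ^ 3 ≤ biScale c ^ 3 := by gcongr; exact hb s hs
    have h3 : 0 ≤ 3 * biScale c ^ 5 := by positivity
    linarith
  · rw [← NNReal.coe_le_coe, Real.coe_toNNReal _ (by positivity), coe_nnnorm, norm_mul, norm_pow, Real.norm_eq_abs, Real.norm_eq_abs]
    have : |biScale s| ^ 5 ≤ biScale c ^ 5 := by gcongr; exact hb s hs
    have h3 : 0 ≤ biScale c ^ 3 := by positivity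
    rw [abs_of_pos (by norm_num : (0 : ℝ) < 3)]
    linarith

/-- The midpoint of `a` and `b` on the sphere. -/
noncomputable def bisector (a b : Space) : Space := biScale (inner ℝ a b) • (a + b)

/-- The derivative of `biScale ⟪a, b⟫` in the direction `(a₁, b₁)`. -/
noncomputable def biScaleDeriv (a b a₁ b₁ : Space) : ℝ :=
  -biScale (inner ℝ a b) ^ 3 * (inner ℝ a₁ b + inner ℝ a b₁)

/-- The derivative of `bisector` at `(a, b)` in the direction `(a₁, b₁)`. -/
noncomputable def bisectorDeriv (a b a₁ b₁ : Space) : Space :=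
  biScaleDeriv a b a₁ b₁ • (a + b) + biScale (inner ℝ a b) • (a₁ + b₁)

variable {a b : Space}

theorem inner_bisector_self (ha : ‖a‖ = 1) (hb : ‖b‖ = 1) (hab : -1 < inner ℝ a b) :
    inner ℝ (bisector a b) (bisector a b) = (1 : ℝ) := by
  rw [bisector, inner_smul_left, inner_smul_right, inner_add_left, inner_add_right, inner_add_right,
    real_inner_self_eq_norm_sq, real_inner_self_eq_norm_sq, ha, hb, real_inner_comm a b]
  have := biScale_sq hab
  simp only [conj_trivial]
  linear_combination this

theorem norm_bisector (ha : ‖a‖ = 1) (hb : ‖b‖ = 1) (hab : -1 < inner ℝ a b) :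
    ‖bisector a b‖ = 1 := by
  have := inner_bisector_self ha hb hab
  rw [real_inner_self_eq_norm_sq] at this
  exact (pow_eq_one_iff_of_nonneg (norm_nonneg _) two_ne_zero).1 this

theorem mirror_bisector_left (ha : ‖a‖ = 1) (hab : -1 < inner ℝ a b) :
    mirror (bisector a b) a = -b := by
  have h := biScale_sq hab
  rw [mirror_apply, bisector, inner_smul_left, inner_add_left, real_inner_self_eq_norm_sq, ha,
    real_inner_comm a b, smul_smul]
  have e : 2 * ((starRingEnd ℝ) (biScale (inner ℝ a b)) * (1 ^ 2 + inner ℝ a b)) *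
      biScale (inner ℝ a b) = 1 := by
    simp only [conj_trivial]
    linear_combination h
  rw [e]
  module

/-- Parallel transport along the minimal geodesic from `a` to `b` is the reflection that exchanges
`a` and `-b`. -/
theorem parallelTransport_eq_mirror {ξ : Space} (ha : ‖a‖ = 1) (hb : ‖b‖ = 1)
    (hab : InnerProductGeometry.angle a b < Real.pi) (hξ : inner ℝ a ξ = (0 : ℝ))
    (hab' : -1 < inner ℝ a b) :
    parallelTransport (minimalGeodesic a b) 1 0 ξ = mirror (bisector a b) ξ := by
  rw [parallelTransport_minimalGeodesic ha hb hab (by rwa [real_inner_comm]), mirror_apply,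
    bisector, inner_smul_left, inner_add_left, hξ, smul_smul, real_inner_comm b ξ]
  have h := biScale_sq hab'
  congr 2
  have h1 : 1 + inner ℝ a b ≠ 0 := by linarith
  simp only [conj_trivial]
  rw [div_eq_iff h1]
  linear_combination -(inner ℝ b ξ) * h

theorem abs_biScaleDeriv_le {K : ℝ} (ha : ‖a‖ = 1) (hb : ‖b‖ = 1) (hK : |biScale (inner ℝ a b)| ≤ K)
    (a₁ b₁ : Space) : |biScaleDeriv a b a₁ b₁| ≤ K ^ 3 * (‖a₁‖ + ‖b₁‖) := by
  rw [biScaleDeriv, abs_mul, abs_neg, abs_pow]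
  have h1 := abs_real_inner_le_norm a₁ b
  have h2 := abs_real_inner_le_norm a b₁
  rw [ha, one_mul] at h2
  rw [hb, mul_one] at h1
  have h0 := (abs_nonneg _).trans hK
  gcongr
  exact (abs_add_le _ _).trans (add_le_add h1 h2)

theorem norm_add_le_two (ha : ‖a‖ = 1) (hb : ‖b‖ = 1) : ‖a + b‖ ≤ 2 :=
  (norm_add_le _ _).trans (by rw [ha, hb]; norm_num)

theorem norm_bisectorDeriv_le {K : ℝ} (ha : ‖a‖ = 1) (hb : ‖b‖ = 1)
    (hK : |biScale (inner ℝ a b)| ≤ K) (hK₁ : 1 ≤ K) (a₁ b₁ : Space) :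
    ‖bisectorDeriv a b a₁ b₁‖ ≤ 3 * K ^ 3 * (‖a₁‖ + ‖b₁‖) := by
  refine (norm_add_le _ _).trans ?_
  rw [norm_smul, norm_smul, Real.norm_eq_abs, Real.norm_eq_abs]
  have h1 := abs_biScaleDeriv_le ha hb hK a₁ b₁
  have h2 := norm_add_le_two ha hb
  have h3 := norm_add_le a₁ b₁
  have h4 : K ≤ K ^ 3 := le_self_pow₀ hK₁ (by norm_num)
  calc _ ≤ K ^ 3 * (‖a₁‖ + ‖b₁‖) * 2 + K * (‖a₁‖ + ‖b₁‖) := by gcongr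
    _ ≤ K ^ 3 * (‖a₁‖ + ‖b₁‖) * 2 + K ^ 3 * (‖a₁‖ + ‖b₁‖) := by gcongr
    _ = _ := by ring

end Bisector

section Frame

variable {E : Type*} [NormedAddCommGroup E] [NormedSpace ℝ E]

theorem IsBddSobolev.of_eq {f g : Plane → E} {f' g' : Fin 2 → Plane → E} (h : IsBddSobolev f f')
    (hf : ∀ x, f x = g x) (hf' : ∀ k x, f' k x = g' k x) : IsBddSobolev g g' := by
  obtain rfl : f = g := funext hf
  obtain rfl : f' = g' := funext fun k => funext (hf' k)
  exact h

theorem IsSobolev.of_eq {f g : Plane → E} {f' g' : Fin 2 → Plane → E} (h : IsSobolev f f')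
    (hf : ∀ x, f x = g x) (hf' : ∀ k x, f' k x = g' k x) : IsSobolev g g' := by
  obtain rfl : f = g := funext hf
  obtain rfl : f' = g' := funext fun k => funext (hf' k)
  exact h

/-- The size of the first derivatives of two maps. -/
noncomputable def gradSize (a' b' : Fin 2 → Plane → Space) (x : Plane) : ℝ :=
  ∑ k, (‖a' k x‖ + ‖b' k x‖)

/-- The size of the second derivatives of two maps. -/
noncomputable def hessSize (a'' b'' : Fin 2 → Fin 2 → Plane → Space) (x : Plane) : ℝ :=
  ∑ j, ∑ k, (‖a'' j k x‖ + ‖b'' j k x‖)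

variable {a b : Plane → Space} {a' b' : Fin 2 → Plane → Space}
  {a'' b'' : Fin 2 → Fin 2 → Plane → Space} {c : ℝ}

theorem gradSize_nonneg (a' b' : Fin 2 → Plane → Space) (x : Plane) : 0 ≤ gradSize a' b' x :=
  Finset.sum_nonneg fun _ _ => by positivity

theorem hessSize_nonneg (a'' b'' : Fin 2 → Fin 2 → Plane → Space) (x : Plane) :
    0 ≤ hessSize a'' b'' x :=
  Finset.sum_nonneg fun _ _ => Finset.sum_nonneg fun _ _ => by positivity

theorem add_le_gradSize (a' b' : Fin 2 → Plane → Space) (k : Fin 2) (x : Plane) :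
    ‖a' k x‖ + ‖b' k x‖ ≤ gradSize a' b' x :=
  Finset.single_le_sum (f := fun k => ‖a' k x‖ + ‖b' k x‖) (fun _ _ => by positivity)
    (Finset.mem_univ k)

theorem add_le_hessSize (a'' b'' : Fin 2 → Fin 2 → Plane → Space) (j k : Fin 2) (x : Plane) :
    ‖a'' j k x‖ + ‖b'' j k x‖ ≤ hessSize a'' b'' x :=
  (Finset.single_le_sum (f := fun k => ‖a'' j k x‖ + ‖b'' j k x‖) (fun _ _ => by positivity)
    (Finset.mem_univ k)).trans (Finset.single_le_sum
      (f := fun j => ∑ k, (‖a'' j k x‖ + ‖b'' j k x‖))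
      (fun _ _ => Finset.sum_nonneg fun _ _ => by positivity) (Finset.mem_univ j))

/-- The bound for the scale `biScale ⟪a, b⟫` and its derivatives when `c ≤ ⟪a, b⟫`. -/
noncomputable def frameConst (c : ℝ) : ℝ := biScale c + 1

theorem one_le_frameConst (hc : -1 < c) : 1 ≤ frameConst c := by
  have := biScale_pos hc
  rw [frameConst]; linarith

theorem abs_biScale_le (hc : -1 < c) {s : ℝ} (hs : c ≤ s) : |biScale s| ≤ frameConst c := by
  rw [abs_of_pos (biScale_pos (hc.trans_le hs)), frameConst]
  linarith [biScale_le hc hs]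

/-- The bisector of two sphere-valued maps at a distance less than `π` is as regular as the maps,
with derivatives bounded by those of the maps. -/
theorem IsSphereMap.exists_bisector (ha : IsSphereMap a a' a'') (hb : IsSphereMap b b' b'')
    (hc : -1 < c) (hab : ∀ᵐ x, c ≤ inner ℝ (a x) (b x)) :
    IsBddSobolev (fun x => bisector (a x) (b x))
        (fun k x => bisectorDeriv (a x) (b x) (a' k x) (b' k x)) ∧
      ∃ n'' : Fin 2 → Fin 2 → Plane → Space,
        (∀ k, IsSobolev (fun x => bisectorDeriv (a x) (b x) (a' k x) (b' k x))
          (fun j => n'' j k)) ∧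
        ∀ j k, ∀ᵐ x, ‖n'' j k x‖ ≤
          11 * frameConst c ^ 5 * (hessSize a'' b'' x + gradSize a' b' x ^ 2) := by
  have hg : IsBddSobolev (fun x => inner ℝ (a x) (b x))
      (fun k x => inner ℝ (a' k x) (b x) + inner ℝ (a x) (b' k x)) :=
    (ha.bdd.bilin innerL hb.bdd).of_eq (fun _ => rfl) fun _ _ => rfl
  have hg' : ∀ k, IsSobolev (fun x => inner ℝ (a' k x) (b x) + inner ℝ (a x) (b' k x))
      (fun j x => (inner ℝ (a'' j k x) (b x) + inner ℝ (a' k x) (b' j x)) +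
        (inner ℝ (a' j x) (b' k x) + inner ℝ (a x) (b'' j k x))) := fun k =>
    (((ha.sobolev k).bilin_bdd innerL hb.bdd).add (ha.bdd.bilin_sobolev innerL (hb.sobolev k))).of_eq
      (fun _ => rfl) fun _ _ => rfl
  have hm : ∀ᵐ x, inner ℝ (a x) (b x) ∈ Icc c 1 := by
    filter_upwards [hab, ha.norm_eq, hb.norm_eq] with x h1 h2 h3
    exact ⟨h1, (real_inner_le_norm _ _).trans (by rw [h2, h3, one_mul])⟩
  obtain ⟨L, hL, hL'⟩ := exists_lipschitz_biScale hc
  have hl : IsBddSobolev (fun x => biScale (inner ℝ (a x) (b x)))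
      (fun k x => biScaleDeriv (a x) (b x) (a' k x) (b' k x)) :=
    hg.comp_real (fun s hs => hasDerivAt_biScale (hc.trans_le hs.1)) hL hL' hm
  have hP := (hl.bilin (ContinuousLinearMap.mul ℝ ℝ) hl).bilin (ContinuousLinearMap.mul ℝ ℝ) hl
  have hl' := fun k => (hP.bilin_sobolev (ContinuousLinearMap.mul ℝ ℝ) (hg' k)).const_smul (-1)
  have hab' := ha.bdd.add hb.bdd
  have habs := fun k => (ha.sobolev k).add (hb.sobolev k)
  refine ⟨(hl.bilin (ContinuousLinearMap.lsmul ℝ ℝ) hab').of_eq (fun x => rfl) fun k x => rfl, ?_⟩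
  have hn := fun k => ((hl' k).bilin_bdd (ContinuousLinearMap.lsmul ℝ ℝ) hab').add
    (hl.bilin_sobolev (ContinuousLinearMap.lsmul ℝ ℝ) (habs k))
  refine ⟨_, fun k => (hn k).of_eq (fun x => ?_) fun j x => rfl, fun j k => ?_⟩
  · simp only [ContinuousLinearMap.mul_apply', ContinuousLinearMap.lsmul_apply, bisectorDeriv,
      biScaleDeriv, smul_eq_mul]
    congr 2
    ring
  filter_upwards [hm, ha.norm_eq, hb.norm_eq] with x hx h1 h2
  simp only [ContinuousLinearMap.mul_apply', ContinuousLinearMap.lsmul_apply, smul_eq_mul]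
  obtain ⟨l, hle⟩ : ∃ l, l = biScale (inner ℝ (a x) (b x)) := ⟨_, rfl⟩
  have hK : |l| ≤ frameConst c := hle ▸ abs_biScale_le hc hx.1
  have hK1 := one_le_frameConst hc
  have hd := abs_biScaleDeriv_le h1 h2 (hle ▸ hK)
  rw [← hle]
  obtain ⟨K, hKe⟩ : ∃ K, K = frameConst c := ⟨_, rfl⟩
  rw [← hKe] at hd hK hK1 ⊢
  obtain ⟨g, hge⟩ : ∃ g, g = gradSize a' b' x := ⟨_, rfl⟩
  obtain ⟨G, hGe⟩ : ∃ G, G = hessSize a'' b'' x + gradSize a' b' x ^ 2 := ⟨_, rfl⟩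
  have hg0 : 0 ≤ g := hge ▸ gradSize_nonneg _ _ _
  have hh0 := hessSize_nonneg a'' b'' x
  have hK0 : 0 ≤ K := zero_le_one.trans hK1
  have gk : ∀ k, ‖a' k x‖ + ‖b' k x‖ ≤ g := fun k => hge ▸ add_le_gradSize a' b' k x
  have hG0 : 0 ≤ G := by rw [hGe]; positivity
  have hgG : g ^ 2 ≤ G := by rw [hGe, ← hge]; linarith
  have hhG : ‖a'' j k x‖ + ‖b'' j k x‖ ≤ G := by
    rw [hGe]; nlinarith [add_le_hessSize a'' b'' j k x, sq_nonneg (gradSize a' b' x)]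
  have hgd : ∀ k, |inner ℝ (a' k x) (b x) + inner ℝ (a x) (b' k x)| ≤ g := fun k => by
    have e1 := abs_real_inner_le_norm (a' k x) (b x)
    have e2 := abs_real_inner_le_norm (a x) (b' k x)
    rw [h1, one_mul] at e2
    rw [h2, mul_one] at e1
    exact (abs_add_le _ _).trans ((add_le_add e1 e2).trans (gk k))
  have hgdd : |(inner ℝ (a'' j k x) (b x) + inner ℝ (a' k x) (b' j x)) +
        (inner ℝ (a' j x) (b' k x) + inner ℝ (a x) (b'' j k x))| ≤ G := by
    have e1 := abs_real_inner_le_norm (a'' j k x) (b x)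
    have e2 := abs_real_inner_le_norm (a x) (b'' j k x)
    have e3 := abs_real_inner_le_norm (a' k x) (b' j x)
    have e4 := abs_real_inner_le_norm (a' j x) (b' k x)
    rw [h1, one_mul] at e2
    rw [h2, mul_one] at e1
    have e5 : (‖a' j x‖ + ‖b' j x‖) * (‖a' k x‖ + ‖b' k x‖) ≤ g * g := by
      gcongr
      · exact gk j
      · exact gk k
    have e6 : ‖a' k x‖ * ‖b' j x‖ + ‖a' j x‖ * ‖b' k x‖ ≤ g * g := by
      nlinarith [norm_nonneg (a' k x), norm_nonneg (a' j x), norm_nonneg (b' k x),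
        norm_nonneg (b' j x), mul_nonneg (norm_nonneg (a' k x)) (norm_nonneg (a' j x)),
        mul_nonneg (norm_nonneg (b' k x)) (norm_nonneg (b' j x))]
    have e7 := add_le_hessSize a'' b'' j k x
    have e8 : G = hessSize a'' b'' x + g * g := by rw [hGe, hge]; ring
    refine (abs_add_le _ _).trans ((add_le_add (abs_add_le _ _) (abs_add_le _ _)).trans ?_)
    linarith
  have hS := norm_add_le_two h1 h2
  have hl1 : ∀ k, |biScaleDeriv (a x) (b x) (a' k x) (b' k x)| ≤ K ^ 3 * g := fun k =>
    (hd _ _).trans (by gcongr; exact gk k)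
  -- the derivative of `l³` is `3 l² l'`
  have hP' : |(biScaleDeriv (a x) (b x) (a' j x) (b' j x) * l +
      l * biScaleDeriv (a x) (b x) (a' j x) (b' j x)) * l +
      l * l * biScaleDeriv (a x) (b x) (a' j x) (b' j x)| ≤ 3 * K ^ 5 * g := by
    have : (biScaleDeriv (a x) (b x) (a' j x) (b' j x) * l +
      l * biScaleDeriv (a x) (b x) (a' j x) (b' j x)) * l +
      l * l * biScaleDeriv (a x) (b x) (a' j x) (b' j x) =
      3 * (l ^ 2 * biScaleDeriv (a x) (b x) (a' j x) (b' j x)) := by ring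
    rw [this, abs_mul, abs_mul, abs_pow, abs_of_pos (by norm_num : (0 : ℝ) < 3)]
    calc _ ≤ 3 * (K ^ 2 * (K ^ 3 * g)) := by gcongr; exact hl1 j
      _ = _ := by ring
  have hA : ∀ X : Space, ∀ y, ‖X‖ ≤ y → ∀ s A, |s| ≤ A → ‖s • X‖ ≤ A * y := fun X y hX s A hs => by
    rw [norm_smul, Real.norm_eq_abs]
    have := (abs_nonneg s).trans hs
    gcongr
  have hB : ∀ s t A B : ℝ, |s| ≤ A → |t| ≤ B → |s * t| ≤ A * B := fun s t A B hs ht => by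
    rw [abs_mul]
    have := (abs_nonneg s).trans hs
    gcongr
  have hl3 : |l * l * l| ≤ K * K * K := hB _ _ _ _ (hB _ _ _ _ hK hK) hK
  have hgk : |l * l * l * (inner ℝ (a' k x) (b x) + inner ℝ (a x) (b' k x))| ≤ K * K * K * g :=
    hB _ _ _ _ hl3 (hgd k)
  have hlkk := (abs_add_le _ _).trans (add_le_add (hB _ _ _ _ hP' (hgd k)) (hB _ _ _ _ hl3 hgdd))
  have nn : ∀ k, ‖a' k x + b' k x‖ ≤ g := fun k => (norm_add_le _ _).trans (gk k)
  have nnn : ‖a'' j k x + b'' j k x‖ ≤ G := (norm_add_le _ _).trans hhG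
  have hneg : ∀ s A : ℝ, |s| ≤ A → |-1 * s| ≤ A := fun s A hs => by rwa [neg_one_mul, abs_neg]
  -- the bound of `∂ⱼ (l³ s (a + b) + l (aₖ + bₖ))`, term by term, where `s = -⟪a, b⟫ₖ`
  refine (norm_add_le_of_le (norm_add_le_of_le (hA _ _ hS _ _ (hneg _ _ hlkk))
    (hA _ _ (nn j) _ _ (hneg _ _ hgk))) (norm_add_le_of_le (hA _ _ (nn k) _ _ (hl1 j))
    (hA _ _ nnn _ _ hK))).trans ?_
  rw [← hGe]
  have k3 : K ^ 3 ≤ K ^ 5 := pow_le_pow_right₀ hK1 (by norm_num)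
  have k1 : K ≤ K ^ 5 := le_self_pow₀ hK1 (by norm_num)
  calc _ = 6 * K ^ 5 * g ^ 2 + K ^ 3 * (2 * G + 2 * g ^ 2) + K * G := by ring
    _ ≤ 6 * K ^ 5 * G + K ^ 5 * (2 * G + 2 * G) + K ^ 5 * G := by gcongr
    _ = _ := by ring

end Frame

/-! ### The energy estimate at a fixed time -/

section Energy

set_option maxSynthPendingDepth 3

/-- The evaluation of operators as a bilinear map. -/
noncomputable def applyL : (Space →L[ℝ] Space) →L[ℝ] Space →L[ℝ] Space :=
  ContinuousLinearMap.id ℝ _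

@[simp] theorem applyL_apply (A : Space →L[ℝ] Space) (ξ : Space) : applyL A ξ = A ξ := rfl

theorem IsBddSobolev.mirror {n : Plane → Space} {n' : Fin 2 → Plane → Space}
    (hn : IsBddSobolev n n') :
    IsBddSobolev (fun x => mirror (n x)) (fun k x => mirrorDeriv (n x) (n' k x)) :=
  ((IsBddSobolev.const (ContinuousLinearMap.id ℝ Space)).add
    ((hn.bilin dyadL hn).const_smul (-2))).of_eq (fun _ => rfl) fun k x => by
      rw [zero_add]; rfl

/-- The second derivative of `mirror n`. -/
noncomputable def mirrorDeriv₂ (n n₁ n₂ n₁₂ : Space) : Space →L[ℝ] Space :=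
  (-2 : ℝ) • (dyadL n₁₂ n + dyadL n₁ n₂ + (dyadL n₂ n₁ + dyadL n n₁₂))

theorem IsBddSobolev.mirrorDeriv {n : Plane → Space} {n' : Fin 2 → Plane → Space}
    (hn : IsBddSobolev n n') {n₁ : Plane → Space} {n₁' : Fin 2 → Plane → Space}
    (hn₁ : IsSobolev n₁ n₁') :
    IsSobolev (fun x => mirrorDeriv (n x) (n₁ x))
      (fun j x => mirrorDeriv₂ (n x) (n₁ x) (n' j x) (n₁' j x)) :=
  ((((hn₁.bilin_bdd dyadL hn).add (hn.bilin_sobolev dyadL hn₁)).const_smul (-2))).of_eq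
    (fun _ => rfl) fun _ _ => rfl

theorem norm_mirrorDeriv_le {n : Space} (hn : ‖n‖ = 1) (n₁ : Space) :
    ‖mirrorDeriv n n₁‖ ≤ 4 * ‖n₁‖ := by
  rw [mirrorDeriv, norm_smul, show ‖(-2 : ℝ)‖ = 2 by norm_num]
  have h1 := norm_dyadL_le n₁ n
  have h2 := norm_dyadL_le n n₁
  rw [hn] at h1 h2
  have := norm_add_le (dyadL n₁ n) (dyadL n n₁)
  linarith

variable (a b : Plane → Space) (a' b' : Fin 2 → Plane → Space)
  (a'' b'' : Fin 2 → Fin 2 → Plane → Space)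

/-- The operator `S` that transports `T_a 𝕊²` to `T_b 𝕊²`, extended to a reflection of `ℝ³`. -/
noncomputable def transportOp (x : Plane) : Space →L[ℝ] Space := mirror (bisector (a x) (b x))

/-- The derivative of `transportOp` for the variations `a₁`, `b₁` of `a`, `b`. -/
noncomputable def transportOpDeriv (a₁ b₁ : Plane → Space) (x : Plane) : Space →L[ℝ] Space :=
  mirrorDeriv (bisector (a x) (b x)) (bisectorDeriv (a x) (b x) (a₁ x) (b₁ x))

/-- The difference `V_m = S ∂_m a - ∂_m b`. -/
noncomputable def transportDiff (m : Fin 2) (x : Plane) : Space :=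
  transportOp a b x (a' m x) - b' m x

/-- The weak derivative `∂_k V_m`. -/
noncomputable def transportDiffDeriv (m k : Fin 2) (x : Plane) : Space :=
  transportOpDeriv a b (a' k) (b' k) x (a' m x) + transportOp a b x (a'' k m x) - b'' k m x

/-- The coefficient of `∂_m ψ` in the pairing `⟨∂_t V_m, ψ⟩` for solutions of the Schrödinger map
equation. -/
noncomputable def fluxMain (x : Plane) : Space :=
  -transportOp a b x (schrodingerField a a'' x) + schrodingerField b b'' x

/-- The coefficient of `ψ` in the pairing `⟨∂_t V_m, ψ⟩` for solutions of the Schrödinger map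
equation. -/
noncomputable def fluxLower (m : Fin 2) (x : Plane) : Space :=
  -transportOpDeriv a b (a' m) (b' m) x (schrodingerField a a'' x) +
    transportOpDeriv a b (schrodingerField a a'') (schrodingerField b b'') x (a' m x)

/-- The size of the differences `V_k`. -/
noncomputable def diffSize (x : Plane) : ℝ := ∑ k, ‖transportDiff a b a' b' k x‖

/-- The pointwise bound of the energy flux by quadratic expressions in `a - b` and `V`. -/
noncomputable def energyDensity (x : Plane) : ℝ :=
  ‖a x - b x‖ * diffSize a b a' b' x * gradSize a' b' x *
      (hessSize a'' b'' x + gradSize a' b' x ^ 2) +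
    diffSize a b a' b' x ^ 2 * gradSize a' b' x ^ 2

variable {a b a' b' a'' b''} {c : ℝ}

theorem diffSize_nonneg (x : Plane) : 0 ≤ diffSize a b a' b' x :=
  Finset.sum_nonneg fun _ _ => norm_nonneg _

theorem norm_le_diffSize (k : Fin 2) (x : Plane) :
    ‖transportDiff a b a' b' k x‖ ≤ diffSize a b a' b' x :=
  Finset.single_le_sum (f := fun k => ‖transportDiff a b a' b' k x‖)
    (fun _ _ => norm_nonneg _) (Finset.mem_univ k)

theorem norm_schrodingerField_le {x : Plane} (ha : ‖a x‖ = 1) :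
    ‖schrodingerField a a'' x‖ ≤ ∑ k, ‖a'' k k x‖ :=
  norm_sum_le_of_le _ fun k _ => by simpa [ha] using norm_vecProd_le (a x) (a'' k k x)

theorem norm_schrodingerField_add_le {x : Plane} (ha : ‖a x‖ = 1) (hb : ‖b x‖ = 1) :
    ‖schrodingerField a a'' x‖ + ‖schrodingerField b b'' x‖ ≤ hessSize a'' b'' x := by
  refine (add_le_add (norm_schrodingerField_le ha) (norm_schrodingerField_le hb)).trans ?_
  rw [← Finset.sum_add_distrib]
  exact Finset.sum_le_sum fun j _ => Finset.single_le_sum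
    (f := fun k => ‖a'' j k x‖ + ‖b'' j k x‖) (fun _ _ => by positivity) (Finset.mem_univ j)

/-- The bound for the bisecting frame and its derivatives when `c ≤ ⟪a, b⟫`. -/
noncomputable def energyConst (c : ℝ) : ℝ := 11 * frameConst c ^ 5

theorem frameConst_bounds (hc : -1 < c) : 1 ≤ energyConst c ∧ frameConst c ≤ energyConst c ∧
    3 * frameConst c ^ 3 ≤ energyConst c ∧
    frameConst c ^ 3 * (2 + 2 * frameConst c) ≤ energyConst c := by
  have h := one_le_frameConst hc
  have h1 : frameConst c ≤ frameConst c ^ 5 := le_self_pow₀ h (by norm_num)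
  have h2 : frameConst c ^ 4 ≤ frameConst c ^ 5 := pow_le_pow_right₀ h (by norm_num)
  have h3 : frameConst c ^ 3 ≤ frameConst c ^ 5 := pow_le_pow_right₀ h (by norm_num)
  rw [energyConst]
  refine ⟨by linarith, by linarith, by linarith, by nlinarith⟩

theorem IsSphereMap.transportOp_bdd (ha : IsSphereMap a a' a'') (hb : IsSphereMap b b' b'')
    (hc : -1 < c) (hab : ∀ᵐ x, c ≤ inner ℝ (a x) (b x)) :
    IsBddSobolev (transportOp a b) (fun k => transportOpDeriv a b (a' k) (b' k)) :=
  (ha.exists_bisector hb hc hab).1.mirror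

theorem IsSphereMap.transportDiff_sobolev (ha : IsSphereMap a a' a'') (hb : IsSphereMap b b' b'')
    (hc : -1 < c) (hab : ∀ᵐ x, c ≤ inner ℝ (a x) (b x)) (m : Fin 2) :
    IsSobolev (transportDiff a b a' b' m) (transportDiffDeriv a b a' b' a'' b'' m) :=
  (((ha.transportOp_bdd hb hc hab).bilin_sobolev applyL (ha.sobolev m)).sub (hb.sobolev m)).of_eq
    (fun _ => rfl) fun _ _ => rfl

theorem IsSphereMap.inner_transportDiff (ha : IsSphereMap a a' a'') (hb : IsSphereMap b b' b'')
    (hc : -1 < c) (hab : ∀ᵐ x, c ≤ inner ℝ (a x) (b x)) (m : Fin 2) :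
    ∀ᵐ x, inner ℝ (b x) (transportDiff a b a' b' m x) = (0 : ℝ) := by
  filter_upwards [ha.norm_eq, hb.norm_eq, ha.inner_eq_zero m, hb.inner_eq_zero m, hab]
    with x h1 h2 h3 h4 h5
  have h6 := hc.trans_le h5
  have e : b x = -transportOp a b x (a x) := by
    rw [transportOp, mirror_bisector_left h1 h6, neg_neg]
  rw [transportDiff, inner_sub_right, h4, sub_zero, e, inner_neg_left, transportOp,
    inner_mirror_left, mirror_mirror (inner_bisector_self h1 h2 h6), h3, neg_zero]

/-- The derivative of the identity `⟪b, V_m⟫ = 0`. -/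
theorem IsSphereMap.inner_transportDiffDeriv (ha : IsSphereMap a a' a'')
    (hb : IsSphereMap b b' b'') (hc : -1 < c) (hab : ∀ᵐ x, c ≤ inner ℝ (a x) (b x)) (m k : Fin 2) :
    ∀ᵐ x, inner ℝ (b x) (transportDiffDeriv a b a' b' a'' b'' m k x) =
      -inner ℝ (b' k x) (transportDiff a b a' b' m x) := by
  have h := ((hb.bdd.bilin_sobolev innerL (ha.transportDiff_sobolev hb hc hab m)).weak k).ae_unique
    (IsWeakPartial.const k (0 : ℝ)) (ha.inner_transportDiff hb hc hab m)
  filter_upwards [h] with x hx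
  simp only [innerL_apply] at hx
  linarith

/-- The derivative of the identity `S a = -b`. -/
theorem IsSphereMap.transportOpDeriv_left (ha : IsSphereMap a a' a'')
    (hb : IsSphereMap b b' b'') (hc : -1 < c) (hab : ∀ᵐ x, c ≤ inner ℝ (a x) (b x)) (k : Fin 2) :
    ∀ᵐ x, transportOpDeriv a b (a' k) (b' k) x (a x) = -b' k x - transportOp a b x (a' k x) := by
  have h0 : (fun x => applyL (transportOp a b x) (a x)) =ᵐ[volume] fun x => -b x := by
    filter_upwards [ha.norm_eq, hab] with x h1 h2
    exact mirror_bisector_left h1 (hc.trans_le h2)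
  have h := (((ha.transportOp_bdd hb hc hab).bilin applyL ha.bdd).weak k).ae_unique
    (hb.weak k).neg h0
  filter_upwards [h] with x hx
  simp only [applyL_apply] at hx
  rw [← hx]
  abel

theorem IsSphereMap.aesm_biScale (ha : IsSphereMap a a' a'') (hb : IsSphereMap b b' b'') :
    AEStronglyMeasurable (fun x => biScale (inner ℝ (a x) (b x))) volume := by
  have : Measurable biScale := by unfold biScale; fun_prop
  exact (this.comp_aemeasurable
    (ha.bdd.aesm.inner hb.bdd.aesm).aemeasurable).aestronglyMeasurable

theorem IsSphereMap.aesm_transportOpDeriv (ha : IsSphereMap a a' a'')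
    (hb : IsSphereMap b b' b'') (hc : -1 < c) (hab : ∀ᵐ x, c ≤ inner ℝ (a x) (b x))
    {a₁ b₁ : Plane → Space} (ha₁ : AEStronglyMeasurable a₁ volume)
    (hb₁ : AEStronglyMeasurable b₁ volume) :
    AEStronglyMeasurable (transportOpDeriv a b a₁ b₁) volume := by
  have hl := ha.aesm_biScale hb
  have hn := (ha.exists_bisector hb hc hab).1.aesm
  have hnt : AEStronglyMeasurable (fun x => bisectorDeriv (a x) (b x) (a₁ x) (b₁ x)) volume :=
    ((((hl.pow 3).neg).mul ((ha₁.inner hb.bdd.aesm).add (ha.bdd.aesm.inner hb₁))).smul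
      (ha.bdd.aesm.add hb.bdd.aesm)).add (hl.smul (ha₁.add hb₁))
  exact ((dyadL.aestronglyMeasurable_bilin hnt hn).add
    (dyadL.aestronglyMeasurable_bilin hn hnt)).const_smul (-2 : ℝ)

theorem IsSphereMap.norm_transportOpDeriv_le (ha : IsSphereMap a a' a'')
    (hb : IsSphereMap b b' b'') (hc : -1 < c) (hab : ∀ᵐ x, c ≤ inner ℝ (a x) (b x)) :
    ∀ᵐ x, ∀ a₁ b₁ : Plane → Space, ‖transportOpDeriv a b a₁ b₁ x‖ ≤
      12 * frameConst c ^ 3 * (‖a₁ x‖ + ‖b₁ x‖) := by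
  filter_upwards [ha.norm_eq, hb.norm_eq, hab] with x h1 h2 h3 a₁ b₁
  refine (norm_mirrorDeriv_le (norm_bisector h1 h2 (hc.trans_le h3)) _).trans ?_
  have := norm_bisectorDeriv_le h1 h2 (abs_biScale_le hc h3) (one_le_frameConst hc) (a₁ x) (b₁ x)
  linarith

theorem IsSphereMap.memLp_transportOpDeriv_schrodingerField (ha : IsSphereMap a a' a'')
    (hb : IsSphereMap b b' b'') (hc : -1 < c) (hab : ∀ᵐ x, c ≤ inner ℝ (a x) (b x)) :
    MemLp (transportOpDeriv a b (schrodingerField a a'') (schrodingerField b b'')) 2 volume := by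
  have hA := ha.memLp_schrodingerField
  have hB := hb.memLp_schrodingerField
  refine (hA.norm.add hB.norm).of_le_mul (c := 12 * frameConst c ^ 3)
    (ha.aesm_transportOpDeriv hb hc hab hA.1 hB.1) ?_
  filter_upwards [ha.norm_transportOpDeriv_le hb hc hab] with x hx
  refine (hx _ _).trans (le_of_eq ?_)
  simp only [Pi.add_apply, Real.norm_eq_abs]
  rw [abs_of_nonneg (by positivity)]

end Energy

section EnergyEstimate

set_option maxSynthPendingDepth 3

variable {a b : Plane → Space} {a' b' : Fin 2 → Plane → Space}
  {a'' b'' : Fin 2 → Fin 2 → Plane → Space} {c : ℝ}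

/-- The trilinear form `⟪x, A y⟫`. -/
noncomputable def tripleL : Space →L[ℝ] (Space →L[ℝ] Space) →L[ℝ] Space →L[ℝ] ℝ :=
  (ContinuousLinearMap.compL ℝ Space Space ℝ).comp innerL

@[simp] theorem tripleL_apply (x : Space) (A : Space →L[ℝ] Space) (y : Space) :
    tripleL x A y = inner ℝ x (A y) := rfl

/-- The operator `ξ ↦ b × A ξ`. -/
noncomputable def crossCompL : Space →L[ℝ] (Space →L[ℝ] Space) →L[ℝ] Space →L[ℝ] Space :=
  (ContinuousLinearMap.compL ℝ Space Space Space).comp crossL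

@[simp] theorem crossCompL_apply (x : Space) (A : Space →L[ℝ] Space) (y : Space) :
    crossCompL x A y = vecProd x (A y) := rfl

theorem IsSobolev.integrable_trilin {E F G : Type*} [NormedAddCommGroup E] [NormedSpace ℝ E]
    [NormedAddCommGroup F] [NormedSpace ℝ F] [NormedAddCommGroup G] [NormedSpace ℝ G]
    [CompleteSpace E] [CompleteSpace F] [CompleteSpace G] (T : E →L[ℝ] F →L[ℝ] G →L[ℝ] ℝ)
    {a : Plane → E} {b : Plane → F} {c : Plane → G} (ha : MemLp a 2 volume)
    (hb : MemLp b 4 volume) (hc : MemLp c 4 volume) :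
    Integrable (fun x => T (a x) (b x) (c x)) volume :=
  _root_.integrable_trilin T ha.1 hb.1 hc.1 (lintegral_trilin_lt_top₁ ha hb hc)

theorem integral_neg_add {f g : Plane → ℝ} (hf : Integrable f volume) (hg : Integrable g volume) :
    ∫ x, (-f x + g x) = -(∫ x, f x) + ∫ x, g x := by
  rw [← integral_neg]
  exact integral_add hf.neg hg

/-- The remainder in `IsSphereMap.integral_flux`. -/
noncomputable def fluxRemainder (a b : Plane → Space) (a' b' : Fin 2 → Plane → Space)
    (a'' : Fin 2 → Fin 2 → Plane → Space) (m k : Fin 2) (x : Plane) : ℝ :=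
  -inner ℝ (vecProd (a x) (a'' m k x))
      (transportOpDeriv a b (a' k) (b' k) x (transportDiff a b a' b' m x)) +
    inner ℝ (transportDiff a b a' b' m x)
      (inner ℝ (b x) (vecProd (transportOp a b x (a' m x)) (transportOp a b x (a' k x))) •
          transportOp a b x (a' k x)
        - inner ℝ (b x) (vecProd (b' m x) (b' k x)) • b' k x)

/-- `pairing_pointwise` along the maps: in the integrand of the energy identity, only one term
contains a derivative of `V`. -/
theorem IsSphereMap.flux_pointwise (ha : IsSphereMap a a' a'') (hb : IsSphereMap b b' b'')
    (hc : -1 < c) (hab : ∀ᵐ x, c ≤ inner ℝ (a x) (b x)) (m k : Fin 2) :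
    ∀ᵐ x, -inner ℝ (vecProd (a' m x) (a' k x) + vecProd (a x) (a'' m k x))
          (transportOpDeriv a b (a' k) (b' k) x (transportDiff a b a' b' m x) +
            transportOp a b x (transportDiffDeriv a b a' b' a'' b'' m k x))
        + inner ℝ (vecProd (b' m x) (b' k x) + vecProd (b x) (b'' m k x))
            (transportDiffDeriv a b a' b' a'' b'' m k x) =
      tripleL (transportDiffDeriv a b a' b' a'' b'' m k x)
          (crossCompL (b x) (transportOpDeriv a b (a' k) (b' k) x)) (a' m x)
        + fluxRemainder a b a' b' a'' m k x := by
  filter_upwards [ha.norm_eq, hb.norm_eq, hb.inner_self, hab, hb.inner_eq_zero m,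
    hb.inner_eq_zero k, ha.inner_eq_zero m, ha.inner_eq_zero k,
    ha.inner_transportDiffDeriv hb hc hab m k, ha.transportOpDeriv_left hb hc hab k,
    ha.symm m k, hb.symm m k] with x h1 h2 h3 h4 h5 h6 h7 h8 h9 h10 h11 h12
  have h13 := hc.trans_le h4
  have := pairing_pointwise (inner_bisector_self h1 h2 h13) h3 (mirror_bisector_left h1 h13) h5 h6
    h7 h8 (Vₖ := transportDiffDeriv a b a' b' a'' b'' m k x) (aₘₖ := a'' m k x) (bₘₖ := b'' m k x)
    (by rw [h11, h12]; rfl) h9 h10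
  refine this.trans ?_
  rw [tripleL_apply, crossCompL_apply, fluxRemainder, sub_eq_add_neg, add_assoc]
  rfl

/-- The divergence term left after integrating the quadratic part of the flux by parts. -/
noncomputable def fluxDiv (a b : Plane → Space) (a' b' : Fin 2 → Plane → Space)
    (a'' n'' : Fin 2 → Fin 2 → Plane → Space) (m k : Fin 2) (x : Plane) : ℝ :=
  inner ℝ (transportDiff a b a' b' m x)
    (vecProd (b' k x) (transportOpDeriv a b (a' k) (b' k) x (a' m x)) +
      vecProd (b x) (mirrorDeriv₂ (bisector (a x) (b x))
        (bisectorDeriv (a x) (b x) (a' k x) (b' k x))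
        (bisectorDeriv (a x) (b x) (a' k x) (b' k x)) (n'' k k x) (a' m x)) +
      vecProd (b x) (transportOpDeriv a b (a' k) (b' k) x (a'' k m x)))

/-- The pairing `⟨∂_t V_m, V_m⟩`, after the integrations by parts that remove all terms with
derivatives of `V_m`. -/
theorem IsSphereMap.integral_flux (ha : IsSphereMap a a' a'') (hb : IsSphereMap b b' b'')
    (hc : -1 < c) (hab : ∀ᵐ x, c ≤ inner ℝ (a x) (b x)) {n'' : Fin 2 → Fin 2 → Plane → Space}
    (hn : ∀ k, IsSobolev (fun x => bisectorDeriv (a x) (b x) (a' k x) (b' k x))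
          (fun j => n'' j k)) (m : Fin 2) :
    ∫ x, (inner ℝ (fluxMain a b a'' b'' x) (transportDiffDeriv a b a' b' a'' b'' m m x) +
        inner ℝ (fluxLower a b a' b' a'' b'' m x) (transportDiff a b a' b' m x)) =
      (∑ k, (-(∫ x, fluxDiv a b a' b' a'' n'' m k x) + ∫ x, fluxRemainder a b a' b' a'' m k x)) +
        ∫ x, inner ℝ (a' m x) (transportOpDeriv a b (schrodingerField a a'')
          (schrodingerField b b'') x (transportDiff a b a' b' m x)) := by
  have hV := ha.transportDiff_sobolev hb hc hab m
  have hS := ha.transportOp_bdd hb hc hab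
  have hΦ := hS.bilin_sobolev applyL hV
  have hSt := ha.memLp_transportOpDeriv_schrodingerField hb hc hab
  have hFa := ha.memLp_schrodingerField
  have hFb := hb.memLp_schrodingerField
  have hB := (ha.exists_bisector hb hc hab).1
  have hSk : ∀ k, IsSobolev (transportOpDeriv a b (a' k) (b' k)) _ := fun k =>
    hB.mirrorDeriv (hn k)
  have i1 : Integrable (fun x => inner ℝ (schrodingerField a a'' x)
      (transportOpDeriv a b (a' m) (b' m) x (transportDiff a b a' b' m x) +
        transportOp a b x (transportDiffDeriv a b a' b' a'' b'' m m x))) volume :=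
    integrable_bilin innerL hFa (hΦ.memLp_partial m)
  have i2 : Integrable (fun x => inner ℝ (schrodingerField b b'' x)
      (transportDiffDeriv a b a' b' a'' b'' m m x)) volume :=
    integrable_bilin innerL hFb (hV.memLp_partial m)
  have i3 : Integrable (fun x => inner ℝ (a' m x) (transportOpDeriv a b (schrodingerField a a'')
      (schrodingerField b b'') x (transportDiff a b a' b' m x))) volume :=
    integrable_trilin tripleL (ha.sobolev m).memLp.1 hSt.1 hV.memLp.1
      ((lintegral_trilin_le₂ (ha.sobolev m).memLp.1 hSt.1 hV.memLp.1).trans_lt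
        (ENNReal.mul_lt_top hSt.2 (ENNReal.mul_lt_top (ha.sobolev m).memLp_four.2 hV.memLp_four.2)))
  have e1 : ∀ x, inner ℝ (fluxMain a b a'' b'' x) (transportDiffDeriv a b a' b' a'' b'' m m x) +
        inner ℝ (fluxLower a b a' b' a'' b'' m x) (transportDiff a b a' b' m x) =
      (-inner ℝ (schrodingerField a a'' x)
        (transportOpDeriv a b (a' m) (b' m) x (transportDiff a b a' b' m x) +
          transportOp a b x (transportDiffDeriv a b a' b' a'' b'' m m x)) +
        inner ℝ (schrodingerField b b'' x) (transportDiffDeriv a b a' b' a'' b'' m m x)) +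
      inner ℝ (a' m x) (transportOpDeriv a b (schrodingerField a a'')
          (schrodingerField b b'') x (transportDiff a b a' b' m x)) := fun x => by
    simp only [fluxMain, fluxLower, inner_add_left, inner_neg_left, inner_add_right, transportOp,
      transportOpDeriv, inner_mirror_left, inner_mirrorDeriv_left]
    ring
  have j1 : ∀ k, Integrable (fun x => inner ℝ (vecProd (a' m x) (a' k x) +
      vecProd (a x) (a'' m k x)) (transportOpDeriv a b (a' k) (b' k) x
        (transportDiff a b a' b' m x) +
        transportOp a b x (transportDiffDeriv a b a' b' a'' b'' m k x))) volume := fun k =>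
    integrable_bilin innerL ((ha.sobolev_vecProd k).memLp_partial m) (hΦ.memLp_partial k)
  have j2 : ∀ k, Integrable (fun x => inner ℝ (vecProd (b' m x) (b' k x) +
      vecProd (b x) (b'' m k x)) (transportDiffDeriv a b a' b' a'' b'' m k x)) volume := fun k =>
    integrable_bilin innerL ((hb.sobolev_vecProd k).memLp_partial m) (hV.memLp_partial k)
  have hC := fun k => hb.bdd.bilin_sobolev crossCompL (hSk k)
  have j3 : ∀ k, Integrable (fun x => tripleL (transportDiffDeriv a b a' b' a'' b'' m k x)
      (crossCompL (b x) (transportOpDeriv a b (a' k) (b' k) x)) (a' m x)) volume := fun k =>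
    IsSobolev.integrable_trilin tripleL (hV.memLp_partial k) (hC k).memLp_four
      (ha.sobolev m).memLp_four
  have hp := ha.flux_pointwise hb hc hab m
  have j4 : ∀ k, Integrable (fluxRemainder a b a' b' a'' m k) volume := fun k => by
    refine (((j1 k).neg.add (j2 k)).sub (j3 k)).congr ?_
    filter_upwards [hp k] with x hx
    simp only [Pi.sub_apply, Pi.add_apply, Pi.neg_apply]
    rw [hx, add_sub_cancel_left]
  -- integrate by parts to move the derivative off `V`
  have hd : ∀ k, ∫ x, tripleL (transportDiffDeriv a b a' b' a'' b'' m k x)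
      (crossCompL (b x) (transportOpDeriv a b (a' k) (b' k) x)) (a' m x) =
      -∫ x, fluxDiv a b a' b' a'' n'' m k x := fun k => by
    rw [hV.integral_trilin tripleL (hC k) (ha.sobolev m) k]
    congr 2
    ext x
    simp only [tripleL_apply, crossCompL_apply, add_apply, fluxDiv, inner_add_right]
  have e3 := ha.integral_schrodingerField hΦ m
  simp only [applyL_apply] at e3
  simp only [e1]
  rw [integral_add (f := fun x => -_ + _) (i1.neg.add i2) i3, integral_neg_add i1 i2,
    e3, hb.integral_schrodingerField hV m, ← Finset.sum_neg_distrib,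
    ← Finset.sum_add_distrib]
  congr 1
  refine Finset.sum_congr rfl fun k _ => ?_
  have e2 := integral_congr_ae (hp k)
  rw [integral_neg_add (j1 k) (j2 k), integral_add (j3 k) (j4 k), hd k] at e2
  exact e2

theorem abs_le_of_enorm_integral {f : Plane → ℝ} {D : Plane → ℝ} {A : ℝ} (hA : 0 ≤ A)
    (h : ∀ᵐ x, |f x| ≤ A * D x) :
    ‖∫ x, f x‖ₑ ≤ ENNReal.ofReal A * ∫⁻ x, ENNReal.ofReal (D x) := by
  refine (enorm_integral_le_lintegral_enorm _).trans ?_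
  rw [← lintegral_const_mul' _ _ ENNReal.ofReal_ne_top]
  refine lintegral_mono_ae (h.mono fun x hx => ?_)
  rw [← ENNReal.ofReal_mul hA, ← ofReal_norm, Real.norm_eq_abs]
  exact ENNReal.ofReal_le_ofReal hx

/-- The pointwise bounds of the three terms of `IsSphereMap.integral_flux`. -/
theorem IsSphereMap.abs_flux_le (ha : IsSphereMap a a' a'') (hb : IsSphereMap b b' b'')
    (hc : -1 < c) (hab : ∀ᵐ x, c ≤ inner ℝ (a x) (b x)) {n'' : Fin 2 → Fin 2 → Plane → Space}
    (hn : ∀ j k, ∀ᵐ x, ‖n'' j k x‖ ≤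
      energyConst c * (hessSize a'' b'' x + gradSize a' b' x ^ 2)) (m k : Fin 2) :
    ∀ᵐ x, |fluxDiv a b a' b' a'' n'' m k x| ≤
        12 * energyConst c ^ 2 * energyDensity a b a' b' a'' b'' x ∧
      |fluxRemainder a b a' b' a'' m k x| ≤
        7 * energyConst c ^ 2 * energyDensity a b a' b' a'' b'' x ∧
      |inner ℝ (a' m x) (transportOpDeriv a b (schrodingerField a a'')
          (schrodingerField b b'') x (transportDiff a b a' b' m x))| ≤
        4 * energyConst c ^ 2 * energyDensity a b a' b' a'' b'' x := by
  obtain ⟨hK1, hK2, hK3, hK4⟩ := frameConst_bounds hc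
  obtain ⟨K, hKe⟩ : ∃ K, K = energyConst c := ⟨_, rfl⟩
  have hf1 := one_le_frameConst hc
  obtain ⟨f, hfe⟩ : ∃ f, f = frameConst c := ⟨_, rfl⟩
  rw [← hKe] at hn hK1 hK2 hK3 hK4 ⊢
  rw [← hfe] at hK2 hK3 hK4 hf1
  have hK0 : 0 ≤ K := zero_le_one.trans hK1
  have hKK : 1 ≤ K ^ 2 := one_le_pow₀ hK1
  filter_upwards [ha.norm_eq, hb.norm_eq, hab, ha.inner_eq_zero m, ha.inner_eq_zero k,
    ha.inner_transportDiff hb hc hab m, ha.symm m k, hn k k, ha.inner_add_inner k m]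
    with x h1 h2 h3 h4 h4' h5 h6 h7 h8
  have h9 := hc.trans_le h3
  -- `q`, `v`, `g`, `G` below are the sizes of `a - b`, of `V`, and of the first and second
  -- derivatives of the maps
  obtain ⟨l, hle⟩ : ∃ l, l = biScale (inner ℝ (a x) (b x)) := ⟨_, rfl⟩
  have hl : |l| ≤ f := by rw [hle, hfe]; exact abs_biScale_le hc h3
  have hl₁ := abs_biScaleDeriv_le h1 h2 (hle ▸ hl) (a' k x) (b' k x)
  have hn1 := norm_bisectorDeriv_le h1 h2 (hle ▸ hl) hf1 (a' k x) (b' k x)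
  have hnt := norm_bisectorDeriv_le h1 h2 (hle ▸ hl) hf1 (schrodingerField a a'' x)
    (schrodingerField b b'' x)
  have hFF := norm_schrodingerField_add_le (a'' := a'') (b'' := b'') h1 h2
  have hne : bisector (a x) (b x) = l • (a x + b x) := by rw [hle]; rfl
  have hnk : bisectorDeriv (a x) (b x) (a' k x) (b' k x) =
      biScaleDeriv (a x) (b x) (a' k x) (b' k x) • (a x + b x) + l • (a' k x + b' k x) := by
    rw [hle]; rfl
  have hnn := norm_bisector h1 h2 h9
  have hself := inner_bisector_self h1 h2 h9
  have hmk := h8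
  obtain ⟨q, hq⟩ : ∃ q, q = ‖a x - b x‖ := ⟨_, rfl⟩
  obtain ⟨v, hv⟩ : ∃ v, v = diffSize a b a' b' x := ⟨_, rfl⟩
  obtain ⟨g, hg⟩ : ∃ g, g = gradSize a' b' x := ⟨_, rfl⟩
  obtain ⟨G, hG⟩ : ∃ G, G = hessSize a'' b'' x + gradSize a' b' x ^ 2 := ⟨_, rfl⟩
  have hq0 : 0 ≤ q := hq ▸ norm_nonneg _
  have hv0 : 0 ≤ v := hv ▸ diffSize_nonneg x
  have hg0 : 0 ≤ g := hg ▸ gradSize_nonneg _ _ _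
  have hgG : g * g ≤ G := by
    rw [hG, hg]; nlinarith [hessSize_nonneg a'' b'' x]
  have hG0 : 0 ≤ G := (mul_nonneg hg0 hg0).trans hgG
  have hhG : hessSize a'' b'' x ≤ G := by
    rw [hG]; nlinarith [sq_nonneg (gradSize a' b' x)]
  have ga : ∀ k, ‖a' k x‖ ≤ g := fun k => by
    linarith [hg ▸ add_le_gradSize a' b' k x, norm_nonneg (b' k x)]
  have gb : ∀ k, ‖b' k x‖ ≤ g := fun k => by
    linarith [hg ▸ add_le_gradSize a' b' k x, norm_nonneg (a' k x)]
  have Ga : ∀ j k, ‖a'' j k x‖ ≤ G := fun j k => by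
    linarith [add_le_hessSize a'' b'' j k x, norm_nonneg (b'' j k x)]
  have hV : ∀ k, ‖transportDiff a b a' b' k x‖ ≤ v := fun k => hv ▸ norm_le_diffSize k x
  have hf0 : 0 ≤ f := zero_le_one.trans hf1
  have hna : ∀ k, inner ℝ (a x) (a' k x) = (0 : ℝ) →
      |inner ℝ (bisector (a x) (b x)) (a' k x)| ≤ f * (q * g) := fun k h => by
    rw [hne, hq]; exact abs_inner_bisector_le hl h (ga k)
  have hd : ‖a' k x - b' k x‖ ≤ v + 2 * (f * (q * g)) :=
    (norm_sub_le_mirror hnn (hna k h4')).trans (by gcongr; exact hV k)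
  have hl₁' : |biScaleDeriv (a x) (b x) (a' k x) (b' k x)| ≤ f ^ 3 * g := by
    refine hl₁.trans ?_
    have := hg ▸ add_le_gradSize a' b' k x
    gcongr
  have hl' : |l| ≤ f ^ 3 := hl.trans (le_self_pow₀ hf1 (by norm_num))
  have hn1' : ‖bisectorDeriv (a x) (b x) (a' k x) (b' k x)‖ ≤ K * g := by
    refine hn1.trans ?_
    have := hg ▸ add_le_gradSize a' b' k x
    gcongr
  have hnt' : ‖bisectorDeriv (a x) (b x) (schrodingerField a a'' x)
      (schrodingerField b b'' x)‖ ≤ K * G := hnt.trans (by gcongr; exact hFF.trans hhG)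
  have hbn : ‖vecProd (b x) (bisector (a x) (b x))‖ ≤ K * q := by
    rw [hne]; exact (norm_vecProd_bisector_le hl h2).trans (by rw [hq]; gcongr)
  have han : ‖vecProd (a x) (bisector (a x) (b x))‖ ≤ K * q := by
    rw [hne]; exact (norm_vecProd_bisector_le' hl h1).trans (by rw [hq]; gcongr)
  have hnV : |inner ℝ (bisector (a x) (b x)) (transportDiff a b a' b' m x)| ≤ K * (q * v) := by
    rw [hne]
    exact (abs_inner_bisector_le' hl h5 (hV m)).trans (by rw [hq]; gcongr)
  have hnam := (hna m h4).trans (b := f * (q * g)) (c := K * (q * g)) (by gcongr)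
  have hbn₁ : ‖vecProd (b' k x) (bisector (a x) (b x)) +
      vecProd (b x) (bisectorDeriv (a x) (b x) (a' k x) (b' k x))‖ ≤ K * (q * g + v) := by
    rw [hne, hnk]
    refine (norm_vecProd_bisector_deriv_le hl' hl₁' h2 (gb k) hd).trans ?_
    rw [← hq]
    calc _ ≤ f ^ 3 * (2 + 2 * f) * (q * g + v) := by
          have : 0 ≤ f ^ 3 * ((1 + 2 * f) * v) := by positivity
          linarith
      _ ≤ _ := by gcongr
  have hna₁ : |inner ℝ (bisectorDeriv (a x) (b x) (a' k x) (b' k x)) (a' m x) +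
      inner ℝ (bisector (a x) (b x)) (a'' k m x)| ≤ K * (q * G + g * v) := by
    rw [hne, hnk]
    refine (abs_inner_bisector_deriv_le hl' hl₁' h4 h8 (ga m) (Ga k m) hgG hd).trans ?_
    rw [← hq]
    calc _ ≤ f ^ 3 * (2 * (q * G) + (v * g + 2 * f * (q * G))) := by
          have : f * (q * (g * g)) ≤ f * (q * G) := by gcongr
          gcongr
          linarith
      _ ≤ f ^ 3 * (2 + 2 * f) * (q * G + g * v) := by
          have : 0 ≤ f ^ 3 * ((1 + 2 * f) * (g * v)) := by positivity
          linarith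
      _ ≤ _ := by gcongr
  have hD : energyDensity a b a' b' a'' b'' x = q * v * g * G + v ^ 2 * g ^ 2 := by
    rw [hq, hv, hg, hG]; rfl
  have hn2 : ‖n'' k k x‖ ≤ K * G := hG ▸ h7
  have hp1 : 0 ≤ q * v * g * G := by positivity
  have hp2 : 0 ≤ v ^ 2 * g ^ 2 := by positivity
  refine ⟨?_, ?_, ?_⟩
  · rw [hD]
    exact abs_inner_div_le hK0 hq0 hv0 hg0 hgG h2 hnam hbn hn1' hn2 hbn₁ hna₁ (ga m) (gb k)
      (Ga k m) (hV m)
  · rw [hD]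
    have b1 := abs_inner_vecProd_mirrorDeriv_le hK0 hq0 hv0 hg0 hG0 h1 hnV han hn1' (Ga m k)
      (hV m)
    have b2 : |inner ℝ (transportDiff a b a' b' m x)
        (inner ℝ (b x) (vecProd (transportOp a b x (a' m x)) (transportOp a b x (a' k x))) •
          transportOp a b x (a' k x) - inner ℝ (b x) (vecProd (b' m x) (b' k x)) • b' k x)| ≤
        3 * (v ^ 2 * g ^ 2) :=
      abs_inner_sub_smul_le h2 (hV m) ((norm_mirror hself _).trans_le (ga m))
        ((norm_mirror hself _).trans_le (ga k)) (gb m) (gb k) (hV m) (hV k)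
    refine (abs_add_le _ _).trans ?_
    rw [abs_neg]
    refine (add_le_add b1 b2).trans ?_
    have : 1 * (v ^ 2 * g ^ 2) ≤ K ^ 2 * (v ^ 2 * g ^ 2) := by gcongr
    have : 0 ≤ K ^ 2 * (q * v * g * G) := by positivity
    have : 0 ≤ K ^ 2 * (v ^ 2 * g ^ 2) := by positivity
    linarith
  · rw [hD]
    refine (abs_inner_mirrorDeriv_le hK0 hq0 hv0 hg0 hG0 hnam hnV hnt' (ga m) (hV m)).trans ?_
    gcongr
    linarith

/-- The energy estimate: the pairing `⟨∂_t V_m, V_m⟩` is bounded by an integral that is quadratic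
in `a - b` and `V`, and contains no derivatives of them. -/
theorem IsSphereMap.enorm_integral_flux_le (ha : IsSphereMap a a' a'') (hb : IsSphereMap b b' b'')
    (hc : -1 < c) (hab : ∀ᵐ x, c ≤ inner ℝ (a x) (b x)) (m : Fin 2) :
    ‖∫ x, (inner ℝ (fluxMain a b a'' b'' x) (transportDiffDeriv a b a' b' a'' b'' m m x) +
        inner ℝ (fluxLower a b a' b' a'' b'' m x) (transportDiff a b a' b' m x))‖ₑ ≤
      ENNReal.ofReal (42 * energyConst c ^ 2) *
        ∫⁻ x, ENNReal.ofReal (energyDensity a b a' b' a'' b'' x) := by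
  obtain ⟨-, n'', hn, hn''⟩ := ha.exists_bisector hb hc hab
  have hkey := ha.abs_flux_le hb hc hab hn'' m
  obtain ⟨K, hKe⟩ : ∃ K, K = energyConst c := ⟨_, rfl⟩
  rw [← hKe] at hkey ⊢
  rw [ha.integral_flux hb hc hab hn m]
  obtain ⟨I, hI⟩ : ∃ I, I = ∫⁻ x, ENNReal.ofReal (energyDensity a b a' b' a'' b'' x) := ⟨_, rfl⟩
  have b1 : ∀ k, ‖∫ x, fluxDiv a b a' b' a'' n'' m k x‖ₑ ≤ ENNReal.ofReal (12 * K ^ 2) * I :=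
    fun k => hI ▸ abs_le_of_enorm_integral (by positivity) ((hkey k).mono fun x hx => hx.1)
  have b2 : ∀ k, ‖∫ x, fluxRemainder a b a' b' a'' m k x‖ₑ ≤ ENNReal.ofReal (7 * K ^ 2) * I :=
    fun k => hI ▸ abs_le_of_enorm_integral (by positivity) ((hkey k).mono fun x hx => hx.2.1)
  have b3 : ‖∫ x, inner ℝ (a' m x) (transportOpDeriv a b (schrodingerField a a'')
          (schrodingerField b b'') x (transportDiff a b a' b' m x))‖ₑ ≤
      ENNReal.ofReal (4 * K ^ 2) * I :=
    hI ▸ abs_le_of_enorm_integral (by positivity) ((hkey 0).mono fun x hx => hx.2.2)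
  rw [← hI]
  refine (enorm_add_le _ _).trans ((add_le_add (enorm_sum_le _ _) b3).trans ?_)
  rw [Fin.sum_univ_two]
  refine (add_le_add (add_le_add ((enorm_add_le _ _).trans (add_le_add
    ((enorm_neg _).trans_le (b1 0)) (b2 0))) ((enorm_add_le _ _).trans (add_le_add
    ((enorm_neg _).trans_le (b1 1)) (b2 1)))) le_rfl).trans (le_of_eq ?_)
  -- `42 = 2 (12 + 7) + 4`, because `k` takes two values
  have e : ENNReal.ofReal (42 * K ^ 2) =
      (ENNReal.ofReal (12 * K ^ 2) + ENNReal.ofReal (7 * K ^ 2)) +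
      (ENNReal.ofReal (12 * K ^ 2) + ENNReal.ofReal (7 * K ^ 2)) + ENNReal.ofReal (4 * K ^ 2) := by
    have h12 : 0 ≤ 12 * K ^ 2 := by positivity
    have h7 : 0 ≤ 7 * K ^ 2 := by positivity
    have h4 : 0 ≤ 4 * K ^ 2 := by positivity
    rw [← ENNReal.ofReal_add h12 h7, ← ENNReal.ofReal_add (add_nonneg h12 h7) (add_nonneg h12 h7),
      ← ENNReal.ofReal_add (add_nonneg (add_nonneg h12 h7) (add_nonneg h12 h7)) h4]
    congr 1
    ring
  rw [e]
  ring

end EnergyEstimate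

/-! ### Hölder estimates with explicit dependence on the exponent -/

section Holder

variable {α : Type*} {m : MeasurableSpace α} {μ : Measure α}

theorem ENNReal.pow_rpow_eq (x : ℝ≥0∞) (n : ℕ) (y : ℝ) : (x ^ n) ^ y = x ^ (n * y) := by
  rw [← ENNReal.rpow_natCast, ← ENNReal.rpow_mul]

/-- Hölder's inequality in which `v²` is split into powers of `v²` and `v⁴`, so that `∫ v²`
appears with the exponent `1 - 1 / p` and `g` in `L^{4p}`. -/
theorem lintegral_sq_mul_sq_le {v g : α → ℝ≥0∞} (hv : AEMeasurable v μ) (hg : AEMeasurable g μ)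
    {p : ℝ} (hp : 2 < p) :
    ∫⁻ x, v x ^ 2 * g x ^ 2 ∂μ ≤ (∫⁻ x, v x ^ 2 ∂μ) ^ (1 - 1 / p) *
      (∫⁻ x, v x ^ 4 ∂μ) ^ (1 / (2 * p)) * (∫⁻ x, g x ^ (4 * p) ∂μ) ^ (1 / (2 * p)) := by
  have hp0 : 0 < p := by linarith
  have h2p : 0 ≤ 1 / (2 * p) := by positivity
  have h1p : 1 / p ≤ 1 := by rw [div_le_one hp0]; linarith
  have h := ENNReal.lintegral_prod_norm_pow_le (μ := μ) Finset.univ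
    (f := ![fun x => v x ^ 2, fun x => v x ^ 4, fun x => g x ^ (4 * p)])
    (fun i _ => by
      fin_cases i
      exacts [hv.pow_const 2, hv.pow_const 4, hg.pow_const _])
    (p := ![1 - 1 / p, 1 / (2 * p), 1 / (2 * p)])
    (by simp [Fin.sum_univ_three]; field_simp; ring)
    (fun i _ => by
      fin_cases i
      exacts [sub_nonneg.2 h1p, h2p, h2p])
  simp only [Fin.prod_univ_three, Matrix.cons_val_zero, Matrix.cons_val_one, Matrix.cons_val_two,
    Matrix.tail_cons, Matrix.head_cons] at h
  refine le_trans (le_of_eq (lintegral_congr fun x => ?_)) h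
  rw [ENNReal.pow_rpow_eq, ENNReal.pow_rpow_eq, ← ENNReal.rpow_mul,
    ← ENNReal.rpow_add_of_nonneg _ _ (by have := sub_nonneg.2 h1p; positivity) (by positivity),
    ← ENNReal.rpow_natCast, ← ENNReal.rpow_natCast]
  congr 2
  · push_cast; field_simp; ring
  · push_cast; field_simp; ring

/-- Hölder's inequality in which `v` is split into powers of `v²` and `v⁴`, so that `∫ v²`
appears with the exponent `1 / 2 - 1 / p`; the missing `1 / 2` comes from the norm of `q` in
`L^{4p}`. -/
theorem lintegral_mul_four_le {q v g h : α → ℝ≥0∞} (hq : AEMeasurable q μ) (hv : AEMeasurable v μ)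
    (hg : AEMeasurable g μ) (hh : AEMeasurable h μ) {p : ℝ} (hp : 2 < p) :
    ∫⁻ x, q x * v x * g x * h x ∂μ ≤ (∫⁻ x, q x ^ (4 * p) ∂μ) ^ (1 / (4 * p)) *
      (∫⁻ x, v x ^ 2 ∂μ) ^ (1 / 2 - 1 / p) * (∫⁻ x, v x ^ 4 ∂μ) ^ (1 / (2 * p)) *
      (∫⁻ x, g x ^ (4 * p) ∂μ) ^ (1 / (4 * p)) * (∫⁻ x, h x ^ 2 ∂μ) ^ (1 / 2 : ℝ) := by
  have hp0 : 0 < p := by linarith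
  have h2p : 0 ≤ 1 / (2 * p) := by positivity
  have h4p : 0 ≤ 1 / (4 * p) := by positivity
  have h1p : 1 / p ≤ 1 / 2 := one_div_le_one_div_of_le two_pos hp.le
  have hH := ENNReal.lintegral_prod_norm_pow_le (μ := μ) Finset.univ
    (f := ![fun x => q x ^ (4 * p), fun x => v x ^ 2, fun x => v x ^ 4, fun x => g x ^ (4 * p),
      fun x => h x ^ 2])
    (fun i _ => by
      fin_cases i
      exacts [hq.pow_const _, hv.pow_const 2, hv.pow_const 4, hg.pow_const _, hh.pow_const 2])
    (p := ![1 / (4 * p), 1 / 2 - 1 / p, 1 / (2 * p), 1 / (4 * p), 1 / 2])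
    (by simp [Fin.sum_univ_five]; field_simp; ring)
    (fun i _ => by
      fin_cases i
      exacts [h4p, sub_nonneg.2 h1p, h2p, h4p, one_half_pos.le])
  simp only [Fin.prod_univ_five, Matrix.cons_val_zero, Matrix.cons_val_one, Matrix.cons_val_two,
    Matrix.tail_cons, Matrix.head_cons, Matrix.cons_val] at hH
  refine le_trans (le_of_eq (lintegral_congr fun x => ?_)) hH
  have e1 : (v x ^ 2) ^ (1 / 2 - 1 / p) * (v x ^ 4) ^ (1 / (2 * p)) = v x := by
    rw [ENNReal.pow_rpow_eq, ENNReal.pow_rpow_eq, ← ENNReal.rpow_add_of_nonneg _ _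
      (by have := sub_nonneg.2 h1p; positivity) (by positivity)]
    conv_rhs => rw [← ENNReal.rpow_one (v x)]
    congr 1
    push_cast; field_simp; ring
  have e2 : ∀ y : ℝ≥0∞, (y ^ (4 * p)) ^ (1 / (4 * p)) = y := fun y => by
    rw [← ENNReal.rpow_mul, mul_one_div_cancel (by positivity), ENNReal.rpow_one]
  have e3 : (h x ^ 2) ^ (1 / 2 : ℝ) = h x := by
    rw [ENNReal.pow_rpow_eq]; norm_num
  rw [e2, e2, e3]
  conv_lhs => rw [← e1]
  ring

theorem ENNReal.rpow_le_one_add (x : ℝ≥0∞) {s : ℝ} (h0 : 0 ≤ s) (h1 : s ≤ 1) : x ^ s ≤ 1 + x := by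
  rcases le_total x 1 with h | h
  · exact (ENNReal.rpow_le_one h h0).trans le_self_add
  · exact ((ENNReal.rpow_le_rpow_of_exponent_le h h1).trans_eq (ENNReal.rpow_one x)).trans
      le_add_self

theorem eLpNorm_rpow_eq {E : Type*} [NormedAddCommGroup E] (f : α → E) {q : ℝ} (hq : 0 < q) (s : ℝ) :
    (∫⁻ x, ‖f x‖ₑ ^ q ∂μ) ^ (s / q) = eLpNorm f (ENNReal.ofReal q) μ ^ s := by
  rw [eLpNorm_eq_lintegral_rpow_enorm_toReal (by simpa using hq) ENNReal.ofReal_ne_top,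
    ENNReal.toReal_ofReal hq.le, ← ENNReal.rpow_mul]
  congr 1
  ring

/-- Interpolation of `L⁴` between `L²` and `L⁶`. -/
theorem eLpNorm_four_pow_le {E : Type*} [NormedAddCommGroup E] {f : α → E}
    (hf : AEStronglyMeasurable f μ) :
    eLpNorm f 4 μ ^ 4 ≤ eLpNorm f 2 μ * eLpNorm f 6 μ ^ 3 := by
  have h := ENNReal.lintegral_mul_le_Lp_mul_Lq μ Real.HolderConjugate.two_two
    (f := fun x => ‖f x‖ₑ) (g := fun x => ‖f x‖ₑ ^ 3) hf.enorm (hf.enorm.pow_const 3)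
  have e4 := eLpNorm_rpow_eq (μ := μ) f (q := 4) (by norm_num) 4
  have e2 := eLpNorm_rpow_eq (μ := μ) f (q := 2) (by norm_num) 1
  have e6 := eLpNorm_rpow_eq (μ := μ) f (q := 6) (by norm_num) 3
  norm_num at e2 e4 e6
  rw [← e4, ← e2, ← e6]
  refine le_trans (le_of_eq ?_) (h.trans_eq ?_)
  · refine lintegral_congr fun x => ?_
    simp only [Pi.mul_apply]
    ring
  · congr 1
    · congr 1
      refine lintegral_congr fun x => ?_
      rw [← ENNReal.rpow_natCast]; norm_num
    · congr 1
      refine lintegral_congr fun x => ?_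
      rw [ENNReal.pow_rpow_eq, ← ENNReal.rpow_natCast]; norm_num

end Holder

section EnergyBound

/-- The quantity `‖a - b‖²_{L²} + ∑_k ‖V_k‖²_{L²}` that the energy estimate controls. -/
noncomputable def energyNorm (a b : Plane → Space) (a' b' : Fin 2 → Plane → Space) : ℝ≥0∞ :=
  eLpNorm (fun x => a x - b x) 2 volume ^ 2 +
    ∑ k, eLpNorm (transportDiff a b a' b' k) 2 volume ^ 2

variable {a b : Plane → Space} {a' b' : Fin 2 → Plane → Space}
  {a'' b'' : Fin 2 → Fin 2 → Plane → Space} {c : ℝ} {M : ℝ≥0∞}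

theorem aestronglyMeasurable_gradSize (ha : ∀ k, AEStronglyMeasurable (a' k) volume)
    (hb : ∀ k, AEStronglyMeasurable (b' k) volume) :
    AEStronglyMeasurable (gradSize a' b') volume :=
  Finset.aestronglyMeasurable_fun_sum _ fun k _ => (ha k).norm.add (hb k).norm

theorem eLpNorm_gradSize_le (ha : ∀ k, AEStronglyMeasurable (a' k) volume)
    (hb : ∀ k, AEStronglyMeasurable (b' k) volume) {s : ℝ≥0∞} (hs : 1 ≤ s) {N : ℝ≥0∞}
    (hN : ∀ k, eLpNorm (a' k) s volume ≤ N) (hN' : ∀ k, eLpNorm (b' k) s volume ≤ N) :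
    eLpNorm (gradSize a' b') s volume ≤ 4 * N := by
  have e : gradSize a' b' = ∑ k, ((fun x => ‖a' k x‖) + fun x => ‖b' k x‖) := by
    ext x; simp [gradSize]
  rw [e]
  refine (eLpNorm_sum_le (fun k _ => (ha k).norm.add (hb k).norm) hs).trans ?_
  calc _ ≤ ∑ k : Fin 2, (N + N) := Finset.sum_le_sum fun k _ =>
        (eLpNorm_add_le (ha k).norm (hb k).norm hs).trans (add_le_add
          ((eLpNorm_norm _).trans_le (hN k)) ((eLpNorm_norm _).trans_le (hN' k)))
    _ = 4 * N := by simp; ring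

theorem eLpNorm_hessSize_le (ha : ∀ j k, AEStronglyMeasurable (a'' j k) volume)
    (hb : ∀ j k, AEStronglyMeasurable (b'' j k) volume)
    (hN : ∀ j k, eLpNorm (a'' j k) 2 volume ≤ M) (hN' : ∀ j k, eLpNorm (b'' j k) 2 volume ≤ M) :
    eLpNorm (hessSize a'' b'') 2 volume ≤ 8 * M := by
  have e : hessSize a'' b'' = ∑ j, gradSize (a'' j) (b'' j) := by
    ext x; simp [gradSize, hessSize]
  rw [e]
  refine (eLpNorm_sum_le (fun j _ => aestronglyMeasurable_gradSize (ha j) (hb j))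
    one_le_two).trans ?_
  calc _ ≤ ∑ j : Fin 2, 4 * M := Finset.sum_le_sum fun j _ =>
        eLpNorm_gradSize_le (ha j) (hb j) one_le_two (hN j) (hN' j)
    _ = 8 * M := by simp; ring

/-- The absorption step for an interpolated term. -/
theorem le_of_pow_four_le {Z B Y : ℝ≥0∞} (h : Z ^ 4 ≤ B * Y ^ 3) : Z ≤ 8 * B + Y / 2 := by
  have h2 : (2 : ℝ≥0∞) ≠ 0 := two_ne_zero
  rcases le_total Y (16 * B) with hY | hY
  · have : Z ^ 4 ≤ (8 * B) ^ 4 := by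
      calc Z ^ 4 ≤ B * (16 * B) ^ 3 := h.trans (by gcongr)
        _ = (8 * B) ^ 4 := by ring
    exact ((ENNReal.pow_le_pow_left_iff four_ne_zero).1 this).trans le_self_add
  · have e : Y = 2 * (Y / 2) := by rw [ENNReal.mul_div_cancel h2 (by simp)]
    have hB : 8 * B ≤ Y / 2 := by
      rw [e, show (16 : ℝ≥0∞) * B = 2 * (8 * B) by ring,
        ENNReal.mul_le_mul_iff_right h2 (by simp)] at hY
      exact hY
    have : Z ^ 4 ≤ (Y / 2) ^ 4 := by
      calc Z ^ 4 ≤ B * Y ^ 3 := h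
        _ = 8 * B * (Y / 2) ^ 3 := by conv_lhs => rw [e]
                                      ring
        _ ≤ (Y / 2) * (Y / 2) ^ 3 := by gcongr
        _ = _ := by ring
    exact ((ENNReal.pow_le_pow_left_iff four_ne_zero).1 this).trans le_add_self

/-- The constant of the embedding of `H¹` in `L^{4p}`. -/
theorem sobolev_const_four_mul (p : ℝ) :
    ENNReal.ofReal (4 * √(4 * p)) = 8 * ENNReal.ofReal (√p) := by
  rw [Real.sqrt_mul (by norm_num), show √(4 : ℝ) = 2 by
    rw [show (4 : ℝ) = 2 ^ 2 by norm_num]; exact Real.sqrt_sq (by norm_num),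
    ← mul_assoc, ENNReal.ofReal_mul (by norm_num)]
  norm_num

/-- The gradient in `L^{4p}`, from the Sobolev inequality. -/
theorem IsSphereMap.eLpNorm_partial_le (ha : IsSphereMap a a' a'')
    (hN : ∀ k, eLpNorm (a' k) 2 volume ≤ M) (hN' : ∀ j k, eLpNorm (a'' j k) 2 volume ≤ M)
    {p : ℝ} (hp : 1 ≤ p) (k : Fin 2) :
    eLpNorm (a' k) (ENNReal.ofReal (4 * p)) volume ≤ ENNReal.ofReal (√p) * (24 * M) := by
  refine ((ha.sobolev k).eLpNorm_le (by linarith)).trans ?_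
  rw [sobolev_const_four_mul]
  calc _ ≤ 8 * ENNReal.ofReal (√p) * (M + ∑ _j : Fin 2, M) := by
        gcongr with j
        · exact hN k
        · exact hN' j k
    _ = _ := by simp; ring

/-- The trivial bound for `V`, from `‖S‖ = 1`. -/
theorem IsSphereMap.diffSize_le (ha : IsSphereMap a a' a'') (hb : IsSphereMap b b' b'')
    (hc : -1 < c) (hab : ∀ᵐ x, c ≤ inner ℝ (a x) (b x)) :
    ∀ᵐ x, diffSize a b a' b' x ≤ gradSize a' b' x := by
  filter_upwards [ha.norm_eq, hb.norm_eq, hab] with x h1 h2 h3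
  refine Finset.sum_le_sum fun k _ => (norm_sub_le _ _).trans (add_le_add (le_of_eq ?_) le_rfl)
  exact norm_mirror (inner_bisector_self h1 h2 (hc.trans_le h3)) _

theorem rpow_half_sq (x : ℝ≥0∞) : (x ^ (1 / 2 : ℝ)) ^ 2 = x := by
  rw [← ENNReal.rpow_natCast, ← ENNReal.rpow_mul]; norm_num

theorem le_rpow_half_of_sq_le {x y : ℝ≥0∞} (h : x ^ 2 ≤ y) : x ≤ y ^ (1 / 2 : ℝ) := by
  rw [← ENNReal.pow_le_pow_left_iff two_ne_zero, rpow_half_sq]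
  exact h

theorem eLpNorm_sub_le_energyNorm :
    eLpNorm (fun x => a x - b x) 2 volume ≤ energyNorm a b a' b' ^ (1 / 2 : ℝ) :=
  le_rpow_half_of_sq_le le_self_add

theorem eLpNorm_transportDiff_le_energyNorm (k : Fin 2) :
    eLpNorm (transportDiff a b a' b' k) 2 volume ≤ energyNorm a b a' b' ^ (1 / 2 : ℝ) :=
  le_rpow_half_of_sq_le ((Finset.single_le_sum
    (f := fun k => eLpNorm (transportDiff a b a' b' k) 2 volume ^ 2) (fun _ _ => zero_le)
    (Finset.mem_univ k)).trans le_add_self)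

/-- The `H¹` norm of `a - b` is controlled by the `L²` norms of `a - b` and of the `V_k`. -/
theorem IsSphereMap.sum_eLpNorm_sub_le (ha : IsSphereMap a a' a'') (hb : IsSphereMap b b' b'')
    (hc : -1 < c) (hab : ∀ᵐ x, c ≤ inner ℝ (a x) (b x))
    (ha1 : ∀ k, eLpNorm (a' k) 2 volume ≤ M) (hb1 : ∀ k, eLpNorm (b' k) 2 volume ≤ M)
    (ha2 : ∀ j k, eLpNorm (a'' j k) 2 volume ≤ M) (hb2 : ∀ j k, eLpNorm (b'' j k) 2 volume ≤ M)
    (hq : MemLp (fun x => a x - b x) 2 volume) :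
    ∑ k, eLpNorm (fun x => a' k x - b' k x) 2 volume ≤
      (5 + 16000 * (384 * ENNReal.ofReal (frameConst c) * M) ^ 4) *
        energyNorm a b a' b' ^ (1 / 2 : ℝ) := by
  obtain ⟨D, hD⟩ : ∃ D, D = energyNorm a b a' b' ^ (1 / 2 : ℝ) := ⟨_, rfl⟩
  obtain ⟨X, hX⟩ : ∃ X, X = ∑ k, eLpNorm (fun x => a' k x - b' k x) 2 volume := ⟨_, rfl⟩
  obtain ⟨A, hA⟩ : ∃ A, A = eLpNorm (fun x => a x - b x) 2 volume := ⟨_, rfl⟩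
  obtain ⟨κ, hκ⟩ : ∃ κ, κ = 384 * ENNReal.ofReal (frameConst c) * M := ⟨_, rfl⟩
  have hs : IsSobolev (fun x => a x - b x) (fun k x => a' k x - b' k x) :=
    ⟨hq, fun k => (ha.sobolev k).memLp.sub (hb.sobolev k).memLp,
      fun k => (ha.weak k).sub (hb.weak k)⟩
  have hm := fun k => (ha.sobolev k).memLp.1
  have hm' := fun k => (hb.sobolev k).memLp.1
  have hg4 : eLpNorm (gradSize a' b') 4 volume ≤ 96 * M := by
    have h4 : ENNReal.ofReal (4 * 1) = 4 := by norm_num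
    have e1 := fun k => ha.eLpNorm_partial_le ha1 ha2 le_rfl k
    have e2 := fun k => hb.eLpNorm_partial_le hb1 hb2 le_rfl k
    rw [h4, Real.sqrt_one, ENNReal.ofReal_one, one_mul] at e1 e2
    refine (eLpNorm_gradSize_le hm hm' (by norm_num) e1 e2).trans_eq (by ring)
  obtain ⟨Q, hQ⟩ : ∃ Q, Q = eLpNorm (fun x => a x - b x) 4 volume := ⟨_, rfl⟩
  -- `a' - b' = V + (a' - S a')`, and `a' - S a' = 2 ⟪n, a'⟫ n` is of the order `|a - b| |a'|`,
  -- because `a'` is orthogonal to `a`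
  have hk : ∀ k, eLpNorm (fun x => a' k x - b' k x) 2 volume ≤
      D + 2 * ENNReal.ofReal (frameConst c) * (Q * (96 * M)) := fun k => by
    have h1 : eLpNorm (fun x => a' k x - b' k x) 2 volume ≤
        eLpNorm ((fun x => ‖transportDiff a b a' b' k x‖) +
          (2 * frameConst c) • fun x => ‖a x - b x‖ * ‖gradSize a' b' x‖) 2 volume := by
      refine eLpNorm_mono_ae_real ?_
      filter_upwards [ha.norm_eq, hb.norm_eq, hab, ha.inner_eq_zero k] with x h1 h2 h3 h4
      have h6 : ‖a' k x‖ ≤ gradSize a' b' x := by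
        linarith [add_le_gradSize a' b' k x, norm_nonneg (b' k x)]
      refine (norm_sub_le_mirror (norm_bisector h1 h2 (hc.trans_le h3))
        (abs_inner_bisector_le (abs_biScale_le hc h3) h4 h6)).trans (le_of_eq ?_)
      simp only [Pi.add_apply, Pi.smul_apply, smul_eq_mul, Real.norm_eq_abs,
        abs_of_nonneg (gradSize_nonneg a' b' x), mul_assoc]
      rfl
    have hgm := aestronglyMeasurable_gradSize hm hm'
    refine h1.trans ((eLpNorm_add_le (ha.transportDiff_sobolev hb hc hab k).memLp.1.norm
      ((hq.1.norm.mul hgm.norm).const_smul _) one_le_two).trans ?_)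
    rw [eLpNorm_norm, eLpNorm_const_smul, Real.enorm_eq_ofReal
      (by have := one_le_frameConst hc; linarith), ENNReal.ofReal_mul zero_le_two,
      ENNReal.ofReal_ofNat, hD, hQ]
    gcongr
    · exact eLpNorm_transportDiff_le_energyNorm k
    · exact (eLpNorm_norm_mul_norm_le (p := 4) (q := 4) hq.1 hgm).trans (by gcongr)
  have hX1 : X ≤ 2 * D + κ * Q := by
    rw [hX, Fin.sum_univ_two]
    refine (add_le_add (hk 0) (hk 1)).trans (le_of_eq ?_)
    rw [hκ]; ring
  have h6 : eLpNorm (fun x => a x - b x) 6 volume ≤ 10 * (A + X) := by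
    have := hs.eLpNorm_le (p := 6) (by norm_num)
    rw [ENNReal.ofReal_ofNat] at this
    rw [hA, hX]
    refine this.trans ?_
    gcongr
    rw [ENNReal.ofReal_le_ofNat]
    have : √(6 : ℝ) ≤ 2.5 := by rw [Real.sqrt_le_left (by norm_num)]; norm_num
    linarith
  -- interpolate `q` in `L⁴` between `L²` and `L⁶`; half of `X` is then absorbed on the left, which
  -- is allowed because `X` is finite
  have hZ : (κ * Q) ^ 4 ≤ (1000 * κ ^ 4 * A) * (A + X) ^ 3 := by
    rw [mul_pow]
    calc κ ^ 4 * Q ^ 4 ≤ κ ^ 4 * (A * (10 * (A + X)) ^ 3) := by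
          rw [hQ]
          gcongr
          exact (eLpNorm_four_pow_le hq.1).trans (by rw [← hA]; gcongr)
      _ = _ := by ring
  have hZ' := le_of_pow_four_le hZ
  have hXt : X ≠ ⊤ := by
    rw [hX]
    exact (ENNReal.sum_lt_top.2 fun k _ => (hs.memLp_partial k).2).ne
  have hAD : A ≤ D := by rw [hA, hD]; exact eLpNorm_sub_le_energyNorm
  have h2 : X / 2 + X / 2 ≤ (2 * D + 8 * (1000 * κ ^ 4 * A) + A / 2) + X / 2 := by
    rw [ENNReal.add_halves]
    calc X ≤ 2 * D + κ * Q := hX1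
      _ ≤ 2 * D + (8 * (1000 * κ ^ 4 * A) + (A + X) / 2) := by gcongr
      _ = _ := by rw [ENNReal.add_div]; ring
  have h3 := (ENNReal.add_le_add_iff_right (ENNReal.div_ne_top hXt two_ne_zero)).1 h2
  rw [← hX, ← hD, ← hκ]
  calc X = 2 * (X / 2) := by rw [ENNReal.mul_div_cancel two_ne_zero (by simp)]
    _ ≤ 2 * (2 * D + 8 * (1000 * κ ^ 4 * A) + A / 2) := by gcongr
    _ = 4 * D + 16000 * κ ^ 4 * A + 2 * (A / 2) := by ring
    _ = 4 * D + 16000 * κ ^ 4 * A + A := by rw [ENNReal.mul_div_cancel two_ne_zero (by simp)]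
    _ ≤ 4 * D + 16000 * κ ^ 4 * D + D := by gcongr
    _ = _ := by ring

end EnergyBound

section EnergyBound

variable {a b : Plane → Space} {a' b' : Fin 2 → Plane → Space}
  {a'' b'' : Fin 2 → Fin 2 → Plane → Space} {c : ℝ} {M : ℝ≥0∞}

theorem rpow_le_of_le_two_mul {x y : ℝ≥0∞} {s : ℝ} (h : x ≤ 2 * y) (h0 : 0 ≤ s) (h1 : s ≤ 1) :
    x ^ s ≤ 2 * y ^ s := by
  calc x ^ s ≤ (2 * y) ^ s := by gcongr
    _ = 2 ^ s * y ^ s := ENNReal.mul_rpow_of_nonneg _ _ h0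
    _ ≤ 2 * y ^ s := by
      gcongr
      exact (ENNReal.rpow_le_rpow_of_exponent_le (by norm_num) h1).trans_eq (ENNReal.rpow_one 2)

theorem add_sq_le_two_mul (x y : ℝ≥0∞) : (x + y) ^ 2 ≤ 2 * (x ^ 2 + y ^ 2) := by
  have := ENNReal.rpow_add_le_mul_rpow_add_rpow x y one_le_two
  norm_num at this
  exact this

theorem lintegral_diffSize_sq_le (h : ∀ k, AEStronglyMeasurable (transportDiff a b a' b' k) volume) :
    ∫⁻ x, ‖diffSize a b a' b' x‖ₑ ^ 2 ≤ 2 * energyNorm a b a' b' := by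
  calc _ ≤ ∫⁻ x, 2 * (‖transportDiff a b a' b' 0 x‖ₑ ^ 2 + ‖transportDiff a b a' b' 1 x‖ₑ ^ 2) := by
        refine lintegral_mono fun x => ?_
        rw [diffSize, Fin.sum_univ_two]
        refine le_trans ?_ (add_sq_le_two_mul _ _)
        gcongr
        exact (enorm_add_le _ _).trans (by rw [enorm_norm, enorm_norm])
    _ = 2 * ∑ k, eLpNorm (transportDiff a b a' b' k) 2 volume ^ 2 := by
        rw [lintegral_const_mul' _ _ (by simp), lintegral_add_left' ((h 0).enorm.pow_const 2),
          Fin.sum_univ_two, sq_eLpNorm_two, sq_eLpNorm_two]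
    _ ≤ _ := by gcongr; exact le_add_self

theorem ofReal_energyDensity (x : Plane) :
    ENNReal.ofReal (energyDensity a b a' b' a'' b'' x) =
      ‖a x - b x‖ₑ * ‖diffSize a b a' b' x‖ₑ * ‖gradSize a' b' x‖ₑ *
        ‖hessSize a'' b'' x + gradSize a' b' x ^ 2‖ₑ +
      ‖diffSize a b a' b' x‖ₑ ^ 2 * ‖gradSize a' b' x‖ₑ ^ 2 := by
  have h1 := diffSize_nonneg (a := a) (b := b) (a' := a') (b' := b') x
  have h2 := gradSize_nonneg a' b' x
  have h3 := hessSize_nonneg a'' b'' x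
  rw [energyDensity, ENNReal.ofReal_add (by positivity) (by positivity),
    ENNReal.ofReal_mul (by positivity), ENNReal.ofReal_mul (by positivity),
    ENNReal.ofReal_mul (by positivity), ENNReal.ofReal_mul (by positivity),
    ENNReal.ofReal_pow h1, ENNReal.ofReal_pow h2, ofReal_norm, Real.enorm_eq_ofReal h1,
    Real.enorm_eq_ofReal h2, Real.enorm_eq_ofReal (by positivity)]

/-- The energy density integrates to a multiple of `p E^{1 - 1/p}`, where `E` is `energyNorm`. The
factor `p` is the square of the constant in the embedding of `H¹` in `L^{4p}`. -/
theorem IsSphereMap.exists_energy_bound (hc : -1 < c) (hM : M ≠ ⊤) : ∃ C : ℝ≥0,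
    ∀ (a b : Plane → Space) (a' b' : Fin 2 → Plane → Space)
      (a'' b'' : Fin 2 → Fin 2 → Plane → Space),
      IsSphereMap a a' a'' → IsSphereMap b b' b'' → (∀ᵐ x, c ≤ inner ℝ (a x) (b x)) →
      (∀ k, eLpNorm (a' k) 2 volume ≤ M) → (∀ k, eLpNorm (b' k) 2 volume ≤ M) →
      (∀ j k, eLpNorm (a'' j k) 2 volume ≤ M) → (∀ j k, eLpNorm (b'' j k) 2 volume ≤ M) →
      MemLp (fun x => a x - b x) 2 volume → ∀ p : ℝ, 2 < p →
      ∫⁻ x, ENNReal.ofReal (energyDensity a b a' b' a'' b'' x) ≤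
        C * ENNReal.ofReal p * energyNorm a b a' b' ^ (1 - 1 / p) := by
  obtain ⟨κ, hκ⟩ : ∃ κ, κ = 5 + 16000 * (384 * ENNReal.ofReal (frameConst c) * M) ^ 4 := ⟨_, rfl⟩
  have hκt : κ ≠ ⊤ := by
    rw [hκ]
    exact ENNReal.add_ne_top.2 ⟨by simp, ENNReal.mul_ne_top (by simp) (ENNReal.pow_ne_top
      (ENNReal.mul_ne_top (by simp [ENNReal.mul_eq_top]) hM))⟩
  obtain ⟨C, hC⟩ : ∃ C, C = 8 * (1 + κ) * 2 * (1 + 96 * M) * (96 * M) *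
      (8 * M + (96 * M) * (96 * M)) + 2 * (1 + 96 * M) * (96 * M) ^ 2 := ⟨_, rfl⟩
  have hCt : C ≠ ⊤ := by
    have h1 : 96 * M ≠ ⊤ := ENNReal.mul_ne_top (by simp) hM
    have h2 : 1 + 96 * M ≠ ⊤ := ENNReal.add_ne_top.2 ⟨by simp, h1⟩
    rw [hC]
    refine ENNReal.add_ne_top.2 ⟨ENNReal.mul_ne_top (ENNReal.mul_ne_top (ENNReal.mul_ne_top
      (ENNReal.mul_ne_top (ENNReal.mul_ne_top (by simp) (ENNReal.add_ne_top.2 ⟨by simp, hκt⟩))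
      (by simp)) h2) h1) (ENNReal.add_ne_top.2 ⟨ENNReal.mul_ne_top (by simp) hM,
      ENNReal.mul_ne_top h1 h1⟩), ENNReal.mul_ne_top (ENNReal.mul_ne_top (by simp) h2)
      (ENNReal.pow_ne_top h1)⟩
  refine ⟨C.toNNReal, fun a b a' b' a'' b'' ha hb hab ha1 hb1 ha2 hb2 hq p hp => ?_⟩
  rw [ENNReal.coe_toNNReal hCt]
  have hp0 : 0 < p := by linarith
  have hm := fun k => (ha.sobolev k).memLp.1
  have hm' := fun k => (hb.sobolev k).memLp.1
  have hgm := aestronglyMeasurable_gradSize hm hm'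
  have hVm := fun k => (ha.transportDiff_sobolev hb hc hab k).memLp.1
  have hvm : AEStronglyMeasurable (diffSize a b a' b') volume :=
    Finset.aestronglyMeasurable_fun_sum _ fun k _ => (hVm k).norm
  have hhm : AEStronglyMeasurable (hessSize a'' b'') volume :=
    Finset.aestronglyMeasurable_fun_sum _ fun j _ => Finset.aestronglyMeasurable_fun_sum _
      fun k _ => ((ha.sobolev k).memLp_partial j).1.norm.add
        ((hb.sobolev k).memLp_partial j).1.norm
  obtain ⟨E, hE⟩ : ∃ E, E = energyNorm a b a' b' := ⟨_, rfl⟩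
  obtain ⟨R, hR⟩ : ∃ R, R = ENNReal.ofReal (√p) := ⟨_, rfl⟩
  -- each factor `R = √p` stands for one use of the embedding of `H¹` in `L^{4p}`
  have hRR : R * R = ENNReal.ofReal p := by
    rw [hR, ← ENNReal.ofReal_mul (Real.sqrt_nonneg _), Real.mul_self_sqrt hp0.le]
  have hgp : eLpNorm (gradSize a' b') (ENNReal.ofReal (4 * p)) volume ≤ R * (96 * M) := by
    refine (eLpNorm_gradSize_le hm hm' ?_ (ha.eLpNorm_partial_le ha1 ha2 (by linarith))
      (hb.eLpNorm_partial_le hb1 hb2 (by linarith))).trans_eq (by rw [hR]; ring)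
    rw [ENNReal.one_le_ofReal]
    linarith
  have hg4 : eLpNorm (gradSize a' b') 4 volume ≤ 96 * M := by
    have h4 : ENNReal.ofReal (4 * 1) = 4 := by norm_num
    have e1 := fun k => ha.eLpNorm_partial_le ha1 ha2 le_rfl k
    have e2 := fun k => hb.eLpNorm_partial_le hb1 hb2 le_rfl k
    rw [h4, Real.sqrt_one, ENNReal.ofReal_one, one_mul] at e1 e2
    exact (eLpNorm_gradSize_le hm hm' (by norm_num) e1 e2).trans_eq (by ring)
  have hv4 : eLpNorm (diffSize a b a' b') 4 volume ≤ 96 * M := by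
    refine (eLpNorm_mono_ae_real ?_).trans hg4
    filter_upwards [ha.diffSize_le hb hc hab] with x hx
    rwa [Real.norm_eq_abs, abs_of_nonneg (diffSize_nonneg x)]
  have hGm : AEStronglyMeasurable (fun x => hessSize a'' b'' x + gradSize a' b' x ^ 2) volume :=
    hhm.add (hgm.pow 2)
  have hG : eLpNorm (fun x => hessSize a'' b'' x + gradSize a' b' x ^ 2) 2 volume ≤
      8 * M + (96 * M) * (96 * M) := by
    refine (eLpNorm_add_le hhm (hgm.pow 2) one_le_two).trans (add_le_add (eLpNorm_hessSize_le
      (fun j k => ((ha.sobolev k).memLp_partial j).1)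
      (fun j k => ((hb.sobolev k).memLp_partial j).1) ha2 hb2) ?_)
    refine le_trans (le_of_eq ?_) ((eLpNorm_norm_mul_norm_le (p := 4) (q := 4) (r := 2) hgm
      hgm).trans (mul_le_mul' hg4 hg4))
    refine eLpNorm_congr_norm_ae (ae_of_all _ fun x => ?_)
    simp [sq]
  have hqs : IsSobolev (fun x => a x - b x) (fun k x => a' k x - b' k x) :=
    ⟨hq, fun k => (ha.sobolev k).memLp.sub (hb.sobolev k).memLp,
      fun k => (ha.weak k).sub (hb.weak k)⟩
  have hqp : eLpNorm (fun x => a x - b x) (ENNReal.ofReal (4 * p)) volume ≤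
      R * (8 * (1 + κ)) * E ^ (1 / 2 : ℝ) := by
    refine (hqs.eLpNorm_le (by linarith)).trans ?_
    rw [sobolev_const_four_mul, ← hR]
    calc _ ≤ 8 * R * (E ^ (1 / 2 : ℝ) + κ * E ^ (1 / 2 : ℝ)) := by
          rw [hκ, hE]
          gcongr
          · exact eLpNorm_sub_le_energyNorm
          · exact ha.sum_eLpNorm_sub_le hb hc hab ha1 hb1 ha2 hb2 hq
      _ = _ := by ring
  have hv2 := lintegral_diffSize_sq_le hVm
  rw [← hE] at hv2 ⊢
  have h1p : 1 / p ≤ 1 / 2 := one_div_le_one_div_of_le two_pos hp.le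
  have h0p : 0 < 1 / p := by positivity
  -- the power `2 / p ≤ 1` of a quantity bounded in terms of `M` is bounded uniformly in `p`
  have hv4' : (∫⁻ x, ‖diffSize a b a' b' x‖ₑ ^ 4) ^ (1 / (2 * p)) ≤ 1 + 96 * M := by
    have := eLpNorm_rpow_eq (μ := volume) (diffSize a b a' b') (q := 4) (by norm_num) (2 / p)
    rw [ENNReal.ofReal_ofNat, show 2 / p / 4 = 1 / (2 * p) by field_simp; norm_num] at this
    have e : ∀ x, ‖diffSize a b a' b' x‖ₑ ^ 4 = ‖diffSize a b a' b' x‖ₑ ^ (4 : ℝ) := fun x => by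
      rw [← ENNReal.rpow_natCast]; norm_num
    simp only [e]
    rw [this]
    refine (ENNReal.rpow_le_one_add _ (by positivity) ?_).trans (by gcongr)
    rw [div_le_one hp0]; exact hp.le
  have hg' : (∫⁻ x, ‖gradSize a' b' x‖ₑ ^ (4 * p)) ^ (1 / (4 * p)) ≤ R * (96 * M) := by
    rw [eLpNorm_rpow_eq _ (by positivity), ENNReal.rpow_one]; exact hgp
  have hg'' : (∫⁻ x, ‖gradSize a' b' x‖ₑ ^ (4 * p)) ^ (1 / (2 * p)) ≤ (R * (96 * M)) ^ 2 := by
    rw [show 1 / (2 * p) = 2 / (4 * p) by field_simp; norm_num, eLpNorm_rpow_eq _ (by positivity),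
      ENNReal.rpow_two]
    gcongr
  have hq' : (∫⁻ x, ‖a x - b x‖ₑ ^ (4 * p)) ^ (1 / (4 * p)) ≤
      R * (8 * (1 + κ)) * E ^ (1 / 2 : ℝ) := by
    rw [eLpNorm_rpow_eq (fun x => a x - b x) (by positivity), ENNReal.rpow_one]; exact hqp
  have hG' : (∫⁻ x, ‖hessSize a'' b'' x + gradSize a' b' x ^ 2‖ₑ ^ 2) ^ (1 / 2 : ℝ) ≤
      8 * M + (96 * M) * (96 * M) := by
    rw [← sq_eLpNorm_two, ENNReal.pow_rpow_eq]
    norm_num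
    exact hG
  simp only [ofReal_energyDensity]
  have hvg : AEMeasurable (fun x => ‖diffSize a b a' b' x‖ₑ ^ 2 * ‖gradSize a' b' x‖ₑ ^ 2)
      volume := (hvm.enorm.pow_const 2).mul (hgm.enorm.pow_const 2)
  rw [lintegral_add_right' _ hvg]
  calc _ ≤ (R * (8 * (1 + κ)) * E ^ (1 / 2 : ℝ)) * (2 * E ^ (1 / 2 - 1 / p)) * (1 + 96 * M) *
          (R * (96 * M)) * (8 * M + (96 * M) * (96 * M)) +
        (2 * E ^ (1 - 1 / p)) * (1 + 96 * M) * (R * (96 * M)) ^ 2 := by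
        refine add_le_add ((lintegral_mul_four_le hq.1.enorm hvm.enorm hgm.enorm hGm.enorm
          hp).trans ?_) ((lintegral_sq_mul_sq_le hvm.enorm hgm.enorm hp).trans ?_)
        · gcongr
          exact rpow_le_of_le_two_mul hv2 (by linarith) (by linarith)
        · gcongr
          exact rpow_le_of_le_two_mul hv2 (by linarith) (by linarith)
    _ = C * (R * R) * E ^ (1 - 1 / p) := by
        have : E ^ (1 - 1 / p) = E ^ (1 / 2 : ℝ) * E ^ (1 / 2 - 1 / p) := by
          rw [← ENNReal.rpow_add_of_nonneg _ _ (by norm_num) (by linarith)]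
          congr 1; ring
        rw [hC, this]
        ring
    _ = _ := by rw [hRR]

end EnergyBound

/-! ### Weak derivatives in time -/

section Time

open scoped Convolution

/-- Smooth bump functions on the line which shrink to the origin. -/
noncomputable def timeBump (n : ℕ) : ContDiffBump (0 : ℝ) where
  rIn := 1 / (2 * (n + 1))
  rOut := 1 / (n + 1)
  rIn_pos := by positivity
  rIn_lt_rOut := by
    apply one_div_lt_one_div_of_lt <;> [positivity; (have : (0 : ℝ) ≤ n := n.cast_nonneg; linarith)]

theorem tendsto_timeBump_rOut : Tendsto (fun n => (timeBump n).rOut) atTop (𝓝 0) :=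
  tendsto_one_div_add_atTop_nhds_zero_nat

/-- A continuous function whose weak derivative is bounded is the integral of its derivative. -/
theorem sub_eq_integral_of_weak_deriv {T : ℝ} {g f : ℝ → ℝ} (hg : ContinuousOn g (Ioo 0 T))
    (hgi : IntegrableOn g (Ioo 0 T)) (hf : AEStronglyMeasurable f (volume.restrict (Ioo 0 T)))
    {C : ℝ} (hC : ∀ᵐ t ∂(volume.restrict (Ioo 0 T)), ‖f t‖ ≤ C)
    (h : ∀ θ : ℝ → ℝ, ContDiff ℝ ∞ θ → HasCompactSupport θ → tsupport θ ⊆ Ioo 0 T →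
      ∫ t in Ioo 0 T, deriv θ t * g t = -∫ t in Ioo 0 T, θ t * f t)
    {s t : ℝ} (hs : s ∈ Ioo 0 T) (ht : t ∈ Ioo 0 T) (hst : s ≤ t) :
    g t - g s = ∫ τ in s..t, f τ := by
  have hI : MeasurableSet (Ioo (0 : ℝ) T) := measurableSet_Ioo
  have hfi : IntegrableOn f (Ioo 0 T) :=
    ⟨hf, HasFiniteIntegral.of_bounded hC⟩
  obtain ⟨g₀, hg₀⟩ : ∃ g₀, g₀ = (Ioo 0 T).indicator g := ⟨_, rfl⟩
  obtain ⟨f₀, hf₀⟩ : ∃ f₀, f₀ = (Ioo 0 T).indicator f := ⟨_, rfl⟩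
  have hg₀i : Integrable g₀ := by rw [hg₀, integrable_indicator_iff hI]; exact hgi
  have hf₀i : Integrable f₀ := by rw [hf₀, integrable_indicator_iff hI]; exact hfi
  have hC0 : ∀ᵐ τ, ‖f₀ τ‖ ≤ max C 0 := by
    rw [ae_restrict_iff' hI] at hC
    filter_upwards [hC] with τ hτ
    rw [hf₀]
    by_cases hm : τ ∈ Ioo 0 T
    · rw [indicator_of_mem hm]; exact (hτ hm).trans (le_max_left _ _)
    · rw [indicator_of_notMem hm, norm_zero]; exact le_max_right _ _
  obtain ⟨ρ, hρ⟩ : ∃ ρ : ℕ → ℝ → ℝ, ρ = fun n => (timeBump n).normed volume := ⟨_, rfl⟩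
  have hρs : ∀ n, ContDiff ℝ ∞ (ρ n) := fun n => by rw [hρ]; exact (timeBump n).contDiff_normed
  have hρc : ∀ n, HasCompactSupport (ρ n) := fun n => by
    rw [hρ]; exact (timeBump n).hasCompactSupport_normed
  let L := ContinuousLinearMap.lsmul ℝ ℝ (E := ℝ)
  have hconv : ∀ n (k : ℝ → ℝ) τ, (ρ n ⋆[L, volume] k) τ = ∫ σ, ρ n (τ - σ) * k σ := fun n k τ => by
    rw [convolution_eq_swap]; rfl
  have hGd : ∀ n τ, HasDerivAt (ρ n ⋆[L, volume] g₀) ((deriv (ρ n) ⋆[L, volume] g₀) τ) τ :=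
    fun n τ => (hρc n).hasDerivAt_convolution_left L ((hρs n).of_le (by simp))
      hg₀i.locallyIntegrable τ
  -- `σ ↦ ρ n (τ - σ)` is a test function on `(0, T)` once the support of `ρ n` is small
  have hder : ∀ᶠ n in atTop, ∀ τ ∈ Icc s t,
      (deriv (ρ n) ⋆[L, volume] g₀) τ = (ρ n ⋆[L, volume] f₀) τ := by
    have hpos : 0 < min s (T - t) := lt_min hs.1 (by linarith [ht.2])
    filter_upwards [tendsto_timeBump_rOut.eventually (gt_mem_nhds hpos)] with n hn τ hτ
    have h1 : Function.support (fun σ => ρ n (τ - σ)) ⊆ Metric.closedBall τ (timeBump n).rOut := by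
      intro σ hσ
      have h2 : τ - σ ∈ Function.support (ρ n) := hσ
      rw [hρ, (timeBump n).support_normed_eq, Metric.mem_ball, dist_zero_right] at h2
      rw [Metric.mem_closedBall, dist_comm, Real.dist_eq, ← Real.norm_eq_abs]
      exact h2.le
    have hsupp : tsupport (fun σ => ρ n (τ - σ)) ⊆ Ioo 0 T := by
      refine (closure_minimal h1 Metric.isClosed_closedBall).trans fun σ hσ => ?_
      rw [Metric.mem_closedBall, Real.dist_eq, abs_le] at hσ
      have h3 := lt_min_iff.1 hn
      constructor <;> linarith [hτ.1, hτ.2, h3.1, h3.2]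
    have hcomp : HasCompactSupport (fun σ => ρ n (τ - σ)) :=
      HasCompactSupport.of_support_subset_isCompact (isCompact_closedBall _ _) h1
    have h4 := h (fun σ => ρ n (τ - σ)) ((hρs n).comp (contDiff_const.sub contDiff_id)) hcomp hsupp
    have h5 : ∀ σ, deriv (fun σ => ρ n (τ - σ)) σ = -deriv (ρ n) (τ - σ) := fun σ =>
      deriv_comp_const_sub _ _ _
    simp only [h5, neg_mul, integral_neg, neg_inj] at h4
    rw [convolution_eq_swap, hconv]
    have h6 : ∀ (k l : ℝ → ℝ), ∫ σ, k σ * (Ioo 0 T).indicator l σ = ∫ σ in Ioo 0 T, k σ * l σ :=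
      fun k l => by
        rw [← integral_indicator hI]
        congr 1
        ext σ
        by_cases hm : σ ∈ Ioo 0 T <;> simp [hm]
    rw [hg₀, hf₀, h6, ← h4]
    exact h6 _ _
  have hFc : ∀ n, Continuous (ρ n ⋆[L, volume] f₀) := fun n =>
    (hρc n).continuous_convolution_left L (hρs n).continuous hf₀i.locallyIntegrable
  have hFTC : ∀ᶠ n in atTop, ∫ τ in s..t, (ρ n ⋆[L, volume] f₀) τ =
      (ρ n ⋆[L, volume] g₀) t - (ρ n ⋆[L, volume] g₀) s := by
    filter_upwards [hder] with n hn
    refine intervalIntegral.integral_eq_sub_of_hasDerivAt (fun τ hτ => ?_)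
      ((hFc n).intervalIntegrable _ _)
    rw [uIcc_of_le hst] at hτ
    rw [← hn τ hτ]
    exact hGd n τ
  have hlim : ∀ τ ∈ Ioo 0 T, Tendsto (fun n => (ρ n ⋆[L, volume] g₀) τ) atTop (𝓝 (g τ)) :=
    fun τ hτ => by
      have h1 : Tendsto g₀ (𝓝 τ) (𝓝 (g τ)) := by
        refine (hg.continuousAt (isOpen_Ioo.mem_nhds hτ)).tendsto.congr' ?_
        filter_upwards [isOpen_Ioo.mem_nhds hτ] with σ hσ
        rw [hg₀, indicator_of_mem hσ]
      have := ContDiffBump.convolution_tendsto_right (φ := timeBump) (μ := volume) (l := atTop)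
        (g := fun _ => g₀) (k := fun _ : ℕ => τ) tendsto_timeBump_rOut
        (Eventually.of_forall fun _ => hg₀i.aestronglyMeasurable)
        (h1.comp tendsto_snd) tendsto_const_nhds
      rw [hρ]
      exact this
  have hFlim : Tendsto (fun n => ∫ τ in s..t, (ρ n ⋆[L, volume] f₀) τ) atTop
      (𝓝 (∫ τ in s..t, f₀ τ)) := by
    refine intervalIntegral.tendsto_integral_filter_of_dominated_convergence (fun _ => max C 0)
      (Eventually.of_forall fun n => (hFc n).aestronglyMeasurable) (Eventually.of_forall fun n =>
      ae_of_all _ fun τ _ => ?_) (by simp) ?_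
    · rw [hconv]
      have h1 : ∀ᵐ σ, ‖ρ n (τ - σ) * f₀ σ‖ ≤ ρ n (τ - σ) * max C 0 := by
        filter_upwards [hC0] with σ hσ
        rw [norm_mul, Real.norm_eq_abs, abs_of_nonneg (by rw [hρ]; exact (timeBump n).nonneg_normed _)]
        gcongr
        rw [hρ]; exact (timeBump n).nonneg_normed _
      refine (norm_integral_le_of_norm_le ?_ h1).trans (le_of_eq ?_)
      · exact ((((hρs n).continuous.integrable_of_hasCompactSupport (hρc n)).comp_sub_left
          τ)).mul_const _
      · rw [integral_mul_const, integral_sub_left_eq_self (ρ n) volume τ, hρ,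
          (timeBump n).integral_normed, one_mul]
    · have := ContDiffBump.ae_convolution_tendsto_right_of_locallyIntegrable (φ := timeBump)
        (l := atTop) (K := 2) tendsto_timeBump_rOut (Eventually.of_forall fun n => by
          change 1 / ((n : ℝ) + 1) ≤ 2 * (1 / (2 * (n + 1)))
          rw [← mul_div_assoc, mul_one, mul_comm 2 ((n : ℝ) + 1), div_mul_cancel_right₀]
          · rw [one_div]
          · norm_num) hf₀i.locallyIntegrable (μ := volume)
      filter_upwards [this] with τ hτ _
      rw [hρ]
      exact hτ
  have h7 := tendsto_nhds_unique (((hlim t ht).sub (hlim s hs)).congr' (hFTC.mono fun n hn =>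
    hn.symm)) hFlim
  rw [h7]
  refine intervalIntegral.integral_congr fun τ hτ => ?_
  rw [uIcc_of_le hst] at hτ
  have hm : τ ∈ Ioo 0 T := ⟨hs.1.trans_le hτ.1, hτ.2.trans_lt ht.2⟩
  rw [hf₀, indicator_of_mem hm]

end Time

/-! ### Weak convergence and duality in `L²` -/

section Weak

variable {ι : Type*} {l : Filter ι}

theorem enorm_integral_inner_le_two {f g : Plane → Space} (hf : AEStronglyMeasurable f volume)
    (hg : AEStronglyMeasurable g volume) :
    ‖∫ x, inner ℝ (f x) (g x)‖ₑ ≤ eLpNorm f 2 volume * eLpNorm g 2 volume := by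
  refine (enorm_integral_le_lintegral_enorm _).trans ?_
  refine (lintegral_mono fun x => ?_).trans (lintegral_enorm_mul_le hf hg)
  rw [← enorm_norm (f x), ← enorm_norm (g x), ← enorm_mul, enorm_le_iff_norm_le, norm_mul,
    norm_norm, norm_norm]
  exact norm_inner_le_norm (𝕜 := ℝ) (f x) (g x)

theorem integrable_inner {f g : Plane → Space} (hf : MemLp f 2 volume) (hg : MemLp g 2 volume) :
    Integrable (fun x => inner ℝ (f x) (g x)) volume :=
  integrable_bilin innerL hf hg

/-- For bounded families in `L²`, it is enough to test weak convergence on a dense set. -/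
theorem tendsto_integral_inner_of_dense {S : Set (Plane → Space)}
    (hS : ∀ φ ∈ S, MemLp φ 2 volume)
    (hd : ∀ ψ : Plane → Space, MemLp ψ 2 volume → ∀ ε : ℝ≥0∞, ε ≠ 0 →
      ∃ φ ∈ S, eLpNorm (ψ - φ) 2 volume ≤ ε)
    {h : ι → Plane → Space} {h₀ : Plane → Space} {K : ℝ≥0}
    (hm : ∀ᶠ i in l, MemLp (h i) 2 volume) (hK : ∀ᶠ i in l, eLpNorm (h i) 2 volume ≤ K)
    (hm₀ : MemLp h₀ 2 volume)
    (ht : ∀ φ ∈ S, Tendsto (fun i => ∫ x, inner ℝ (φ x) (h i x)) l (𝓝 (∫ x, inner ℝ (φ x) (h₀ x))))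
    {ψ : Plane → Space} (hψ : MemLp ψ 2 volume) :
    Tendsto (fun i => ∫ x, inner ℝ (ψ x) (h i x)) l (𝓝 (∫ x, inner ℝ (ψ x) (h₀ x))) := by
  rw [Metric.tendsto_nhds]
  intro ε hε
  obtain ⟨K₀, hK₀⟩ : ∃ K₀ : ℝ≥0, eLpNorm h₀ 2 volume = K₀ :=
    ⟨_, (ENNReal.coe_toNNReal hm₀.2.ne).symm⟩
  -- each of the two replacements of `ψ` by `φ` costs `ε / 3`
  obtain ⟨δ, hδ⟩ : ∃ δ : ℝ≥0, δ = (ε.toNNReal / 3) / (K + K₀ + 1) := ⟨_, rfl⟩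
  have hδ0 : 0 < δ := by rw [hδ]; have := Real.toNNReal_pos.2 hε; positivity
  have hδK : (δ : ℝ) * (K + K₀ + 1) = ε / 3 := by
    have : (ε.toNNReal : ℝ) = ε := Real.coe_toNNReal _ hε.le
    rw [hδ]; push_cast; rw [this]; field_simp
  obtain ⟨φ, hφ, hφe⟩ := hd ψ hψ δ (by simpa using hδ0.ne')
  have hφm := hS φ hφ
  have bound : ∀ (g : Plane → Space) (A : ℝ≥0), MemLp g 2 volume → eLpNorm g 2 volume ≤ A →
      A ≤ K + K₀ + 1 → dist (∫ x, inner ℝ (ψ x) (g x)) (∫ x, inner ℝ (φ x) (g x)) ≤ ε / 3 := by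
    intro g A hg hgA hA
    rw [dist_eq_norm, ← integral_sub (integrable_inner hψ hg) (integrable_inner hφm hg), ← hδK]
    have h1 := enorm_integral_inner_le_two (hψ.sub hφm).1 hg.1
    simp only [Pi.sub_apply, inner_sub_left] at h1
    have h2 : ‖∫ x, inner ℝ (ψ x) (g x) - inner ℝ (φ x) (g x)‖ₑ ≤ ((δ * (K + K₀ + 1) : ℝ≥0) : ℝ≥0∞) := by
      refine h1.trans ?_
      rw [ENNReal.coe_mul]
      exact mul_le_mul' hφe (hgA.trans (by exact_mod_cast hA))
    rw [enorm_eq_nnnorm, ENNReal.coe_le_coe] at h2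
    exact_mod_cast h2
  filter_upwards [hm, hK, Metric.tendsto_nhds.1 (ht φ hφ) (ε / 3) (by positivity)] with i h1 h2 h3
  have h4 := bound (h i) K h1 h2 (by rw [add_assoc]; exact le_self_add)
  have h5 := bound h₀ K₀ hm₀ hK₀.le (by rw [add_comm K, add_assoc]; exact le_self_add)
  calc _ ≤ dist (∫ x, inner ℝ (ψ x) (h i x)) (∫ x, inner ℝ (φ x) (h i x)) +
        dist (∫ x, inner ℝ (φ x) (h i x)) (∫ x, inner ℝ (φ x) (h₀ x)) +
        dist (∫ x, inner ℝ (φ x) (h₀ x)) (∫ x, inner ℝ (ψ x) (h₀ x)) := dist_triangle4 _ _ _ _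
    _ < ε := by rw [dist_comm] at h5; linarith

theorem exists_test_eLpNorm_sub_le {ψ : Plane → Space} (hψ : MemLp ψ 2 volume) {ε : ℝ≥0∞}
    (hε : ε ≠ 0) : ∃ φ : Plane → Space, (ContDiff ℝ ∞ φ ∧ HasCompactSupport φ) ∧
      eLpNorm (ψ - φ) 2 volume ≤ ε := by
  obtain ⟨r, hr0, hr⟩ := ENNReal.lt_iff_exists_nnreal_btwn.1 (pos_iff_ne_zero.2 hε)
  obtain ⟨φ, h1, h2, h3⟩ := hψ.exist_eLpNorm_sub_le (by simp) (by norm_num)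
    (ε := (r : ℝ)) (by exact_mod_cast hr0)
  exact ⟨φ, ⟨h2, h1⟩, h3.trans (by simpa using hr.le)⟩

/-- Countably many test functions are dense in `L²`. -/
theorem exists_countable_dense_test : ∃ S : Set (Plane → Space), S.Countable ∧
    (∀ φ ∈ S, ContDiff ℝ ∞ φ ∧ HasCompactSupport φ) ∧
    ∀ ψ : Plane → Space, MemLp ψ 2 volume → ∀ ε : ℝ≥0∞, ε ≠ 0 →
      ∃ φ ∈ S, eLpNorm (ψ - φ) 2 volume ≤ ε := by
  have : Fact ((2 : ℝ≥0∞) ≠ ⊤) := ⟨by simp⟩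
  obtain ⟨A, hA⟩ : ∃ A : Set (Lp Space 2 (volume : Measure Plane)), A =
    {f : Lp Space 2 (volume : Measure Plane) | ∃ φ : Plane → Space,
      (ContDiff ℝ ∞ φ ∧ HasCompactSupport φ) ∧ f =ᵐ[volume] φ} := ⟨_, rfl⟩
  obtain ⟨t, htA, htc, htd⟩ := (TopologicalSpace.IsSeparable.of_separableSpace
    A).exists_countable_dense_subset
  have hex : ∀ f : Lp Space 2 (volume : Measure Plane), ∃ φ : Plane → Space, f ∈ t →
      (ContDiff ℝ ∞ φ ∧ HasCompactSupport φ) ∧ f =ᵐ[volume] φ := fun f => by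
    by_cases hf : f ∈ t
    · have := htA hf
      rw [hA] at this
      obtain ⟨φ, h⟩ := this
      exact ⟨φ, fun _ => h⟩
    · exact ⟨0, fun h => absurd h hf⟩
  choose Φ hΦ using hex
  refine ⟨Φ '' t, htc.image _, ?_, fun ψ hψ ε hε => ?_⟩
  · rintro _ ⟨f, hf, rfl⟩
    exact (hΦ f hf).1
  · obtain ⟨χ, hχ, hχe⟩ := exists_test_eLpNorm_sub_le hψ (ENNReal.half_pos hε).ne'
    have hχm : MemLp χ 2 volume := hχ.1.continuous.memLp_of_hasCompactSupport hχ.2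
    have hmem : hχm.toLp χ ∈ closure t := htd (by rw [hA]; exact ⟨χ, hχ, hχm.coeFn_toLp⟩)
    obtain ⟨f, hf, hfe⟩ := EMetric.mem_closure_iff.1 hmem _ (ENNReal.half_pos hε)
    refine ⟨Φ f, ⟨f, hf, rfl⟩, ?_⟩
    have h1 : eLpNorm (χ - Φ f) 2 volume ≤ ε / 2 := by
      rw [Lp.edist_def] at hfe
      refine (eLpNorm_congr_ae ?_).le.trans hfe.le
      filter_upwards [hχm.coeFn_toLp, (hΦ f hf).2] with x hx1 hx2
      simp [hx1, hx2]
    have hm : MemLp (Φ f) 2 volume :=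
      (hΦ f hf).1.1.continuous.memLp_of_hasCompactSupport (hΦ f hf).1.2
    calc eLpNorm (ψ - Φ f) 2 volume = eLpNorm ((ψ - χ) + (χ - Φ f)) 2 volume := by
          rw [sub_add_sub_cancel]
      _ ≤ ε / 2 + ε / 2 := (eLpNorm_add_le (hψ.1.sub hχm.1) (hχm.1.sub hm.1) (by norm_num)).trans
          (add_le_add hχe h1)
      _ = ε := ENNReal.add_halves ε

/-- The duality characterization of the norm of `L²`. -/
theorem eLpNorm_le_of_integral_inner_le {h : Plane → Space} (hh : LocL2 h) {C : ℝ≥0}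
    (hm : AEStronglyMeasurable h volume)
    (hC : ∀ φ : Plane → Space, ContDiff ℝ ∞ φ → HasCompactSupport φ →
      ‖∫ x, inner ℝ (φ x) (h x)‖ₑ ≤ C * eLpNorm φ 2 volume) :
    eLpNorm h 2 volume ≤ C := by
  -- test with mollifications of `f = 1_{|x| < R} h`; their supports lie in the ball of radius `R +
  -- 1`, so that only the truncation `g` of `h` to that ball enters, and `g ∈ L²`
  have key : ∀ R : ℝ, eLpNorm ((Metric.ball 0 R).indicator h) 2 volume ≤ C := fun R => by
    obtain ⟨f, hf⟩ : ∃ f, f = (Metric.ball 0 R).indicator h := ⟨_, rfl⟩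
    obtain ⟨g, hg⟩ : ∃ g, g = (Metric.ball 0 (R + 1)).indicator h := ⟨_, rfl⟩
    have hfm : MemLp f 2 volume := by
      rw [hf]; exact (memLp_indicator_iff_restrict measurableSet_ball).2 (hh R)
    have hgm : MemLp g 2 volume := by
      rw [hg]; exact (memLp_indicator_iff_restrict measurableSet_ball).2 (hh (R + 1))
    have hfs : Function.support f ⊆ Metric.closedBall 0 R := by
      rw [hf]; exact support_indicator_subset.trans Metric.ball_subset_closedBall
    have hfc : HasCompactSupport f :=
      HasCompactSupport.of_support_subset_isCompact (isCompact_closedBall _ _) hfs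
    have hfl := hfm.locallyIntegrable (by norm_num)
    have hms : ∀ n x, x ∉ Metric.ball (0 : Plane) (R + 1) → mollify n f x = 0 := fun n x hx => by
      rw [mollify_apply]
      refine integral_eq_zero_of_ae (ae_of_all _ fun t => ?_)
      simp only [Pi.zero_apply]
      by_cases ht : t ∈ Metric.ball (0 : Plane) (mollifier n).rOut
      · rw [hf, indicator_of_notMem, smul_zero]
        intro hx'
        rw [mem_ball_zero_iff] at hx' ht hx
        have h1 := norm_add_le (x - t) t
        rw [sub_add_cancel] at h1
        have h2 := mollifier_rOut_le_one n
        linarith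
      · rw [← (mollifier n).support_normed_eq (μ := volume)] at ht
        rw [Function.notMem_support.1 ht, zero_smul]
    have hmm : ∀ n, MemLp (mollify n f) 2 volume := fun n =>
      ⟨(contDiff_mollify n hfl).continuous.aestronglyMeasurable,
        (eLpNorm_mollify_le n hfm.1).trans_lt hfm.2⟩
    have hlim : Tendsto (fun n => ∫ x, innerL (mollify n f x) (g x)) atTop
        (𝓝 (∫ x, innerL (f x) (g x))) :=
      tendsto_integral_bilin innerL hfm hgm hmm (fun _ => hgm) (tendsto_eLpNorm_mollify_sub hfm)
        (by simp)
    have hb : ∀ n, ‖∫ x, innerL (mollify n f x) (g x)‖ₑ ≤ C * eLpNorm f 2 volume := fun n => by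
      have e : ∀ x, innerL (mollify n f x) (g x) = inner ℝ (mollify n f x) (h x) := fun x => by
        by_cases hx : x ∈ Metric.ball (0 : Plane) (R + 1)
        · rw [hg, indicator_of_mem hx, innerL_apply]
        · rw [hms n x hx, innerL_apply, inner_zero_left, inner_zero_left]
      simp only [e]
      refine (hC _ (contDiff_mollify n hfl) (hfc.mollify n)).trans ?_
      gcongr
      exact eLpNorm_mollify_le n hfm.1
    have h1 := le_of_tendsto hlim.enorm (Eventually.of_forall hb)
    have h2 : ∀ x, innerL (f x) (g x) = ‖f x‖ ^ 2 := fun x => by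
      rw [innerL_apply, ← real_inner_self_eq_norm_sq, hf, hg]
      by_cases hx : x ∈ Metric.ball (0 : Plane) R
      · rw [indicator_of_mem hx, indicator_of_mem (Metric.ball_subset_ball (by linarith) hx)]
      · rw [indicator_of_notMem hx, inner_zero_left, inner_zero_left]
    have h3 : ‖∫ x, innerL (f x) (g x)‖ₑ = eLpNorm f 2 volume ^ 2 := by
      simp only [h2]
      rw [Real.enorm_of_nonneg (integral_nonneg fun _ => by positivity),
        ofReal_integral_eq_lintegral_ofReal (hfm.integrable_norm_pow two_ne_zero)
        (ae_of_all _ fun _ => by positivity), sq_eLpNorm_two]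
      refine lintegral_congr fun x => ?_
      rw [ENNReal.ofReal_pow (norm_nonneg _), ofReal_norm]
    rw [h3, sq] at h1
    rw [← hf]
    by_cases h0 : eLpNorm f 2 volume = 0
    · rw [h0]; exact zero_le
    · exact (ENNReal.mul_le_mul_iff_left h0 hfm.2.ne).1 h1
  refine (Lp.eLpNorm_lim_le_liminf_eLpNorm (f := fun n : ℕ => (Metric.ball (0 : Plane) n).indicator h)
    (fun n => hm.indicator measurableSet_ball) h (ae_of_all _ fun x => ?_)).trans ?_
  · refine tendsto_const_nhds.congr' ?_
    filter_upwards [tendsto_natCast_atTop_atTop.eventually_gt_atTop ‖x‖] with n hn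
    rw [indicator_of_mem (by simpa using hn)]
  · exact (liminf_le_liminf (v := fun _ : ℕ => (C : ℝ≥0∞))
      (Eventually.of_forall fun n : ℕ => key n)).trans (liminf_const _).le

end Weak

/-! ### The Schrödinger flow in `L²` -/

section Flow

/-- A solution `u` of the Schrödinger map equation on `(0, T)`. The set `I ⊆ (0, T)` has full
measure and consists of times at which `u t` has two weak derivatives, `u' t k = ∂_k u` and
`u'' t j k = ∂_j ∂_k u`, with `L²` norms at most `K`. -/
structure IsSchrodingerFlow (T : ℝ) (I : Set ℝ) (K : ℝ≥0) (u : ℝ → Plane → Space)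
    (u' : ℝ → Fin 2 → Plane → Space) (u'' : ℝ → Fin 2 → Fin 2 → Plane → Space) : Prop where
  subset : I ⊆ Ioo 0 T
  measurableSet : MeasurableSet I
  ae_mem : ∀ᵐ t ∂(volume.restrict (Ioo 0 T)), t ∈ I
  aesm : ∀ t ∈ Ioo 0 T, AEStronglyMeasurable (u t) volume
  norm_eq : ∀ t ∈ Ioo 0 T, ∀ᵐ x, ‖u t x‖ = 1
  continuous : ∀ s ∈ Ioo 0 T, Tendsto (fun t => eLpNorm (u t - u s) ⊤ volume) (𝓝 s) (𝓝 0)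
  sphere : ∀ t ∈ I, IsSphereMap (u t) (u' t) (u'' t)
  bound : ∀ t ∈ I, ∀ k, eLpNorm (u' t k) 2 volume ≤ K
  bound₂ : ∀ t ∈ I, ∀ j k, eLpNorm (u'' t j k) 2 volume ≤ K
  equation : ∀ (θ : ℝ → ℝ) (χ : Plane → ℝ), ContDiff ℝ ∞ θ → HasCompactSupport θ →
    tsupport θ ⊆ Ioo 0 T → ContDiff ℝ ∞ χ → HasCompactSupport χ →
    ∫ t in Ioo 0 T, deriv θ t • ∫ x, χ x • u t x =
      -∫ t in Ioo 0 T, θ t • ∫ x, χ x • schrodingerField (u t) (u'' t) x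

theorem enorm_integral_inner_le_top {f g : Plane → Space} (hf : AEStronglyMeasurable f volume) :
    ‖∫ x, inner ℝ (f x) (g x)‖ₑ ≤ eLpNorm f 1 volume * eLpNorm g ⊤ volume := by
  refine (enorm_integral_le_lintegral_enorm _).trans ?_
  rw [eLpNorm_one_eq_lintegral_enorm, eLpNorm_exponent_top, ← lintegral_mul_const'' _ hf.enorm]
  refine lintegral_mono_ae ((ae_le_eLpNormEssSup (f := g)).mono fun x hx => ?_)
  refine le_trans ?_ (mul_le_mul_right hx _)
  rw [← enorm_norm (f x), ← enorm_norm (g x), ← enorm_mul, enorm_le_iff_norm_le, norm_mul,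
    norm_norm, norm_norm]
  exact norm_inner_le_norm (𝕜 := ℝ) (f x) (g x)

namespace IsSchrodingerFlow

variable {T : ℝ} {I : Set ℝ} {K : ℝ≥0} {u : ℝ → Plane → Space} {u' : ℝ → Fin 2 → Plane → Space}
  {u'' : ℝ → Fin 2 → Fin 2 → Plane → Space}

theorem restrict_eq (h : IsSchrodingerFlow T I K u u' u'') :
    (volume : Measure ℝ).restrict (Ioo 0 T) = volume.restrict I := by
  refine Measure.restrict_congr_set ?_
  have h1 := (ae_restrict_iff' measurableSet_Ioo).1 h.ae_mem
  filter_upwards [h1] with t ht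
  exact propext ⟨ht, fun h2 => h.subset h2⟩

theorem eLpNorm_field_le (h : IsSchrodingerFlow T I K u u' u'') {t : ℝ} (ht : t ∈ I) :
    eLpNorm (schrodingerField (u t) (u'' t)) 2 volume ≤ ((2 * K : ℝ≥0) : ℝ≥0∞) := by
  have hs := h.sphere t ht
  have e : schrodingerField (u t) (u'' t) = ∑ k, fun x => vecProd (u t x) (u'' t k k x) := by
    ext1 x; rw [Finset.sum_apply]; rfl
  have hm : ∀ k, MemLp (fun x => vecProd (u t x) (u'' t k k x)) 2 volume := fun k =>
    memLp_bilin_of_bound (C := 1) crossL hs.bdd.aesm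
      (hs.norm_eq.mono fun _ hx => hx.le) ((hs.sobolev k).memLp_partial k)
  rw [e]
  refine (eLpNorm_sum_le (fun k _ => (hm k).1) (by norm_num)).trans ?_
  refine (Finset.sum_le_sum fun k _ => (eLpNorm_mono_ae (hs.norm_eq.mono fun x hx => ?_)).trans
    (h.bound₂ t ht k k)).trans ?_
  · simpa [hx] using norm_vecProd_le (u t x) (u'' t k k x)
  · simp [two_mul]

theorem continuousOn_inner (h : IsSchrodingerFlow T I K u u' u'') {φ : Plane → Space}
    (hφ : Integrable φ volume) :
    ContinuousOn (fun t => ∫ x, inner ℝ (φ x) (u t x)) (Ioo 0 T) := by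
  intro s hs
  refine ContinuousAt.continuousWithinAt ?_
  have hint : ∀ t ∈ Ioo 0 T, Integrable (fun x => inner ℝ (φ x) (u t x)) volume := fun t ht => by
    refine hφ.norm.mono' (hφ.1.inner (h.aesm t ht)) ?_
    filter_upwards [h.norm_eq t ht] with x hx
    simpa [hx] using norm_inner_le_norm (𝕜 := ℝ) (φ x) (u t x)
  have h1 : Tendsto (fun t => eLpNorm φ 1 volume * eLpNorm (u t - u s) ⊤ volume) (𝓝 s) (𝓝 0) := by
    simpa using ENNReal.Tendsto.const_mul (h.continuous s hs)
      (Or.inr (memLp_one_iff_integrable.2 hφ).2.ne)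
  rw [ContinuousAt, tendsto_iff_edist_tendsto_0]
  refine tendsto_of_tendsto_of_tendsto_of_le_of_le' tendsto_const_nhds h1
    (Eventually.of_forall fun _ => zero_le) ?_
  filter_upwards [isOpen_Ioo.mem_nhds hs] with t ht
  rw [edist_eq_enorm_sub, ← integral_sub (hint t ht) (hint s hs)]
  simp only [← inner_sub_right]
  exact enorm_integral_inner_le_top (g := u t - u s) hφ.1

theorem enorm_inner_le (h : IsSchrodingerFlow T I K u u' u'') {φ : Plane → Space}
    (hφ : Integrable φ volume) {t : ℝ} (ht : t ∈ Ioo 0 T) :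
    ‖∫ x, inner ℝ (φ x) (u t x)‖ ≤ ∫ x, ‖φ x‖ := by
  refine norm_integral_le_of_norm_le hφ.norm ?_
  filter_upwards [h.norm_eq t ht] with x hx
  simpa [hx] using norm_inner_le_norm (𝕜 := ℝ) (φ x) (u t x)

/-- The derivatives of `u` are weakly continuous in `L²`. -/
theorem tendsto_inner_partial (h : IsSchrodingerFlow T I K u u' u'') {s : ℝ} (hs : s ∈ I)
    (k : Fin 2) {ψ : Plane → Space} (hψ : MemLp ψ 2 volume) :
    Tendsto (fun t => ∫ x, inner ℝ (ψ x) (u' t k x)) (𝓝[I] s)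
      (𝓝 (∫ x, inner ℝ (ψ x) (u' s k x))) := by
  obtain ⟨S, -, hS, hd⟩ := exists_countable_dense_test
  refine tendsto_integral_inner_of_dense (K := K)
    (fun φ hφ => (hS φ hφ).1.continuous.memLp_of_hasCompactSupport (hS φ hφ).2) hd
    ?_ ?_ ((h.sphere s hs).sobolev k).memLp (fun φ hφ => ?_) hψ
  · filter_upwards [self_mem_nhdsWithin] with t ht using ((h.sphere t ht).sobolev k).memLp
  · filter_upwards [self_mem_nhdsWithin] with t ht using h.bound t ht k
  -- on test functions the claim is the continuity of `u` in `L^∞`, after an integration by parts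
  · have hi : ∀ t ∈ I, ∫ x, inner ℝ (φ x) (u' t k x) =
        -∫ x, inner ℝ (fderiv ℝ φ x (EuclideanSpace.single k 1)) (u t x) := fun t ht => by
      have hφB := IsSobolev.isBddSobolev_of_contDiff (hS φ hφ).1 (hS φ hφ).2
      have hb := (h.sphere t ht).bdd
      have hφc : MemLp φ 1 volume := (hS φ hφ).1.continuous.memLp_of_hasCompactSupport (hS φ hφ).2
      have hφc' : MemLp (fun x => fderiv ℝ φ x (EuclideanSpace.single k 1)) 1 volume :=
        (contDiff_partial (hS φ hφ).1 _).continuous.memLp_of_hasCompactSupport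
          ((hS φ hφ).2.fderiv_apply (𝕜 := ℝ) _)
      have hle := (h.sphere t ht).norm_eq.mono fun _ hx => hx.le
      have i0 := memLp_one_iff_integrable.1 (memLp_bilin_of_bound innerL.flip hb.aesm hle hφc)
      have i1 := memLp_one_iff_integrable.1 (memLp_bilin_of_bound innerL.flip hb.aesm hle hφc')
      have i2 := integrable_inner (IsSobolev.of_contDiff (hS φ hφ).1 (hS φ hφ).2).memLp
        ((h.sphere t ht).sobolev k).memLp
      have h1 := ((hφB.bilin innerL hb).weak k).integral_eq_zero i0 (i1.add i2)
      simp only [innerL_apply] at h1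
      simp only [ContinuousLinearMap.flip_apply, innerL_apply] at i1
      rw [integral_add i1 i2] at h1
      exact eq_neg_of_add_eq_zero_right h1
    have hφi : Integrable (fun x => fderiv ℝ φ x (EuclideanSpace.single k 1)) volume :=
      (contDiff_partial (hS φ hφ).1 _).continuous.integrable_of_hasCompactSupport
        ((hS φ hφ).2.fderiv_apply (𝕜 := ℝ) _)
    rw [hi s hs]
    refine Tendsto.congr' (f₁ := fun t => -∫ x, inner ℝ
      (fderiv ℝ φ x (EuclideanSpace.single k 1)) (u t x)) ?_ ?_
    · filter_upwards [self_mem_nhdsWithin] with t ht using (hi t ht).symm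
    · exact (((h.continuousOn_inner hφi).neg s (h.subset hs)).mono h.subset)

/-- The field `u × Δ u = ∑ ∂_k (u × ∂_k u)`, tested against a smooth function. -/
theorem integral_inner_field (h : IsSchrodingerFlow T I K u u' u'') {φ : Plane → Space}
    (h1 : ContDiff ℝ ∞ φ) (h2 : HasCompactSupport φ) {t : ℝ} (ht : t ∈ I) :
    ∫ x, inner ℝ (φ x) (schrodingerField (u t) (u'' t) x) =
      -∑ k, ∫ x, inner ℝ (vecProd (fderiv ℝ φ x (EuclideanSpace.single k 1)) (u t x))
        (u' t k x) := by
  have hs := h.sphere t ht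
  have hφ := IsSobolev.of_contDiff h1 h2
  have e : ∀ k, ∫ x, inner ℝ (φ x) (vecProd (u t x) (u'' t k k x)) =
      -∫ x, inner ℝ (vecProd (fderiv ℝ φ x (EuclideanSpace.single k 1)) (u t x)) (u' t k x) :=
    fun k => by
      have h3 := hφ.integral_bilin innerL (hs.sobolev_vecProd k) k
      simp only [vecProd_self, zero_add, innerL_apply] at h3
      rw [eq_neg_iff_add_eq_zero, add_comm, ← eq_neg_iff_add_eq_zero, ← h3]
      refine integral_congr_ae (ae_of_all _ fun x => ?_)
      simp only []
      rw [inner_vecProd_left_comm, inner_vecProd_left_comm, real_inner_comm]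
  rw [← Finset.sum_neg_distrib, ← Finset.sum_congr rfl fun k _ => e k, ← integral_finsetSum]
  · simp only [schrodingerField, inner_sum]
  · intro k _
    have := integrable_bilin innerL hφ.memLp ((hs.sobolev_vecProd k).memLp_partial k)
    simpa only [vecProd_self, zero_add, innerL_apply] using this

/-- The field `u × Δ u` is weakly continuous on `I`, when tested against smooth functions. -/
theorem continuousOn_inner_field (h : IsSchrodingerFlow T I K u u' u'') {φ : Plane → Space}
    (h1 : ContDiff ℝ ∞ φ) (h2 : HasCompactSupport φ) :
    ContinuousOn (fun t => ∫ x, inner ℝ (φ x) (schrodingerField (u t) (u'' t) x)) I := by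
  have key : ∀ k, ContinuousOn (fun t => ∫ x, inner ℝ
      (vecProd (fderiv ℝ φ x (EuclideanSpace.single k 1)) (u t x)) (u' t k x)) I := fun k s hs => by
    obtain ⟨χ, hχ⟩ : ∃ χ : Plane → Space, χ = fun x => fderiv ℝ φ x (EuclideanSpace.single k 1) :=
      ⟨_, rfl⟩
    have hχm : MemLp χ 2 volume := by
      rw [hχ]; exact (IsSobolev.of_contDiff h1 h2).memLp_partial k
    have hz : ∀ t ∈ I, MemLp (fun x => vecProd (χ x) (u t x)) 2 volume := fun t ht =>
      memLp_bilin_of_bound (C := 1) crossL.flip (h.sphere t ht).bdd.aesm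
        ((h.sphere t ht).norm_eq.mono fun _ hx => hx.le) hχm
    -- `⟪χ × u t, u' t k⟫` is the product of a strongly and a weakly convergent factor
    have hw := h.tendsto_inner_partial hs k (hz s hs)
    have hr : Tendsto (fun t => ∫ x, inner ℝ (vecProd (χ x) ((u t - u s) x)) (u' t k x)) (𝓝[I] s)
        (𝓝 0) := by
      rw [tendsto_zero_iff_enorm_tendsto_zero]
      have h3 : Tendsto (fun t => eLpNorm (u t - u s) ⊤ volume * eLpNorm χ 2 volume * K) (𝓝[I] s)
          (𝓝 (0 * eLpNorm χ 2 volume * K)) :=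
        ENNReal.Tendsto.mul_const (ENNReal.Tendsto.mul_const ((h.continuous s (h.subset hs)).mono_left
          nhdsWithin_le_nhds) (Or.inr hχm.2.ne)) (Or.inr (by simp))
      rw [zero_mul, zero_mul] at h3
      refine tendsto_of_tendsto_of_tendsto_of_le_of_le' tendsto_const_nhds h3
        (Eventually.of_forall fun _ => zero_le) ?_
      filter_upwards [self_mem_nhdsWithin] with t ht
      have hd : AEStronglyMeasurable (u t - u s) volume :=
        (h.sphere t ht).bdd.aesm.sub (h.sphere s hs).bdd.aesm
      refine (enorm_integral_inner_le_two (crossL.aestronglyMeasurable_bilin hχm.1 hd)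
        ((h.sphere t ht).sobolev k).memLp.1).trans ?_
      refine mul_le_mul' ?_ (h.bound t ht k)
      have h4 := eLpNorm_le_eLpNorm_top_mul_eLpNorm 2 (u t - u s) hχm.1
        (fun x y => vecProd y x) 1 (ae_of_all _ fun x => ?_)
      · simpa using h4
      · rw [one_mul, mul_comm, ← NNReal.coe_le_coe]
        exact norm_vecProd_le _ _
    suffices hc : ContinuousWithinAt (fun t => ∫ x, inner ℝ (vecProd (χ x) (u t x)) (u' t k x)) I s by
      rw [hχ] at hc
      exact hc
    have := hr.add hw
    rw [zero_add] at this
    refine this.congr' ?_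
    filter_upwards [self_mem_nhdsWithin] with t ht
    have hu := ((h.sphere t ht).sobolev k).memLp
    have e : (fun x => vecProd (χ x) ((u t - u s) x)) =
        fun x => vecProd (χ x) (u t x) - vecProd (χ x) (u s x) := by
      ext1 x
      rw [← crossL_apply, Pi.sub_apply, map_sub, crossL_apply, crossL_apply]
    have hd : ∀ x, vecProd (χ x) ((u t - u s) x) = vecProd (χ x) (u t x) - vecProd (χ x) (u s x) :=
      fun x => congrFun e x
    rw [← integral_add]
    · simp only [hd, inner_sub_left, sub_add_cancel]
    · simp only [hd]
      exact integrable_inner ((hz t ht).sub (hz s hs)) hu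
    · exact integrable_inner (hz s hs) hu
  refine ContinuousOn.congr (f := fun t => -∑ k, ∫ x, inner ℝ
    (vecProd (fderiv ℝ φ x (EuclideanSpace.single k 1)) (u t x)) (u' t k x)) ?_
    fun t ht => h.integral_inner_field h1 h2 ht
  exact (continuousOn_finsetSum _ fun k _ => key k).neg

theorem enorm_inner_field_le (h : IsSchrodingerFlow T I K u u' u'') {φ : Plane → Space}
    (hφ : MemLp φ 2 volume) {t : ℝ} (ht : t ∈ I) :
    ‖∫ x, inner ℝ (φ x) (schrodingerField (u t) (u'' t) x)‖ₑ ≤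
      eLpNorm φ 2 volume * ((2 * K : ℝ≥0) : ℝ≥0∞) :=
  (enorm_integral_inner_le_two hφ.1 (h.sphere t ht).memLp_schrodingerField.1).trans
    (mul_le_mul_right (h.eLpNorm_field_le ht) _)

end IsSchrodingerFlow

end Flow

/-! ### Difference quotients in time -/

section Quotient

/-- Time steps which shrink to `0`. -/
noncomputable def timeStep (n : ℕ) : ℝ := ((n : ℝ) + 1)⁻¹

theorem timeStep_pos (n : ℕ) : 0 < timeStep n := by unfold timeStep; positivity

theorem tendsto_timeStep : Tendsto timeStep atTop (𝓝 0) := tendsto_inv_nat_add_one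

theorem eventually_sub_timeStep_mem {T t : ℝ} (ht : t ∈ Ioo 0 T) :
    ∀ᶠ n in atTop, t - timeStep n ∈ Ioo 0 T := by
  have h : Tendsto (fun n => t - timeStep n) atTop (𝓝 (t - 0)) := tendsto_timeStep.const_sub t
  rw [sub_zero] at h
  exact h.eventually (isOpen_Ioo.mem_nhds ht)

namespace IsSchrodingerFlow

variable {T : ℝ} {I : Set ℝ} {K : ℝ≥0} {u : ℝ → Plane → Space} {u' : ℝ → Fin 2 → Plane → Space}
  {u'' : ℝ → Fin 2 → Fin 2 → Plane → Space}

theorem integrable_inner_left (h : IsSchrodingerFlow T I K u u' u'') {φ : Plane → Space}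
    (hφ : Integrable φ volume) {t : ℝ} (ht : t ∈ Ioo 0 T) :
    Integrable (fun x => inner ℝ (φ x) (u t x)) volume := by
  refine hφ.norm.mono' (hφ.1.inner (h.aesm t ht)) ?_
  filter_upwards [h.norm_eq t ht] with x hx
  simpa [hx] using norm_inner_le_norm (𝕜 := ℝ) (φ x) (u t x)

theorem integrable_time_inner (h : IsSchrodingerFlow T I K u u' u'') {φ : Plane → Space}
    (hφ : Integrable φ volume) :
    Integrable (fun t => ∫ x, inner ℝ (φ x) (u t x)) (volume.restrict (Ioo 0 T)) :=
  Integrable.of_bound ((h.continuousOn_inner hφ).aestronglyMeasurable measurableSet_Ioo) _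
    ((ae_restrict_iff' measurableSet_Ioo).2 (ae_of_all _ fun _ ht => h.enorm_inner_le hφ ht))

theorem ae_norm_inner_field_le (h : IsSchrodingerFlow T I K u u' u'') {φ : Plane → Space}
    (hφ : MemLp φ 2 volume) : ∀ᵐ t ∂(volume.restrict (Ioo 0 T)),
    ‖∫ x, inner ℝ (φ x) (schrodingerField (u t) (u'' t) x)‖ ≤
      (eLpNorm φ 2 volume * ((2 * K : ℝ≥0) : ℝ≥0∞)).toReal := by
  filter_upwards [h.ae_mem] with t ht
  rw [← toReal_enorm]
  exact ENNReal.toReal_mono (ENNReal.mul_ne_top hφ.2.ne ENNReal.coe_ne_top) (h.enorm_inner_field_le hφ ht)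

theorem aesm_inner_field (h : IsSchrodingerFlow T I K u u' u'') {φ : Plane → Space}
    (h1 : ContDiff ℝ ∞ φ) (h2 : HasCompactSupport φ) :
    AEStronglyMeasurable (fun t => ∫ x, inner ℝ (φ x) (schrodingerField (u t) (u'' t) x))
      (volume.restrict (Ioo 0 T)) := by
  rw [h.restrict_eq]
  exact (h.continuousOn_inner_field h1 h2).aestronglyMeasurable h.measurableSet

theorem integrable_time_inner_field (h : IsSchrodingerFlow T I K u u' u'') {φ : Plane → Space}
    (h1 : ContDiff ℝ ∞ φ) (h2 : HasCompactSupport φ) :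
    Integrable (fun t => ∫ x, inner ℝ (φ x) (schrodingerField (u t) (u'' t) x))
      (volume.restrict (Ioo 0 T)) :=
  Integrable.of_bound (h.aesm_inner_field h1 h2) _
    (h.ae_norm_inner_field_le (h1.continuous.memLp_of_hasCompactSupport h2))

theorem _root_.integrable_of_inner {μ : Measure ℝ} {A : ℝ → Space}
    (hA : ∀ e : Space, Integrable (fun t => inner ℝ e (A t)) μ) : Integrable A μ := by
  have b := EuclideanSpace.basisFun (Fin 3) ℝ
  have : A = fun t => ∑ i, inner ℝ (b i) (A t) • b i := by
    ext1 t; exact (b.sum_repr' (A t)).symm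
  rw [this]
  exact integrable_finsetSum _ fun i _ => (hA (b i)).smul_const (b i)

theorem _root_.integrable_test_mul {μ : Measure ℝ} {θ g : ℝ → ℝ} (h1 : Continuous θ)
    (h2 : HasCompactSupport θ) (hg : Integrable g μ) : Integrable (fun t => θ t * g t) μ := by
  obtain ⟨C, hC⟩ := h1.bounded_above_of_compact_support h2
  exact hg.bdd_mul h1.aestronglyMeasurable (ae_of_all _ hC)

/-- The equation `∂_t u = u × Δ u`, tested in space against a vector field. -/
theorem integral_deriv_mul_inner (h : IsSchrodingerFlow T I K u u' u'') {φ : Plane → Space}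
    (h1 : ContDiff ℝ ∞ φ) (h2 : HasCompactSupport φ) {θ : ℝ → ℝ} (hθ : ContDiff ℝ ∞ θ)
    (hc : HasCompactSupport θ) (hT : tsupport θ ⊆ Ioo 0 T) :
    ∫ t in Ioo 0 T, deriv θ t * ∫ x, inner ℝ (φ x) (u t x) =
      -∫ t in Ioo 0 T, θ t * ∫ x, inner ℝ (φ x) (schrodingerField (u t) (u'' t) x) := by
  have hθ' : Continuous (deriv θ) := hθ.continuous_deriv (by simp)
  have hc' : HasCompactSupport (deriv θ) := hc.deriv
  -- the equation for the scalar test function `χ`, paired with a fixed vector `e`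
  have key : ∀ (χ : Plane → ℝ) (e : Space), ContDiff ℝ ∞ χ → HasCompactSupport χ →
      ∫ t in Ioo 0 T, deriv θ t * ∫ x, inner ℝ (χ x • e) (u t x) =
      -∫ t in Ioo 0 T, θ t * ∫ x, inner ℝ (χ x • e) (schrodingerField (u t) (u'' t) x) := by
    intro χ e hχ hχc
    have hs : ∀ e : Space, ContDiff ℝ ∞ fun x => χ x • e := fun e => hχ.smul contDiff_const
    have hsc : ∀ e : Space, HasCompactSupport fun x => χ x • e := fun e => hχc.smul_right
    have a1 : ∀ t ∈ Ioo 0 T, ∀ e : Space, ∫ x, inner ℝ (χ x • e) (u t x) =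
        inner ℝ e (∫ x, χ x • u t x) := fun t ht e => by
      rw [← integral_inner]
      · simp only [inner_smul_left, inner_smul_right, conj_trivial]
      · exact (LocL2.of_bound (h.aesm t ht) ((h.norm_eq t ht).mono fun _ hx => hx.le)
          |>.locallyIntegrable).integrable_test_smul hχ.continuous hχc
    have a2 : ∀ t ∈ I, ∀ e : Space, ∫ x, inner ℝ (χ x • e) (schrodingerField (u t) (u'' t) x) =
        inner ℝ e (∫ x, χ x • schrodingerField (u t) (u'' t) x) := fun t ht e => by
      rw [← integral_inner]
      · simp only [inner_smul_left, inner_smul_right, conj_trivial]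
      · exact ((h.sphere t ht).memLp_schrodingerField.locL2.locallyIntegrable).integrable_test_smul
          hχ.continuous hχc
    have i1 : Integrable (fun t => ∫ x, χ x • u t x) (volume.restrict (Ioo 0 T)) :=
      integrable_of_inner fun e => (h.integrable_time_inner
        ((hs e).continuous.integrable_of_hasCompactSupport (hsc e))).congr
        ((ae_restrict_iff' measurableSet_Ioo).2 (ae_of_all _ fun t ht => a1 t ht e))
    have i2 : Integrable (fun t => ∫ x, χ x • schrodingerField (u t) (u'' t) x)
        (volume.restrict (Ioo 0 T)) :=
      integrable_of_inner fun e => (h.integrable_time_inner_field (hs e) (hsc e)).congr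
        (h.ae_mem.mono fun t ht => a2 t ht e)
    have j : ∀ {η : ℝ → ℝ} {A : ℝ → Space}, Continuous η → HasCompactSupport η →
        Integrable A (volume.restrict (Ioo 0 T)) →
        Integrable (fun t => η t • A t) (volume.restrict (Ioo 0 T)) := fun {η A} k1 k2 k3 =>
      integrable_of_inner fun e => by
        simp only [inner_smul_right]
        exact integrable_test_mul k1 k2 (k3.const_inner e)
    have h3 := congrArg (inner ℝ e) (h.equation θ χ hθ hc hT hχ hχc)
    rw [inner_neg_right, ← integral_inner (j hθ' hc' i1), ← integral_inner (j hθ.continuous hc i2)]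
      at h3
    simp only [inner_smul_right] at h3
    refine (integral_congr_ae ?_).trans (h3.trans (congrArg Neg.neg (integral_congr_ae ?_)))
    · refine (ae_restrict_iff' measurableSet_Ioo).2 (ae_of_all _ fun t ht => ?_)
      simp only [a1 t ht e]
    · filter_upwards [h.ae_mem] with t ht
      simp only [a2 t ht e]
  -- decompose the vector field `φ` into components
  have b := EuclideanSpace.basisFun (Fin 3) ℝ
  have hφi : ∀ i, ContDiff ℝ ∞ fun x => inner ℝ (b i) (φ x) := fun i =>
    contDiff_const.inner ℝ h1
  have hφc : ∀ i, HasCompactSupport fun x => inner ℝ (b i) (φ x) := fun i =>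
    h2.comp_left (g := fun y => inner ℝ (b i) y) (inner_zero_right _)
  have hs : ∀ i, ContDiff ℝ ∞ fun x => (inner ℝ (b i) (φ x) : ℝ) • b i :=
    fun i => (hφi i).smul contDiff_const
  have hsc : ∀ i, HasCompactSupport fun x => (inner ℝ (b i) (φ x) : ℝ) • b i :=
    fun i => (hφc i).smul_right
  have e1 : ∀ t ∈ I, ∀ v : Plane → Space, (∀ i, Integrable (fun x => inner ℝ
      ((inner ℝ (b i) (φ x) : ℝ) • b i) (v x)) volume) → ∫ x, inner ℝ (φ x) (v x) =
      ∑ i, ∫ x, inner ℝ ((inner ℝ (b i) (φ x) : ℝ) • b i) (v x) := fun t _ v hv => by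
    rw [← integral_finsetSum _ fun i _ => hv i]
    simp only [← sum_inner, b.sum_repr']
  have k1 : ∀ t ∈ I, ∫ x, inner ℝ (φ x) (u t x) =
      ∑ i, ∫ x, inner ℝ ((inner ℝ (b i) (φ x) : ℝ) • b i) (u t x) := fun t ht =>
    e1 t ht _ fun i => h.integrable_inner_left
      ((hs i).continuous.integrable_of_hasCompactSupport (hsc i)) (h.subset ht)
  have k2 : ∀ t ∈ I, ∫ x, inner ℝ (φ x) (schrodingerField (u t) (u'' t) x) =
      ∑ i, ∫ x, inner ℝ ((inner ℝ (b i) (φ x) : ℝ) • b i) (schrodingerField (u t) (u'' t) x) :=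
    fun t ht => e1 t ht _ fun i => integrable_inner
      ((hs i).continuous.memLp_of_hasCompactSupport (hsc i)) (h.sphere t ht).memLp_schrodingerField
  rw [integral_congr_ae (h.ae_mem.mono fun t ht => congrArg (deriv θ t * ·) (k1 t ht)),
    integral_congr_ae (h.ae_mem.mono fun t ht => congrArg (θ t * ·) (k2 t ht))]
  simp only [Finset.mul_sum]
  rw [integral_finsetSum _ fun i _ => integrable_test_mul hθ' hc' (h.integrable_time_inner
      ((hs i).continuous.integrable_of_hasCompactSupport (hsc i))),
    integral_finsetSum _ fun i _ => integrable_test_mul hθ.continuous hc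
      (h.integrable_time_inner_field (hs i) (hsc i)), ← Finset.sum_neg_distrib]
  exact Finset.sum_congr rfl fun i _ => key _ _ (hφi i) (hφc i)

/-- The increments of `⟨φ, u⟩` are the integrals of `⟨φ, u × Δ u⟩`. -/
theorem inner_sub_inner (h : IsSchrodingerFlow T I K u u' u'') {φ : Plane → Space}
    (h1 : ContDiff ℝ ∞ φ) (h2 : HasCompactSupport φ) {s t : ℝ} (hs : s ∈ Ioo 0 T)
    (ht : t ∈ Ioo 0 T) (hst : s ≤ t) :
    (∫ x, inner ℝ (φ x) (u t x)) - ∫ x, inner ℝ (φ x) (u s x) =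
      ∫ τ in s..t, ∫ x, inner ℝ (φ x) (schrodingerField (u τ) (u'' τ) x) :=
  sub_eq_integral_of_weak_deriv
    (h.continuousOn_inner (h1.continuous.integrable_of_hasCompactSupport h2))
    (h.integrable_time_inner (h1.continuous.integrable_of_hasCompactSupport h2))
    (h.aesm_inner_field h1 h2)
    (h.ae_norm_inner_field_le (h1.continuous.memLp_of_hasCompactSupport h2))
    (fun _ hθ hc hT => h.integral_deriv_mul_inner h1 h2 hθ hc hT) hs ht hst

/-- The flow is Lipschitz continuous in `L²`. -/
theorem eLpNorm_time_sub_le (h : IsSchrodingerFlow T I K u u' u'') {s t : ℝ} (hs : s ∈ Ioo 0 T)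
    (ht : t ∈ Ioo 0 T) :
    eLpNorm (u t - u s) 2 volume ≤ ENNReal.ofReal (2 * K * |t - s|) := by
  wlog hst : s ≤ t generalizing s t
  · rw [eLpNorm_sub_comm, abs_sub_comm]
    exact this ht hs (le_of_not_ge hst)
  have hm : AEStronglyMeasurable (u t - u s) volume := (h.aesm t ht).sub (h.aesm s hs)
  have hle : ∀ᵐ x, ‖(u t - u s) x‖ ≤ 2 := by
    filter_upwards [h.norm_eq t ht, h.norm_eq s hs] with x h1 h2
    refine (norm_sub_le _ _).trans ?_
    rw [h1, h2]; norm_num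
  refine eLpNorm_le_of_integral_inner_le (C := (2 * K * |t - s|).toNNReal) (LocL2.of_bound hm hle) hm
    fun φ h1 h2 => ?_
  have hφ : Integrable φ volume := h1.continuous.integrable_of_hasCompactSupport h2
  have hφm : MemLp φ 2 volume := h1.continuous.memLp_of_hasCompactSupport h2
  simp only [Pi.sub_apply, inner_sub_right]
  rw [integral_sub (h.integrable_inner_left hφ ht) (h.integrable_inner_left hφ hs),
    h.inner_sub_inner h1 h2 hs ht hst]
  have h3 : ‖∫ τ in s..t, ∫ x, inner ℝ (φ x) (schrodingerField (u τ) (u'' τ) x)‖ ≤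
      (eLpNorm φ 2 volume * ((2 * K : ℝ≥0) : ℝ≥0∞)).toReal * |t - s| := by
    refine intervalIntegral.norm_integral_le_of_norm_le_const_ae ?_
    have := (ae_restrict_iff' measurableSet_Ioo).1 (h.ae_norm_inner_field_le hφm)
    filter_upwards [this] with τ hτ hτ'
    rw [uIoc_of_le hst] at hτ'
    exact hτ ⟨hs.1.trans hτ'.1, hτ'.2.trans_lt ht.2⟩
  rw [← ofReal_norm]
  refine (ENNReal.ofReal_le_ofReal h3).trans (le_of_eq ?_)
  rw [ENNReal.ofReal_mul ENNReal.toReal_nonneg, ENNReal.ofReal_toReal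
    (ENNReal.mul_ne_top hφm.2.ne ENNReal.coe_ne_top), ← ENNReal.ofReal, ENNReal.ofReal_mul (by positivity)]
  have : ENNReal.ofReal (2 * K) = ((2 * K : ℝ≥0) : ℝ≥0∞) := by
    rw [← ENNReal.ofReal_coe_nnreal]; norm_num
  rw [this, mul_comm (eLpNorm φ 2 volume), mul_right_comm]

/-- At almost every time the difference quotients of `u` converge weakly in `L²` to `u × Δ u`. -/
theorem ae_tendsto_quotient (h : IsSchrodingerFlow T I K u u' u'') :
    ∀ᵐ t ∂(volume.restrict (Ioo 0 T)), ∀ ψ : Plane → Space, MemLp ψ 2 volume →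
      Tendsto (fun n => (timeStep n)⁻¹ * ∫ x, inner ℝ (ψ x) (u t x - u (t - timeStep n) x)) atTop
        (𝓝 (∫ x, inner ℝ (ψ x) (schrodingerField (u t) (u'' t) x))) := by
  obtain ⟨S, hSc, hS, hd⟩ := exists_countable_dense_test
  have key : ∀ φ ∈ S, ∀ᵐ t ∂(volume.restrict (Ioo 0 T)),
      Tendsto (fun n => (timeStep n)⁻¹ * ∫ x, inner ℝ (φ x) (u t x - u (t - timeStep n) x)) atTop
        (𝓝 (∫ x, inner ℝ (φ x) (schrodingerField (u t) (u'' t) x))) := fun φ hφ => by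
    obtain ⟨h1, h2⟩ := hS φ hφ
    have hφi : Integrable φ volume := h1.continuous.integrable_of_hasCompactSupport h2
    obtain ⟨f, hf⟩ : ∃ f : ℝ → ℝ, f = fun t => ∫ x, inner ℝ (φ x)
      (schrodingerField (u t) (u'' t) x) := ⟨_, rfl⟩
    have hfi : Integrable ((Ioo 0 T).indicator f) volume := by
      rw [integrable_indicator_iff measurableSet_Ioo, hf]
      exact h.integrable_time_inner_field h1 h2
    rw [ae_restrict_iff' measurableSet_Ioo]
    -- Lebesgue's differentiation theorem for the integral of `f`
    filter_upwards [LocallyIntegrable.ae_hasDerivAt_integral hfi.locallyIntegrable] with t ht htT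
    have h3 := (hasDerivAt_iff_tendsto_slope_zero.1 (ht 0))
    have h4 : Tendsto (fun n => -timeStep n) atTop (𝓝[≠] 0) := by
      refine tendsto_nhdsWithin_iff.2 ⟨by simpa using tendsto_timeStep.neg, ?_⟩
      exact Eventually.of_forall fun n => (neg_neg_of_pos (timeStep_pos n)).ne
    have h5 := h3.comp h4
    rw [indicator_of_mem htT] at h5
    have e : f t = ∫ x, inner ℝ (φ x) (schrodingerField (u t) (u'' t) x) := by rw [hf]
    rw [← e]
    refine h5.congr' ?_
    filter_upwards [eventually_sub_timeStep_mem htT] with n hn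
    have hle : t - timeStep n ≤ t := by linarith [timeStep_pos n]
    simp only [inner_sub_right]
    rw [integral_sub (h.integrable_inner_left hφi htT) (h.integrable_inner_left hφi hn),
      h.inner_sub_inner h1 h2 hn htT hle, Function.comp_apply, ← sub_eq_add_neg, smul_eq_mul,
      intervalIntegral.integral_interval_sub_left hfi.intervalIntegrable hfi.intervalIntegrable,
      intervalIntegral.integral_symm, inv_neg, neg_mul_neg]
    congr 1
    refine intervalIntegral.integral_congr fun τ hτ => ?_
    rw [uIcc_of_le hle] at hτ
    have hm : τ ∈ Ioo 0 T := ⟨hn.1.trans_le hτ.1, hτ.2.trans_lt htT.2⟩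
    rw [indicator_of_mem hm, hf]
  -- countably many test functions suffice, because the quotients are bounded in `L²`
  have hall := (ae_ball_iff hSc).2 key
  filter_upwards [hall, h.ae_mem] with t ht htI ψ hψ
  have htT := h.subset htI
  have hm : ∀ᶠ n in atTop, MemLp (fun x => (timeStep n)⁻¹ • (u t x - u (t - timeStep n) x)) 2
      volume ∧ eLpNorm (fun x => (timeStep n)⁻¹ • (u t x - u (t - timeStep n) x)) 2 volume ≤
        ((2 * K : ℝ≥0) : ℝ≥0∞) := by
    filter_upwards [eventually_sub_timeStep_mem htT] with n hn
    have h1 := h.eLpNorm_time_sub_le hn htT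
    rw [sub_sub_cancel, abs_of_pos (timeStep_pos n)] at h1
    have h2 : eLpNorm (fun x => (timeStep n)⁻¹ • (u t x - u (t - timeStep n) x)) 2 volume ≤
        ((2 * K : ℝ≥0) : ℝ≥0∞) := by
      have := eLpNorm_const_smul (timeStep n)⁻¹ (u t - u (t - timeStep n)) 2 volume
      refine (this.le.trans (mul_le_mul_right h1 _)).trans (le_of_eq ?_)
      rw [Real.enorm_eq_ofReal (inv_nonneg.2 (timeStep_pos n).le), ← ENNReal.ofReal_mul
        (inv_nonneg.2 (timeStep_pos n).le), mul_comm (2 * (K : ℝ)), inv_mul_cancel_left₀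
        (timeStep_pos n).ne', ← ENNReal.ofReal_coe_nnreal]
      norm_num
    exact ⟨⟨((h.aesm t htT).sub (h.aesm _ hn)).const_smul (timeStep n)⁻¹, h2.trans_lt ENNReal.coe_lt_top⟩, h2⟩
  have e : ∀ (φ : Plane → Space) n, (timeStep n)⁻¹ * ∫ x, inner ℝ (φ x)
      (u t x - u (t - timeStep n) x) =
      ∫ x, inner ℝ (φ x) ((timeStep n)⁻¹ • (u t x - u (t - timeStep n) x)) := fun φ n => by
    rw [← integral_const_mul]
    simp only [inner_smul_right]
  simp only [e] at ht ⊢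
  exact tendsto_integral_inner_of_dense
    (fun φ hφ => (hS φ hφ).1.continuous.memLp_of_hasCompactSupport (hS φ hφ).2) hd
    (hm.mono fun _ hn => hn.1) (hm.mono fun _ hn => hn.2)
    (h.sphere t htI).memLp_schrodingerField ht hψ

end IsSchrodingerFlow

end Quotient

/-! ### Increments of the reflections -/

section Increment

/-- The first-order Taylor expansion of the scaling factor of the bisector. -/
theorem abs_biScale_sub_le {x y K : ℝ} (hx : -1 < x) (hy : -1 < y) (hxK : biScale x ≤ K)
    (hyK : biScale y ≤ K) : |biScale x - biScale y| ≤ K ^ 3 * |x - y| ∧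
      |biScale x - biScale y + biScale x ^ 3 * (x - y)| ≤ 2 * K ^ 5 * (x - y) ^ 2 := by
  obtain ⟨l, hl⟩ : ∃ l, l = biScale x := ⟨_, rfl⟩
  obtain ⟨k, hk⟩ : ∃ k, k = biScale y := ⟨_, rfl⟩
  have l0 : 0 < l := hl ▸ biScale_pos hx
  have k0 : 0 < k := hk ▸ biScale_pos hy
  have l1 : l ^ 2 * (2 + 2 * x) = 1 := hl ▸ biScale_sq hx
  have k1 : k ^ 2 * (2 + 2 * y) = 1 := hk ▸ biScale_sq hy
  rw [← hl, ← hk]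
  rw [← hl] at hxK
  rw [← hk] at hyK
  have K0 : 0 < K := l0.trans_le hxK
  have hlk : l * k ≤ K * K := by gcongr
  -- `l - k = -2 l² k² (x - y) / (l + k)`, because `l⁻² - k⁻² = 2 (x - y)`
  have e : (l - k) * (l + k) = -2 * l ^ 2 * k ^ 2 * (x - y) := by
    linear_combination (-l ^ 2) * k1 + k ^ 2 * l1
  have e1 : |l - k| * (l + k) = 2 * l ^ 2 * k ^ 2 * |x - y| := by
    have := congrArg abs e
    have h0 : -2 * l ^ 2 * k ^ 2 < 0 := by nlinarith [mul_pos (pow_pos l0 2) (pow_pos k0 2)]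
    rw [abs_mul, abs_of_pos (by positivity : 0 < l + k), abs_mul, abs_of_neg h0] at this
    rw [this]; ring
  have h1 : |l - k| ≤ K ^ 3 * |x - y| := by
    refine le_of_mul_le_mul_right ?_ (by positivity : 0 < l + k)
    rw [e1]
    have h2 : 2 * l ^ 2 * k ^ 2 ≤ K ^ 3 * (l + k) := by
      have h3 : 2 * (l * k) ≤ K * (l + k) := by nlinarith
      calc 2 * l ^ 2 * k ^ 2 = (l * k) * (2 * (l * k)) := by ring
        _ ≤ (K * K) * (K * (l + k)) := by gcongr
        _ = _ := by ring
    calc _ ≤ K ^ 3 * (l + k) * |x - y| := by gcongr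
      _ = _ := by ring
  refine ⟨h1, ?_⟩
  have e2 : (l - k + l ^ 3 * (x - y)) * (l + k) = l ^ 2 * (l - k) * (l + 2 * k) * (x - y) := by
    linear_combination e
  have e3 : |l - k + l ^ 3 * (x - y)| * (l + k) = l ^ 2 * |l - k| * (l + 2 * k) * |x - y| := by
    have := congrArg abs e2
    rwa [abs_mul, abs_of_pos (by positivity : 0 < l + k), abs_mul, abs_mul, abs_mul,
      abs_of_pos (by positivity : 0 < l ^ 2), abs_of_pos (by positivity : 0 < l + 2 * k)] at this
  refine le_of_mul_le_mul_right ?_ (by positivity : 0 < l + k)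
  rw [e3]
  have hK2 : l ^ 2 ≤ K ^ 2 := by gcongr
  calc _ ≤ K ^ 2 * (K ^ 3 * |x - y|) * (2 * (l + k)) * |x - y| := by
        gcongr
        linarith
    _ = 2 * K ^ 5 * |x - y| ^ 2 * (l + k) := by ring
    _ = _ := by rw [sq_abs]

variable {a b p q : Space} {c : ℝ}

/-- The first-order Taylor expansion of the bisector of two unit vectors. -/
theorem norm_bisector_sub_le (ha : ‖a‖ = 1) (hb : ‖b‖ = 1) (hp : ‖p‖ = 1)
    (hc : -1 < c) (hab : c ≤ inner ℝ a b) (hpq : c ≤ inner ℝ p q) :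
    ‖bisector a b - bisector p q‖ ≤ 3 * frameConst c ^ 3 * (‖a - p‖ + ‖b - q‖) ∧
      ‖bisector a b - bisector p q - bisectorDeriv a b (a - p) (b - q)‖ ≤
        7 * frameConst c ^ 5 * (‖a - p‖ + ‖b - q‖) ^ 2 := by
  obtain ⟨K, hK⟩ : ∃ K, K = frameConst c := ⟨_, rfl⟩
  obtain ⟨d, hd⟩ : ∃ d, d = ‖a - p‖ + ‖b - q‖ := ⟨_, rfl⟩
  have K1 : 1 ≤ K := hK ▸ one_le_frameConst hc
  have d0 : 0 ≤ d := hd ▸ by positivity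
  have hl : biScale (inner ℝ a b) ≤ K := by
    have := abs_biScale_le hc hab
    exact hK ▸ (le_abs_self _).trans this
  have hk : |biScale (inner ℝ p q)| ≤ K := hK ▸ abs_biScale_le hc hpq
  obtain ⟨s1, s2⟩ := abs_biScale_sub_le (hc.trans_le hab) (hc.trans_le hpq) hl
    ((le_abs_self _).trans hk)
  have hx : inner ℝ a b - inner ℝ p q = (inner ℝ (a - p) b + inner ℝ a (b - q) : ℝ) -
      inner ℝ (a - p) (b - q) := by
    simp only [inner_sub_left, inner_sub_right]; ring
  have hin : ∀ v w : Space, |(inner ℝ v w : ℝ)| ≤ ‖v‖ * ‖w‖ := fun v w => abs_real_inner_le_norm v w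
  have i1 : |inner ℝ a b - inner ℝ p q| ≤ d := by
    have : inner ℝ a b - inner ℝ p q = (inner ℝ (a - p) b + inner ℝ p (b - q) : ℝ) := by
      simp only [inner_sub_left, inner_sub_right]; ring
    rw [this, hd]
    refine (abs_add_le _ _).trans (add_le_add ((hin _ _).trans ?_) ((hin _ _).trans ?_))
    · rw [hb, mul_one]
    · rw [hp, one_mul]
  have i2 : |(inner ℝ (a - p) (b - q) : ℝ)| ≤ d ^ 2 := by
    refine (hin _ _).trans ?_
    rw [hd]; nlinarith [norm_nonneg (a - p), norm_nonneg (b - q)]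
  have j1 : |biScale (inner ℝ a b) - biScale (inner ℝ p q)| ≤ K ^ 3 * d := s1.trans (by gcongr)
  have j2 : |biScale (inner ℝ a b) - biScale (inner ℝ p q) - biScaleDeriv a b (a - p) (b - q)| ≤
      3 * K ^ 5 * d ^ 2 := by
    have e : biScale (inner ℝ a b) - biScale (inner ℝ p q) - biScaleDeriv a b (a - p) (b - q) =
        (biScale (inner ℝ a b) - biScale (inner ℝ p q) +
          biScale (inner ℝ a b) ^ 3 * (inner ℝ a b - inner ℝ p q)) +
        biScale (inner ℝ a b) ^ 3 * inner ℝ (a - p) (b - q) := by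
      rw [biScaleDeriv, hx]; ring
    have h0 := (biScale_pos (hc.trans_le hab)).le
    have h3 : (inner ℝ a b - inner ℝ p q) ^ 2 ≤ d ^ 2 := by
      rw [← sq_abs]; gcongr
    have h4 : K ^ 3 ≤ K ^ 5 := pow_le_pow_right₀ K1 (by norm_num)
    rw [e]
    refine (abs_add_le _ _).trans ?_
    rw [abs_mul _ (inner ℝ (a - p) (b - q)), abs_of_nonneg (by positivity : 0 ≤ biScale (inner ℝ a b) ^ 3)]
    calc _ ≤ 2 * K ^ 5 * d ^ 2 + K ^ 3 * d ^ 2 := by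
          gcongr
          exact s2.trans (by gcongr)
      _ ≤ 2 * K ^ 5 * d ^ 2 + K ^ 5 * d ^ 2 := by gcongr
      _ = _ := by ring
  have hε : ‖(a - p) + (b - q)‖ ≤ d := hd ▸ norm_add_le _ _
  have h2 := norm_add_le_two ha hb
  have K3 : K ≤ K ^ 3 := le_self_pow₀ K1 (by norm_num)
  have K5 : K ^ 3 ≤ K ^ 5 := pow_le_pow_right₀ K1 (by norm_num)
  rw [← hK, ← hd]
  constructor
  · have e : bisector a b - bisector p q = (biScale (inner ℝ a b) - biScale (inner ℝ p q)) • (a + b) +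
        biScale (inner ℝ p q) • ((a - p) + (b - q)) := by
      rw [bisector, bisector]; module
    rw [e]
    refine (norm_add_le _ _).trans ?_
    rw [norm_smul, norm_smul, Real.norm_eq_abs, Real.norm_eq_abs]
    calc _ ≤ K ^ 3 * d * 2 + K * d := by gcongr
      _ ≤ K ^ 3 * d * 2 + K ^ 3 * d := by gcongr
      _ = _ := by ring
  · have e : bisector a b - bisector p q - bisectorDeriv a b (a - p) (b - q) =
        (biScale (inner ℝ a b) - biScale (inner ℝ p q) - biScaleDeriv a b (a - p) (b - q)) • (a + b) -
          (biScale (inner ℝ a b) - biScale (inner ℝ p q)) • ((a - p) + (b - q)) := by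
      rw [bisector, bisector, bisectorDeriv]; module
    rw [e]
    refine (norm_sub_le _ _).trans ?_
    rw [norm_smul, norm_smul, Real.norm_eq_abs, Real.norm_eq_abs]
    calc _ ≤ 3 * K ^ 5 * d ^ 2 * 2 + K ^ 3 * d * d := by gcongr
      _ ≤ 3 * K ^ 5 * d ^ 2 * 2 + K ^ 5 * d * d := by gcongr
      _ = _ := by ring

/-- The first-order Taylor expansion of the reflection that transports `a` to `b`. -/
theorem norm_mirror_sub_le (ha : ‖a‖ = 1) (hb : ‖b‖ = 1) (hp : ‖p‖ = 1) (hq : ‖q‖ = 1)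
    (hc : -1 < c) (hab : c ≤ inner ℝ a b) (hpq : c ≤ inner ℝ p q) :
    ‖mirror (bisector a b) - mirror (bisector p q)‖ ≤
        12 * frameConst c ^ 3 * (‖a - p‖ + ‖b - q‖) ∧
      ‖mirror (bisector a b) - mirror (bisector p q) -
          mirrorDeriv (bisector a b) (bisectorDeriv a b (a - p) (b - q))‖ ≤
        46 * frameConst c ^ 6 * (‖a - p‖ + ‖b - q‖) ^ 2 := by
  obtain ⟨h1, h2⟩ := norm_bisector_sub_le ha hb hp hc hab hpq
  obtain ⟨K, hK⟩ : ∃ K, K = frameConst c := ⟨_, rfl⟩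
  obtain ⟨d, hd⟩ : ∃ d, d = ‖a - p‖ + ‖b - q‖ := ⟨_, rfl⟩
  have K1 : 1 ≤ K := hK ▸ one_le_frameConst hc
  have d0 : 0 ≤ d := hd ▸ by positivity
  have hn := norm_bisector ha hb (hc.trans_le hab)
  have hm := norm_bisector hp hq (hc.trans_le hpq)
  rw [← hK, ← hd] at h1 h2 ⊢
  obtain ⟨n, hn'⟩ : ∃ n, n = bisector a b := ⟨_, rfl⟩
  obtain ⟨m, hm'⟩ : ∃ m, m = bisector p q := ⟨_, rfl⟩
  obtain ⟨n₁, hn₁⟩ : ∃ n₁, n₁ = bisectorDeriv a b (a - p) (b - q) := ⟨_, rfl⟩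
  rw [← hn'] at hn
  rw [← hm'] at hm
  rw [← hn', ← hm', ← hn₁] at h2
  rw [← hn', ← hm'] at h1
  rw [← hn', ← hm', ← hn₁]
  have hD : ∀ v w : Space, ‖dyadL v w‖ ≤ ‖v‖ * ‖w‖ := norm_dyadL_le
  have s2 : ‖(-2 : ℝ)‖ = 2 := by norm_num
  constructor
  · have e : mirror n - mirror m = (-2 : ℝ) • (dyadL (n - m) n + dyadL m (n - m)) := by
      simp only [mirror, map_sub, sub_apply]; module
    rw [e, norm_smul, s2]
    have := norm_add_le (dyadL (n - m) n) (dyadL m (n - m))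
    have k1 := hD (n - m) n
    have k2 := hD m (n - m)
    rw [hn, mul_one] at k1
    rw [hm, one_mul] at k2
    linarith
  · have e : mirror n - mirror m - mirrorDeriv n n₁ = (-2 : ℝ) • (dyadL (n - m - n₁) n +
        dyadL n (n - m - n₁) - dyadL (n - m) (n - m)) := by
      simp only [mirror, mirrorDeriv, map_sub, sub_apply]; module
    rw [e, norm_smul, s2]
    have k0 := norm_sub_le (dyadL (n - m - n₁) n + dyadL n (n - m - n₁)) (dyadL (n - m) (n - m))
    have k1 := norm_add_le (dyadL (n - m - n₁) n) (dyadL n (n - m - n₁))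
    have k2 := hD (n - m - n₁) n
    have k3 := hD n (n - m - n₁)
    have k4 := hD (n - m) (n - m)
    rw [hn, mul_one] at k2
    rw [hn, one_mul] at k3
    have k5 : ‖n - m‖ * ‖n - m‖ ≤ (3 * K ^ 3 * d) * (3 * K ^ 3 * d) := by gcongr
    have k6 : 7 * K ^ 5 * d ^ 2 ≤ 7 * K ^ 6 * d ^ 2 := by
      gcongr
      · norm_num
    have k7 : (3 * K ^ 3 * d) * (3 * K ^ 3 * d) = 9 * K ^ 6 * d ^ 2 := by ring
    linarith

end Increment

/-! ### Continuity of the gradient in time -/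

section Gradient

namespace IsSchrodingerFlow

variable {T : ℝ} {I : Set ℝ} {K : ℝ≥0} {u : ℝ → Plane → Space} {u' : ℝ → Fin 2 → Plane → Space}
  {u'' : ℝ → Fin 2 → Fin 2 → Plane → Space}

theorem sobolev_sub (h : IsSchrodingerFlow T I K u u' u'') {s t : ℝ} (hs : s ∈ I) (ht : t ∈ I) :
    IsSobolev (u t - u s) (fun k => u' t k - u' s k) :=
  ⟨⟨(h.aesm t (h.subset ht)).sub (h.aesm s (h.subset hs)),
      (h.eLpNorm_time_sub_le (h.subset hs) (h.subset ht)).trans_lt ENNReal.ofReal_lt_top⟩,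
    fun k => ((h.sphere t ht).sobolev k).memLp.sub ((h.sphere s hs).sobolev k).memLp,
    fun k => ((h.sphere t ht).weak k).sub ((h.sphere s hs).weak k)⟩

/-- The gradient is Hölder continuous of exponent `1/2` in `L²`, by interpolation between the
Lipschitz continuity of `u` and the bound of its second derivatives. -/
theorem eLpNorm_partial_sub_sq_le (h : IsSchrodingerFlow T I K u u' u'') {s t : ℝ} (hs : s ∈ I)
    (ht : t ∈ I) (k : Fin 2) :
    eLpNorm (u' t k - u' s k) 2 volume ^ 2 ≤ ENNReal.ofReal (2 * K * |t - s|) * (K + K) := by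
  -- interpolate: `‖∂_k f‖² = -⟨f, ∂_k ∂_k f⟩` for `f = u t - u s`
  have h1 := h.sobolev_sub hs ht
  have h2 := ((h.sphere t ht).sobolev k).sub ((h.sphere s hs).sobolev k)
  have h3 := h1.integral_bilin innerL h2 k
  simp only [innerL_apply] at h3
  have h4 : eLpNorm (u' t k - u' s k) 2 volume ^ 2 =
      ‖∫ x, inner ℝ ((u' t k - u' s k) x) (u' t k x - u' s k x)‖ₑ := by
    have e : ∀ x, (inner ℝ ((u' t k - u' s k) x) (u' t k x - u' s k x) : ℝ) =
        ‖(u' t k - u' s k) x‖ ^ 2 := fun x => by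
      rw [← real_inner_self_eq_norm_sq, Pi.sub_apply]
    simp only [e]
    rw [Real.enorm_of_nonneg (integral_nonneg fun _ => by positivity),
      ofReal_integral_eq_lintegral_ofReal ((h1.memLp_partial k).integrable_norm_pow two_ne_zero)
      (ae_of_all _ fun _ => by positivity), sq_eLpNorm_two]
    refine lintegral_congr fun x => ?_
    rw [ENNReal.ofReal_pow (norm_nonneg _), ofReal_norm]
  rw [h4, h3, enorm_neg]
  refine (enorm_integral_inner_le_two h1.memLp.1 (h2.memLp_partial k).1).trans ?_
  refine mul_le_mul' (h.eLpNorm_time_sub_le (h.subset hs) (h.subset ht)) ?_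
  exact (eLpNorm_sub_le ((h.sphere t ht).sobolev k |>.memLp_partial k).1
    ((h.sphere s hs).sobolev k |>.memLp_partial k).1 (by norm_num)).trans
    (add_le_add (h.bound₂ t ht k k) (h.bound₂ s hs k k))

theorem tendsto_ofReal_abs_sub (s : ℝ) {C : ℝ} :
    Tendsto (fun t => ENNReal.ofReal (C * |t - s|)) (𝓝[I] s) (𝓝 0) := by
  have : Continuous fun t : ℝ => ENNReal.ofReal (C * |t - s|) :=
    ENNReal.continuous_ofReal.comp (by fun_prop)
  have h := (this.tendsto s).mono_left (nhdsWithin_le_nhds (s := I))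
  simpa using h

theorem tendsto_eLpNorm_partial (h : IsSchrodingerFlow T I K u u' u'') {s : ℝ} (hs : s ∈ I)
    (k : Fin 2) : Tendsto (fun t => eLpNorm (u' t k - u' s k) 2 volume) (𝓝[I] s) (𝓝 0) := by
  have h1 : Tendsto (fun t => (ENNReal.ofReal (2 * K * |t - s|) * (K + K)) ^ (1 / 2 : ℝ)) (𝓝[I] s)
      (𝓝 ((0 * (K + K)) ^ (1 / 2 : ℝ))) :=
    ((ENNReal.continuous_rpow_const (y := (1 / 2 : ℝ))).tendsto _).comp
      (ENNReal.Tendsto.mul_const (tendsto_ofReal_abs_sub s) (Or.inr (by simp)))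
  rw [zero_mul, ENNReal.zero_rpow_of_pos (by norm_num)] at h1
  refine tendsto_of_tendsto_of_tendsto_of_le_of_le' tendsto_const_nhds h1
    (Eventually.of_forall fun _ => zero_le) ?_
  filter_upwards [self_mem_nhdsWithin] with t ht
  exact le_rpow_half_of_sq_le (h.eLpNorm_partial_sub_sq_le hs ht k)

/-- The gradient is continuous in `L⁴`, by interpolation between `L²` and the bound in `L⁶`. -/
theorem tendsto_eLpNorm_partial_four (h : IsSchrodingerFlow T I K u u' u'') {s : ℝ} (hs : s ∈ I)
    (k : Fin 2) : Tendsto (fun t => eLpNorm (u' t k - u' s k) 4 volume) (𝓝[I] s) (𝓝 0) := by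
  obtain ⟨B, hB⟩ : ∃ B : ℝ≥0∞, B = ENNReal.ofReal (4 * √6) * ((K + K) + ∑ _k : Fin 2, ((K : ℝ≥0∞) + K)) :=
    ⟨_, rfl⟩
  have hBt : B ^ 3 ≠ ⊤ := by
    rw [hB]
    exact ENNReal.pow_ne_top (ENNReal.mul_ne_top ENNReal.ofReal_ne_top
      (ENNReal.add_ne_top.2 ⟨by simp, ENNReal.sum_ne_top.2 fun _ _ => by simp⟩))
  have h1 : Tendsto (fun t => (eLpNorm (u' t k - u' s k) 2 volume * B ^ 3) ^ (1 / 4 : ℝ)) (𝓝[I] s)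
      (𝓝 ((0 * B ^ 3) ^ (1 / 4 : ℝ))) :=
    ((ENNReal.continuous_rpow_const (y := (1 / 4 : ℝ))).tendsto _).comp
      (ENNReal.Tendsto.mul_const (h.tendsto_eLpNorm_partial hs k) (Or.inr hBt))
  rw [zero_mul, ENNReal.zero_rpow_of_pos (by norm_num)] at h1
  refine tendsto_of_tendsto_of_tendsto_of_le_of_le' tendsto_const_nhds h1
    (Eventually.of_forall fun _ => zero_le) ?_
  filter_upwards [self_mem_nhdsWithin] with t ht
  have h2 := ((h.sphere t ht).sobolev k).sub ((h.sphere s hs).sobolev k)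
  have h3 := h2.eLpNorm_le (p := 6) (by norm_num)
  rw [ENNReal.ofReal_ofNat] at h3
  have h4 : eLpNorm (u' t k - u' s k) 6 volume ≤ B := by
    refine h3.trans ?_
    rw [hB]
    refine mul_le_mul_right (add_le_add ?_ (Finset.sum_le_sum fun j _ => ?_)) _
    · exact (eLpNorm_sub_le ((h.sphere t ht).sobolev k).memLp.1
        ((h.sphere s hs).sobolev k).memLp.1 (by norm_num)).trans
        (add_le_add (h.bound t ht k) (h.bound s hs k))
    · exact (eLpNorm_sub_le (((h.sphere t ht).sobolev k).memLp_partial j).1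
        (((h.sphere s hs).sobolev k).memLp_partial j).1 (by norm_num)).trans
        (add_le_add (h.bound₂ t ht j k) (h.bound₂ s hs j k))
  have h5 := eLpNorm_four_pow_le (μ := volume) (f := u' t k - u' s k) h2.memLp.1
  have h6 : eLpNorm (u' t k - u' s k) 4 volume ^ 4 ≤
      eLpNorm (u' t k - u' s k) 2 volume * B ^ 3 := h5.trans (by gcongr)
  have h7 := ENNReal.rpow_le_rpow h6 (by norm_num : (0 : ℝ) ≤ 1 / 4)
  rwa [← ENNReal.rpow_natCast, ← ENNReal.rpow_mul, show ((4 : ℕ) : ℝ) * (1 / 4) = 1 by norm_num,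
    ENNReal.rpow_one] at h7

theorem eLpNorm_partial_four_le (h : IsSchrodingerFlow T I K u u' u'') {t : ℝ} (ht : t ∈ I)
    (k : Fin 2) : eLpNorm (u' t k) 4 volume ≤ 24 * K := by
  have := (h.sphere t ht).eLpNorm_partial_le (h.bound t ht) (h.bound₂ t ht) (p := 1) le_rfl k
  simpa using this

end IsSchrodingerFlow

end Gradient

/-! ### The time derivative of the differences `V_m` -/

section Variation

/-- The pairing of `g` with the variation of the reflection `transportOp a b` applied to `ψ` is
linear in the variations of `a` and `b`. Its coefficients are `variation a b g ψ b` and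
`variation a b g ψ a`. -/
noncomputable def variation (a b g ψ y : Space) : Space :=
  biScale (inner ℝ a b) • ((-2 : ℝ) • (inner ℝ (bisector a b) g • ψ + inner ℝ (bisector a b) ψ • g)) -
    (biScale (inner ℝ a b) ^ 3 * inner ℝ (a + b)
      ((-2 : ℝ) • (inner ℝ (bisector a b) g • ψ + inner ℝ (bisector a b) ψ • g))) • y

theorem inner_mirrorDeriv_eq (a b a₁ b₁ g ψ : Space) :
    inner ℝ g (mirrorDeriv (bisector a b) (bisectorDeriv a b a₁ b₁) ψ) =
      inner ℝ a₁ (variation a b g ψ b) + (inner ℝ b₁ (variation a b g ψ a) : ℝ) := by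
  have e : inner ℝ g (mirrorDeriv (bisector a b) (bisectorDeriv a b a₁ b₁) ψ) =
      (inner ℝ (bisectorDeriv a b a₁ b₁)
        ((-2 : ℝ) • (inner ℝ (bisector a b) g • ψ + inner ℝ (bisector a b) ψ • g)) : ℝ) := by
    simp only [mirrorDeriv_apply, inner_add_right, inner_smul_right]
    rw [real_inner_comm (bisector a b) g, real_inner_comm (bisectorDeriv a b a₁ b₁) g]
    ring
  rw [e, variation, variation, bisectorDeriv, biScaleDeriv]
  obtain ⟨W, hW⟩ : ∃ W, W = (-2 : ℝ) • (inner ℝ (bisector a b) g • ψ + inner ℝ (bisector a b) ψ • g) :=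
    ⟨_, rfl⟩
  rw [← hW]
  simp only [inner_add_left, inner_sub_right, inner_smul_left, inner_smul_right, conj_trivial]
  rw [real_inner_comm a b₁]
  ring

theorem norm_variation_le {a b g ψ y : Space} {c : ℝ} (ha : ‖a‖ = 1) (hb : ‖b‖ = 1) (hy : ‖y‖ = 1)
    (hc : -1 < c) (hab : c ≤ inner ℝ a b) :
    ‖variation a b g ψ y‖ ≤ 12 * frameConst c ^ 3 * (‖g‖ * ‖ψ‖) := by
  have hn := norm_bisector ha hb (hc.trans_le hab)
  have hl := abs_biScale_le hc hab
  have h1 := one_le_frameConst hc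
  have h3 : frameConst c ≤ frameConst c ^ 3 := le_self_pow₀ h1 (by norm_num)
  have hW : ‖(-2 : ℝ) • (inner ℝ (bisector a b) g • ψ + inner ℝ (bisector a b) ψ • g)‖ ≤
      4 * (‖g‖ * ‖ψ‖) := by
    rw [norm_smul, show ‖(-2 : ℝ)‖ = 2 by norm_num]
    have k0 := norm_add_le (inner ℝ (bisector a b) g • ψ) (inner ℝ (bisector a b) ψ • g)
    rw [norm_smul, norm_smul] at k0
    have k1 := norm_inner_le_norm (𝕜 := ℝ) (bisector a b) g
    have k2 := norm_inner_le_norm (𝕜 := ℝ) (bisector a b) ψ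
    rw [hn, one_mul] at k1 k2
    have k3 : ‖(inner ℝ (bisector a b) g : ℝ)‖ * ‖ψ‖ ≤ ‖g‖ * ‖ψ‖ := by gcongr
    have k4 : ‖(inner ℝ (bisector a b) ψ : ℝ)‖ * ‖g‖ ≤ ‖ψ‖ * ‖g‖ := by gcongr
    linarith
  rw [variation]
  obtain ⟨W, hW'⟩ : ∃ W, W = (-2 : ℝ) • (inner ℝ (bisector a b) g • ψ + inner ℝ (bisector a b) ψ • g) :=
    ⟨_, rfl⟩
  rw [← hW'] at hW ⊢
  refine (norm_sub_le _ _).trans ?_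
  rw [norm_smul, norm_smul, hy, mul_one, norm_mul, norm_pow, Real.norm_eq_abs]
  have k5 := (norm_inner_le_norm (𝕜 := ℝ) (a + b) W).trans
    (mul_le_mul_of_nonneg_right (norm_add_le_two ha hb) (norm_nonneg W))
  calc _ ≤ frameConst c * ‖W‖ + frameConst c ^ 3 * (2 * ‖W‖) := by gcongr
    _ ≤ frameConst c ^ 3 * ‖W‖ + frameConst c ^ 3 * (2 * ‖W‖) := by gcongr
    _ = 3 * frameConst c ^ 3 * ‖W‖ := by ring
    _ ≤ 3 * frameConst c ^ 3 * (4 * (‖g‖ * ‖ψ‖)) := by gcongr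
    _ = _ := by ring

theorem IsSphereMap.memLp_variation {a b : Plane → Space} {a' b' : Fin 2 → Plane → Space}
    {a'' b'' : Fin 2 → Fin 2 → Plane → Space} {c : ℝ} (ha : IsSphereMap a a' a'')
    (hb : IsSphereMap b b' b'') (hc : -1 < c) (hab : ∀ᵐ x, c ≤ inner ℝ (a x) (b x))
    {g ψ y : Plane → Space} (hg : MemLp g 4 volume) (hψ : MemLp ψ 4 volume)
    (hy : AEStronglyMeasurable y volume) (hy₁ : ∀ᵐ x, ‖y x‖ = 1) :
    MemLp (fun x => variation (a x) (b x) (g x) (ψ x) (y x)) 2 volume := by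
  have hl := ha.aesm_biScale hb
  have hn := (ha.exists_bisector hb hc hab).1.aesm
  have hW := (((hn.inner (𝕜 := ℝ) hg.1).smul hψ.1).add ((hn.inner (𝕜 := ℝ) hψ.1).smul hg.1)).const_smul
    (-2 : ℝ)
  have hp : MemLp (fun x => ‖g x‖ * ‖ψ x‖) 2 volume :=
    ⟨hg.1.norm.mul hψ.1.norm, (eLpNorm_norm_mul_norm_le hg.1 hψ.1).trans_lt
      (ENNReal.mul_lt_top hg.2 hψ.2)⟩
  refine hp.of_le_mul (c := 12 * frameConst c ^ 3)
    ((hl.smul hW).sub (((hl.pow 3).mul ((ha.bdd.aesm.add hb.bdd.aesm).inner hW)).smul hy)) ?_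
  filter_upwards [ha.norm_eq, hb.norm_eq, hy₁, hab] with x h1 h2 h3 h4
  rw [norm_mul, norm_norm, norm_norm]
  exact norm_variation_le h1 h2 h3 hc h4

theorem enorm_integral_le_of_trilin {f : Plane → ℝ} {d : Plane → ℝ} {g h : Plane → Space} {C : ℝ}
    (hd : AEStronglyMeasurable d volume) (hg : AEStronglyMeasurable g volume)
    (hh : AEStronglyMeasurable h volume) (hf : ∀ᵐ x, ‖f x‖ ≤ C * (‖d x‖ * (‖g x‖ * ‖h x‖))) :
    ∫⁻ x, ‖f x‖ₑ ≤
      ENNReal.ofReal C * (eLpNorm d 2 volume * (eLpNorm g 4 volume * eLpNorm h 4 volume)) := by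
  refine (lintegral_mono_ae (g := fun x => ENNReal.ofReal C * (‖d x‖ₑ * (‖g x‖ₑ * ‖h x‖ₑ)))
    (hf.mono fun x hx => ?_)).trans ?_
  · rw [← ofReal_norm (f x), ← ofReal_norm (d x), ← ofReal_norm (g x), ← ofReal_norm (h x),
      ← ENNReal.ofReal_mul (norm_nonneg _), ← ENNReal.ofReal_mul (norm_nonneg _),
      ← ENNReal.ofReal_mul' (by positivity)]
    exact ENNReal.ofReal_le_ofReal hx
  · rw [lintegral_const_mul' _ _ ENNReal.ofReal_ne_top]
    gcongr
    exact lintegral_enorm_mul_mul_le hd hg hh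

variable {T : ℝ} {I : Set ℝ} {K : ℝ≥0} {a b : ℝ → Plane → Space} {a' b' : ℝ → Fin 2 → Plane → Space}
  {a'' b'' : ℝ → Fin 2 → Fin 2 → Plane → Space} {c : ℝ}

/-- The pointwise size of the increments of `a` and `b`. -/
noncomputable def incrementSize (a b : ℝ → Plane → Space) (s t : ℝ) (x : Plane) : ℝ :=
  ‖(a t - a s) x‖ + ‖(b t - b s) x‖

/-- The pairing of `V_m` with `ψ`. -/
noncomputable def diffPairing (a b : ℝ → Plane → Space) (a' b' : ℝ → Fin 2 → Plane → Space)
    (m : Fin 2) (ψ : Plane → Space) (t : ℝ) : ℝ :=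
  ∫ x, inner ℝ (transportDiff (a t) (b t) (a' t) (b' t) m x) (ψ x)

/-- The pairing of `∂_t V_m` with `ψ`, where `ψ₁ = ∂_m ψ`. -/
noncomputable def fluxPairing (a b : ℝ → Plane → Space) (a' b' : ℝ → Fin 2 → Plane → Space)
    (a'' b'' : ℝ → Fin 2 → Fin 2 → Plane → Space) (m : Fin 2) (ψ ψ₁ : Plane → Space) (t : ℝ) : ℝ :=
  ∫ x, (inner ℝ (fluxMain (a t) (b t) (a'' t) (b'' t) x) (ψ₁ x) +
    inner ℝ (fluxLower (a t) (b t) (a' t) (b' t) (a'' t) (b'' t) m x) (ψ x))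

namespace IsSchrodingerFlow

theorem aesm_incrementSize (ha : IsSchrodingerFlow T I K a a' a'')
    (hb : IsSchrodingerFlow T I K b b' b'') {s t : ℝ} (hs : s ∈ I) (ht : t ∈ I) :
    AEStronglyMeasurable (incrementSize a b s t) volume :=
  (ha.sobolev_sub hs ht).memLp.1.norm.add (hb.sobolev_sub hs ht).memLp.1.norm

theorem eLpNorm_incrementSize_le (ha : IsSchrodingerFlow T I K a a' a'')
    (hb : IsSchrodingerFlow T I K b b' b'') {s t : ℝ} (hs : s ∈ I) (ht : t ∈ I) :
    eLpNorm (incrementSize a b s t) 2 volume ≤ ENNReal.ofReal (4 * K * |t - s|) := by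
  refine (MeasureTheory.eLpNorm_add_le (ha.sobolev_sub hs ht).memLp.1.norm
    (hb.sobolev_sub hs ht).memLp.1.norm (by norm_num)).trans ?_
  rw [eLpNorm_norm, eLpNorm_norm]
  refine (add_le_add (ha.eLpNorm_time_sub_le (ha.subset hs) (ha.subset ht))
    (hb.eLpNorm_time_sub_le (hb.subset hs) (hb.subset ht))).trans ?_
  rw [← ENNReal.ofReal_add (by positivity) (by positivity)]
  exact ENNReal.ofReal_le_ofReal (by linarith)

theorem norm_transportOp_sub_le (ha : IsSchrodingerFlow T I K a a' a'')
    (hb : IsSchrodingerFlow T I K b b' b'') (hc : -1 < c)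
    (hab : ∀ t ∈ I, ∀ᵐ x, c ≤ inner ℝ (a t x) (b t x)) {s t : ℝ} (hs : s ∈ I) (ht : t ∈ I) :
    ∀ᵐ x, ‖transportOp (a t) (b t) x - transportOp (a s) (b s) x‖ ≤
        12 * frameConst c ^ 3 * incrementSize a b s t x ∧
      ‖transportOp (a t) (b t) x - transportOp (a s) (b s) x -
          transportOpDeriv (a t) (b t) (a t - a s) (b t - b s) x‖ ≤
        46 * frameConst c ^ 6 * incrementSize a b s t x ^ 2 := by
  filter_upwards [(ha.sphere t ht).norm_eq, (hb.sphere t ht).norm_eq, (ha.sphere s hs).norm_eq,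
    (hb.sphere s hs).norm_eq, hab t ht, hab s hs] with x h1 h2 h3 h4 h5 h6
  exact norm_mirror_sub_le h1 h2 h3 h4 hc h5 h6

variable {ψ : Plane → Space} {ψ' : Fin 2 → Plane → Space}

theorem aesm_transportOp_apply (ha : IsSchrodingerFlow T I K a a' a'')
    (hb : IsSchrodingerFlow T I K b b' b'') (hc : -1 < c)
    (hab : ∀ t ∈ I, ∀ᵐ x, c ≤ inner ℝ (a t x) (b t x)) {t : ℝ} (ht : t ∈ I)
    (hψ : AEStronglyMeasurable ψ volume) :
    AEStronglyMeasurable (fun x => transportOp (a t) (b t) x (ψ x)) volume :=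
  applyL.aestronglyMeasurable_bilin
    ((ha.sphere t ht).transportOp_bdd (hb.sphere t ht) hc (hab t ht)).aesm hψ

theorem memLp_transportOp_apply (ha : IsSchrodingerFlow T I K a a' a'')
    (hb : IsSchrodingerFlow T I K b b' b'') (hc : -1 < c)
    (hab : ∀ t ∈ I, ∀ᵐ x, c ≤ inner ℝ (a t x) (b t x)) {t : ℝ} (ht : t ∈ I)
    (hψ : MemLp ψ 2 volume) :
    MemLp (fun x => transportOp (a t) (b t) x (ψ x)) 2 volume := by
  refine hψ.of_le (ha.aesm_transportOp_apply hb hc hab ht hψ.1) ?_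
  filter_upwards [(ha.sphere t ht).norm_eq, (hb.sphere t ht).norm_eq, hab t ht] with x h1 h2 h3
  exact (norm_mirror (inner_bisector_self h1 h2 (hc.trans_le h3)) _).le

/-- The increments of the pairing of `V_m` with a function of `H¹`. -/
theorem diffPairing_sub (ha : IsSchrodingerFlow T I K a a' a'')
    (hb : IsSchrodingerFlow T I K b b' b'') (hc : -1 < c)
    (hab : ∀ t ∈ I, ∀ᵐ x, c ≤ inner ℝ (a t x) (b t x)) (hψ : IsSobolev ψ ψ') (m : Fin 2) {s t : ℝ}
    (hs : s ∈ I) (ht : t ∈ I) :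
    diffPairing a b a' b' m ψ t - diffPairing a b a' b' m ψ s =
      (-∫ x, inner ℝ ((a t - a s) x) (transportOpDeriv (a t) (b t) (a' t m) (b' t m) x (ψ x) +
        transportOp (a t) (b t) x (ψ' m x))) +
      (∫ x, inner ℝ (a' s m x) (transportOp (a t) (b t) x (ψ x) - transportOp (a s) (b s) x (ψ x))) +
      ∫ x, inner ℝ ((b t - b s) x) (ψ' m x) := by
  have hat := (ha.sphere t ht).sobolev m
  have has := (ha.sphere s hs).sobolev m
  have hbt := (hb.sphere t ht).sobolev m
  have hbs := (hb.sphere s hs).sobolev m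
  have hSt := ha.memLp_transportOp_apply hb hc hab ht hψ.memLp
  have hSs := ha.memLp_transportOp_apply hb hc hab hs hψ.memLp
  have e : ∀ r, r ∈ I → diffPairing a b a' b' m ψ r =
      (∫ x, inner ℝ (a' r m x) (transportOp (a r) (b r) x (ψ x))) - ∫ x, inner ℝ (b' r m x) (ψ x) :=
    fun r hr => by
      rw [← integral_sub (integrable_inner ((ha.sphere r hr).sobolev m).memLp
        (ha.memLp_transportOp_apply hb hc hab hr hψ.memLp))
        (integrable_inner ((hb.sphere r hr).sobolev m).memLp hψ.memLp)]
      refine integral_congr_ae (ae_of_all _ fun x => ?_)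
      simp only [transportDiff, inner_sub_left, transportOp, inner_mirror_left]
  -- integrate by parts to move `∂_m` off the increments of `a` and `b`
  have p1 := (ha.sobolev_sub hs ht).integral_bilin innerL
    (((ha.sphere t ht).transportOp_bdd (hb.sphere t ht) hc (hab t ht)).bilin_sobolev applyL hψ) m
  have p2 := (hb.sobolev_sub hs ht).integral_bilin innerL hψ m
  simp only [innerL_apply, applyL_apply, Pi.sub_apply (f := a' t m), Pi.sub_apply (f := b' t m),
    inner_sub_left] at p1 p2
  rw [integral_sub (integrable_inner hat.memLp hSt) (integrable_inner has.memLp hSt)] at p1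
  rw [integral_sub (integrable_inner hbt.memLp hψ.memLp) (integrable_inner hbs.memLp hψ.memLp)] at p2
  rw [e t ht, e s hs, ← p1]
  simp only [inner_sub_right]
  rw [integral_sub (integrable_inner has.memLp hSt) (integrable_inner has.memLp hSs)]
  linarith

/-- The size of `ψ` in `H¹` and `L⁴`. -/
noncomputable def _root_.testSize (ψ : Plane → Space) (ψ' : Fin 2 → Plane → Space) : ℝ≥0∞ :=
  eLpNorm ψ 2 volume + eLpNorm ψ 4 volume + ∑ k, eLpNorm (ψ' k) 2 volume

theorem eLpNorm_partial_transportOp_le (ha : IsSchrodingerFlow T I K a a' a'')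
    (hb : IsSchrodingerFlow T I K b b' b'') (hc : -1 < c)
    (hab : ∀ t ∈ I, ∀ᵐ x, c ≤ inner ℝ (a t x) (b t x)) (hψ : IsSobolev ψ ψ') (m : Fin 2) {t : ℝ}
    (ht : t ∈ I) :
    eLpNorm (fun x => transportOpDeriv (a t) (b t) (a' t m) (b' t m) x (ψ x) +
        transportOp (a t) (b t) x (ψ' m x)) 2 volume ≤
      ENNReal.ofReal (12 * frameConst c ^ 3) * (48 * K) * eLpNorm ψ 4 volume +
        eLpNorm (ψ' m) 2 volume := by
  have hA := (ha.sphere t ht).sobolev m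
  have hB := (hb.sphere t ht).sobolev m
  have m1 := applyL.aestronglyMeasurable_bilin ((ha.sphere t ht).aesm_transportOpDeriv
    (hb.sphere t ht) hc (hab t ht) hA.memLp.1 hB.memLp.1) hψ.memLp.1
  have m2 := ha.memLp_transportOp_apply hb hc hab ht (hψ.memLp_partial m)
  refine (MeasureTheory.eLpNorm_add_le m1 m2.1 (by norm_num)).trans (add_le_add ?_ ?_)
  · have h1 : ∀ᵐ x, ‖transportOpDeriv (a t) (b t) (a' t m) (b' t m) x (ψ x)‖ ≤
        12 * frameConst c ^ 3 * ‖‖‖a' t m x‖ + ‖b' t m x‖‖ * ‖ψ x‖‖ := by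
      filter_upwards [(ha.sphere t ht).norm_transportOpDeriv_le (hb.sphere t ht) hc (hab t ht)]
        with x hx
      refine (ContinuousLinearMap.le_opNorm _ _).trans ?_
      rw [norm_mul, norm_norm, norm_norm, Real.norm_of_nonneg (by positivity), ← mul_assoc]
      gcongr
      exact hx _ _
    refine (eLpNorm_le_mul_eLpNorm_of_ae_le_mul h1 2).trans ?_
    rw [mul_assoc]
    gcongr
    refine (eLpNorm_norm_mul_norm_le (p := 4) (q := 4) (r := 2)
      (hA.memLp.1.norm.add hB.memLp.1.norm) hψ.memLp.1).trans ?_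
    gcongr
    refine (MeasureTheory.eLpNorm_add_le hA.memLp.1.norm hB.memLp.1.norm (by norm_num)).trans ?_
    rw [eLpNorm_norm, eLpNorm_norm]
    refine (add_le_add (ha.eLpNorm_partial_four_le ht m) (hb.eLpNorm_partial_four_le ht m)).trans ?_
    rw [← two_mul, ← mul_assoc]
    norm_num
  · refine eLpNorm_mono_ae ?_
    filter_upwards [(ha.sphere t ht).norm_eq, (hb.sphere t ht).norm_eq, hab t ht] with x h1 h2 h3
    exact (norm_mirror (inner_bisector_self h1 h2 (hc.trans_le h3)) _).le

/-- The Lipschitz constant of the pairings of `V_m`. -/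
noncomputable def _root_.lipConst (c : ℝ) (K : ℝ≥0) : ℝ≥0 :=
  (2 * K) * ((12 * frameConst c ^ 3).toNNReal * (48 * K) + 1) +
    (12 * frameConst c ^ 3).toNNReal * (4 * K * (24 * K)) + 2 * K

/-- The pairing of `V_m` with a function of `H¹` is Lipschitz continuous in time. -/
theorem enorm_diffPairing_sub_le (ha : IsSchrodingerFlow T I K a a' a'')
    (hb : IsSchrodingerFlow T I K b b' b'') (hc : -1 < c)
    (hab : ∀ t ∈ I, ∀ᵐ x, c ≤ inner ℝ (a t x) (b t x)) (hψ : IsSobolev ψ ψ') (m : Fin 2) {s t : ℝ}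
    (hs : s ∈ I) (ht : t ∈ I) :
    ‖diffPairing a b a' b' m ψ t - diffPairing a b a' b' m ψ s‖ₑ ≤
      lipConst c K * testSize ψ ψ' * ENNReal.ofReal |t - s| := by
  rw [ha.diffPairing_sub hb hc hab hψ m hs ht]
  obtain ⟨δ, hδ⟩ : ∃ δ, δ = ENNReal.ofReal |t - s| := ⟨_, rfl⟩
  obtain ⟨Z, hZ⟩ : ∃ Z, Z = testSize ψ ψ' := ⟨_, rfl⟩
  have z1 : eLpNorm ψ 4 volume ≤ Z := by
    rw [hZ, testSize]; exact le_add_self.trans le_self_add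
  have z2 : eLpNorm (ψ' m) 2 volume ≤ Z := by
    rw [hZ, testSize]
    exact (Finset.single_le_sum (f := fun k => eLpNorm (ψ' k) 2 volume) (fun _ _ => zero_le)
      (Finset.mem_univ m)).trans le_add_self
  have d2 : ∀ r : ℝ, 0 ≤ r → ENNReal.ofReal (r * K * |t - s|) = ENNReal.ofReal r * K * δ :=
    fun r hr => by
      rw [ENNReal.ofReal_mul (by positivity), ENNReal.ofReal_mul hr, ENNReal.ofReal_coe_nnreal, hδ]
  have da := ha.eLpNorm_time_sub_le (ha.subset hs) (ha.subset ht)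
  have db := hb.eLpNorm_time_sub_le (hb.subset hs) (hb.subset ht)
  have dd := ha.eLpNorm_incrementSize_le hb hs ht
  rw [d2 _ (by norm_num), ENNReal.ofReal_ofNat] at da db dd
  have hS := ((ha.sphere t ht).transportOp_bdd (hb.sphere t ht) hc (hab t ht)).bilin_sobolev applyL hψ
  have t1 : ‖∫ x, inner ℝ ((a t - a s) x) (transportOpDeriv (a t) (b t) (a' t m) (b' t m) x (ψ x) +
        transportOp (a t) (b t) x (ψ' m x))‖ₑ ≤ 2 * K * δ *
          (ENNReal.ofReal (12 * frameConst c ^ 3) * (48 * K) * Z + Z) := by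
    refine (enorm_integral_inner_le_two (ha.sobolev_sub hs ht).memLp.1
      (hS.memLp_partial m).1).trans (mul_le_mul' da ?_)
    exact (ha.eLpNorm_partial_transportOp_le hb hc hab hψ m ht).trans (by gcongr)
  have t3 : ‖∫ x, inner ℝ ((b t - b s) x) (ψ' m x)‖ₑ ≤ 2 * K * δ * Z :=
    (enorm_integral_inner_le_two (hb.sobolev_sub hs ht).memLp.1 (hψ.memLp_partial m).1).trans
      (mul_le_mul' db z2)
  have t2 : ‖∫ x, inner ℝ (a' s m x) (transportOp (a t) (b t) x (ψ x) -
      transportOp (a s) (b s) x (ψ x))‖ₑ ≤ ENNReal.ofReal (12 * frameConst c ^ 3) *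
        (4 * K * δ * (24 * K * Z)) := by
    refine (enorm_integral_le_lintegral_enorm _).trans ((enorm_integral_le_of_trilin
      (C := 12 * frameConst c ^ 3) (ha.aesm_incrementSize hb hs ht)
      ((ha.sphere s hs).sobolev m).memLp.1 hψ.memLp.1 ?_).trans ?_)
    · filter_upwards [ha.norm_transportOp_sub_le hb hc hab hs ht] with x hx
      refine (norm_inner_le_norm _ _).trans ?_
      have h1 := (transportOp (a t) (b t) x - transportOp (a s) (b s) x).le_opNorm (ψ x)
      rw [sub_apply] at h1
      have h0 : 0 ≤ incrementSize a b s t x := by unfold incrementSize; positivity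
      rw [Real.norm_of_nonneg h0]
      calc _ ≤ ‖a' s m x‖ * (12 * frameConst c ^ 3 * incrementSize a b s t x * ‖ψ x‖) := by
            gcongr; exact h1.trans (by gcongr; exact hx.1)
        _ = _ := by ring
    · gcongr
      exact ha.eLpNorm_partial_four_le hs m
  refine (enorm_add_le _ _).trans ((add_le_add ((enorm_add_le _ _).trans (add_le_add
    ((enorm_neg _).le.trans t1) t2)) t3).trans (le_of_eq ?_))
  rw [lipConst, ENNReal.ofReal, ← hZ, ← hδ]
  push_cast
  ring

end IsSchrodingerFlow

end Variation

section FluxLimit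

namespace IsSchrodingerFlow

variable {T : ℝ} {I : Set ℝ} {K : ℝ≥0} {a b : ℝ → Plane → Space} {a' b' : ℝ → Fin 2 → Plane → Space}
  {a'' b'' : ℝ → Fin 2 → Fin 2 → Plane → Space} {c : ℝ} {ψ : Plane → Space}
  {ψ' : Fin 2 → Plane → Space}

/-- `fluxPairing` has the form of `diffPairing_sub`, with the increments of `a` and `b` replaced
by `a × Δ a` and `b × Δ b`, and the increment of the transport operator by its linearization. -/
theorem fluxPairing_eq (ha : IsSchrodingerFlow T I K a a' a'')
    (hb : IsSchrodingerFlow T I K b b' b'') (hc : -1 < c)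
    (hab : ∀ t ∈ I, ∀ᵐ x, c ≤ inner ℝ (a t x) (b t x)) (hψ : IsSobolev ψ ψ') (m : Fin 2) {t : ℝ}
    (ht : t ∈ I) :
    fluxPairing a b a' b' a'' b'' m ψ (ψ' m) t =
      (-∫ x, inner ℝ (transportOpDeriv (a t) (b t) (a' t m) (b' t m) x (ψ x) +
        transportOp (a t) (b t) x (ψ' m x)) (schrodingerField (a t) (a'' t) x)) +
      ((∫ x, inner ℝ (variation (a t x) (b t x) (a' t m x) (ψ x) (b t x))
          (schrodingerField (a t) (a'' t) x)) +
        ∫ x, inner ℝ (variation (a t x) (b t x) (a' t m x) (ψ x) (a t x))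
          (schrodingerField (b t) (b'' t) x)) +
      ∫ x, inner ℝ (ψ' m x) (schrodingerField (b t) (b'' t) x) := by
  have sa := ha.sphere t ht
  have sb := hb.sphere t ht
  have hS := (sa.transportOp_bdd sb hc (hab t ht)).bilin_sobolev applyL hψ
  have hA := sa.memLp_variation sb hc (hab t ht) (sa.sobolev m).memLp_four hψ.memLp_four sb.bdd.aesm
    sb.norm_eq
  have hB := sa.memLp_variation sb hc (hab t ht) (sa.sobolev m).memLp_four hψ.memLp_four sa.bdd.aesm
    sa.norm_eq
  have i1 := integrable_inner (hS.memLp_partial m) sa.memLp_schrodingerField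
  simp only [applyL_apply] at i1
  have i2 := integrable_inner hA sa.memLp_schrodingerField
  have i3 := integrable_inner hB sb.memLp_schrodingerField
  have i4 := integrable_inner (hψ.memLp_partial m) sb.memLp_schrodingerField
  refine Eq.trans ?_ (((integral_add (i1.neg.add (i2.add i3)) i4).trans (congrArg₂ (· + ·)
    ((integral_add i1.neg (i2.add i3)).trans (congrArg₂ (· + ·) (integral_neg _)
      (integral_add i2 i3))) rfl)))
  refine integral_congr_ae (ae_of_all _ fun x => ?_)
  simp only [Pi.add_apply, Pi.neg_apply]
  simp only [fluxMain, fluxLower, inner_add_left, inner_neg_left, transportOp, transportOpDeriv,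
    inner_mirror_left, inner_mirrorDeriv_left]
  rw [inner_mirrorDeriv_eq (a t x) (b t x) (schrodingerField (a t) (a'' t) x) _ (a' t m x),
    ← inner_mirror_left _ (schrodingerField (a t) (a'' t) x),
    ← inner_mirrorDeriv_left _ _ (schrodingerField (a t) (a'' t) x), real_inner_comm (ψ' m x),
    real_inner_comm (ψ' m x), real_inner_comm (ψ x),
    real_inner_comm (variation _ _ _ _ (b t x)), real_inner_comm (variation _ _ _ _ (a t x))]
  ring

/-- The difference between the increment of the transport operator and its linearization is
negligible. -/
theorem tendsto_transportOp_remainder (ha : IsSchrodingerFlow T I K a a' a'')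
    (hb : IsSchrodingerFlow T I K b b' b'') (hc : -1 < c)
    (hab : ∀ t ∈ I, ∀ᵐ x, c ≤ inner ℝ (a t x) (b t x)) (hψ : IsSobolev ψ ψ') (m : Fin 2) {t : ℝ}
    (ht : t ∈ I) (hI : ∀ᶠ n in atTop, t - timeStep n ∈ I) :
    Tendsto (fun n => (timeStep n)⁻¹ *
      ((∫ x, inner ℝ (a' (t - timeStep n) m x) (transportOp (a t) (b t) x (ψ x) -
          transportOp (a (t - timeStep n)) (b (t - timeStep n)) x (ψ x))) -
        ∫ x, inner ℝ (a' t m x) (transportOpDeriv (a t) (b t) (a t - a (t - timeStep n))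
          (b t - b (t - timeStep n)) x (ψ x)))) atTop (𝓝 0) := by
  obtain ⟨η, hη⟩ : ∃ η : ℝ → ℝ≥0∞, η = fun s => eLpNorm (a s - a t) ⊤ volume +
    eLpNorm (b s - b t) ⊤ volume := ⟨_, rfl⟩
  have hs : Tendsto (fun n => t - timeStep n) atTop (𝓝[I] t) := by
    refine tendsto_nhdsWithin_iff.2 ⟨?_, hI⟩
    simpa using tendsto_timeStep.const_sub t
  have hηl : Tendsto η (𝓝[I] t) (𝓝 0) := by
    rw [hη]
    simpa using ((ha.continuous t (ha.subset ht)).mono_left nhdsWithin_le_nhds).add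
      ((hb.continuous t (hb.subset ht)).mono_left nhdsWithin_le_nhds)
  obtain ⟨C, hC⟩ : ∃ C, C = 12 * frameConst c ^ 3 := ⟨_, rfl⟩
  obtain ⟨D, hD⟩ : ∃ D, D = 46 * frameConst c ^ 6 := ⟨_, rfl⟩
  have hf := one_le_frameConst hc
  have hC0 : 0 ≤ C := by rw [hC]; positivity
  have hD0 : 0 ≤ D := by rw [hD]; positivity
  obtain ⟨Z, hZ⟩ : ∃ Z, Z = eLpNorm ψ 4 volume := ⟨_, rfl⟩
  have hZt : Z ≠ ⊤ := hZ ▸ hψ.memLp_four.2.ne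
  have sa := ha.sphere t ht
  have sb := hb.sphere t ht
  have hA := sa.memLp_variation sb hc (hab t ht) (sa.sobolev m).memLp_four hψ.memLp_four sb.bdd.aesm
    sb.norm_eq
  have hB := sa.memLp_variation sb hc (hab t ht) (sa.sobolev m).memLp_four hψ.memLp_four sa.bdd.aesm
    sa.norm_eq
  have hSt := ha.memLp_transportOp_apply hb hc hab ht hψ.memLp
  -- the bound of the remainder for a time step `t - s`
  have key : ∀ s ∈ I, η s ≠ ⊤ → ‖(∫ x, inner ℝ (a' s m x) (transportOp (a t) (b t) x (ψ x) -
        transportOp (a s) (b s) x (ψ x))) - ∫ x, inner ℝ (a' t m x)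
          (transportOpDeriv (a t) (b t) (a t - a s) (b t - b s) x (ψ x))‖ₑ ≤
      ENNReal.ofReal (4 * K * |t - s|) * (ENNReal.ofReal C * (eLpNorm (a' s m - a' t m) 4 volume * Z) +
        ENNReal.ofReal D * η s * (24 * K * Z)) := fun s hs hηs => by
    have mψ := hψ.memLp.1
    have has := ((ha.sphere s hs).sobolev m).memLp
    have da := (ha.sobolev_sub hs ht).memLp
    have db := (hb.sobolev_sub hs ht).memLp
    have m1 : AEStronglyMeasurable (fun x => transportOpDeriv (a t) (b t) (a t - a s) (b t - b s) x
        (ψ x)) volume :=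
      applyL.aestronglyMeasurable_bilin (sa.aesm_transportOpDeriv sb hc (hab t ht) da.1 db.1) mψ
    have i1 : Integrable (fun x => inner ℝ (a' s m x) (transportOp (a t) (b t) x (ψ x) -
        transportOp (a s) (b s) x (ψ x))) volume :=
      integrable_inner has (hSt.sub (ha.memLp_transportOp_apply hb hc hab hs hψ.memLp))
    have i2 : Integrable (fun x => inner ℝ (a' t m x)
        (transportOpDeriv (a t) (b t) (a t - a s) (b t - b s) x (ψ x))) volume := by
      refine ((integrable_inner da hA).add (integrable_inner db hB)).congr
        (ae_of_all _ fun x => (inner_mirrorDeriv_eq _ _ _ _ _ _).symm)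
    have hd := ha.aesm_incrementSize hb hs ht
    have hd0 : ∀ x, 0 ≤ incrementSize a b s t x := fun x => by unfold incrementSize; positivity
    have hη' : ∀ᵐ x, incrementSize a b s t x ≤ (η s).toReal := by
      filter_upwards [ae_le_eLpNormEssSup (f := a s - a t) (μ := volume),
        ae_le_eLpNormEssSup (f := b s - b t) (μ := volume)] with x h1 h2
      rw [← eLpNorm_exponent_top] at h1 h2
      refine (ENNReal.ofReal_le_iff_le_toReal hηs).1 ?_
      rw [incrementSize, ENNReal.ofReal_add (norm_nonneg _) (norm_nonneg _), ofReal_norm, ofReal_norm,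
        hη, ← enorm_neg, ← enorm_neg ((b t - b s) x)]
      simp only [Pi.sub_apply, neg_sub] at h1 h2 ⊢
      exact add_le_add h1 h2
    rw [← integral_sub i1 i2]
    refine (enorm_integral_le_lintegral_enorm _).trans ?_
    -- the remainder is `⟪a' s - a' t, dS ψ⟫ + ⟪a' s, (S t - S s - dS) ψ⟫`; the first factor is
    -- small in `L⁴`, and the second term is quadratic in the increments, one of which is small in
    -- `L^∞`
    have b1 := enorm_integral_le_of_trilin (f := fun x => inner ℝ ((a' s m - a' t m) x)
      (transportOpDeriv (a t) (b t) (a t - a s) (b t - b s) x (ψ x))) (C := C) hd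
      (has.1.sub (sa.sobolev m).memLp.1) mψ (by
        filter_upwards [sa.norm_transportOpDeriv_le sb hc (hab t ht)] with x hx
        refine (norm_inner_le_norm _ _).trans ?_
        have h1 := (transportOpDeriv (a t) (b t) (a t - a s) (b t - b s) x).le_opNorm (ψ x)
        rw [Real.norm_of_nonneg (hd0 x)]
        calc _ ≤ ‖(a' s m - a' t m) x‖ * (C * incrementSize a b s t x * ‖ψ x‖) := by
              gcongr
              refine h1.trans ?_
              gcongr
              rw [hC]
              exact hx _ _
          _ = _ := by ring)
    have b2 := enorm_integral_le_of_trilin (f := fun x => inner ℝ (a' s m x)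
      ((transportOp (a t) (b t) x - transportOp (a s) (b s) x -
        transportOpDeriv (a t) (b t) (a t - a s) (b t - b s) x) (ψ x))) (C := D * (η s).toReal) hd
      has.1 mψ (by
        filter_upwards [ha.norm_transportOp_sub_le hb hc hab hs ht, hη'] with x hx hx'
        refine (norm_inner_le_norm _ _).trans ?_
        have h1 := (transportOp (a t) (b t) x - transportOp (a s) (b s) x -
          transportOpDeriv (a t) (b t) (a t - a s) (b t - b s) x).le_opNorm (ψ x)
        rw [Real.norm_of_nonneg (hd0 x)]
        have h2 : incrementSize a b s t x ^ 2 ≤ (η s).toReal * incrementSize a b s t x := by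
          rw [sq]; exact mul_le_mul_of_nonneg_right hx' (hd0 x)
        calc _ ≤ ‖a' s m x‖ * (D * ((η s).toReal * incrementSize a b s t x) * ‖ψ x‖) := by
              gcongr
              refine h1.trans ?_
              gcongr
              rw [hD]
              refine hx.2.trans ?_
              gcongr
          _ = _ := by ring)
    refine (lintegral_mono fun x => ?_).trans ((lintegral_add_left'
      ((has.1.sub (sa.sobolev m).memLp.1).inner (𝕜 := ℝ) m1).enorm _).trans_le
        ((add_le_add b1 b2).trans ?_))
    · refine le_trans (le_of_eq ?_) (enorm_add_le _ _)
      congr 1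
      simp only [Pi.sub_apply (f := a' s m), inner_sub_left, inner_sub_right, sub_apply]
      ring
    · rw [ENNReal.ofReal_mul hD0, ENNReal.ofReal_toReal hηs, mul_add]
      rw [← hZ]
      have hdl := ha.eLpNorm_incrementSize_le hb hs ht
      refine add_le_add ?_ ?_
      · calc _ ≤ ENNReal.ofReal C * (ENNReal.ofReal (4 * K * |t - s|) *
              (eLpNorm (a' s m - a' t m) 4 volume * Z)) := by gcongr
          _ = _ := by ring
      · calc _ ≤ ENNReal.ofReal D * η s * (ENNReal.ofReal (4 * K * |t - s|) * (24 * K * Z)) := by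
              gcongr
              exact ha.eLpNorm_partial_four_le hs m
          _ = _ := by ring
  have hlim : Tendsto (fun s => ENNReal.ofReal (4 * K) * (ENNReal.ofReal C *
      (eLpNorm (a' s m - a' t m) 4 volume * Z) + ENNReal.ofReal D * η s * (24 * K * Z))) (𝓝[I] t)
      (𝓝 (ENNReal.ofReal (4 * K) * (ENNReal.ofReal C * (0 * Z) + ENNReal.ofReal D * 0 *
        (24 * K * Z)))) := by
    have hk : (24 * K * Z : ℝ≥0∞) ≠ ⊤ :=
      ENNReal.mul_ne_top (ENNReal.mul_ne_top (by simp) ENNReal.coe_ne_top) hZt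
    refine ENNReal.Tendsto.const_mul (Tendsto.add (ENNReal.Tendsto.const_mul
      (ENNReal.Tendsto.mul_const (ha.tendsto_eLpNorm_partial_four ht m) (Or.inr hZt))
      (Or.inr ENNReal.ofReal_ne_top)) (ENNReal.Tendsto.mul_const (ENNReal.Tendsto.const_mul hηl
      (Or.inr ENNReal.ofReal_ne_top)) (Or.inr hk))) (Or.inr ENNReal.ofReal_ne_top)
  simp only [zero_mul, mul_zero, add_zero] at hlim
  rw [tendsto_zero_iff_enorm_tendsto_zero]
  refine tendsto_of_tendsto_of_tendsto_of_le_of_le' tendsto_const_nhds (hlim.comp hs)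
    (Eventually.of_forall fun _ => zero_le) ?_
  have hfin : ∀ᶠ n in atTop, η (t - timeStep n) < ⊤ :=
    (hηl.comp hs).eventually (gt_mem_nhds ENNReal.zero_lt_top)
  filter_upwards [hI, hfin] with n hn hn'
  have hp := timeStep_pos n
  have h1 := key _ hn hn'.ne
  rw [enorm_mul, Function.comp_apply]
  rw [sub_sub_cancel, abs_of_pos hp] at h1
  refine (mul_le_mul_right h1 _).trans (le_of_eq ?_)
  rw [← mul_assoc, Real.enorm_eq_ofReal (inv_nonneg.2 hp.le), ← ENNReal.ofReal_mul
    (inv_nonneg.2 hp.le), mul_comm (4 * (K : ℝ)), inv_mul_cancel_left₀ hp.ne']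

/-- The difference quotients of the pairings of `V_m` converge. -/
theorem tendsto_diffPairing_quotient (ha : IsSchrodingerFlow T I K a a' a'')
    (hb : IsSchrodingerFlow T I K b b' b'') (hc : -1 < c)
    (hab : ∀ t ∈ I, ∀ᵐ x, c ≤ inner ℝ (a t x) (b t x)) (hψ : IsSobolev ψ ψ') (m : Fin 2) {t : ℝ}
    (ht : t ∈ I) (hI : ∀ᶠ n in atTop, t - timeStep n ∈ I)
    (hFa : ∀ ψ : Plane → Space, MemLp ψ 2 volume →
      Tendsto (fun n => (timeStep n)⁻¹ * ∫ x, inner ℝ (ψ x) (a t x - a (t - timeStep n) x)) atTop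
        (𝓝 (∫ x, inner ℝ (ψ x) (schrodingerField (a t) (a'' t) x))))
    (hFb : ∀ ψ : Plane → Space, MemLp ψ 2 volume →
      Tendsto (fun n => (timeStep n)⁻¹ * ∫ x, inner ℝ (ψ x) (b t x - b (t - timeStep n) x)) atTop
        (𝓝 (∫ x, inner ℝ (ψ x) (schrodingerField (b t) (b'' t) x)))) :
    Tendsto (fun n => (timeStep n)⁻¹ * (diffPairing a b a' b' m ψ t -
      diffPairing a b a' b' m ψ (t - timeStep n))) atTop
      (𝓝 (fluxPairing a b a' b' a'' b'' m ψ (ψ' m) t)) := by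
  have sa := ha.sphere t ht
  have sb := hb.sphere t ht
  have hS := ((sa.transportOp_bdd sb hc (hab t ht)).bilin_sobolev applyL hψ).memLp_partial m
  have hA := sa.memLp_variation sb hc (hab t ht) (sa.sobolev m).memLp_four hψ.memLp_four sb.bdd.aesm
    sb.norm_eq
  have hB := sa.memLp_variation sb hc (hab t ht) (sa.sobolev m).memLp_four hψ.memLp_four sa.bdd.aesm
    sa.norm_eq
  have l := (((hFa _ hS).neg.add ((hFa _ hA).add (hFb _ hB))).add
    (hFb _ (hψ.memLp_partial m))).add (ha.tendsto_transportOp_remainder hb hc hab hψ m ht hI)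
  rw [add_zero] at l
  rw [ha.fluxPairing_eq hb hc hab hψ m ht]
  refine l.congr' ?_
  filter_upwards [hI] with n hn
  rw [ha.diffPairing_sub hb hc hab hψ m hn ht]
  have da := (ha.sobolev_sub hn ht).memLp
  have db := (hb.sobolev_sub hn ht).memLp
  have e : ∫ x, inner ℝ (a' t m x) (transportOpDeriv (a t) (b t) (a t - a (t - timeStep n))
      (b t - b (t - timeStep n)) x (ψ x)) =
      (∫ x, inner ℝ (variation (a t x) (b t x) (a' t m x) (ψ x) (b t x))
        (a t x - a (t - timeStep n) x)) +
      ∫ x, inner ℝ (variation (a t x) (b t x) (a' t m x) (ψ x) (a t x))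
        (b t x - b (t - timeStep n) x) := by
    refine Eq.trans ?_ (integral_add (integrable_inner hA da) (integrable_inner hB db))
    refine integral_congr_ae (ae_of_all _ fun x => ?_)
    simp only [transportOpDeriv]
    rw [inner_mirrorDeriv_eq, real_inner_comm (variation _ _ _ _ (b t x)),
      real_inner_comm (variation _ _ _ _ (a t x))]
    rfl
  have sw : ∀ (f : Plane → Space) (g : Plane → Space), ∫ x, inner ℝ (f x) (g x) =
      ∫ x, (inner ℝ (g x) (f x) : ℝ) := fun f g =>
    integral_congr_ae (ae_of_all _ fun x => real_inner_comm _ _)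
  rw [e, sw (a t - a (t - timeStep n)), sw (b t - b (t - timeStep n))]
  simp only [applyL_apply, Pi.sub_apply]
  ring

end IsSchrodingerFlow

end FluxLimit

/-! ### Weak time derivatives from difference quotients -/

section TimeDerivative

variable {T : ℝ} {I : Set ℝ}

theorem ae_eventually_sub_timeStep_mem (hI : ∀ᵐ t ∂(volume.restrict (Ioo 0 T)), t ∈ I) :
    ∀ᵐ t ∂(volume.restrict (Ioo 0 T)), ∀ᶠ n in atTop, t - timeStep n ∈ I := by
  rw [ae_restrict_iff' measurableSet_Ioo] at hI ⊢
  have h1 : ∀ n, ∀ᵐ t : ℝ, t - timeStep n ∈ Ioo 0 T → t - timeStep n ∈ I := fun n =>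
    (measurePreserving_sub_right volume (timeStep n)).quasiMeasurePreserving.ae hI
  filter_upwards [ae_all_iff.2 h1] with t ht htT
  filter_upwards [eventually_sub_timeStep_mem htT] with n hn using ht n hn

/-- If the difference quotients of a function which is Lipschitz continuous on a set of full
measure converge almost everywhere, then their limit is the weak derivative. -/
theorem weak_deriv_of_tendsto_quotient {G w : ℝ → ℝ} {L : ℝ≥0}
    (hI : ∀ᵐ t ∂(volume.restrict (Ioo 0 T)), t ∈ I) (hL : LipschitzOnWith L G I)
    (hq : ∀ᵐ t ∂(volume.restrict (Ioo 0 T)),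
      Tendsto (fun n => (timeStep n)⁻¹ * (G t - G (t - timeStep n))) atTop (𝓝 (w t))) :
    AEStronglyMeasurable w (volume.restrict (Ioo 0 T)) ∧
      ∀ θ : ℝ → ℝ, ContDiff ℝ ∞ θ → HasCompactSupport θ → tsupport θ ⊆ Ioo 0 T →
        ∫ t in Ioo 0 T, deriv θ t * G t = -∫ t in Ioo 0 T, θ t * w t := by
  -- `G` agrees on `I` with a Lipschitz function, which is differentiable almost everywhere
  obtain ⟨g, hg, hgG⟩ := hL.extend_real
  have hw : ∀ᵐ t ∂(volume.restrict (Ioo 0 T)), lineDeriv ℝ g t 1 = w t := by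
    filter_upwards [hq, ae_eventually_sub_timeStep_mem hI, hI,
      ae_restrict_of_ae (hg.ae_lineDifferentiableAt (μ := volume) 1)] with t h1 h2 h3 h4
    have h5 : HasDerivAt (fun s : ℝ => g (t + s • (1 : ℝ))) (lineDeriv ℝ g t 1) (0 : ℝ) := h4.hasLineDerivAt
    have h6 : Tendsto (fun n => -timeStep n) atTop (𝓝[≠] 0) := by
      refine tendsto_nhdsWithin_iff.2 ⟨by simpa using tendsto_timeStep.neg, ?_⟩
      exact Eventually.of_forall fun n => (neg_neg_of_pos (timeStep_pos n)).ne
    have h7 := (hasDerivAt_iff_tendsto_slope_zero.1 h5).comp h6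
    refine tendsto_nhds_unique h7 (h1.congr' ?_)
    filter_upwards [h2] with n hn
    simp only [Function.comp_apply, zero_add, smul_eq_mul, mul_one, add_zero]
    rw [← sub_eq_add_neg, ← hgG h3, ← hgG hn, inv_neg]
    ring
  refine ⟨(measurable_lineDeriv hg.continuous).aestronglyMeasurable.congr hw,
    fun θ h1 h2 h3 => ?_⟩
  obtain ⟨D, hD⟩ := ContDiff.lipschitzWith_of_hasCompactSupport h2 h1 (by simp)
  have key := hg.integral_lineDeriv_mul_eq (μ := volume) hD h2 1
  have d1 : ∀ t, lineDeriv ℝ θ t (-1) = -deriv θ t := fun t => by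
    rw [((h1.differentiable (by simp)) t).lineDeriv_eq_fderiv, map_neg, fderiv_apply_one_eq_deriv]
  have z1 : ∀ t, t ∉ Ioo 0 T → θ t = 0 := fun t ht => image_eq_zero_of_notMem_tsupport
    fun h => ht (h3 h)
  have z2 : ∀ t, t ∉ Ioo 0 T → deriv θ t = 0 := fun t ht => by
    refine image_eq_zero_of_notMem_tsupport fun h => ht (h3 ?_)
    exact tsupport_deriv_subset h
  simp only [d1, neg_mul, integral_neg] at key
  have e1 : ∫ t in Ioo 0 T, deriv θ t * G t = ∫ t, deriv θ t * g t := by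
    rw [← setIntegral_eq_integral_of_forall_compl_eq_zero (s := Ioo 0 T) (f := fun t => deriv θ t * g t)
      fun t ht => by rw [z2 t ht, zero_mul]]
    exact integral_congr_ae (hI.mono fun t ht => by simp only [hgG ht])
  have e2 : ∫ t in Ioo 0 T, θ t * w t = ∫ t, lineDeriv ℝ g t 1 * θ t := by
    rw [← setIntegral_eq_integral_of_forall_compl_eq_zero (s := Ioo 0 T)
      (f := fun t => lineDeriv ℝ g t 1 * θ t) fun t ht => by rw [z1 t ht, mul_zero]]
    exact integral_congr_ae (hw.mono fun t ht => by simp only [ht]; ring)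
  rw [e1, e2, key, neg_neg]

theorem IsSobolev.testSize_lt_top {ψ : Plane → Space} {ψ' : Fin 2 → Plane → Space}
    (h : IsSobolev ψ ψ') : testSize ψ ψ' < ⊤ :=
  ENNReal.add_lt_top.2 ⟨ENNReal.add_lt_top.2 ⟨h.memLp.2, h.memLp_four.2⟩,
    ENNReal.sum_lt_top.2 fun k _ => (h.memLp_partial k).2⟩

namespace IsSchrodingerFlow

variable {K : ℝ≥0} {a b : ℝ → Plane → Space} {a' b' : ℝ → Fin 2 → Plane → Space}
  {a'' b'' : ℝ → Fin 2 → Fin 2 → Plane → Space} {c : ℝ} {ψ : Plane → Space}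
  {ψ' : Fin 2 → Plane → Space}

theorem lipschitzOnWith_diffPairing (ha : IsSchrodingerFlow T I K a a' a'')
    (hb : IsSchrodingerFlow T I K b b' b'') (hc : -1 < c)
    (hab : ∀ t ∈ I, ∀ᵐ x, c ≤ inner ℝ (a t x) (b t x)) (hψ : IsSobolev ψ ψ') (m : Fin 2) :
    LipschitzOnWith (lipConst c K * (testSize ψ ψ').toNNReal) (diffPairing a b a' b' m ψ) I := by
  refine fun t ht s hs => ?_
  have h := ha.enorm_diffPairing_sub_le hb hc hab hψ m hs ht
  rw [edist_eq_enorm_sub, edist_eq_enorm_sub, ENNReal.coe_mul,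
    ENNReal.coe_toNNReal hψ.testSize_lt_top.ne, ← ofReal_norm (t - s)]
  exact h

theorem ae_tendsto_diffPairing_quotient (ha : IsSchrodingerFlow T I K a a' a'')
    (hb : IsSchrodingerFlow T I K b b' b'') (hc : -1 < c)
    (hab : ∀ t ∈ I, ∀ᵐ x, c ≤ inner ℝ (a t x) (b t x)) (m : Fin 2) :
    ∀ᵐ t ∂(volume.restrict (Ioo 0 T)), ∀ (ψ : Plane → Space) (ψ' : Fin 2 → Plane → Space),
      IsSobolev ψ ψ' → Tendsto (fun n => (timeStep n)⁻¹ * (diffPairing a b a' b' m ψ t -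
        diffPairing a b a' b' m ψ (t - timeStep n))) atTop
        (𝓝 (fluxPairing a b a' b' a'' b'' m ψ (ψ' m) t)) := by
  filter_upwards [ha.ae_tendsto_quotient, hb.ae_tendsto_quotient, ha.ae_mem,
    ae_eventually_sub_timeStep_mem ha.ae_mem] with t h1 h2 h3 h4 ψ ψ' hψ
  exact ha.tendsto_diffPairing_quotient hb hc hab hψ m h3 h4 h1 h2

theorem ae_enorm_fluxPairing_le (ha : IsSchrodingerFlow T I K a a' a'')
    (hb : IsSchrodingerFlow T I K b b' b'') (hc : -1 < c)
    (hab : ∀ t ∈ I, ∀ᵐ x, c ≤ inner ℝ (a t x) (b t x)) (m : Fin 2) :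
    ∀ᵐ t ∂(volume.restrict (Ioo 0 T)), ∀ (ψ : Plane → Space) (ψ' : Fin 2 → Plane → Space),
      IsSobolev ψ ψ' → ‖fluxPairing a b a' b' a'' b'' m ψ (ψ' m) t‖ₑ ≤
        lipConst c K * testSize ψ ψ' := by
  filter_upwards [ha.ae_tendsto_diffPairing_quotient hb hc hab m, ha.ae_mem,
    ae_eventually_sub_timeStep_mem ha.ae_mem] with t h1 h2 h3 ψ ψ' hψ
  refine le_of_tendsto (h1 ψ ψ' hψ).enorm ?_
  filter_upwards [h3] with n hn
  have hp := timeStep_pos n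
  have h := ha.enorm_diffPairing_sub_le hb hc hab hψ m hn h2
  rw [sub_sub_cancel, abs_of_pos hp] at h
  rw [enorm_mul]
  refine (mul_le_mul_right h _).trans (le_of_eq ?_)
  rw [mul_left_comm, Real.enorm_eq_ofReal (inv_nonneg.2 hp.le), ← ENNReal.ofReal_mul
    (inv_nonneg.2 hp.le), inv_mul_cancel₀ hp.ne', ENNReal.ofReal_one, mul_one]

/-- The weak time derivative of `V_m`, tested against a function of `H¹`. -/
theorem integral_deriv_mul_diffPairing (ha : IsSchrodingerFlow T I K a a' a'')
    (hb : IsSchrodingerFlow T I K b b' b'') (hc : -1 < c)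
    (hab : ∀ t ∈ I, ∀ᵐ x, c ≤ inner ℝ (a t x) (b t x)) (hψ : IsSobolev ψ ψ') (m : Fin 2) :
    AEStronglyMeasurable (fluxPairing a b a' b' a'' b'' m ψ (ψ' m)) (volume.restrict (Ioo 0 T)) ∧
      ∀ θ : ℝ → ℝ, ContDiff ℝ ∞ θ → HasCompactSupport θ → tsupport θ ⊆ Ioo 0 T →
        ∫ t in Ioo 0 T, deriv θ t * diffPairing a b a' b' m ψ t =
          -∫ t in Ioo 0 T, θ t * fluxPairing a b a' b' a'' b'' m ψ (ψ' m) t :=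
  weak_deriv_of_tendsto_quotient ha.ae_mem
    (ha.lipschitzOnWith_diffPairing hb hc hab hψ m)
    ((ha.ae_tendsto_diffPairing_quotient hb hc hab m).mono fun _ ht => ht ψ ψ' hψ)

theorem eLpNorm_transportDiff_le (ha : IsSchrodingerFlow T I K a a' a'')
    (hb : IsSchrodingerFlow T I K b b' b'') (hc : -1 < c)
    (hab : ∀ t ∈ I, ∀ᵐ x, c ≤ inner ℝ (a t x) (b t x)) (m : Fin 2) {t : ℝ} (ht : t ∈ I) :
    eLpNorm (transportDiff (a t) (b t) (a' t) (b' t) m) 2 volume ≤ ((2 * K : ℝ≥0) : ℝ≥0∞) := by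
  have h1 := ha.memLp_transportOp_apply hb hc hab ht ((ha.sphere t ht).sobolev m).memLp
  refine (MeasureTheory.eLpNorm_sub_le h1.1 ((hb.sphere t ht).sobolev m).memLp.1
    (by norm_num)).trans ?_
  have h2 : eLpNorm (fun x => transportOp (a t) (b t) x (a' t m x)) 2 volume ≤ K := by
    refine (eLpNorm_mono_ae ?_).trans (ha.bound t ht m)
    filter_upwards [(ha.sphere t ht).norm_eq, (hb.sphere t ht).norm_eq, hab t ht] with x h1 h2 h3
    exact (norm_mirror (inner_bisector_self h1 h2 (hc.trans_le h3)) _).le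
  refine (add_le_add h2 (hb.bound t ht m)).trans (le_of_eq ?_)
  push_cast
  ring

/-- The bound for the derivatives of `V_m` in `L²`. -/
noncomputable def _root_.diffDerivConst (c : ℝ) (K : ℝ≥0) : ℝ≥0 :=
  (12 * frameConst c ^ 3).toNNReal * (48 * K) * (24 * K) + K + K

theorem eLpNorm_transportDiffDeriv_le (ha : IsSchrodingerFlow T I K a a' a'')
    (hb : IsSchrodingerFlow T I K b b' b'') (hc : -1 < c)
    (hab : ∀ t ∈ I, ∀ᵐ x, c ≤ inner ℝ (a t x) (b t x)) (m k : Fin 2) {t : ℝ} (ht : t ∈ I) :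
    eLpNorm (transportDiffDeriv (a t) (b t) (a' t) (b' t) (a'' t) (b'' t) m k) 2 volume ≤
      diffDerivConst c K := by
  have hs := (ha.sphere t ht).sobolev m
  have h1 := ((((ha.sphere t ht).transportOp_bdd (hb.sphere t ht) hc (hab t ht)).bilin_sobolev
    applyL hs).memLp_partial k).1
  refine (MeasureTheory.eLpNorm_sub_le h1 (((hb.sphere t ht).sobolev m).memLp_partial k).1
    (by norm_num)).trans ?_
  have h2 := ha.eLpNorm_partial_transportOp_le hb hc hab hs k ht
  refine (add_le_add (h2.trans (add_le_add (mul_le_mul_right (ha.eLpNorm_partial_four_le ht m) _)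
    (ha.bound₂ t ht k m))) (hb.bound₂ t ht k m)).trans (le_of_eq ?_)
  rw [diffDerivConst, ENNReal.ofReal]
  push_cast
  rfl

/-- The derivatives of `V_m` are weakly continuous in `L²` on the set `I`. -/
theorem continuousOn_inner_transportDiffDeriv (ha : IsSchrodingerFlow T I K a a' a'')
    (hb : IsSchrodingerFlow T I K b b' b'') (hc : -1 < c)
    (hab : ∀ t ∈ I, ∀ᵐ x, c ≤ inner ℝ (a t x) (b t x)) (m k : Fin 2) {χ : Plane → Space}
    (hχ : MemLp χ 2 volume) :
    ContinuousOn (fun t => ∫ x, inner ℝ (χ x)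
      (transportDiffDeriv (a t) (b t) (a' t) (b' t) (a'' t) (b'' t) m k x)) I := by
  intro s hs
  have hV : ∀ t ∈ I, IsSobolev _ _ := fun t ht =>
    (ha.sphere t ht).transportDiff_sobolev (hb.sphere t ht) hc (hab t ht) m
  obtain ⟨S, -, hS, hd⟩ := exists_countable_dense_test
  refine tendsto_integral_inner_of_dense (K := diffDerivConst c K)
    (fun φ hφ => (hS φ hφ).1.continuous.memLp_of_hasCompactSupport (hS φ hφ).2) hd
    ?_ ?_ ((hV s hs).memLp_partial k) (fun φ hφ => ?_) hχ
  · filter_upwards [self_mem_nhdsWithin] with t ht using (hV t ht).memLp_partial k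
  · filter_upwards [self_mem_nhdsWithin] with t ht
      using ha.eLpNorm_transportDiffDeriv_le hb hc hab m k ht
  · have hφ' := IsSobolev.of_contDiff (contDiff_partial (hS φ hφ).1 (EuclideanSpace.single k 1))
      ((hS φ hφ).2.fderiv_apply (𝕜 := ℝ) _)
    have hcont := (ha.lipschitzOnWith_diffPairing hb hc hab hφ' m).continuousOn.neg s hs
    have e : ∀ t ∈ I, ∫ x, inner ℝ (φ x)
        (transportDiffDeriv (a t) (b t) (a' t) (b' t) (a'' t) (b'' t) m k x) =
        -diffPairing a b a' b' m (fun x => fderiv ℝ φ x (EuclideanSpace.single k 1)) t :=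
      fun t ht => by
        have h := (hV t ht).integral_bilin innerL (IsSobolev.of_contDiff (hS φ hφ).1 (hS φ hφ).2) k
        simp only [innerL_apply] at h
        rw [diffPairing, ← h]
        exact integral_congr_ae (ae_of_all _ fun x => real_inner_comm _ _)
    rw [e s hs]
    refine hcont.congr' ?_
    filter_upwards [self_mem_nhdsWithin] with t ht using (e t ht).symm

end IsSchrodingerFlow

end TimeDerivative

/-! ### The time derivative in `H⁻¹` -/

namespace H1

theorem isSobolev (f : H1) : IsSobolev (f.1 none) fun k => f.1 (some k) :=
  ⟨Lp.memLp _, fun _ => Lp.memLp _, fun k => isWeakPartial_iff.2 (f.2 k)⟩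

theorem eLpNorm_le (f : H1) (i : Option (Fin 2)) : eLpNorm (f.1 i) 2 volume ≤ ‖f‖ₑ := by
  rw [← Lp.enorm_def, enorm_le_iff_norm_le]
  exact PiLp.norm_apply_le f.1 i

theorem enorm_le (f : H1) :
    ‖f‖ₑ ≤ eLpNorm (f.1 none) 2 volume + ∑ k : Fin 2, eLpNorm (f.1 (some k)) 2 volume := by
  have h : ‖f‖ ≤ ∑ i, ‖f.1 i‖ := by
    rw [show ‖f‖ = ‖f.1‖ from rfl, PiLp.norm_eq_of_L2]
    refine Real.sqrt_le_iff.2 ⟨by positivity, ?_⟩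
    exact Finset.sum_sq_le_sq_sum_of_nonneg fun i _ => norm_nonneg _
  rw [Fintype.sum_option] at h
  rw [← ofReal_norm f]
  refine (ENNReal.ofReal_le_ofReal h).trans (le_of_eq ?_)
  rw [ENNReal.ofReal_add (norm_nonneg _) (by positivity), ENNReal.ofReal_sum_of_nonneg
    fun _ _ => norm_nonneg _]
  simp only [ofReal_norm, Lp.enorm_def]

theorem testSize_le (f : H1) : testSize (f.1 none) (fun k => f.1 (some k)) ≤ 27 * ‖f‖ₑ := by
  have h4 := (H1.isSobolev f).eLpNorm_le (p := 4) (by norm_num)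
  rw [ENNReal.ofReal_ofNat, show √(4 : ℝ) = 2 by rw [Real.sqrt_eq_iff_mul_self_eq] <;> norm_num] at h4
  have e : ENNReal.ofReal (4 * 2) = 8 := by norm_num
  have h1 := H1.eLpNorm_le f
  have h5 : eLpNorm (f.1 none) 2 volume + ∑ k : Fin 2, eLpNorm (f.1 (some k)) 2 volume ≤ 3 * ‖f‖ₑ := by
    rw [Fin.sum_univ_two]
    exact (add_le_add (h1 _) (add_le_add (h1 _) (h1 _))).trans (le_of_eq (by ring))
  rw [e] at h4
  calc testSize (f.1 none) (fun k => f.1 (some k))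
      = (eLpNorm (f.1 none) 2 volume + ∑ k : Fin 2, eLpNorm (f.1 (some k)) 2 volume) +
        eLpNorm (f.1 none) 4 volume := by rw [testSize]; ring
    _ ≤ 3 * ‖f‖ₑ + 8 * (3 * ‖f‖ₑ) := add_le_add h5 (h4.trans (mul_le_mul_right h5 _))
    _ = 27 * ‖f‖ₑ := by ring

theorem inner_eq (f g : H1) : inner ℝ f g =
    (∫ x, inner ℝ (f.1 none x) (g.1 none x)) + ∑ k : Fin 2, ∫ x, inner ℝ (f.1 (some k) x) (g.1 (some k) x) := by
  rw [Submodule.coe_inner, PiLp.inner_apply, Fintype.sum_option]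
  simp only [L2.inner_def]

end H1

theorem IsSobolev.exists_H1 {f : Plane → Space} {f' : Fin 2 → Plane → Space} (h : IsSobolev f f') :
    ∃ v : H1, v.1 none =ᵐ[volume] f ∧ ∀ k, v.1 (some k) =ᵐ[volume] f' k := by
  let F : PiLp 2 fun _ : Option (Fin 2) => Lp Space 2 (volume : Measure Plane) :=
    WithLp.toLp 2 fun i => i.elim (h.memLp.toLp f) fun k => (h.memLp_partial k).toLp (f' k)
  refine ⟨⟨F, fun k => (isWeakPartial_iff.1 (h.weak k)).congr h.memLp.coeFn_toLp.symm
    (h.memLp_partial k).coeFn_toLp.symm⟩, h.memLp.coeFn_toLp, fun k =>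
    (h.memLp_partial k).coeFn_toLp⟩

/-- A pointwise limit of functionals `⟨g, ·⟩` with `g ∈ L²` belongs to `H⁻¹` if it obeys a linear
bound. -/
theorem exists_hNegOne_of_tendsto {g : ℕ → Lp Space 2 (volume : Measure Plane)} {f : H1 → ℝ}
    {C : ℝ≥0} (h : ∀ ψ, Tendsto (fun n => inner ℝ (g n) (H1.toL2 ψ)) atTop (𝓝 (f ψ)))
    (hC : ∀ ψ, ‖f ψ‖ₑ ≤ C * ‖ψ‖ₑ) : ∃ w : HNegOne, (∀ ψ, w ψ = f ψ) ∧ ‖w‖ₑ ≤ C := by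
  have hC' : ∀ ψ, ‖f ψ‖ ≤ C * ‖ψ‖ := fun ψ => by
    have := hC ψ
    rw [← ofReal_norm, ← ofReal_norm, ← ENNReal.ofReal_coe_nnreal,
      ← ENNReal.ofReal_mul C.coe_nonneg] at this
    exact (ENNReal.ofReal_le_ofReal_iff (mul_nonneg C.2 (norm_nonneg _))).1 this
  let w : H1 →ₗ[ℝ] ℝ :=
    { toFun := f
      map_add' := fun x y => tendsto_nhds_unique (h (x + y)) (((h x).add (h y)).congr fun n =>
        (inner_add_right (𝕜 := ℝ) (g n) (H1.toL2 x) (H1.toL2 y)).symm)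
      map_smul' := fun r x => tendsto_nhds_unique (h (r • x)) (((h x).const_mul r).congr fun n =>
        (real_inner_smul_right (g n) (H1.toL2 x) r).symm) }
  refine ⟨w.mkContinuous C hC', fun ψ => rfl, ?_⟩
  rw [← ofReal_norm, ← ENNReal.ofReal_coe_nnreal]
  exact ENNReal.ofReal_le_ofReal (w.mkContinuous_norm_le C.2 hC')

namespace IsSchrodingerFlow

variable {T : ℝ} {I : Set ℝ} {K : ℝ≥0} {a b : ℝ → Plane → Space} {a' b' : ℝ → Fin 2 → Plane → Space}
  {a'' b'' : ℝ → Fin 2 → Fin 2 → Plane → Space} {c : ℝ}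

/-- The differences `V_m` have representatives in `H¹` with a bounded weak time derivative in
`H⁻¹`, and the pairing of this derivative with `V_m` is bounded by the energy density. -/
theorem exists_hasWeakTimeDeriv (ha : IsSchrodingerFlow T I K a a' a'')
    (hb : IsSchrodingerFlow T I K b b' b'') (hc : -1 < c)
    (hab : ∀ t ∈ I, ∀ᵐ x, c ≤ inner ℝ (a t x) (b t x)) (m : Fin 2) :
    ∃ (v : ℝ → H1) (w : ℝ → HNegOne),
      (∀ t ∈ I, H1.toL2 (v t) =ᵐ[volume] transportDiff (a t) (b t) (a' t) (b' t) m) ∧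
      HasWeakTimeDeriv T v w ∧
      ∀ᵐ t ∂(timeMeasure T), ‖w t (v t)‖ₑ ≤ ENNReal.ofReal (42 * energyConst c ^ 2) *
        ∫⁻ x, ENNReal.ofReal (energyDensity (a t) (b t) (a' t) (b' t) (a'' t) (b'' t) x) := by
  have hμ : timeMeasure T = volume.restrict (Ioo 0 T) :=
    (Measure.restrict_congr_set Ioo_ae_eq_Icc).symm
  have hV : ∀ t, t ∈ I → IsSobolev _ _ := fun t ht =>
    (ha.sphere t ht).transportDiff_sobolev (hb.sphere t ht) hc (hab t ht) m
  have hex : ∀ t, ∃ v : H1, t ∈ I →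
      v.1 none =ᵐ[volume] transportDiff (a t) (b t) (a' t) (b' t) m ∧ ∀ k, v.1 (some k) =ᵐ[volume]
        transportDiffDeriv (a t) (b t) (a' t) (b' t) (a'' t) (b'' t) m k := fun t => by
    by_cases ht : t ∈ I
    · obtain ⟨v, h1⟩ := (hV t ht).exists_H1
      exact ⟨v, fun _ => h1⟩
    · exact ⟨0, fun h => absurd h ht⟩
  choose v hv using hex
  have hvG : ∀ t ∈ I, ∀ ψ : H1, inner ℝ (H1.toL2 (v t)) (H1.toL2 ψ) =
      diffPairing a b a' b' m (ψ.1 none) t := fun t ht ψ => by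
    rw [L2.inner_def, diffPairing]
    exact integral_congr_ae ((hv t ht).1.mono fun x hx => by simp only [H1.toL2, hx])
  -- outside a null set of times some `w` satisfies `Q t w`; on the null set the value `0` is chosen
  let Q : ℝ → HNegOne → Prop := fun t w =>
    (∀ ψ : H1, w ψ = fluxPairing a b a' b' a'' b'' m (ψ.1 none) (ψ.1 (some m)) t) ∧
      ‖w‖ₑ ≤ ((lipConst c K * 27 : ℝ≥0) : ℝ≥0∞)
  have hex : ∀ t, ∃ w : HNegOne, (∃ w, Q t w) → Q t w := fun t => by
    by_cases h : ∃ w, Q t w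
    · exact ⟨h.choose, fun _ => h.choose_spec⟩
    · exact ⟨0, fun h' => absurd h' h⟩
  choose w hw using hex
  have hw : ∀ᵐ t ∂(volume.restrict (Ioo 0 T)), Q t (w t) := by
    filter_upwards [ha.ae_tendsto_diffPairing_quotient hb hc hab m, ha.ae_mem,
      ae_eventually_sub_timeStep_mem ha.ae_mem, ha.ae_enorm_fluxPairing_le hb hc hab m]
      with t h1 h2 h3 h4
    refine hw t (exists_hNegOne_of_tendsto
      (g := fun n => (timeStep n)⁻¹ • (H1.toL2 (v t) - H1.toL2 (v (t - timeStep n))))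
      (fun ψ => (h1 _ _ (H1.isSobolev ψ)).congr' ?_) fun ψ => ?_)
    · filter_upwards [h3] with n hn
      rw [real_inner_smul_left, inner_sub_left, hvG t h2, hvG _ hn]
    · refine (h4 _ _ (H1.isSobolev ψ)).trans ((mul_le_mul_right (H1.testSize_le ψ) _).trans (le_of_eq ?_))
      push_cast
      ring
  refine ⟨v, w, fun t ht => (hv t ht).1, ⟨fun ψ => ?_, ?_, fun ψ => ?_, ?_, fun θ h1 h2 h3 ψ => ?_⟩, ?_⟩
  · rw [hμ, ha.restrict_eq]
    have hcont : ContinuousOn (fun t => inner ℝ (v t) ψ) I := by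
      have h1 := (ha.lipschitzOnWith_diffPairing hb hc hab (H1.isSobolev ψ) m).continuousOn
      have h2 := continuousOn_finsetSum Finset.univ fun k _ =>
        ha.continuousOn_inner_transportDiffDeriv hb hc hab m k (Lp.memLp (ψ.1 (some k)))
      refine (h1.add h2).congr fun t ht => ?_
      rw [H1.inner_eq, ← L2.inner_def]
      refine congrArg₂ _ (hvG t ht ψ) (Finset.sum_congr rfl fun k _ => integral_congr_ae ?_)
      filter_upwards [(hv t ht).2 k] with x hx
      rw [hx, real_inner_comm]
    exact hcont.aestronglyMeasurable ha.measurableSet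
  · rw [hμ]
    refine lt_of_le_of_lt (essSup_le_of_ae_le (((2 * K + 2 * diffDerivConst c K : ℝ≥0) : ℝ≥0∞)) ?_)
      ENNReal.coe_lt_top
    filter_upwards [ha.ae_mem] with t ht
    refine (H1.enorm_le (v t)).trans ?_
    rw [eLpNorm_congr_ae (hv t ht).1, Fin.sum_univ_two, eLpNorm_congr_ae ((hv t ht).2 0),
      eLpNorm_congr_ae ((hv t ht).2 1)]
    refine (add_le_add (ha.eLpNorm_transportDiff_le hb hc hab m ht)
      (add_le_add (ha.eLpNorm_transportDiffDeriv_le hb hc hab m 0 ht)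
      (ha.eLpNorm_transportDiffDeriv_le hb hc hab m 1 ht))).trans (le_of_eq ?_)
    push_cast
    ring
  · rw [hμ]
    exact (ha.integral_deriv_mul_diffPairing hb hc hab (H1.isSobolev ψ) m).1.congr
      (hw.mono fun t ht => (ht.1 ψ).symm)
  · rw [hμ]
    exact lt_of_le_of_lt (essSup_le_of_ae_le _ (hw.mono fun t ht => ht.2)) ENNReal.coe_lt_top
  · have h := (ha.integral_deriv_mul_diffPairing hb hc hab (H1.isSobolev ψ) m).2 θ h1 h2 h3
    have e : ∫ t in Ioo 0 T, θ t * w t ψ =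
        ∫ t in Ioo 0 T, θ t * fluxPairing a b a' b' a'' b'' m (ψ.1 none) (ψ.1 (some m)) t :=
      integral_congr_ae (hw.mono fun t ht => by simp only [ht.1 ψ])
    rw [e, ← h]
    exact integral_congr_ae (ha.ae_mem.mono fun t ht => by simp only [hvG t ht ψ])
  · rw [hμ]
    filter_upwards [hw, ha.ae_mem] with t h1 h2
    rw [h1.1 (v t)]
    refine le_of_eq_of_le (congrArg _ (integral_congr_ae ?_))
      ((ha.sphere t h2).enorm_integral_flux_le (hb.sphere t h2) hc (hab t h2) m)
    filter_upwards [(hv t h2).1, (hv t h2).2 m] with x e1 e2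
    rw [e1, e2]

end IsSchrodingerFlow

/-! ### From Schrödinger maps to Schrödinger flows -/

section Reduction

theorem eLpNorm_two_le_rpow {f : Plane → Space} {g : Plane → ℝ≥0∞} (h : ∀ x, ‖f x‖ₑ ^ 2 ≤ g x) :
    eLpNorm f 2 volume ≤ (∫⁻ x, g x) ^ (1 / 2 : ℝ) := by
  rw [one_div, ENNReal.le_rpow_inv_iff (by norm_num), ENNReal.rpow_ofNat, sq_eLpNorm_two]
  exact lintegral_mono h

theorem lintegral_max_sq_le {f g : Plane → Space} (hf : AEStronglyMeasurable f volume) :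
    ∫⁻ x, max ‖f x‖ₑ ‖g x‖ₑ ^ 2 ≤ eLpNorm f 2 volume ^ 2 + eLpNorm g 2 volume ^ 2 := by
  rw [sq_eLpNorm_two, sq_eLpNorm_two, ← lintegral_add_left' (hf.enorm.pow_const 2)]
  refine lintegral_mono fun x => ?_
  rcases max_cases ‖f x‖ₑ ‖g x‖ₑ with h | h <;> rw [h.1]
  exacts [le_self_add, le_add_self]

theorem timeMeasure_eq (T : ℝ) : timeMeasure T = volume.restrict (Ioo 0 T) :=
  (Measure.restrict_congr_set Ioo_ae_eq_Icc).symm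

variable {T : ℝ} {u u₀ u₁ : ℝ → Plane → Space}

theorem aesm_weakPartial {k : Fin 2} {f : Plane → Space} (h : ∃ g, HasWeakPartial k f g) :
    AEStronglyMeasurable (weakPartial k f) volume :=
  (hasWeakPartial_weakPartial h).locInt_partial.aestronglyMeasurable

/-- The norm of the maximum of the two gradients is at most the sum of the two norms. -/
theorem normGradMax_lt_top (h₀ : IsSchrodingerMap T u₀) (h₁ : IsSchrodingerMap T u₁) :
    normGradMax T u₀ u₁ < ⊤ := by
  let B : ℝ≥0∞ := (∑ k, (normLinftyL2 T (fun t => weakPartial k (u₀ t)) ^ 2 +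
      normLinftyL2 T (fun t => weakPartial k (u₁ t)) ^ 2)) +
    ∑ j, ∑ k, (normLinftyL2 T (fun t => weakPartial j (weakPartial k (u₀ t))) ^ 2 +
      normLinftyL2 T (fun t => weakPartial j (weakPartial k (u₁ t))) ^ 2)
  have hB : B < ⊤ := by
    refine ENNReal.add_lt_top.2 ⟨ENNReal.sum_lt_top.2 fun k _ => ?_,
      ENNReal.sum_lt_top.2 fun j _ => ENNReal.sum_lt_top.2 fun k _ => ?_⟩
    · exact ENNReal.add_lt_top.2 ⟨ENNReal.pow_lt_top (h₀.bound k), ENNReal.pow_lt_top (h₁.bound k)⟩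
    · exact ENNReal.add_lt_top.2 ⟨ENNReal.pow_lt_top (h₀.bound₂ j k),
        ENNReal.pow_lt_top (h₁.bound₂ j k)⟩
  refine lt_of_le_of_lt (essSup_le_of_ae_le (B ^ (1 / 2 : ℝ)) ?_)
    (ENNReal.rpow_lt_top_of_nonneg (by norm_num) hB.ne)
  filter_upwards [h₀.exists_partial, h₁.exists_partial, h₀.exists_partial₂, h₁.exists_partial₂,
    ae_all_iff.2 fun k => ENNReal.ae_le_essSup (μ := timeMeasure T)
      fun t => eLpNorm (weakPartial k (u₀ t)) 2 volume,
    ae_all_iff.2 fun k => ENNReal.ae_le_essSup (μ := timeMeasure T)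
      fun t => eLpNorm (weakPartial k (u₁ t)) 2 volume,
    ae_all_iff.2 fun j => ae_all_iff.2 fun k => ENNReal.ae_le_essSup (μ := timeMeasure T)
      fun t => eLpNorm (weakPartial j (weakPartial k (u₀ t))) 2 volume,
    ae_all_iff.2 fun j => ae_all_iff.2 fun k => ENNReal.ae_le_essSup (μ := timeMeasure T)
      fun t => eLpNorm (weakPartial j (weakPartial k (u₁ t))) 2 volume]
    with t e0 e1 d0 d1 b0 b1 c0 c1
  have m1 : ∀ k, AEMeasurable
      (fun x => max ‖weakPartial k (u₀ t) x‖ₑ ‖weakPartial k (u₁ t) x‖ₑ ^ 2) volume := fun k =>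
    ((aesm_weakPartial (e0 k)).enorm.max (aesm_weakPartial (e1 k)).enorm).pow_const 2
  have m2 : ∀ j k, AEMeasurable (fun x => max ‖weakPartial j (weakPartial k (u₀ t)) x‖ₑ
      ‖weakPartial j (weakPartial k (u₁ t)) x‖ₑ ^ 2) volume := fun j k =>
    ((aesm_weakPartial (d0 j k)).enorm.max (aesm_weakPartial (d1 j k)).enorm).pow_const 2
  refine ENNReal.rpow_le_rpow ?_ (by norm_num)
  rw [lintegral_add_left' (Finset.aemeasurable_fun_sum _ fun k _ => m1 k),
    lintegral_finsetSum' _ fun k _ => m1 k, lintegral_finsetSum' _ fun j _ =>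
      Finset.aemeasurable_fun_sum _ fun k _ => m2 j k]
  simp only [lintegral_finsetSum' _ fun k _ => m2 _ k]
  refine add_le_add (Finset.sum_le_sum fun k _ => ?_)
    (Finset.sum_le_sum fun j _ => Finset.sum_le_sum fun k _ => ?_)
  · refine (lintegral_max_sq_le (aesm_weakPartial (e0 k))).trans ?_
    gcongr
    exacts [b0 k, b1 k]
  · refine (lintegral_max_sq_le (aesm_weakPartial (d0 j k))).trans ?_
    gcongr
    exacts [c0 j k, c1 j k]

/-- `normGradMax` bounds the `L²` norms of all the derivatives. -/
theorem ae_eLpNorm_le_normGradMax (T : ℝ) (u₀ u₁ : ℝ → Plane → Space) :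
    ∀ᵐ t ∂(timeMeasure T),
      ((∀ k, eLpNorm (weakPartial k (u₀ t)) 2 volume ≤ normGradMax T u₀ u₁) ∧
        ∀ j k, eLpNorm (weakPartial j (weakPartial k (u₀ t))) 2 volume ≤ normGradMax T u₀ u₁) ∧
      (∀ k, eLpNorm (weakPartial k (u₁ t)) 2 volume ≤ normGradMax T u₀ u₁) ∧
        ∀ j k, eLpNorm (weakPartial j (weakPartial k (u₁ t))) 2 volume ≤ normGradMax T u₀ u₁ := by
  have h1 : ∀ (k : Fin 2) (F : Fin 2 → ℝ≥0∞) {G y : ℝ≥0∞}, y ≤ F k → y ≤ (∑ k, F k) + G :=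
    fun k F G y hy =>
      (hy.trans (Finset.single_le_sum (f := F) (fun _ _ => zero_le) (Finset.mem_univ k))).trans
        le_self_add
  have h2 : ∀ (j k : Fin 2) (F : Fin 2 → Fin 2 → ℝ≥0∞) {G y : ℝ≥0∞}, y ≤ F j k →
      y ≤ G + ∑ j, ∑ k, F j k := fun j k F G y hy =>
    ((hy.trans (Finset.single_le_sum (f := F j) (fun _ _ => zero_le) (Finset.mem_univ k))).trans
      (Finset.single_le_sum (f := fun j => ∑ k, F j k) (fun _ _ => zero_le)
        (Finset.mem_univ j))).trans le_add_self
  have h : ∀ᵐ t ∂(timeMeasure T), (∫⁻ x,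
      ((∑ k, (max ‖weakPartial k (u₀ t) x‖ₑ ‖weakPartial k (u₁ t) x‖ₑ) ^ 2) +
        ∑ j, ∑ k, (max ‖weakPartial j (weakPartial k (u₀ t)) x‖ₑ
          ‖weakPartial j (weakPartial k (u₁ t)) x‖ₑ) ^ 2)) ^ (1 / 2 : ℝ) ≤ normGradMax T u₀ u₁ :=
    ENNReal.ae_le_essSup _
  filter_upwards [h] with t ht
  refine ⟨⟨fun k => (eLpNorm_two_le_rpow fun x => ?_).trans ht,
    fun j k => (eLpNorm_two_le_rpow fun x => ?_).trans ht⟩,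
    fun k => (eLpNorm_two_le_rpow fun x => ?_).trans ht,
    fun j k => (eLpNorm_two_le_rpow fun x => ?_).trans ht⟩
  · exact h1 k (fun k => max ‖weakPartial k (u₀ t) x‖ₑ ‖weakPartial k (u₁ t) x‖ₑ ^ 2)
      (pow_le_pow_left₀ zero_le (le_max_left _ _) 2)
  · exact h2 j k (fun j k => max ‖weakPartial j (weakPartial k (u₀ t)) x‖ₑ
      ‖weakPartial j (weakPartial k (u₁ t)) x‖ₑ ^ 2) (pow_le_pow_left₀ zero_le (le_max_left _ _) 2)
  · exact h1 k (fun k => max ‖weakPartial k (u₀ t) x‖ₑ ‖weakPartial k (u₁ t) x‖ₑ ^ 2)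
      (pow_le_pow_left₀ zero_le (le_max_right _ _) 2)
  · exact h2 j k (fun j k => max ‖weakPartial j (weakPartial k (u₀ t)) x‖ₑ
      ‖weakPartial j (weakPartial k (u₁ t)) x‖ₑ ^ 2) (pow_le_pow_left₀ zero_le (le_max_right _ _) 2)

/-- The tensor product of a test function in time and a test function in space. -/
theorem test_mul {θ : ℝ → ℝ} {χ : Plane → ℝ} (hθ : ContDiff ℝ ∞ θ) (hθc : HasCompactSupport θ)
    (hθT : tsupport θ ⊆ Ioo 0 T) (hχ : ContDiff ℝ ∞ χ) (hχc : HasCompactSupport χ) :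
    ContDiff ℝ ∞ (fun z : ℝ × Plane => θ z.1 * χ z.2) ∧
      HasCompactSupport (fun z : ℝ × Plane => θ z.1 * χ z.2) ∧
      tsupport (fun z : ℝ × Plane => θ z.1 * χ z.2) ⊆ Ioo 0 T ×ˢ univ ∧
      ∀ t x, fderiv ℝ (fun z : ℝ × Plane => θ z.1 * χ z.2) (t, x) (1, 0) = deriv θ t * χ x := by
  have hs : ContDiff ℝ ∞ (fun z : ℝ × Plane => θ z.1 * χ z.2) :=
    (hθ.comp contDiff_fst).mul (hχ.comp contDiff_snd)
  have hsub : tsupport (fun z : ℝ × Plane => θ z.1 * χ z.2) ⊆ tsupport θ ×ˢ tsupport χ := by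
    refine closure_minimal (fun z hz => ?_) ((isClosed_tsupport _).prod (isClosed_tsupport _))
    have hz' := mul_ne_zero_iff.1 hz
    exact ⟨subset_tsupport _ hz'.1, subset_tsupport _ hz'.2⟩
  refine ⟨hs, (hθc.isCompact.prod hχc.isCompact).of_isClosed_subset (isClosed_tsupport _) hsub,
    fun z hz => ⟨hθT (hsub hz).1, mem_univ _⟩, fun t x => ?_⟩
  have h1 := ((hs.differentiable (by simp)) (t, x)).hasFDerivAt.comp_hasDerivAt t
    ((hasDerivAt_id t).prodMk (hasDerivAt_const t x))
  have h2 := ((hθ.differentiable (by simp)) t).hasDerivAt.mul_const (χ x)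
  exact h1.unique h2

namespace IsSchrodingerMap

/-- A Schrödinger map is a Schrödinger flow on any set of good times; test functions in
space-time are specialized to tensor products. -/
theorem isSchrodingerFlow (h : IsSchrodingerMap T u) {I : Set ℝ} {K : ℝ≥0} (hI : I ⊆ Ioo 0 T)
    (hIm : MeasurableSet I) (hae : ∀ᵐ t ∂(volume.restrict (Ioo 0 T)), t ∈ I)
    (h1 : ∀ t ∈ I, ∀ k, ∃ g, HasWeakPartial k (u t) g)
    (h2 : ∀ t ∈ I, ∀ j k, ∃ g, HasWeakPartial j (weakPartial k (u t)) g)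
    (hK1 : ∀ t ∈ I, ∀ k, eLpNorm (weakPartial k (u t)) 2 volume ≤ K)
    (hK2 : ∀ t ∈ I, ∀ j k, eLpNorm (weakPartial j (weakPartial k (u t))) 2 volume ≤ K) :
    IsSchrodingerFlow T I K u (fun t k => weakPartial k (u t))
      fun t j k => weakPartial j (weakPartial k (u t)) where
  subset := hI
  measurableSet := hIm
  ae_mem := hae
  aesm := fun t ht => h.measurable t (Ioo_subset_Icc_self ht)
  norm_eq := fun t ht => h.sphere t (Ioo_subset_Icc_self ht)
  continuous := fun s hs => by
    rw [← nhdsWithin_eq_nhds.2 (Icc_mem_nhds hs.1 hs.2)]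
    exact h.continuous s (Ioo_subset_Icc_self hs)
  sphere := fun t ht =>
    ⟨h.sphere t (Ioo_subset_Icc_self (hI ht)),
      fun k => isWeakPartial_iff.2 (hasWeakPartial_weakPartial (h1 t ht k)), fun k =>
      ⟨⟨aesm_weakPartial (h1 t ht k), (hK1 t ht k).trans_lt ENNReal.coe_lt_top⟩,
        fun j => ⟨aesm_weakPartial (h2 t ht j k), (hK2 t ht j k).trans_lt ENNReal.coe_lt_top⟩,
        fun j => isWeakPartial_iff.2 (hasWeakPartial_weakPartial (h2 t ht j k))⟩⟩
  bound := hK1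
  bound₂ := hK2
  equation := fun θ χ hθ hθc hθT hχ hχc => by
    obtain ⟨t1, t2, t3, t4⟩ := test_mul hθ hθc hθT hχ hχc
    have e := h.equation _ t1 t2 t3
    have e1 : ∀ (t : ℝ) x, vecProd (u t x) (weakLaplacian (u t) x) = schrodingerField (u t)
        (fun j k => weakPartial j (weakPartial k (u t))) x := fun t x => by
      simp only [schrodingerField, weakLaplacian, ← crossL_apply, map_sum]
    simp only [t4, mul_smul, integral_smul, e1] at e
    exact e

/-- The two maps share a set of good times and the bound `normGradMax`. -/
theorem exists_flow (h₀ : IsSchrodingerMap T u₀) (h₁ : IsSchrodingerMap T u₁) :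
    ∃ I, IsSchrodingerFlow T I (normGradMax T u₀ u₁).toNNReal u₀ (fun t k => weakPartial k (u₀ t))
        (fun t j k => weakPartial j (weakPartial k (u₀ t))) ∧
      IsSchrodingerFlow T I (normGradMax T u₀ u₁).toNNReal u₁ (fun t k => weakPartial k (u₁ t))
        fun t j k => weakPartial j (weakPartial k (u₁ t)) := by
  have hae : ∀ᵐ t ∂(volume.restrict (Ioo 0 T)), t ∈ Ioo 0 T ∧
      ((∀ k, ∃ g, HasWeakPartial k (u₀ t) g) ∧ ∀ j k, ∃ g, HasWeakPartial j (weakPartial k (u₀ t)) g) ∧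
      ((∀ k, ∃ g, HasWeakPartial k (u₁ t) g) ∧ ∀ j k, ∃ g, HasWeakPartial j (weakPartial k (u₁ t)) g) ∧
      ((∀ k, eLpNorm (weakPartial k (u₀ t)) 2 volume ≤ normGradMax T u₀ u₁) ∧
        ∀ j k, eLpNorm (weakPartial j (weakPartial k (u₀ t))) 2 volume ≤ normGradMax T u₀ u₁) ∧
      (∀ k, eLpNorm (weakPartial k (u₁ t)) 2 volume ≤ normGradMax T u₀ u₁) ∧
        ∀ j k, eLpNorm (weakPartial j (weakPartial k (u₁ t))) 2 volume ≤ normGradMax T u₀ u₁ := by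
    rw [← timeMeasure_eq]
    filter_upwards [h₀.exists_partial, h₁.exists_partial, h₀.exists_partial₂, h₁.exists_partial₂,
      ae_eLpNorm_le_normGradMax T u₀ u₁,
      (timeMeasure_eq T ▸ ae_restrict_mem measurableSet_Ioo : ∀ᵐ t ∂(timeMeasure T), t ∈ Ioo 0 T)]
      with t e0 e1 d0 d1 b b'
    exact ⟨b', ⟨e0, d0⟩, ⟨e1, d1⟩, b⟩
  obtain ⟨I, hI, hIm, h⟩ := hae.exists_measurable_mem
  rw [← ENNReal.coe_toNNReal (normGradMax_lt_top h₀ h₁).ne] at h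
  exact ⟨I, h₀.isSchrodingerFlow (fun t ht => (h t ht).1) hIm hI (fun t ht => (h t ht).2.1.1)
      (fun t ht => (h t ht).2.1.2) (fun t ht => (h t ht).2.2.2.1.1) fun t ht => (h t ht).2.2.2.1.2,
    h₁.isSchrodingerFlow (fun t ht => (h t ht).1) hIm hI (fun t ht => (h t ht).2.2.1.1)
      (fun t ht => (h t ht).2.2.1.2) (fun t ht => (h t ht).2.2.2.2.1) fun t ht => (h t ht).2.2.2.2.2⟩

end IsSchrodingerMap

/-- If `r < 0`, the hypothesis never holds; `max r 0` makes the cosine monotone in all cases. -/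
theorem cos_le_inner_of_angle_le {a b : Space} {r : ℝ} (hr : r < Real.pi) (ha : ‖a‖ = 1)
    (hb : ‖b‖ = 1) (h : InnerProductGeometry.angle a b ≤ r) :
    Real.cos (max r 0) ≤ inner ℝ a b := by
  have h1 := InnerProductGeometry.cos_angle a b
  rw [ha, hb, mul_one, div_one] at h1
  rw [← h1]
  exact Real.cos_le_cos_of_nonneg_of_le_pi (InnerProductGeometry.angle_nonneg a b)
    (max_le hr.le Real.pi_pos.le) (h.trans (le_max_left r 0))

end Reduction

theorem proposition2p2 (r : ℝ) (hr : r < Real.pi) :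
    ∃ C : ℝ≥0∞ → ℝ≥0, ∀ T : ℝ, 0 < T → ∀ u₀ u₁ : ℝ → Plane → Space,
      IsSchrodingerMap T u₀ → IsSchrodingerMap T u₁ →
      (∀ t ∈ Icc 0 T, ∀ᵐ x, InnerProductGeometry.angle (u₀ t x) (u₁ t x) ≤ r) →
      ∀ m : Fin 2, ∃ (v : ℝ → H1) (w : ℝ → HNegOne),
        (∀ᵐ t ∂(timeMeasure T), H1.toL2 (v t) =ᵐ[volume] derivDiff u₀ u₁ m t) ∧
        HasWeakTimeDeriv T v w ∧
        ∀ p : ℝ, 2 < p →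
          essSup (fun t => ‖w t (v t)‖ₑ) (timeMeasure T) ≤
            C (normGradMax T u₀ u₁) * ENNReal.ofReal p *
              (normLinftyL2 T (fun t => u₀ t - u₁ t) ^ 2 +
                ∑ k, normLinftyL2 T (derivDiff u₀ u₁ k) ^ 2) ^ (1 - 1 / p) := by
  obtain ⟨c, hcr⟩ : ∃ c, c = Real.cos (max r 0) := ⟨_, rfl⟩
  have hc : -1 < c := by
    rw [hcr, ← Real.cos_pi]
    exact Real.cos_lt_cos_of_nonneg_of_le_pi (le_max_right r 0) le_rfl (max_lt hr Real.pi_pos)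
  choose! C hC using fun (M : ℝ≥0∞) (hM : M ≠ ⊤) => IsSphereMap.exists_energy_bound hc hM
  -- the summand `1` makes the constant positive, so that the bound is `∞` if `q ∉ L^∞_T L²_x`
  refine ⟨fun M => (42 * energyConst c ^ 2).toNNReal * C M + 1, fun T _ u₀ u₁ h₀ h₁ hr' m => ?_⟩
  have hM := normGradMax_lt_top h₀ h₁
  obtain ⟨M, hMe⟩ : ∃ M, M = normGradMax T u₀ u₁ := ⟨_, rfl⟩
  obtain ⟨I, ha, hb⟩ := h₀.exists_flow h₁
  rw [← hMe] at hM ha hb ⊢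
  have hIcc : ∀ t ∈ I, t ∈ Icc 0 T := fun t ht => Ioo_subset_Icc_self (ha.subset ht)
  have hab : ∀ t ∈ I, ∀ᵐ x, c ≤ inner ℝ (u₀ t x) (u₁ t x) := fun t ht => by
    filter_upwards [h₀.sphere t (hIcc t ht), h₁.sphere t (hIcc t ht), hr' t (hIcc t ht)]
      with x e1 e2 e3
    exact hcr ▸ cos_le_inner_of_angle_le hr e1 e2 e3
  have hI : ∀ᵐ t ∂(timeMeasure T), t ∈ I := timeMeasure_eq T ▸ ha.ae_mem
  have hV : ∀ t ∈ I, ∀ k, derivDiff u₀ u₁ k t =ᵐ[volume] transportDiff (u₀ t) (u₁ t)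
      (fun k => weakPartial k (u₀ t)) (fun k => weakPartial k (u₁ t)) k := fun t ht k => by
    filter_upwards [h₀.sphere t (hIcc t ht), h₁.sphere t (hIcc t ht), hr' t (hIcc t ht), hab t ht,
      (ha.sphere t ht).inner_eq_zero k] with x e1 e2 e3 e4 e5
    rw [derivDiff, parallelTransport_eq_mirror e1 e2 (e3.trans_lt hr) e5 (hc.trans_le e4)]
    rfl
  obtain ⟨v, w, hv, hw, hvw⟩ := ha.exists_hasWeakTimeDeriv hb hc hab m
  refine ⟨v, w, hI.mono fun t ht => (hv t ht).trans (hV t ht m).symm, hw, fun p hp => ?_⟩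
  have hp' : 0 < 1 - 1 / p := by
    rw [sub_pos, div_lt_one (by linarith)]
    linarith
  -- if `q ∉ L^∞_T L²_x`, then the right-hand side is infinite
  rcases eq_or_ne (normLinftyL2 T fun t => u₀ t - u₁ t) ⊤ with hq | hq
  · rw [hq, ENNReal.top_pow two_ne_zero, top_add, ENNReal.top_rpow_of_pos hp', ENNReal.mul_top]
    · exact le_top
    · refine mul_ne_zero ?_ (by simpa using by linarith)
      exact_mod_cast (by positivity : (42 * energyConst c ^ 2).toNNReal * C M + 1 ≠ 0)
  refine essSup_le_of_ae_le _ ?_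
  filter_upwards [hI, hvw, ENNReal.ae_le_essSup (μ := timeMeasure T)
      fun t => eLpNorm (u₀ t - u₁ t) 2 volume,
    ae_all_iff.2 fun k => ENNReal.ae_le_essSup (μ := timeMeasure T)
      fun t => eLpNorm (derivDiff u₀ u₁ k t) 2 volume] with t ht h1 h2 h3
  have sa := ha.sphere t ht
  have sb := hb.sphere t ht
  have hqt : MemLp (fun x => u₀ t x - u₁ t x) 2 volume :=
    ⟨sa.bdd.aesm.sub sb.bdd.aesm, h2.trans_lt (lt_top_iff_ne_top.2 hq)⟩
  have hK : ((M.toNNReal : ℝ≥0) : ℝ≥0∞) = M := ENNReal.coe_toNNReal hM.ne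
  have h4 := hC M hM.ne (u₀ t) (u₁ t) _ _ _ _ sa sb (hab t ht) (hK ▸ ha.bound t ht)
    (hK ▸ hb.bound t ht) (hK ▸ ha.bound₂ t ht) (hK ▸ hb.bound₂ t ht) hqt p hp
  have h5 : energyNorm (u₀ t) (u₁ t) (fun k => weakPartial k (u₀ t))
      (fun k => weakPartial k (u₁ t)) ≤ normLinftyL2 T (fun t => u₀ t - u₁ t) ^ 2 +
        ∑ k, normLinftyL2 T (derivDiff u₀ u₁ k) ^ 2 := by
    refine add_le_add (pow_le_pow_left₀ zero_le h2 2) (Finset.sum_le_sum fun k _ => ?_)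
    rw [← eLpNorm_congr_ae (hV t ht k)]
    exact pow_le_pow_left₀ zero_le (h3 k) 2
  refine (h1.trans (mul_le_mul_right h4 _)).trans ?_
  rw [← mul_assoc, ← mul_assoc, ENNReal.ofReal, ← ENNReal.coe_mul]
  gcongr
  exact le_self_add
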